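/- Let $b,c,d:[0,1]\to\mathbb{C}$ be continuous and let $$a(x,z)=d(x)z^{-1}+b(x)+c(x)z,\qquad x\in[0,1],\ |z|=1,$$ with Fourier coefficients $\hat a_k(x)=\frac1{2\pi}\int_0^{2\pi}a(x,e^{it})e^{-ikt}\,dt$. For each $n\ge 1$ let $U^{(n)}_1,\dots,U^{(n)}_n$ be independent random variables uniformly distributed on $[0,1]$, with order statistics $x_{1,n}\le\dots\le x_{n,n}$ (the samples for different $n$ may be related in any way), and let $\mathcal{T}_n(a)$ be the random $n\times n$ matrix with entries $$(\mathcal{T}_n(a))_{i,j}=\hat a_{i-j}\bigl(x_{\min(i,j),n}\bigr),\qquad 1\le i,j\le n.$$ Let $$\mu_n=\frac1n\sum_{\lambda\in\mathrm{sp}(\mathcal{T}_n(a))}\delta_\lambda$$ be its eigenvalue-counting measure, where eigenvalues are repeated according to algebraic multiplicity. Then, as $n\to\infty$, $\mu_n$ converges weakly in probability to the deterministic measure $$\mu=\int_0^1\alpha_x\,dx,$$ where $\alpha_x$ is the arcsine measure on the complex segment $\bigl[b(x)-2\sqrt{d(x)c(x)},\ b(x)+2\sqrt{d(x)c(x)}\bigr]$;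 that is, for every bounded continuous $f:\mathbb{C}\to\mathbb{R}$, $\int f\,d\mu_n\to\int f\,d\mu$ in probability. Here the arcsine measure on a segment $[u,v]$ is the image of the probability measure $\frac{dt}{\pi\sqrt{1-t^2}}$ on $(-1,1)$ under $t\mapsto\frac{u+v}2+t\,\frac{v-u}2$ (the point mass $\delta_u$ if $u=v$). -/

import Mathlib

open MeasureTheory ProbabilityTheory Filter Topology
open scoped unitInterval ENNReal BoundedContinuousFunction

noncomputable section

namespace TwistedToeplitz

/-- The `k`-th Fourier coefficient `(1 / 2π) ∫₀^{2π} a(x, e^{it}) e^{-ikt} dt` of `a(x, ·)`. -/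
def symbolCoeff (a : I → Circle → ℂ) (k : ℤ) (x : I) : ℂ :=
  (1 / (2 * Real.pi) : ℂ) *
    ∫ t in (0 : ℝ)..(2 * Real.pi), a x (Circle.exp t) * Complex.exp (-(Complex.I * k * t))

/-- The symbol `a(x, z) = d(x) z⁻¹ + b(x) + c(x) z`. -/
def tridiagSymbol (b c d : C(I, ℂ)) (x : I) (z : Circle) : ℂ :=
  d x * (z : ℂ)⁻¹ + b x + c x * (z : ℂ)

/-- The order statistics of `n` points: `orderStat u i` is the `(i + 1)`-st smallest value,
counted with repetitions (`Fin n` starts at `0`). -/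
def orderStat {n : ℕ} (u : Fin n → I) : Fin n → I :=
  u ∘ Tuple.sort u

/-- The `n × n` matrix with `(i, j)` entry `â_{i-j}(x_{min(i,j)})`, where
`x_1 ≤ ⋯ ≤ x_n` are the order statistics of the points `u`. -/
def sampledToeplitz {n : ℕ} (a : I → Circle → ℂ) (u : Fin n → I) : Matrix (Fin n) (Fin n) ℂ :=
  Matrix.of fun i j => symbolCoeff a ((i : ℤ) - (j : ℤ)) (orderStat u (min i j))

/-- The eigenvalue-counting measure `(1 / n) ∑_{λ ∈ sp(M)} δ_λ`, the eigenvalues being repeated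
according to their algebraic multiplicity. -/
def eigenvalueMeasure {n : ℕ} (M : Matrix (Fin n) (Fin n) ℂ) : Measure ℂ :=
  (n : ℝ≥0∞)⁻¹ • (M.charpoly.roots.map fun z => Measure.dirac z).sum

/-- The arcsine distribution on `[-1, 1]`, with density `1 / (π √(1 - t²))`. -/
def arcsineReal : Measure ℝ :=
  (volume.restrict (Set.Ioo (-1) 1)).withDensity
    fun t => ENNReal.ofReal (1 / (Real.pi * Real.sqrt (1 - t ^ 2)))

/-- The arcsine measure on the complex segment `[u, v]`: the image of the arcsine distribution
on `[-1, 1]` under the affine map with `-1 ↦ u` and `1 ↦ v` (`δ_u` if `u = v`). -/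
def arcsineSegment (u v : ℂ) : Measure ℂ :=
  arcsineReal.map fun t : ℝ => (u + v) / 2 + (t : ℂ) * ((v - u) / 2)

/-- `α_x`, the arcsine measure on `[b(x) - 2√(d(x)c(x)), b(x) + 2√(d(x)c(x))]`. The segment and
the measure do not depend on which of the two square roots is taken. -/
def arcsineAt (b c d : C(I, ℂ)) (x : I) : Measure ℂ :=
  arcsineSegment (b x - 2 * Complex.sqrt (d x * c x)) (b x + 2 * Complex.sqrt (d x * c x))

/-- The mixture `∫₀¹ α_x dx`, that is, the measure `A ↦ ∫₀¹ α_x(A) dx`. -/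
def arcsineMixture (b c d : C(I, ℂ)) : Measure ℂ :=
  Measure.bind volume (arcsineAt b c d)

instance : SFinite arcsineReal := by
  unfold arcsineReal
  infer_instance

/-- `x ↦ α_x` is measurable, so that the mixture is the intended one. -/
theorem measurable_arcsineAt (b c d : C(I, ℂ)) : Measurable (arcsineAt b c d) := by
  have hs : Measurable fun x : I => Complex.sqrt (d x * c x) := by
    unfold Complex.sqrt
    exact ((d.continuous.mul c.continuous).measurable).pow_const _
  refine Measure.measurable_of_measurable_coe _ fun s hs' => ?_
  have hm : Measurable fun p : I × ℝ =>
      ((b p.1 - 2 * Complex.sqrt (d p.1 * c p.1)) + (b p.1 + 2 * Complex.sqrt (d p.1 * c p.1))) / 2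
        + (p.2 : ℂ) * (((b p.1 + 2 * Complex.sqrt (d p.1 * c p.1))
        - (b p.1 - 2 * Complex.sqrt (d p.1 * c p.1))) / 2) := by
    have hb : Measurable fun p : I × ℝ => b p.1 := b.continuous.measurable.comp measurable_fst
    have hq : Measurable fun p : I × ℝ => Complex.sqrt (d p.1 * c p.1) := hs.comp measurable_fst
    have ht : Measurable fun p : I × ℝ => (p.2 : ℂ) :=
      Complex.measurable_ofReal.comp measurable_snd
    fun_prop
  have h := measurable_measure_prodMk_left (ν := arcsineReal) (hm hs')
  convert h using 2 with x
  unfold arcsineAt arcsineSegment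
  rw [Measure.map_apply (by fun_prop) hs']
  rfl

theorem arcsineMixture_apply (b c d : C(I, ℂ)) {s : Set ℂ} (hs : MeasurableSet s) :
    arcsineMixture b c d s = ∫⁻ x : I, arcsineAt b c d x s :=
  Measure.bind_apply hs (measurable_arcsineAt b c d).aemeasurable

/-- Weak convergence in probability of random measures `ν n ω` on `ℂ` to a fixed measure `μ`:
for every bounded continuous `f`, the random variables `∫ f dν_n` converge to `∫ f dμ` in
`P`-probability. -/
def TendstoWeaklyInProbability {Ω : Type*} [MeasurableSpace Ω] (P : Measure Ω)
    (ν : ℕ → Ω → Measure ℂ) (μ : Measure ℂ) : Prop :=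
  ∀ f : ℂ →ᵇ ℝ, TendstoInMeasure P (fun n ω => ∫ z, f z ∂(ν n ω)) atTop (fun _ => ∫ z, f z ∂μ)

end TwistedToeplitz

end

/-!
The eigenvalues of the sampled matrix are the zeros of a continuant: with `l` the list of the pairs
`(b, c d)` at the ordered samples, `charpoly.eval z = contP z l`
(`eval_charpoly_sampledToeplitz`). So the normalized logarithm `log ‖contP z l‖ / n` is the
logarithmic potential of the eigenvalue-counting measure, and the theorem is the convergence of
these potentials, in measure with respect to the sample and to `z`, to the potential of the mixture
of arcsine measures (`tendsto_measureReal_log_norm_contP`). Such convergence implies the weak one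
(`exists_logPot_close`), since on a disc a continuous function is a uniform limit of potentials of
bounded densities: the difference of the potentials of two concentric circles is a bump function.

The matrices are far from normal, so a bound on `log ‖contP‖` from below is the heart of the matter.
Cut `[0, 1]` into finitely many intervals on which `(b, c d)` is nearly constant, equal to `(β, γ)`
say. The continuant is a product of one transfer matrix per sample, and on such a block it grows
like `‖ρ‖ ^ N`, where `ρ` is the larger root of `ρ + γ / ρ = z - β` and `log ‖ρ‖` is the potential
of the arcsine measure (`IsRoot.segPot_eq`), provided that `z` lies in a half-plane avoiding the
segment `[β - 2√γ, β + 2√γ]` (`IsRoot.norm_run_le`, `IsRoot.le_norm_contP`). The half-planes of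
finitely many directions cover everything but a set of small area (`exists_nearSeg_small`).

What may fail is that the vector arriving at the block is nearly annihilated by the block's
transfer matrix. Randomness excludes this. Either the vector arriving has second component `0`
(`LeftFree`), and then nothing can be annihilated, or the function `(b, c d)` takes two different
values near the left end of the block (`Moving`). In the latter case, moving samples between two
small intervals `A` and `B` preserves the law of the sample and spreads the number of samples in
`A` over many values (`measureReal_le_of_flip`, by a central binomial estimate). If the same vector
were nearly annihilated for two different values of that number, the continued fractions of the two
blocks would be exponentially close at `z`. As functions of `z`, these continued fractions are
analytic and differ noticeably near infinity, so by Jensen's inequality, or by Cartan's estimate for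
polynomials, they are close only on a small set of `z` (`tendsto_measureReal_resonant` when `z` lies
in a good half-plane, `exists_crude_bound` for any `z`). The crude bound carries the blocks that are
badly placed with respect to `z`: their total length is small for most `z`, and the logarithm of the
loss along them has small expectation (`exists_loss`).
-/

namespace TwistedToeplitz

/-! ### The characteristic polynomial of a tridiagonal matrix -/

theorem integral_exp_int_mul (k : ℤ) :
    ∫ t in (0 : ℝ)..(2 * Real.pi), Complex.exp (Complex.I * k * t)
      = if k = 0 then (2 * Real.pi : ℂ) else 0 := by
  split_ifs with hk
  · simp [hk]
  · rw [integral_exp_mul_complex (by simp [hk])]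
    have h1 : Complex.I * k * ((2 * Real.pi : ℝ) : ℂ) = k * (2 * Real.pi * Complex.I) := by
      push_cast; ring
    rw [h1, Complex.exp_int_mul_two_pi_mul_I]
    simp

theorem symbolCoeff_tridiagSymbol (b c d : C(I, ℂ)) (k : ℤ) (x : I) :
    symbolCoeff (tridiagSymbol b c d) k x
      = if k = 0 then b x else if k = 1 then c x else if k = -1 then d x else 0 := by
  have hpi : (2 * Real.pi : ℂ) ≠ 0 := by
    simp [Real.pi_ne_zero]
  have key : ∀ t : ℝ, tridiagSymbol b c d x (Circle.exp t) *
      Complex.exp (-(Complex.I * k * t)) =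
      d x * Complex.exp (Complex.I * (-1 - k : ℤ) * t) +
        b x * Complex.exp (Complex.I * (-k : ℤ) * t) +
        c x * Complex.exp (Complex.I * (1 - k : ℤ) * t) := by
    intro t
    unfold tridiagSymbol
    rw [Circle.coe_exp, ← Complex.exp_neg, add_mul, add_mul, mul_assoc, mul_assoc (c x),
      ← Complex.exp_add, ← Complex.exp_add]
    congr 3
    all_goals push_cast; ring_nf
  have hint : ∀ (m : ℤ) (e : ℂ), IntervalIntegrable
      (fun t : ℝ => e * Complex.exp (Complex.I * m * t)) volume 0 (2 * Real.pi) := by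
    intro m e
    exact Continuous.intervalIntegrable (by fun_prop) _ _
  unfold symbolCoeff
  simp_rw [key]
  rw [intervalIntegral.integral_add ((hint _ _).add (hint _ _)) (hint _ _),
    intervalIntegral.integral_add (hint _ _) (hint _ _)]
  simp only [intervalIntegral.integral_const_mul, integral_exp_int_mul]
  have e1 : (-1 - k = 0) ↔ k = -1 := by omega
  have e2 : (-k = 0) ↔ k = 0 := by omega
  have e3 : (1 - k = 0) ↔ k = 1 := by omega
  simp only [e1, e2, e3]
  by_cases h0 : k = 0
  · subst h0; simp; field_simp
  · by_cases h1 : k = 1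
    · subst h1; simp; field_simp
    · by_cases h2 : k = -1
      · subst h2; simp; field_simp
      · simp [h0, h1, h2]

/-- The `n × n` tridiagonal matrix with diagonal `d`, superdiagonal `u` and subdiagonal `l`. -/
def tridiag (d u l : ℕ → ℂ) (n : ℕ) : Matrix (Fin n) (Fin n) ℂ :=
  Matrix.of fun i j =>
    if (i : ℕ) = j then d i else if (i : ℕ) + 1 = j then u i else if (j : ℕ) + 1 = i then l j else 0

theorem det_tridiag_succ_succ (d u l : ℕ → ℂ) (n : ℕ) :
    (tridiag d u l (n + 2)).det =
      d 0 * (tridiag (fun i => d (i + 1)) (fun i => u (i + 1)) (fun i => l (i + 1)) (n + 1)).det -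
        u 0 * l 0 *
          (tridiag (fun i => d (i + 2)) (fun i => u (i + 2)) (fun i => l (i + 2)) n).det := by
  rw [Matrix.det_succ_row_zero, Fin.sum_univ_succ, Fin.sum_univ_succ]
  rw [Finset.sum_eq_zero (s := (Finset.univ : Finset (Fin n)))]
  · have h0 : (tridiag d u l (n + 2)).submatrix Fin.succ (Fin.succAbove 0) =
        tridiag (fun i => d (i + 1)) (fun i => u (i + 1)) (fun i => l (i + 1)) (n + 1) := by
      ext i j
      simp [tridiag]
    have h1 : ((tridiag d u l (n + 2)).submatrix Fin.succ
        (Fin.succAbove (Fin.succ (0 : Fin (n + 1))))).det =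
        l 0 * (tridiag (fun i => d (i + 2)) (fun i => u (i + 2)) (fun i => l (i + 2)) n).det := by
      rw [Matrix.det_succ_column_zero, Fin.sum_univ_succ, Finset.sum_eq_zero]
      · have h2 : ((tridiag d u l (n + 2)).submatrix Fin.succ
            (Fin.succAbove (Fin.succ (0 : Fin (n + 1))))).submatrix (Fin.succAbove 0) Fin.succ =
            tridiag (fun i => d (i + 2)) (fun i => u (i + 2)) (fun i => l (i + 2)) n := by
          ext i j
          have : (Fin.succAbove (Fin.succ (0 : Fin (n + 1))) j.succ) = j.succ.succ := by
            rw [Fin.succ_succAbove_succ]; simp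
          simp only [Matrix.submatrix_apply, this]
          simp [tridiag]
        rw [h2]
        have : (Fin.succAbove (Fin.succ (0 : Fin (n + 1))) 0) = 0 := by
          simp
        simp only [Matrix.submatrix_apply, this]
        simp [tridiag]
      · intro i _
        have : (Fin.succAbove (Fin.succ (0 : Fin (n + 1))) 0) = 0 := by
          simp
        simp only [Matrix.submatrix_apply, this]
        simp [tridiag]
    rw [h0, h1]
    simp [tridiag]
    ring
  · intro i _
    simp [tridiag]

/-- The determinants of `z - T` and of its trailing minor, for the Jacobi matrix `T` with
diagonal entries `y.1` and products `y.2` of opposite off-diagonal entries, as polynomials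
in `z`. -/
noncomputable def contPoly : List (ℂ × ℂ) → Polynomial ℂ × Polynomial ℂ
  | [] => (1, 0)
  | y :: l => ((Polynomial.X - Polynomial.C y.1) * (contPoly l).1 -
      Polynomial.C y.2 * (contPoly l).2, (contPoly l).1)

/-- The continuant `det (z - T)` of a list of Jacobi parameters. -/
noncomputable def contP (z : ℂ) (l : List (ℂ × ℂ)) : ℂ := (contPoly l).1.eval z

/-- The continuant of the list without its first element, `0` for the empty list. -/
noncomputable def contQ (z : ℂ) (l : List (ℂ × ℂ)) : ℂ := (contPoly l).2.eval z

@[simp] theorem contP_nil (z : ℂ) : contP z [] = 1 := by simp [contP, contPoly]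
@[simp] theorem contQ_nil (z : ℂ) : contQ z [] = 0 := by simp [contQ, contPoly]
@[simp] theorem contP_cons (z : ℂ) (y : ℂ × ℂ) (l : List (ℂ × ℂ)) :
    contP z (y :: l) = (z - y.1) * contP z l - y.2 * contQ z l := by
  simp [contP, contQ, contPoly]
@[simp] theorem contQ_cons (z : ℂ) (y : ℂ × ℂ) (l : List (ℂ × ℂ)) :
    contQ z (y :: l) = contP z l := by
  simp [contP, contQ, contPoly]

theorem natDegree_contPoly (l : List (ℂ × ℂ)) :
    (contPoly l).1.natDegree ≤ l.length ∧ (contPoly l).2.natDegree ≤ l.length := by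
  induction l with
  | nil => simp [contPoly]
  | cons y l ih =>
    refine ⟨?_, ih.1.trans (by simp)⟩
    simp only [contPoly, List.length_cons]
    refine (Polynomial.natDegree_sub_le _ _).trans (max_le ?_ ?_)
    · refine Polynomial.natDegree_mul_le.trans ?_
      rw [Polynomial.natDegree_X_sub_C]; omega
    · refine (Polynomial.natDegree_C_mul_le _ _).trans ?_
      omega

theorem det_tridiag (z : ℂ) (n : ℕ) (y : ℕ → ℂ × ℂ) (u l : ℕ → ℂ)
    (hul : ∀ i, u i * l i = (y i).2) :
    (tridiag (fun i => z - (y i).1) u l n).det = contP z (List.ofFn fun i : Fin n => y i) := by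
  induction n using Nat.strong_induction_on generalizing y u l with
  | _ n ih =>
    match n with
    | 0 => simp
    | 1 => simp [tridiag]
    | n + 2 =>
      rw [det_tridiag_succ_succ, ih (n + 1) (by omega) (fun i => y (i + 1)) _ _
        (fun i => hul (i + 1)), ih n (by omega) (fun i => y (i + 2)) _ _ (fun i => hul (i + 2)), hul]
      have e1 : (List.ofFn fun i : Fin (n + 1) => y (i + 1)) =
          y 1 :: List.ofFn fun i : Fin n => y (i + 2) := by
        rw [List.ofFn_succ]; simp [add_assoc]
      have e2 : (List.ofFn fun i : Fin (n + 2) => y i) =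
          y 0 :: List.ofFn fun i : Fin (n + 1) => y (i + 1) := by
        rw [List.ofFn_succ]; simp
      rw [e2, contP_cons, e1, contQ_cons]

/-- The Jacobi parameters `(b(x), c(x) d(x))` at the point `x`. -/
noncomputable def params (b c d : C(I, ℂ)) (x : I) : ℂ × ℂ := (b x, c x * d x)

theorem eval_charpoly_sampledToeplitz (b c d : C(I, ℂ)) {n : ℕ} (u : Fin n → I) (z : ℂ) :
    (sampledToeplitz (tridiagSymbol b c d) u).charpoly.eval z =
      contP z (List.ofFn fun i => params b c d (orderStat u i)) := by
  rw [Matrix.eval_charpoly]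
  let x : ℕ → I := fun i => if h : i < n then orderStat u ⟨i, h⟩ else 0
  have hx : ∀ i : Fin n, x i = orderStat u i := fun i => by simp [x]
  have h := det_tridiag z n (fun i => params b c d (x i)) (fun i => -d (x i)) (fun i => -c (x i))
    (fun i => by simp [params, mul_comm])
  simp only [hx] at h
  rw [← h]
  congr 1
  ext i j
  simp only [Matrix.scalar_apply, Matrix.sub_apply, sampledToeplitz, Matrix.of_apply, tridiag,
    symbolCoeff_tridiagSymbol, Matrix.diagonal_apply, ← hx, params, Fin.ext_iff]
  rcases lt_trichotomy (i : ℕ) j with hij | hij | hij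
  · have hmin : min i j = i := min_eq_left (Fin.le_def.2 hij.le)
    have a1 : ¬ ((i : ℤ) - j = 0) := by omega
    have a2 : ¬ ((i : ℤ) - j = 1) := by omega
    have a3 : ¬ ((j : ℕ) + 1 = i) := by omega
    have a4 : ((i : ℤ) - j = -1) ↔ (i : ℕ) + 1 = j := by omega
    simp only [hmin, hij.ne, a1, a2, a3, a4, if_false]
    split_ifs <;> simp
  · simp [Fin.ext hij]
  · have hmin : min i j = j := min_eq_right (Fin.le_def.2 hij.le)
    have a1 : ¬ ((i : ℤ) - j = 0) := by omega
    have a2 : ¬ ((i : ℤ) - j = -1) := by omega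
    have a3 : ¬ ((i : ℕ) + 1 = j) := by omega
    have a4 : ((i : ℤ) - j = 1) ↔ (j : ℕ) + 1 = i := by omega
    simp only [hmin, hij.ne', a1, a2, a3, a4, if_false]
    split_ifs <;> simp


/-! ### Transfer steps and the Weyl function -/

/-- One transfer step: it maps `(D_{k-1}, γ_{k-1} D_{k-2})` to `(D_k, γ_k D_{k-1})`, where `D_k` is
the leading `k × k` minor of `z - T`. -/
def step (z : ℂ) (v y : ℂ × ℂ) : ℂ × ℂ := ((z - y.1) * v.1 - v.2, y.2 * v.1)

/-- The result of the transfer steps along a list. -/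
def run (z : ℂ) (v : ℂ × ℂ) (l : List (ℂ × ℂ)) : ℂ × ℂ := l.foldl (step z) v

@[simp] theorem run_nil (z : ℂ) (v : ℂ × ℂ) : run z v [] = v := rfl
@[simp] theorem run_cons (z : ℂ) (v y : ℂ × ℂ) (l : List (ℂ × ℂ)) :
    run z v (y :: l) = run z (step z v y) l := rfl
theorem run_append (z : ℂ) (v : ℂ × ℂ) (l l' : List (ℂ × ℂ)) :
    run z v (l ++ l') = run z (run z v l) l' := by
  simp [run, List.foldl_append]

theorem run_fst (z : ℂ) (v : ℂ × ℂ) (l : List (ℂ × ℂ)) :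
    (run z v l).1 = v.1 * contP z l - v.2 * contQ z l := by
  induction l generalizing v with
  | nil => simp
  | cons y l ih => rw [run_cons, ih]; simp [step]; ring

theorem norm_run_le {K C R : ℝ} {z : ℂ} (hz : ‖z‖ ≤ R) (hK : R + C + 1 ≤ K) (l : List (ℂ × ℂ))
    (hl : ∀ y ∈ l, ‖y‖ ≤ C) (v : ℂ × ℂ) : ‖run z v l‖ ≤ K ^ l.length * ‖v‖ := by
  induction l generalizing v with
  | nil => simp
  | cons y l ih =>
    have hy := hl y (by simp)
    have hy1 : ‖y.1‖ ≤ C := (norm_fst_le y).trans hy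
    have hy2 : ‖y.2‖ ≤ C := (norm_snd_le y).trans hy
    have hC : 0 ≤ C := (norm_nonneg _).trans hy
    have hR : 0 ≤ R := (norm_nonneg _).trans hz
    have hK0 : 0 ≤ K := by linarith
    have h1 : ‖step z v y‖ ≤ K * ‖v‖ := by
      have hv1 := norm_fst_le v
      have hv2 := norm_snd_le v
      have h3 : ‖z - y.1‖ ≤ R + C := (norm_sub_le _ _).trans (by linarith)
      refine max_le ?_ ?_
      · calc ‖(z - y.1) * v.1 - v.2‖ ≤ ‖(z - y.1) * v.1‖ + ‖v.2‖ := norm_sub_le _ _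
          _ ≤ (R + C) * ‖v‖ + 1 * ‖v‖ := by
            rw [norm_mul]; gcongr; linarith
          _ ≤ K * ‖v‖ := by rw [← add_mul]; gcongr
      · calc ‖y.2 * v.1‖ = ‖y.2‖ * ‖v.1‖ := norm_mul _ _
          _ ≤ K * ‖v‖ := by gcongr; linarith
    rw [run_cons]
    calc _ ≤ K ^ l.length * ‖step z v y‖ := ih (fun y hy => hl y (by simp [hy])) _
      _ ≤ K ^ l.length * (K * ‖v‖) := by gcongr
      _ = _ := by rw [List.length_cons]; ring

theorem norm_contP_le {K C R : ℝ} {z : ℂ} (hz : ‖z‖ ≤ R) (hK : R + C + 1 ≤ K) (l : List (ℂ × ℂ))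
    (hl : ∀ y ∈ l, ‖y‖ ≤ C) : ‖contP z l‖ ≤ K ^ l.length := by
  have h := (norm_fst_le _).trans (norm_run_le hz hK l hl (1, 0))
  rw [run_fst] at h
  simpa [Prod.norm_def] using h

theorem norm_contQ_le {K C R : ℝ} {z : ℂ} (hz : ‖z‖ ≤ R) (hK : R + C + 1 ≤ K) (l : List (ℂ × ℂ))
    (hl : ∀ y ∈ l, ‖y‖ ≤ C) : ‖contQ z l‖ ≤ K ^ l.length := by
  have h := (norm_fst_le _).trans (norm_run_le hz hK l hl (0, 1))
  rw [run_fst] at h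
  simpa [Prod.norm_def] using h

/-- The Weyl function: the corner entry of the resolvent `(z - T)⁻¹`, as a continued fraction. -/
noncomputable def weyl (z : ℂ) : List (ℂ × ℂ) → ℂ
  | [] => 0
  | y :: l => (z - y.1 - y.2 * weyl z l)⁻¹

@[simp] theorem weyl_nil (z : ℂ) : weyl z [] = 0 := rfl
@[simp] theorem weyl_cons (z : ℂ) (y : ℂ × ℂ) (l : List (ℂ × ℂ)) :
    weyl z (y :: l) = (z - y.1 - y.2 * weyl z l)⁻¹ := rfl

theorem contQ_eq_weyl_mul (z : ℂ) (l : List (ℂ × ℂ)) (h : contP z l ≠ 0)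
    (h' : contQ z l.tail = weyl z l.tail * contP z l.tail) :
    contQ z l = weyl z l * contP z l := by
  cases l with
  | nil => simp
  | cons y l =>
    simp only [List.tail_cons] at h'
    have e : contP z (y :: l) = (z - y.1 - y.2 * weyl z l) * contP z l := by
      rw [contP_cons, h']; ring
    have h0 : z - y.1 - y.2 * weyl z l ≠ 0 := by
      intro h0; rw [e, h0, zero_mul] at h; exact h rfl
    rw [contQ_cons, weyl_cons, e, inv_mul_cancel_left₀ h0]

/-- The inversion `w ↦ s / w` maps the half-plane `Re w ≥ a` to the half-plane `Re w ≤ a` as soon as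
`(Re s + |s|) / 2`, the square of the real part of `√s`, is at most `a²`. -/
theorem re_div_le {a : ℝ} (ha : 0 < a) {w s : ℂ} (hw : a ≤ w.re) (hs : (s.re + ‖s‖) / 2 ≤ a ^ 2) :
    (s / w).re ≤ a := by
  have hn : 0 < Complex.normSq w := by
    rw [Complex.normSq_pos]; rintro rfl; simp at hw; linarith
  rw [Complex.div_re, ← add_div, div_le_iff₀ hn, Complex.normSq_apply]
  have h1 : ‖s‖ ^ 2 = s.re * s.re + s.im * s.im := by
    rw [← Complex.normSq_eq_norm_sq, Complex.normSq_apply]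
  have h2 := norm_nonneg s
  set X := s.re
  set Y := s.im
  set p := w.re
  set q := w.im
  have h3 : Y * Y ≤ 4 * a ^ 4 - 4 * a ^ 2 * X := by nlinarith
  have h4 : 4 * a ^ 2 * (X * p + Y * q) ≤ 4 * a ^ 2 * (a * (p * p + q * q)) := by
    have h5 : 4 * a ^ 2 * X * p ≤ (4 * a ^ 4 - Y * Y) * p := by
      apply mul_le_mul_of_nonneg_right _ (by linarith); linarith
    have h6 : Y * Y * a ≤ Y * Y * p := by
      apply mul_le_mul_of_nonneg_left hw (mul_self_nonneg Y)
    have h7 : 4 * a ^ 3 * (a * p) ≤ 4 * a ^ 3 * (p * p) := by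
      apply mul_le_mul_of_nonneg_left _ (by positivity)
      nlinarith
    have h8 : 0 ≤ a * (Y - 2 * a * q) ^ 2 := by positivity
    nlinarith
  exact le_of_mul_le_mul_left h4 (by positivity)

/-- The Jacobi parameters `y` satisfy the half-plane condition at `z`, in the direction `c` and with
margin `κ`: then `z` lies outside the segment `[y.1 - 2√y.2, y.1 + 2√y.2]`. -/
def HalfPlane (c : ℂ) (a κ : ℝ) (z : ℂ) (y : ℂ × ℂ) : Prop :=
  ((c ^ 2 * y.2).re + ‖y.2‖) / 2 ≤ a ^ 2 ∧ 2 * a + κ ≤ (c * (z - y.1)).re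

section HalfPlane

variable {c : ℂ} {a κ : ℝ} {z : ℂ}

theorem re_mul_div_le (hc : ‖c‖ = 1) (ha : 0 < a) {y : ℂ × ℂ}
    (hy : ((c ^ 2 * y.2).re + ‖y.2‖) / 2 ≤ a ^ 2) {r : ℂ} (hr : a ≤ (c * r).re) :
    (c * (y.2 / r)).re ≤ a := by
  have hc0 : c ≠ 0 := by rintro rfl; simp at hc
  have h := re_div_le ha hr (s := c ^ 2 * y.2) (by simpa [hc] using hy)
  have e : c * (y.2 / r) = c ^ 2 * y.2 / (c * r) := by
    rcases eq_or_ne r 0 with rfl | hr0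
    · simp
    · field_simp
  rwa [e]

theorem le_norm_of_le_re (hc : ‖c‖ = 1) {r : ℂ} {t : ℝ} (h : t ≤ (c * r).re) : t ≤ ‖r‖ := by
  have := (h.trans (Complex.re_le_norm _))
  rwa [norm_mul, hc, one_mul] at this

/-- Under the half-plane condition the continuant does not vanish, and the reciprocal of the Weyl
function stays in a half-plane. -/
theorem HalfPlane.weyl_aux (hc : ‖c‖ = 1) (ha : 0 < a) (hκ : 0 < κ) (l : List (ℂ × ℂ))
    (hl : ∀ y ∈ l, HalfPlane c a κ z y) :
    contP z l ≠ 0 ∧ contQ z l = weyl z l * contP z l ∧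
      (l ≠ [] → weyl z l ≠ 0 ∧ a + κ ≤ (c * (weyl z l)⁻¹).re) := by
  induction l with
  | nil => simp
  | cons y l ih =>
    obtain ⟨h1, h2, h3⟩ := ih fun y hy => hl y (by simp [hy])
    obtain ⟨hy1, hy2⟩ := hl y (by simp)
    have h4 : (c * (y.2 * weyl z l)).re ≤ a := by
      rcases eq_or_ne l [] with rfl | hne
      · simp [ha.le]
      · obtain ⟨-, h5⟩ := h3 hne
        have := re_mul_div_le hc ha hy1 (r := (weyl z l)⁻¹) (by linarith)
        rwa [div_inv_eq_mul] at this
    have h6 : a + κ ≤ (c * (z - y.1 - y.2 * weyl z l)).re := by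
      rw [mul_sub, Complex.sub_re]; linarith
    have h7 : z - y.1 - y.2 * weyl z l ≠ 0 := by
      intro h; rw [h] at h6; simp at h6; linarith
    have h8 : contP z (y :: l) ≠ 0 := by
      rw [contP_cons, h2, ← mul_assoc, ← sub_mul]; exact mul_ne_zero h7 h1
    refine ⟨h8, contQ_eq_weyl_mul _ _ h8 h2, fun _ => ⟨by simpa using h7, ?_⟩⟩
    rwa [weyl_cons, inv_inv]

theorem HalfPlane.norm_weyl_le (hc : ‖c‖ = 1) (ha : 0 < a) (hκ : 0 < κ) (l : List (ℂ × ℂ))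
    (hl : ∀ y ∈ l, HalfPlane c a κ z y) : ‖weyl z l‖ ≤ κ⁻¹ := by
  rcases eq_or_ne l [] with rfl | hne
  · simp [hκ.le]
  · obtain ⟨h0, h⟩ := (HalfPlane.weyl_aux hc ha hκ l hl).2.2 hne
    have h2 := le_norm_of_le_re hc h
    rw [norm_inv] at h2
    have h3 : 0 < ‖weyl z l‖ := norm_pos_iff.2 h0
    rw [← inv_inv ‖weyl z l‖]
    gcongr
    linarith

/-- `ρ` is the root of `ρ² - (z - y.1) ρ + y.2 = 0` that lies in the half-plane of `HalfPlane`. -/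
def IsRoot (c : ℂ) (a κ : ℝ) (z : ℂ) (y : ℂ × ℂ) (ρ : ℂ) : Prop :=
  z - y.1 = ρ + y.2 / ρ ∧ a + κ ≤ (c * ρ).re

theorem HalfPlane.exists_isRoot (hc : ‖c‖ = 1) (ha : 0 < a) (hκ : 0 < κ) {y : ℂ × ℂ}
    (hy : HalfPlane c a κ z y) : ∃ ρ, IsRoot c a κ z y ρ := by
  obtain ⟨hy1, hy2⟩ := hy
  obtain ⟨s, hs⟩ := IsSquare.exists_mul_self ((z - y.1) ^ 2 - 4 * y.2) (by
    obtain ⟨s, hs⟩ := IsAlgClosed.exists_pow_nat_eq ((z - y.1) ^ 2 - 4 * y.2) (n := 2) (by norm_num)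
    exact ⟨s, by rw [← hs, sq]⟩)
  set r := (z - y.1 + s) / 2
  set t := (z - y.1 - s) / 2
  have hsum : z - y.1 = r + t := by simp only [r, t]; ring
  have hprod : r * t = y.2 := by simp only [r, t]; linear_combination (1 / 4 : ℂ) * hs
  -- one of the two roots lies in the half-plane, by the sum; the other one then lies outside
  have key : ∀ r t : ℂ, z - y.1 = r + t → r * t = y.2 → a < (c * r).re → IsRoot c a κ z y r := by
    intro r t h1 h2 h3
    have hr : r ≠ 0 := by rintro rfl; simp at h3; linarith
    have ht : t = y.2 / r := by rw [← h2]; field_simp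
    have h4 := re_mul_div_le hc ha hy1 h3.le
    refine ⟨by rw [h1, ht], ?_⟩
    rw [h1, mul_add, Complex.add_re, ht] at hy2
    linarith
  by_cases h : a < (c * r).re
  · exact ⟨r, key r t hsum hprod h⟩
  · refine ⟨t, key t r (by rw [hsum, add_comm]) (by rw [mul_comm, hprod]) ?_⟩
    rw [hsum, mul_add, Complex.add_re] at hy2
    linarith

theorem IsRoot.le_norm (hc : ‖c‖ = 1) (ha : 0 < a) {y : ℂ × ℂ} {ρ : ℂ}
    (hρ : IsRoot c a κ z y ρ) : κ ≤ ‖ρ‖ := by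
  have := le_norm_of_le_re hc hρ.2
  linarith

/-- `P - (γ / ρ) Q` dominates the continuants. -/
theorem IsRoot.bounds (hc : ‖c‖ = 1) (ha : 0 < a) (hκ : 0 < κ) {C : ℝ} {y₀ : ℂ × ℂ} {ρ : ℂ}
    (h0 : HalfPlane c a κ z y₀) (hC : ‖y₀‖ ≤ C) (hρ : IsRoot c a κ z y₀ ρ) (l : List (ℂ × ℂ))
    (hl : ∀ y ∈ l, HalfPlane c a κ z y) :
    ‖contQ z l‖ ≤ κ⁻¹ * ‖contP z l - y₀.2 / ρ * contQ z l‖ ∧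
    ‖contP z l‖ ≤ (1 + C / κ ^ 2) * ‖contP z l - y₀.2 / ρ * contQ z l‖ ∧
    ‖contP z l - y₀.2 / ρ * contQ z l‖ ≤ (1 + C / κ ^ 2) * ‖contP z l‖ := by
  have hρκ := hρ.le_norm hc ha
  have hρ0 : 0 < ‖ρ‖ := hκ.trans_le hρκ
  have hy2 : ‖y₀.2‖ ≤ C := (norm_snd_le _).trans hC
  have hC0 : 0 ≤ C := (norm_nonneg _).trans hC
  have hρ' : ‖y₀.2 / ρ‖ ≤ C / κ := by
    rw [norm_div]; gcongr
  obtain ⟨h1, h2, h3⟩ := HalfPlane.weyl_aux hc ha hκ l hl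
  have hQ : ‖contQ z l‖ ≤ κ⁻¹ * ‖contP z l - y₀.2 / ρ * contQ z l‖ := by
    rcases eq_or_ne l [] with rfl | hne
    · simp [hκ.le]
    · obtain ⟨h4, h5⟩ := h3 hne
      have h6 : κ ≤ ‖(weyl z l)⁻¹ - y₀.2 / ρ‖ := by
        apply le_norm_of_le_re hc
        have := re_mul_div_le hc ha h0.1 (r := ρ) (by linarith [hρ.2])
        rw [mul_sub, Complex.sub_re]; linarith
      have e : contP z l - y₀.2 / ρ * contQ z l = ((weyl z l)⁻¹ - y₀.2 / ρ) * contQ z l := by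
        rw [sub_mul, h2, inv_mul_cancel_left₀ h4]
      rw [e, norm_mul, ← div_eq_inv_mul, le_div_iff₀ hκ, mul_comm]
      gcongr
  refine ⟨hQ, ?_, ?_⟩
  · calc ‖contP z l‖ = ‖(contP z l - y₀.2 / ρ * contQ z l) + y₀.2 / ρ * contQ z l‖ := by
          rw [sub_add_cancel]
      _ ≤ ‖contP z l - y₀.2 / ρ * contQ z l‖ + ‖y₀.2 / ρ * contQ z l‖ := norm_add_le _ _
      _ ≤ ‖contP z l - y₀.2 / ρ * contQ z l‖ +
          C / κ * (κ⁻¹ * ‖contP z l - y₀.2 / ρ * contQ z l‖) := by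
        rw [norm_mul]; gcongr
      _ = _ := by field_simp
  · have hm := HalfPlane.norm_weyl_le hc ha hκ l hl
    calc ‖contP z l - y₀.2 / ρ * contQ z l‖ ≤ ‖contP z l‖ + ‖y₀.2 / ρ * contQ z l‖ :=
          norm_sub_le _ _
      _ ≤ ‖contP z l‖ + C / κ * (κ⁻¹ * ‖contP z l‖) := by
        rw [h2, norm_mul, norm_mul]; gcongr
      _ = _ := by field_simp

/-- For parameters `δ`-close to `y₀`, the continuants grow like powers of the root `ρ`. -/
theorem IsRoot.growth (hc : ‖c‖ = 1) (ha : 0 < a) (hκ : 0 < κ) {C δ θ : ℝ} {y₀ : ℂ × ℂ} {ρ : ℂ}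
    (h0 : HalfPlane c a κ z y₀) (hC : ‖y₀‖ ≤ C) (hρ : IsRoot c a κ z y₀ ρ)
    (hθ : δ * (1 + C / κ ^ 2 + κ⁻¹) / κ ≤ θ) (hθ1 : θ ≤ 1) (l : List (ℂ × ℂ))
    (hl : ∀ y ∈ l, HalfPlane c a κ z y) (hδ : ∀ y ∈ l, ‖y - y₀‖ ≤ δ) :
    ‖contP z l - y₀.2 / ρ * contQ z l‖ ≤ (‖ρ‖ * (1 + θ)) ^ l.length ∧
    (‖ρ‖ * (1 - θ)) ^ l.length ≤ ‖contP z l - y₀.2 / ρ * contQ z l‖ := by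
  have hρκ := hρ.le_norm hc ha
  have hρ0 : 0 < ‖ρ‖ := hκ.trans_le hρκ
  induction l with
  | nil => simp
  | cons y l ih =>
    have hl' : ∀ y ∈ l, HalfPlane c a κ z y := fun y hy => hl y (by simp [hy])
    obtain ⟨ih1, ih2⟩ := ih hl' (fun y hy => hδ y (by simp [hy]))
    obtain ⟨b1, b2, b3⟩ := IsRoot.bounds hc ha hκ h0 hC hρ l hl'
    have hy := hδ y (by simp)
    have hδ0 : 0 ≤ δ := (norm_nonneg _).trans hy
    have hy1 : ‖y.1 - y₀.1‖ ≤ δ := (norm_fst_le (y - y₀)).trans hy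
    have hy2 : ‖y.2 - y₀.2‖ ≤ δ := (norm_snd_le (y - y₀)).trans hy
    have hC0 : 0 ≤ C := (norm_nonneg _).trans hC
    have hθ0 : 0 ≤ θ := le_trans (by positivity) hθ
    have hρne : ρ ≠ 0 := norm_pos_iff.1 hρ0
    set E := contP z l - y₀.2 / ρ * contQ z l with hE
    have e : contP z (y :: l) - y₀.2 / ρ * contQ z (y :: l) =
        ρ * E - ((y.1 - y₀.1) * contP z l + (y.2 - y₀.2) * contQ z l) := by
      have h1 := hρ.1
      have h2 : z = y₀.1 + ρ + y₀.2 / ρ := by linear_combination h1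
      rw [contP_cons, contQ_cons, hE, h2]
      field_simp
      ring
    have herr : ‖(y.1 - y₀.1) * contP z l + (y.2 - y₀.2) * contQ z l‖ ≤ ‖ρ‖ * θ * ‖E‖ := by
      calc _ ≤ ‖(y.1 - y₀.1) * contP z l‖ + ‖(y.2 - y₀.2) * contQ z l‖ := norm_add_le _ _
        _ ≤ δ * ((1 + C / κ ^ 2) * ‖E‖) + δ * (κ⁻¹ * ‖E‖) := by
          rw [norm_mul, norm_mul]; gcongr
        _ = (δ * (1 + C / κ ^ 2 + κ⁻¹) / κ) * κ * ‖E‖ := by field_simp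
        _ ≤ θ * ‖ρ‖ * ‖E‖ := by gcongr
        _ = _ := by ring
    rw [e, List.length_cons]
    constructor
    · calc _ ≤ ‖ρ * E‖ + ‖ρ‖ * θ * ‖E‖ := (norm_sub_le _ _).trans (by gcongr)
        _ = (‖ρ‖ * (1 + θ)) * ‖E‖ := by rw [norm_mul]; ring
        _ ≤ (‖ρ‖ * (1 + θ)) * (‖ρ‖ * (1 + θ)) ^ l.length := by gcongr
        _ = _ := by ring
    · calc (‖ρ‖ * (1 - θ)) ^ (l.length + 1) = (‖ρ‖ * (1 - θ)) * (‖ρ‖ * (1 - θ)) ^ l.length := by ring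
        _ ≤ (‖ρ‖ * (1 - θ)) * ‖E‖ := by
          gcongr
        _ = ‖ρ * E‖ - ‖ρ‖ * θ * ‖E‖ := by rw [norm_mul]; ring
        _ ≤ ‖ρ * E‖ - ‖(y.1 - y₀.1) * contP z l + (y.2 - y₀.2) * contQ z l‖ := by gcongr
        _ ≤ _ := norm_sub_norm_le _ _

theorem IsRoot.norm_contP_le (hc : ‖c‖ = 1) (ha : 0 < a) (hκ : 0 < κ) {C δ θ : ℝ}
    {y₀ : ℂ × ℂ} {ρ : ℂ} (h0 : HalfPlane c a κ z y₀) (hC : ‖y₀‖ ≤ C) (hρ : IsRoot c a κ z y₀ ρ)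
    (hθ : δ * (1 + C / κ ^ 2 + κ⁻¹) / κ ≤ θ) (hθ1 : θ ≤ 1) (l : List (ℂ × ℂ))
    (hl : ∀ y ∈ l, HalfPlane c a κ z y) (hδ : ∀ y ∈ l, ‖y - y₀‖ ≤ δ) :
    ‖contP z l‖ ≤ (1 + C / κ ^ 2) * (‖ρ‖ * (1 + θ)) ^ l.length := by
  have hC0 : 0 ≤ C := (norm_nonneg _).trans hC
  refine ((IsRoot.bounds hc ha hκ h0 hC hρ l hl).2.1).trans ?_
  gcongr
  exact (IsRoot.growth hc ha hκ h0 hC hρ hθ hθ1 l hl hδ).1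

theorem IsRoot.le_norm_contP (hc : ‖c‖ = 1) (ha : 0 < a) (hκ : 0 < κ) {C δ θ : ℝ}
    {y₀ : ℂ × ℂ} {ρ : ℂ} (h0 : HalfPlane c a κ z y₀) (hC : ‖y₀‖ ≤ C) (hρ : IsRoot c a κ z y₀ ρ)
    (hθ : δ * (1 + C / κ ^ 2 + κ⁻¹) / κ ≤ θ) (hθ1 : θ ≤ 1) (l : List (ℂ × ℂ))
    (hl : ∀ y ∈ l, HalfPlane c a κ z y) (hδ : ∀ y ∈ l, ‖y - y₀‖ ≤ δ) :
    (‖ρ‖ * (1 - θ)) ^ l.length ≤ (1 + C / κ ^ 2) * ‖contP z l‖ :=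
  ((IsRoot.growth hc ha hκ h0 hC hρ hθ hθ1 l hl hδ).2).trans
    (IsRoot.bounds hc ha hκ h0 hC hρ l hl).2.2

theorem norm_run_fst_le (hc : ‖c‖ = 1) (ha : 0 < a) (hκ : 0 < κ) (l : List (ℂ × ℂ))
    (hl : ∀ y ∈ l, HalfPlane c a κ z y) (v : ℂ × ℂ) :
    ‖(run z v l).1‖ ≤ (1 + κ⁻¹) * ‖contP z l‖ * ‖v‖ := by
  have h := (HalfPlane.weyl_aux hc ha hκ l hl).2.1
  have hm := HalfPlane.norm_weyl_le hc ha hκ l hl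
  rw [run_fst, h]
  calc _ ≤ ‖v.1 * contP z l‖ + ‖v.2 * (weyl z l * contP z l)‖ := norm_sub_le _ _
    _ ≤ ‖v‖ * ‖contP z l‖ + ‖v‖ * (κ⁻¹ * ‖contP z l‖) := by
      rw [norm_mul, norm_mul, norm_mul]
      gcongr
      · exact norm_fst_le v
      · exact norm_snd_le v
    _ = _ := by ring

theorem IsRoot.norm_run_le (hc : ‖c‖ = 1) (ha : 0 < a) (hκ : 0 < κ) {C δ θ : ℝ}
    {y₀ : ℂ × ℂ} {ρ : ℂ} (h0 : HalfPlane c a κ z y₀) (hC : ‖y₀‖ ≤ C) (hρ : IsRoot c a κ z y₀ ρ)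
    (hθ : δ * (1 + C / κ ^ 2 + κ⁻¹) / κ ≤ θ) (hθ0 : 0 ≤ θ) (hθ1 : θ ≤ 1) (l : List (ℂ × ℂ))
    (hl : ∀ y ∈ l, HalfPlane c a κ z y) (hδ : ∀ y ∈ l, ‖y - y₀‖ ≤ δ) (hCl : ∀ y ∈ l, ‖y‖ ≤ C)
    (v : ℂ × ℂ) :
    ‖run z v l‖ ≤ (1 + C / κ) * ((1 + κ⁻¹) * (1 + C / κ ^ 2)) *
      (‖ρ‖ * (1 + θ)) ^ l.length * ‖v‖ := by
  have hC0 : 0 ≤ C := (norm_nonneg _).trans hC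
  have hρκ := hρ.le_norm hc ha
  have hρ0 : 0 < ‖ρ‖ := hκ.trans_le hρκ
  set B := (1 + κ⁻¹) * (1 + C / κ ^ 2) with hB
  have hB0 : 0 ≤ B := by positivity
  have hB1 : 1 ≤ B := by
    have : 0 ≤ κ⁻¹ := by positivity
    have : 0 ≤ C / κ ^ 2 := by positivity
    nlinarith
  have hfst : ∀ l : List (ℂ × ℂ), (∀ y ∈ l, HalfPlane c a κ z y) → (∀ y ∈ l, ‖y - y₀‖ ≤ δ) →
      ‖(run z v l).1‖ ≤ B * (‖ρ‖ * (1 + θ)) ^ l.length * ‖v‖ := by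
    intro l hl hδ
    calc _ ≤ (1 + κ⁻¹) * ‖contP z l‖ * ‖v‖ := norm_run_fst_le hc ha hκ l hl v
      _ ≤ (1 + κ⁻¹) * ((1 + C / κ ^ 2) * (‖ρ‖ * (1 + θ)) ^ l.length) * ‖v‖ := by
        gcongr
        exact IsRoot.norm_contP_le hc ha hκ h0 hC hρ hθ hθ1 l hl hδ
      _ = _ := by rw [hB]; ring
  have hCκ : 0 ≤ C / κ := by positivity
  refine max_le ?_ ?_
  · refine (hfst l hl hδ).trans ?_
    have : 0 ≤ C / κ * (B * (‖ρ‖ * (1 + θ)) ^ l.length * ‖v‖) := by positivity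
    linarith
  · rcases List.eq_nil_or_concat l with rfl | ⟨l', y, rfl⟩
    · have := norm_snd_le v
      have h1 : 1 * ‖v‖ ≤ (1 + C / κ) * B * ‖v‖ := by
        gcongr; nlinarith
      simpa using this.trans (by linarith)
    · have hy := hCl y (by simp)
      have hy2 : ‖y.2‖ ≤ C := (norm_snd_le y).trans hy
      rw [List.concat_eq_append, run_append, run_cons, run_nil]
      have h2 := hfst l' (fun y hy => hl y (by simp [hy])) (fun y hy => hδ y (by simp [hy]))
      have h3 : κ ≤ ‖ρ‖ * (1 + θ) := hρκ.trans (by nlinarith)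
      calc ‖(step z (run z v l') y).2‖ = ‖y.2‖ * ‖(run z v l').1‖ := norm_mul _ _
        _ ≤ C * (B * (‖ρ‖ * (1 + θ)) ^ l'.length * ‖v‖) := by gcongr
        _ = C / κ * B * (κ * (‖ρ‖ * (1 + θ)) ^ l'.length) * ‖v‖ := by field_simp
        _ ≤ (1 + C / κ) * B * ((‖ρ‖ * (1 + θ)) * (‖ρ‖ * (1 + θ)) ^ l'.length) * ‖v‖ := by
          gcongr; linarith
        _ = _ := by rw [List.length_append, List.length_singleton]; ring

/-- The root in the half-plane is the one of larger modulus. -/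
theorem IsRoot.norm_div_le (hc : ‖c‖ = 1) (ha : 0 < a) (hκ : 0 < κ) {y : ℂ × ℂ} {ρ : ℂ}
    (h0 : HalfPlane c a κ z y) (hρ : IsRoot c a κ z y ρ) : ‖y.2 / ρ‖ ≤ ‖ρ‖ := by
  have hρκ := hρ.le_norm hc ha
  have hρ0 : 0 < ‖ρ‖ := hκ.trans_le hρκ
  have hρne : ρ ≠ 0 := norm_pos_iff.1 hρ0
  set C := ‖y‖
  -- for constant parameters the two combinations of continuants are exact powers of the roots
  have hpow : ∀ N : ℕ, contP z (List.replicate N y) - ρ * contQ z (List.replicate N y) =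
      (y.2 / ρ) ^ N := by
    intro N
    induction N with
    | zero => simp
    | succ N ih =>
      have h2 : z = y.1 + ρ + y.2 / ρ := by linear_combination hρ.1
      rw [List.replicate_succ, contP_cons, contQ_cons, pow_succ, ← ih]
      rw [show z - y.1 = ρ + y.2 / ρ from hρ.1]
      field_simp
      ring
  have hbound : ∀ N : ℕ, ‖y.2 / ρ‖ ^ N ≤ (1 + C / κ ^ 2 + ‖ρ‖ * κ⁻¹) * ‖ρ‖ ^ N := by
    intro N
    have hl : ∀ x ∈ List.replicate N y, HalfPlane c a κ z x := by
      intro x hx; rw [List.eq_of_mem_replicate hx]; exact h0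
    have hg := (IsRoot.growth hc ha hκ h0 le_rfl hρ (δ := 0) (θ := 0) (by simp) (by simp)
      (List.replicate N y) hl (by
        intro x hx; rw [List.eq_of_mem_replicate hx]; simp)).1
    obtain ⟨b1, b2, -⟩ := IsRoot.bounds hc ha hκ h0 le_rfl hρ (List.replicate N y) hl
    rw [← norm_pow, ← hpow]
    simp only [add_zero, mul_one, List.length_replicate] at hg
    calc _ ≤ ‖contP z (List.replicate N y)‖ + ‖ρ‖ * ‖contQ z (List.replicate N y)‖ := by
          rw [← norm_mul]; exact norm_sub_le _ _
      _ ≤ (1 + C / κ ^ 2) * ‖ρ‖ ^ N + ‖ρ‖ * (κ⁻¹ * ‖ρ‖ ^ N) := by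
          gcongr
          · exact b2.trans (by gcongr)
          · exact b1.trans (by gcongr)
      _ = _ := by ring
  by_contra! hlt
  have h1 : 1 < ‖y.2 / ρ‖ / ‖ρ‖ := by rwa [one_lt_div hρ0]
  obtain ⟨N, hN⟩ := pow_unbounded_of_one_lt (1 + C / κ ^ 2 + ‖ρ‖ * κ⁻¹) h1
  have h2 := hbound N
  rw [div_pow, lt_div_iff₀ (by positivity)] at hN
  linarith

theorem IsRoot.abs_log_sub_le (hc : ‖c‖ = 1) (ha : 0 < a) (hκ : 0 < κ) {δ θ : ℝ}
    {y y₀ : ℂ × ℂ} {ρ ρ₀ : ℂ} (h0 : HalfPlane c a κ z y₀)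
    (hρ : IsRoot c a κ z y ρ) (hρ₀ : IsRoot c a κ z y₀ ρ₀) (hδ : ‖y - y₀‖ ≤ δ)
    (hθ : δ * (1 + κ⁻¹) / κ ≤ θ) (hθ1 : θ ≤ 1 / 2) :
    |Real.log ‖ρ‖ - Real.log ‖ρ₀‖| ≤ 2 * θ := by
  have hρκ := hρ.le_norm hc ha
  have hρ0 : 0 < ‖ρ‖ := hκ.trans_le hρκ
  have hρne : ρ ≠ 0 := norm_pos_iff.1 hρ0
  have hρ₀0 : 0 < ‖ρ₀‖ := hκ.trans_le (hρ₀.le_norm hc ha)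
  have hρ₀ne : ρ₀ ≠ 0 := norm_pos_iff.1 hρ₀0
  have hy1 : ‖y.1 - y₀.1‖ ≤ δ := (norm_fst_le (y - y₀)).trans hδ
  have hy2 : ‖y.2 - y₀.2‖ ≤ δ := (norm_snd_le (y - y₀)).trans hδ
  have hδ0 : 0 ≤ δ := (norm_nonneg _).trans hδ
  have e : (ρ - ρ₀) * (ρ - y₀.2 / ρ₀) = -((y.1 - y₀.1) * ρ + (y.2 - y₀.2)) := by
    have h1 := hρ.1
    have h2 := hρ₀.1
    field_simp at h1 h2 ⊢
    linear_combination (-ρ₀) * h1 + ρ * h2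
  have h6 : κ ≤ ‖ρ - y₀.2 / ρ₀‖ := by
    apply le_norm_of_le_re hc
    have := re_mul_div_le hc ha h0.1 (r := ρ₀) (by linarith [hρ₀.2])
    rw [mul_sub, Complex.sub_re]; linarith [hρ.2]
  have h7 : ‖ρ - ρ₀‖ ≤ θ * ‖ρ‖ := by
    have h8 : ‖ρ - ρ₀‖ * κ ≤ δ * ‖ρ‖ + δ := by
      calc ‖ρ - ρ₀‖ * κ ≤ ‖ρ - ρ₀‖ * ‖ρ - y₀.2 / ρ₀‖ := by gcongr
        _ = ‖(y.1 - y₀.1) * ρ + (y.2 - y₀.2)‖ := by rw [← norm_mul, e, norm_neg]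
        _ ≤ ‖(y.1 - y₀.1) * ρ‖ + ‖y.2 - y₀.2‖ := norm_add_le _ _
        _ ≤ δ * ‖ρ‖ + δ := by rw [norm_mul]; gcongr
    have h9 : δ ≤ δ * κ⁻¹ * ‖ρ‖ := by
      rw [mul_assoc]; apply le_mul_of_one_le_right hδ0
      rw [← div_eq_inv_mul, one_le_div hκ]; exact hρκ
    calc ‖ρ - ρ₀‖ ≤ (δ * ‖ρ‖ + δ) / κ := by rwa [le_div_iff₀ hκ]
      _ ≤ (δ * ‖ρ‖ + δ * κ⁻¹ * ‖ρ‖) / κ := by gcongr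
      _ = δ * (1 + κ⁻¹) / κ * ‖ρ‖ := by ring
      _ ≤ _ := by gcongr
  have hlo : (1 - θ) * ‖ρ‖ ≤ ‖ρ₀‖ := by
    have := norm_sub_norm_le ρ ρ₀; linarith
  have hhi : ‖ρ₀‖ ≤ (1 + θ) * ‖ρ‖ := by
    have := norm_sub_norm_le ρ₀ ρ; rw [norm_sub_rev] at this; linarith
  have hθ0 : 0 ≤ θ := le_trans (by positivity) hθ
  have l1 : Real.log ‖ρ₀‖ ≤ Real.log ‖ρ‖ + θ := by
    calc _ ≤ Real.log ((1 + θ) * ‖ρ‖) := Real.log_le_log hρ₀0 hhi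
      _ = Real.log (1 + θ) + Real.log ‖ρ‖ := Real.log_mul (by positivity) hρ0.ne'
      _ ≤ _ := by have := Real.log_le_sub_one_of_pos (x := 1 + θ) (by positivity); linarith
  have l2 : Real.log ‖ρ‖ - 2 * θ ≤ Real.log ‖ρ₀‖ := by
    have h1θ : 0 < 1 - θ := by linarith
    have h3 : 1 - (1 - θ)⁻¹ ≤ Real.log (1 - θ) := Real.one_sub_inv_le_log_of_pos h1θ
    have h4 : (1 - θ)⁻¹ ≤ 1 + 2 * θ := by
      rw [inv_le_comm₀ h1θ (by positivity), inv_le_iff_one_le_mul₀ (by positivity)]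
      nlinarith
    calc Real.log ‖ρ‖ - 2 * θ ≤ Real.log (1 - θ) + Real.log ‖ρ‖ := by linarith
      _ = Real.log ((1 - θ) * ‖ρ‖) := (Real.log_mul h1θ.ne' hρ0.ne').symm
      _ ≤ _ := Real.log_le_log (by positivity) hlo
  rw [abs_le]; constructor <;> linarith

end HalfPlane


/-! ### The Weyl function near infinity determines the Jacobi parameters -/

/-- The Weyl function in the coordinate `ζ = 1 / z` at infinity, divided by `ζ`. -/
noncomputable def weylInf (ζ : ℂ) : List (ℂ × ℂ) → ℂ
  | [] => 0
  | y :: l => (1 - y.1 * ζ - y.2 * ζ ^ 2 * weylInf ζ l)⁻¹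

@[simp] theorem weylInf_nil (ζ : ℂ) : weylInf ζ [] = 0 := rfl
@[simp] theorem weylInf_cons (ζ : ℂ) (y : ℂ × ℂ) (l : List (ℂ × ℂ)) :
    weylInf ζ (y :: l) = (1 - y.1 * ζ - y.2 * ζ ^ 2 * weylInf ζ l)⁻¹ := rfl

theorem weylInf_zero {l : List (ℂ × ℂ)} (h : l ≠ []) : weylInf 0 l = 1 := by
  cases l with
  | nil => exact absurd rfl h
  | cons y l => simp

theorem weyl_eq_mul_weylInf {z : ℂ} (hz : z ≠ 0) (l : List (ℂ × ℂ)) :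
    weyl z l = z⁻¹ * weylInf z⁻¹ l := by
  induction l with
  | nil => simp
  | cons y l ih =>
    rw [weyl_cons, weylInf_cons, ih, ← mul_inv]
    congr 1
    field_simp

section

variable {C ρ : ℝ} {ζ : ℂ}

theorem weylInf_bounds (hC : 0 ≤ C) (hρ1 : ρ ≤ 1) (hCρ : C * ρ ≤ 1 / 8) (hζ : ‖ζ‖ ≤ ρ)
    (l : List (ℂ × ℂ)) (hl : ∀ y ∈ l, ‖y‖ ≤ C) :
    ‖weylInf ζ l‖ ≤ 2 ∧ ∀ y : ℂ × ℂ, ‖y‖ ≤ C →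
      ‖1 - y.1 * ζ - y.2 * ζ ^ 2 * weylInf ζ l - 1‖ ≤ 1 / 2 := by
  have hρ0 : 0 ≤ ρ := (norm_nonneg _).trans hζ
  have aux : ∀ w : ℂ, ‖w‖ ≤ 2 → ∀ y : ℂ × ℂ, ‖y‖ ≤ C →
      ‖1 - y.1 * ζ - y.2 * ζ ^ 2 * w - 1‖ ≤ 1 / 2 := by
    intro w hw y hy
    have hy1 : ‖y.1‖ ≤ C := (norm_fst_le y).trans hy
    have hy2 : ‖y.2‖ ≤ C := (norm_snd_le y).trans hy
    have e : 1 - y.1 * ζ - y.2 * ζ ^ 2 * w - 1 = -(y.1 * ζ + y.2 * ζ ^ 2 * w) := by ring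
    rw [e, norm_neg]
    calc _ ≤ ‖y.1 * ζ‖ + ‖y.2 * ζ ^ 2 * w‖ := norm_add_le _ _
      _ ≤ C * ρ + C * ρ ^ 2 * 2 := by
        rw [norm_mul, norm_mul, norm_mul, norm_pow]; gcongr
      _ ≤ 1 / 2 := by nlinarith
  have key : ‖weylInf ζ l‖ ≤ 2 := by
    induction l with
    | nil => simp
    | cons y l ih =>
      have h1 := aux _ (ih fun y hy => hl y (by simp [hy])) y (hl y (by simp))
      have h2 : 1 / 2 ≤ ‖1 - y.1 * ζ - y.2 * ζ ^ 2 * weylInf ζ l‖ := by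
        have := norm_sub_norm_le (1 : ℂ) (1 - (1 - y.1 * ζ - y.2 * ζ ^ 2 * weylInf ζ l))
        rw [norm_sub_rev 1 (1 - y.1 * ζ - y.2 * ζ ^ 2 * weylInf ζ l), norm_one,
          sub_sub_cancel] at this
        linarith
      rw [weylInf_cons, norm_inv, inv_le_comm₀ (by linarith) (by norm_num)]
      linarith
  exact ⟨key, aux _ key⟩

theorem weylInf_denom_bounds (hC : 0 ≤ C) (hρ1 : ρ ≤ 1) (hCρ : C * ρ ≤ 1 / 8) (hζ : ‖ζ‖ ≤ ρ)
    (l : List (ℂ × ℂ)) (hl : ∀ y ∈ l, ‖y‖ ≤ C) (y : ℂ × ℂ) (hy : ‖y‖ ≤ C) :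
    1 / 2 ≤ ‖1 - y.1 * ζ - y.2 * ζ ^ 2 * weylInf ζ l‖ ∧
      ‖1 - y.1 * ζ - y.2 * ζ ^ 2 * weylInf ζ l‖ ≤ 2 := by
  have h1 := (weylInf_bounds hC hρ1 hCρ hζ l hl).2 y hy
  set D := 1 - y.1 * ζ - y.2 * ζ ^ 2 * weylInf ζ l
  have h2 := norm_sub_norm_le (1 : ℂ) (1 - D)
  have h3 := norm_sub_norm_le D 1
  rw [norm_sub_rev 1 D, norm_one, sub_sub_cancel] at h2
  rw [norm_one] at h3
  constructor <;> linarith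

theorem differentiableAt_weylInf (hC : 0 ≤ C) (hρ1 : ρ ≤ 1) (hCρ : C * ρ ≤ 1 / 8) (hζ : ‖ζ‖ ≤ ρ)
    (l : List (ℂ × ℂ)) (hl : ∀ y ∈ l, ‖y‖ ≤ C) :
    DifferentiableAt ℂ (fun ζ => weylInf ζ l) ζ := by
  induction l with
  | nil => simp
  | cons y l ih =>
    have hl' : ∀ y ∈ l, ‖y‖ ≤ C := fun y hy => hl y (by simp [hy])
    have h := ih hl'
    have h1 := (weylInf_denom_bounds hC hρ1 hCρ hζ l hl' y (hl y (by simp))).1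
    simp only [weylInf_cons]
    refine DifferentiableAt.inv (by fun_prop) ?_
    intro h0
    rw [h0, norm_zero] at h1
    norm_num at h1

theorem norm_le_of_sphere {f : ℂ → ℂ} {ε : ℝ} (hρ : 0 < ρ)
    (hf : ∀ ζ : ℂ, ‖ζ‖ ≤ ρ → DifferentiableAt ℂ f ζ) (h : ∀ ζ : ℂ, ‖ζ‖ = ρ → ‖f ζ‖ ≤ ε)
    (hζ : ‖ζ‖ ≤ ρ) : ‖f ζ‖ ≤ ε := by
  have hcl := closure_ball (0 : ℂ) hρ.ne'
  refine Complex.norm_le_of_forall_mem_frontier_norm_le (U := Metric.ball 0 ρ)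
    Metric.isBounded_ball ?_ ?_ ?_
  · refine DifferentiableOn.diffContOnCl fun w hw => (hf w ?_).differentiableWithinAt
    rw [hcl] at hw; simpa using hw
  · intro w hw
    rw [frontier_ball _ hρ.ne'] at hw
    exact h w (by simpa using hw)
  · rw [hcl]; simpa using hζ

theorem weylInf_close_step (hC : 0 ≤ C) (hρ : 0 < ρ) (hρ1 : ρ ≤ 1) (hCρ : C * ρ ≤ 1 / 8)
    {ε g : ℝ} (hg : 0 < g) {y y' : ℂ × ℂ} {l l' : List (ℂ × ℂ)}
    (hl : ∀ x ∈ y :: l, ‖x‖ ≤ C) (hl' : ∀ x ∈ y' :: l', ‖x‖ ≤ C) (hne : l ≠ []) (hne' : l' ≠ [])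
    (hy : g ≤ ‖y.2‖)
    (h : ∀ ζ : ℂ, ‖ζ‖ = ρ → ‖weylInf ζ (y :: l) - weylInf ζ (y' :: l')‖ ≤ ε) :
    ‖y.1 - y'.1‖ ≤ 4 * ε / ρ ∧ ‖y.2 - y'.2‖ ≤ 8 * ε / ρ ^ 2 ∧
      ∀ ζ : ℂ, ‖ζ‖ = ρ → ‖weylInf ζ l - weylInf ζ l'‖ ≤ 24 * ε / (ρ ^ 2 * g) := by
  have hl1 : ∀ x ∈ l, ‖x‖ ≤ C := fun x hx => hl x (by simp [hx])
  have hl1' : ∀ x ∈ l', ‖x‖ ≤ C := fun x hx => hl' x (by simp [hx])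
  have hd : ∀ ζ : ℂ, ‖ζ‖ ≤ ρ → DifferentiableAt ℂ (fun ζ => weylInf ζ l) ζ :=
    fun ζ hζ => differentiableAt_weylInf hC hρ1 hCρ hζ l hl1
  have hd' : ∀ ζ : ℂ, ‖ζ‖ ≤ ρ → DifferentiableAt ℂ (fun ζ => weylInf ζ l') ζ :=
    fun ζ hζ => differentiableAt_weylInf hC hρ1 hCρ hζ l' hl1'
  -- the difference of the reciprocals is `-ζ W(ζ)`, and `W = (β - β') + ζ S`
  set S : ℂ → ℂ := fun ζ => y.2 * weylInf ζ l - y'.2 * weylInf ζ l' with hS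
  set W : ℂ → ℂ := fun ζ => (y.1 - y'.1) + ζ * S ζ with hW
  have hdS : ∀ ζ : ℂ, ‖ζ‖ ≤ ρ → DifferentiableAt ℂ S ζ := fun ζ hζ =>
    ((hd ζ hζ).const_mul _).sub ((hd' ζ hζ).const_mul _)
  have hdW : ∀ ζ : ℂ, ‖ζ‖ ≤ ρ → DifferentiableAt ℂ W ζ := fun ζ hζ =>
    (differentiableAt_id.mul (hdS ζ hζ)).const_add _
  have hWs : ∀ ζ : ℂ, ‖ζ‖ = ρ → ‖W ζ‖ ≤ 4 * ε / ρ := by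
    intro ζ hζ
    obtain ⟨a1, a2⟩ := weylInf_denom_bounds hC hρ1 hCρ hζ.le l hl1 y (hl y (by simp))
    obtain ⟨b1, b2⟩ := weylInf_denom_bounds hC hρ1 hCρ hζ.le l' hl1' y' (hl' y' (by simp))
    have h1 := h ζ hζ
    rw [weylInf_cons, weylInf_cons] at h1
    have e : ζ * W ζ = (1 - y'.1 * ζ - y'.2 * ζ ^ 2 * weylInf ζ l') -
        (1 - y.1 * ζ - y.2 * ζ ^ 2 * weylInf ζ l) := by
      simp only [hW, hS]; ring
    set D := 1 - y.1 * ζ - y.2 * ζ ^ 2 * weylInf ζ l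
    set D' := 1 - y'.1 * ζ - y'.2 * ζ ^ 2 * weylInf ζ l'
    have hD : D ≠ 0 := by rw [← norm_pos_iff]; linarith
    have hD' : D' ≠ 0 := by rw [← norm_pos_iff]; linarith
    rw [inv_sub_inv hD hD', ← e, norm_div, norm_mul, norm_mul, hζ,
      div_le_iff₀ (by positivity)] at h1
    have hε : 0 ≤ ε := (norm_nonneg _).trans (h ζ hζ)
    rw [le_div_iff₀ hρ, mul_comm]
    calc ρ * ‖W ζ‖ ≤ ε * (‖D‖ * ‖D'‖) := h1
      _ ≤ ε * (2 * 2) := by gcongr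
      _ = _ := by ring
  have hβ : ‖y.1 - y'.1‖ ≤ 4 * ε / ρ := by
    have := norm_le_of_sphere (ζ := 0) hρ hdW hWs (by simpa using hρ.le)
    simpa [hW] using this
  have hSs : ∀ ζ : ℂ, ‖ζ‖ = ρ → ‖S ζ‖ ≤ 8 * ε / ρ ^ 2 := by
    intro ζ hζ
    have h1 : ρ * ‖S ζ‖ ≤ 8 * ε / ρ := by
      rw [← hζ, ← norm_mul]
      have e : ζ * S ζ = W ζ - (y.1 - y'.1) := by simp only [hW]; ring
      rw [e, hζ]
      calc _ ≤ ‖W ζ‖ + ‖y.1 - y'.1‖ := norm_sub_le _ _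
        _ ≤ 4 * ε / ρ + 4 * ε / ρ := add_le_add (hWs ζ hζ) hβ
        _ = _ := by ring
    calc ‖S ζ‖ = ρ * ‖S ζ‖ / ρ := by field_simp
      _ ≤ (8 * ε / ρ) / ρ := by gcongr
      _ = _ := by field_simp
  have hγ : ‖y.2 - y'.2‖ ≤ 8 * ε / ρ ^ 2 := by
    have := norm_le_of_sphere (ζ := 0) hρ hdS hSs (by simpa using hρ.le)
    simpa [hS, weylInf_zero hne, weylInf_zero hne'] using this
  refine ⟨hβ, hγ, fun ζ hζ => ?_⟩
  have h2 := (weylInf_bounds hC hρ1 hCρ hζ.le l' hl1').1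
  have e : y.2 * (weylInf ζ l - weylInf ζ l') = S ζ - (y.2 - y'.2) * weylInf ζ l' := by
    simp only [hS]; ring
  have h3 : g * ‖weylInf ζ l - weylInf ζ l'‖ ≤ 24 * ε / ρ ^ 2 := by
    calc _ ≤ ‖y.2‖ * ‖weylInf ζ l - weylInf ζ l'‖ := by gcongr
      _ = ‖S ζ - (y.2 - y'.2) * weylInf ζ l'‖ := by rw [← norm_mul, e]
      _ ≤ ‖S ζ‖ + ‖y.2 - y'.2‖ * ‖weylInf ζ l'‖ := by
        rw [← norm_mul]; exact norm_sub_le _ _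
      _ ≤ 8 * ε / ρ ^ 2 + 8 * ε / ρ ^ 2 * 2 := by
        gcongr
        · exact hSs ζ hζ
        · exact (norm_nonneg _).trans hγ
      _ = _ := by ring
  rw [← div_div, le_div_iff₀ hg, mul_comm]
  exact h3

/-- Stability of the inverse problem: if two Weyl functions are `ε`-close on a circle around
infinity, then the first `k` Jacobi parameters are `K ^ k ε`-close. -/
theorem norm_sub_le_of_weylInf_close (hC : 0 ≤ C) (hρ : 0 < ρ) (hρ1 : ρ ≤ 1)
    (hCρ : C * ρ ≤ 1 / 8) {ε g K : ℝ} (hg : 0 < g) (hK1 : 8 / ρ ^ 2 ≤ K)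
    (hK2 : 24 / (ρ ^ 2 * g) ≤ K) (hε : 0 ≤ ε) (k : ℕ) (l l' : List (ℂ × ℂ))
    (hl : ∀ x ∈ l, ‖x‖ ≤ C) (hl' : ∀ x ∈ l', ‖x‖ ≤ C)
    (hk : k < l.length) (hk' : k < l'.length)
    (hg' : ∀ i < k, g ≤ ‖(l.getD i 0).2‖)
    (h : ∀ ζ : ℂ, ‖ζ‖ = ρ → ‖weylInf ζ l - weylInf ζ l'‖ ≤ ε) :
    ∀ i < k, ‖l.getD i 0 - l'.getD i 0‖ ≤ K ^ k * ε := by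
  have hK8 : 8 ≤ K := le_trans (by rw [le_div_iff₀ (by positivity)]; nlinarith) hK1
  have hK0 : 1 ≤ K := by linarith
  induction k generalizing l l' ε with
  | zero => intro i hi; omega
  | succ k ih =>
    match l, l' with
    | [], _ => simp at hk
    | _ :: _, [] => simp at hk'
    | y :: l, y' :: l' =>
      simp only [List.length_cons, add_lt_add_iff_right] at hk hk'
      have hne : l ≠ [] := by rintro rfl; simp at hk
      have hne' : l' ≠ [] := by rintro rfl; simp at hk'
      obtain ⟨h1, h2, h3⟩ := weylInf_close_step hC hρ hρ1 hCρ hg hl hl' hne hne'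
        (by simpa using hg' 0 (by omega)) h
      have hKk : 1 ≤ K ^ k := one_le_pow₀ hK0
      have hε' : 24 * ε / (ρ ^ 2 * g) ≤ K * ε := by
        calc _ = 24 / (ρ ^ 2 * g) * ε := by ring
          _ ≤ K * ε := by gcongr
      have hstep := ih (ε := K * ε) (by positivity) l l' (fun x hx => hl x (by simp [hx]))
        (fun x hx => hl' x (by simp [hx])) hk hk'
        (fun i hi => by simpa using hg' (i + 1) (by omega))
        (fun ζ hζ => (h3 ζ hζ).trans hε')
      intro i hi
      rcases i with _ | i
      · have h4 : K * ε ≤ K ^ (k + 1) * ε := by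
          rw [pow_succ]; gcongr; nlinarith
        refine le_trans ?_ h4
        simp only [List.getD_cons_zero]
        have h5 : 8 * ε / ρ ^ 2 ≤ K * ε := by
          calc _ = 8 / ρ ^ 2 * ε := by ring
            _ ≤ K * ε := by gcongr
        refine max_le ?_ (h2.trans h5)
        refine (h1.trans ?_).trans h5
        rw [div_le_div_iff₀ hρ (by positivity)]
        have : ρ ^ 2 ≤ ρ := by nlinarith
        nlinarith
      · have := hstep i (by omega)
        simp only [List.getD_cons_succ]
        calc _ ≤ K ^ k * (K * ε) := this
          _ = _ := by ring

end

/-- A shifted list cannot stay close to itself across two separated ranges of values: if `a` is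
shorter than `a'`, the values of `a'` are carried along the common part `m`, by steps of
`a'.length - a.length`, up to the first value of `b`. -/
theorem le_of_shifted_close {E : Type*} [NormedAddCommGroup E] {S : Set E} {e θ : ℝ} (he : 0 ≤ e)
    (p a m b s a' b' s' : List E) (hlt : a.length < a'.length)
    (hsum : a.length + b.length = a'.length + b'.length) (ha' : ∀ x ∈ a', x ∈ S)
    (hb : ∀ x ∈ b, ∀ w ∈ S, θ ≤ ‖x - w‖)
    (hclose : ∀ i < p.length + a.length + m.length + b.length,
      ‖(p ++ (a ++ (m ++ (b ++ s)))).getD i 0 - (p ++ (a' ++ (m ++ (b' ++ s')))).getD i 0‖ ≤ e) :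
    θ ≤ (a.length + m.length + 1 : ℕ) * e := by
  have claim : ∀ i, a.length ≤ i → i ≤ a.length + m.length →
      ∃ w ∈ S, ‖(a ++ (m ++ (b ++ s))).getD i 0 - w‖ ≤ (i + 1 : ℕ) * e := by
    intro i
    induction i using Nat.strong_induction_on with
    | _ i ih =>
      intro h1 h2
      have h3 := hclose (p.length + i) (by omega)
      rw [List.getD_append_right _ _ _ _ (by omega), List.getD_append_right p _ _ _ (by omega),
        Nat.add_sub_cancel_left] at h3
      by_cases hi : i < a'.length
      · refine ⟨a'.getD i 0, ha' _ ?_, ?_⟩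
        · rw [List.getD_eq_getElem _ _ hi]; exact List.getElem_mem hi
        · rw [List.getD_append a' _ _ _ hi] at h3
          refine h3.trans ?_
          push_cast
          nlinarith [(Nat.cast_nonneg i : (0 : ℝ) ≤ i)]
      · obtain ⟨w, hw, h4⟩ := ih (i - (a'.length - a.length)) (by omega) (by omega) (by omega)
        refine ⟨w, hw, ?_⟩
        have e1 : (a' ++ (m ++ (b' ++ s'))).getD i 0 = m.getD (i - a'.length) 0 := by
          rw [List.getD_append_right _ _ _ _ (by omega), List.getD_append _ _ _ _ (by omega)]
        have e2 : (a ++ (m ++ (b ++ s))).getD (i - (a'.length - a.length)) 0 =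
            m.getD (i - a'.length) 0 := by
          rw [List.getD_append_right _ _ _ _ (by omega), List.getD_append _ _ _ _ (by omega)]
          congr 1; omega
        rw [e1] at h3
        rw [e2] at h4
        calc _ ≤ _ := norm_sub_le_norm_sub_add_norm_sub _ (m.getD (i - a'.length) 0) w
          _ ≤ e + ((i - (a'.length - a.length) + 1 : ℕ) : ℝ) * e := add_le_add h3 h4
          _ = ((i - (a'.length - a.length) + 2 : ℕ) : ℝ) * e := by push_cast; ring
          _ ≤ _ := mul_le_mul_of_nonneg_right (by exact_mod_cast (by omega)) he
  obtain ⟨w, hw, h⟩ := claim (a.length + m.length) (by omega) le_rfl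
  have hb0 : 0 < b.length := by omega
  rw [List.getD_append_right _ _ _ _ (by omega), List.getD_append_right _ _ _ _ (by omega),
    List.getD_append _ _ _ _ (by omega), List.getD_eq_getElem _ _ (by omega)] at h
  exact (hb _ (List.getElem_mem _) w hw).trans h


/-! ### Area estimates for polynomials and analytic functions -/

theorem lintegral_eq_polar (c : ℂ) {F : ℂ → ℝ≥0∞} (hF : Measurable F) :
    ∫⁻ z, F z = ∫⁻ r in Set.Ioi (0 : ℝ), ENNReal.ofReal r *
      ∫⁻ θ in Set.Ioo (-Real.pi) Real.pi, F (circleMap c r θ) := by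
  have h1 : ∫⁻ z, F z = ∫⁻ z, F (c + z) := (lintegral_add_left_eq_self F c).symm
  have hm : Measurable fun p : ℝ × ℝ => F (circleMap c p.1 p.2) := by
    refine hF.comp ?_
    unfold circleMap
    fun_prop
  rw [h1, ← Complex.lintegral_comp_polarCoord_symm, polarCoord_target,
    Measure.volume_eq_prod, ← Measure.prod_restrict]
  have e : ∀ p : ℝ × ℝ, c + Complex.polarCoord.symm p = circleMap c p.1 p.2 := by
    intro p
    rw [Complex.polarCoord_symm_apply, circleMap, Complex.exp_mul_I]
    push_cast; ring
  simp_rw [e, smul_eq_mul]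
  rw [lintegral_prod _ (by fun_prop)]
  refine lintegral_congr fun r => ?_
  have hm' : Measurable fun θ => F (circleMap c r θ) := hm.comp measurable_prodMk_left
  exact lintegral_const_mul (μ := volume.restrict (Set.Ioo (-Real.pi) Real.pi))
    (ENNReal.ofReal r) hm'

/-- The kernel `1 / |z - ζ|` is integrable over bounded sets, uniformly in `ζ`. -/
theorem exists_lintegral_inv_norm_sub_le (R : ℝ) : ∃ C : ℝ, 0 < C ∧ ∀ ζ : ℂ,
    ∫⁻ z in Metric.closedBall (0 : ℂ) R, ENNReal.ofReal ‖z - ζ‖⁻¹ ≤ ENNReal.ofReal C := by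
  have hunit : ∀ ζ : ℂ, ∫⁻ z in Metric.ball ζ 1, ENNReal.ofReal ‖z - ζ‖⁻¹ ≤
      ENNReal.ofReal (2 * Real.pi) := by
    intro ζ
    rw [← lintegral_indicator measurableSet_ball, lintegral_eq_polar ζ]
    swap
    · exact Measurable.indicator (by fun_prop) measurableSet_ball
    calc _ ≤ ∫⁻ r in Set.Ioi (0 : ℝ), (Set.Ioo (0 : ℝ) 1).indicator
          (fun _ => ENNReal.ofReal (2 * Real.pi)) r := by
          refine setLIntegral_mono_ae (by
            exact (Measurable.indicator measurable_const measurableSet_Ioo).aemeasurable) ?_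
          refine Filter.Eventually.of_forall fun r hr => ?_
          rw [Set.mem_Ioi] at hr
          by_cases h1 : r < 1
          · rw [Set.indicator_of_mem (show r ∈ Set.Ioo (0 : ℝ) 1 from ⟨hr, h1⟩)]
            calc _ ≤ ENNReal.ofReal r * ∫⁻ θ in Set.Ioo (-Real.pi) Real.pi,
                  ENNReal.ofReal r⁻¹ := by
                  gcongr with θ
                  refine (Set.indicator_le_self _ _ _).trans ?_
                  simp [circleMap, abs_of_pos hr]
              _ = ENNReal.ofReal (r * (r⁻¹ * (2 * Real.pi))) := by
                  rw [lintegral_const, Measure.restrict_apply MeasurableSet.univ, Set.univ_inter,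
                    Real.volume_Ioo, ← ENNReal.ofReal_mul (by positivity),
                    ← ENNReal.ofReal_mul hr.le]
                  congr 3; ring
              _ = _ := by rw [mul_inv_cancel_left₀ hr.ne']
          · rw [Set.indicator_of_notMem (fun h => h1 h.2)]
            have : ∀ θ, (Metric.ball ζ 1).indicator (fun z => ENNReal.ofReal ‖z - ζ‖⁻¹)
                (circleMap ζ r θ) = 0 := by
              intro θ
              refine Set.indicator_of_notMem ?_ _
              simp [circleMap, abs_of_pos hr, not_lt.1 h1]
            simp [this]
      _ ≤ ∫⁻ r, (Set.Ioo (0 : ℝ) 1).indicator (fun _ => ENNReal.ofReal (2 * Real.pi)) r :=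
          setLIntegral_le_lintegral _ _
      _ = _ := by
          rw [lintegral_indicator measurableSet_Ioo, lintegral_const,
            Measure.restrict_apply MeasurableSet.univ, Set.univ_inter, Real.volume_Ioo]
          simp
  obtain ⟨V, hV⟩ : ∃ V : ℝ, volume (Metric.closedBall (0 : ℂ) R) = ENNReal.ofReal V :=
    ⟨_, (ENNReal.ofReal_toReal measure_closedBall_lt_top.ne).symm⟩
  refine ⟨2 * Real.pi + |V|, by positivity, fun ζ => ?_⟩
  calc _ ≤ ∫⁻ z in Metric.closedBall (0 : ℂ) R, ((Metric.ball ζ 1).indicator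
          (fun z => ENNReal.ofReal ‖z - ζ‖⁻¹) z + 1) := by
        refine lintegral_mono fun z => ?_
        by_cases hz : z ∈ Metric.ball ζ 1
        · rw [Set.indicator_of_mem hz]; exact le_self_add
        · rw [Set.indicator_of_notMem hz, zero_add]
          rw [Metric.mem_ball, dist_eq_norm, not_lt] at hz
          exact ENNReal.ofReal_le_one.2 (inv_le_one_of_one_le₀ hz)
    _ = (∫⁻ z in Metric.closedBall (0 : ℂ) R, (Metric.ball ζ 1).indicator
          (fun z => ENNReal.ofReal ‖z - ζ‖⁻¹) z) + volume (Metric.closedBall (0 : ℂ) R) := by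
        rw [lintegral_add_right _ measurable_const]; simp
    _ ≤ ENNReal.ofReal (2 * Real.pi) + ENNReal.ofReal |V| := by
        refine add_le_add ?_ (by rw [hV]; exact ENNReal.ofReal_le_ofReal (le_abs_self V))
        refine (setLIntegral_le_lintegral _ _).trans ?_
        rw [lintegral_indicator measurableSet_ball]
        exact hunit ζ
    _ = _ := (ENNReal.ofReal_add (by positivity) (by positivity)).symm

/-- A Remez type inequality: a polynomial of degree at most `D` can be `e⁻ˢ` times smaller than its
value at `w` only on a set of area `O(e^{-s / D})`. It follows from the arithmetic-geometric mean
inequality over the roots and the integrability of `1 / |z - ζ|`. -/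
theorem exists_volume_polynomial_small_le (R : ℝ) : ∃ C : ℝ, 0 < C ∧
    ∀ (p : Polynomial ℂ) (D s : ℝ) (w : ℂ), p.natDegree ≤ D → 0 < D → 0 ≤ s → ‖w‖ ≤ R →
      p.eval w ≠ 0 →
      volume {z ∈ Metric.closedBall (0 : ℂ) R | ‖p.eval z‖ ≤ Real.exp (-s) * ‖p.eval w‖} ≤
        ENNReal.ofReal (C * Real.exp (-s / D)) := by
  obtain ⟨C₁, hC₁, hint⟩ := exists_lintegral_inv_norm_sub_le R
  obtain ⟨V, hV⟩ : ∃ V : ℝ, volume (Metric.closedBall (0 : ℂ) R) = ENNReal.ofReal V :=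
    ⟨_, (ENNReal.ofReal_toReal measure_closedBall_lt_top.ne).symm⟩
  refine ⟨|V| + 1 + |2 * R| * C₁, by positivity, fun p D s w hpD hD hs hw hpw => ?_⟩
  have hR0 : 0 ≤ R := (norm_nonneg _).trans hw
  set S := {z ∈ Metric.closedBall (0 : ℂ) R | ‖p.eval z‖ ≤ Real.exp (-s) * ‖p.eval w‖} with hS
  have hp0 : p ≠ 0 := by rintro rfl; simp at hpw
  set L := p.roots.toList with hL
  have hLlen : L.length = p.natDegree := by
    rw [hL, Multiset.length_toList]
    exact (IsAlgClosed.splits p).natDegree_eq_card_roots.symm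
  have heval : ∀ z, p.eval z = p.leadingCoeff * ∏ i : Fin L.length, (z - L.get i) := by
    intro z
    have h := (IsAlgClosed.splits p).eval_eq_prod_roots z
    rw [h, ← Multiset.coe_toList p.roots, ← hL, Multiset.map_coe, Multiset.prod_coe]
    congr 1
    rw [← List.prod_ofFn]
    congr 1
    apply List.ext_get <;> simp
  by_cases hd : L.length = 0
  · -- a constant polynomial is never smaller than its value at `w`
    have hconst : ∀ z, p.eval z = p.leadingCoeff := by
      intro z; rw [heval z, Finset.prod_eq_one, mul_one]
      intro i; exact absurd i.2 (by omega)
    rcases hs.eq_or_lt with rfl | hs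
    · refine (measure_mono (Set.sep_subset _ _)).trans ?_
      rw [hV]; apply ENNReal.ofReal_le_ofReal
      simp only [neg_zero, zero_div, Real.exp_zero, mul_one]
      have : 0 ≤ |2 * R| * C₁ := by positivity
      linarith [le_abs_self V]
    · have : S = ∅ := by
        rw [hS, Set.sep_eq_empty_iff_mem_false]
        intro z _ h
        rw [hconst z, hconst w] at h
        have h2 : Real.exp (-s) < 1 := by simpa using hs
        have h3 : 0 < ‖p.leadingCoeff‖ := by simpa using hp0
        nlinarith
      rw [this]; simp
  have hd0 : 0 < (L.length : ℝ) := by exact_mod_cast Nat.pos_of_ne_zero hd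
  have hdD : (L.length : ℝ) ≤ D := by rw [hLlen]; exact hpD
  -- pointwise bound of the sum over the roots
  have hpt : ∀ z ∈ S, Real.exp (s / D) * L.length ≤
      ∑ i : Fin L.length, (1 + 2 * R * ‖z - L.get i‖⁻¹) ∨ p.eval z = 0 := by
    intro z hz
    by_cases hpz : p.eval z = 0
    · exact Or.inr hpz
    left
    obtain ⟨hzR, hz⟩ := hz
    rw [mem_closedBall_zero_iff] at hzR
    have hne : ∀ i, z - L.get i ≠ 0 := by
      intro i hi; apply hpz; rw [heval, Finset.prod_eq_zero (Finset.mem_univ i) hi, mul_zero]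
    have hfac : ∀ i, ‖w - L.get i‖ / ‖z - L.get i‖ ≤ 1 + 2 * R * ‖z - L.get i‖⁻¹ := by
      intro i
      have h1 : 0 < ‖z - L.get i‖ := norm_pos_iff.2 (hne i)
      rw [div_le_iff₀ h1, add_mul, one_mul, mul_assoc, inv_mul_cancel₀ h1.ne', mul_one]
      have h2 : w - L.get i = (z - L.get i) + (w - z) := by ring
      rw [h2]
      refine (norm_add_le _ _).trans ?_
      have := norm_sub_le w z
      linarith
    have hprod : Real.exp s ≤ ∏ i : Fin L.length, (1 + 2 * R * ‖z - L.get i‖⁻¹) := by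
      refine le_trans ?_ (Finset.prod_le_prod (fun i _ => by positivity) fun i _ => hfac i)
      rw [Finset.prod_div_distrib, ← norm_prod, ← norm_prod]
      rw [heval z, heval w, norm_mul, norm_mul] at hz
      have h3 : 0 < ‖p.leadingCoeff‖ := by simpa using hp0
      have h4 : 0 < ‖∏ i : Fin L.length, (z - L.get i)‖ :=
        norm_pos_iff.2 (Finset.prod_ne_zero_iff.2 fun i _ => hne i)
      rw [le_div_iff₀ h4]
      have h5 : ‖∏ i : Fin L.length, (z - L.get i)‖ ≤
          Real.exp (-s) * ‖∏ i : Fin L.length, (w - L.get i)‖ := by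
        apply le_of_mul_le_mul_left _ h3
        calc _ ≤ _ := hz
          _ = _ := by ring
      calc _ ≤ Real.exp s * (Real.exp (-s) * ‖∏ i : Fin L.length, (w - L.get i)‖) := by gcongr
        _ = _ := by rw [← mul_assoc, ← Real.exp_add]; simp
    have hamgm := Real.geom_mean_le_arith_mean (Finset.univ : Finset (Fin L.length))
      (fun _ => 1) (fun i => 1 + 2 * R * ‖z - L.get i‖⁻¹) (fun _ _ => zero_le_one)
      (by simpa using Nat.pos_of_ne_zero hd) (fun i _ => by positivity)
    simp only [Real.rpow_one, one_mul, Finset.sum_const, Finset.card_univ, Fintype.card_fin,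
      nsmul_eq_mul, mul_one] at hamgm
    rw [le_div_iff₀ hd0] at hamgm
    refine le_trans ?_ hamgm
    gcongr
    calc Real.exp (s / D) ≤ Real.exp (s * (L.length : ℝ)⁻¹) := by
          rw [Real.exp_le_exp, div_eq_mul_inv]; gcongr
      _ = (Real.exp s) ^ ((L.length : ℝ)⁻¹) := Real.exp_mul _ _
      _ ≤ _ := Real.rpow_le_rpow (Real.exp_pos s).le hprod (by positivity)
  set F : ℂ → ℝ≥0∞ := fun z => ∑ i : Fin L.length,
    (1 + ENNReal.ofReal (2 * R) * ENNReal.ofReal ‖z - L.get i‖⁻¹) with hF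
  have hFint : ∫⁻ z in Metric.closedBall (0 : ℂ) R, F z ≤
      L.length * ENNReal.ofReal (|V| + 1 + |2 * R| * C₁) := by
    rw [hF, lintegral_finsetSum' _ (fun i _ => by fun_prop)]
    refine (Finset.sum_le_card_nsmul _ _ (ENNReal.ofReal (|V| + 1 + |2 * R| * C₁)) ?_).trans
      (by simp)
    intro i _
    rw [lintegral_add_left measurable_const, lintegral_const_mul _ (by fun_prop),
      lintegral_const, Measure.restrict_apply MeasurableSet.univ, Set.univ_inter, one_mul, hV,
      ENNReal.ofReal_add (by positivity) (by positivity)]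
    refine add_le_add (ENNReal.ofReal_le_ofReal ?_) ?_
    · linarith [le_abs_self V]
    · rw [ENNReal.ofReal_mul (abs_nonneg _)]
      exact mul_le_mul' (ENNReal.ofReal_le_ofReal (le_abs_self _)) (hint _)
  have hnull : volume {z : ℂ | p.eval z = 0} = 0 := by
    have : {z : ℂ | p.eval z = 0}.Finite := by
      refine (p.roots.toFinset.finite_toSet).subset fun z hz => ?_
      simpa [hp0] using hz
    exact this.measure_zero _
  have hmeas : volume S * ENNReal.ofReal (Real.exp (s / D) * L.length) ≤
      ∫⁻ z in Metric.closedBall (0 : ℂ) R, F z := by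
    have hFm : Measurable F := by fun_prop
    have hm := mul_meas_ge_le_lintegral₀ (μ := volume.restrict (Metric.closedBall (0 : ℂ) R))
      hFm.aemeasurable (ENNReal.ofReal (Real.exp (s / D) * L.length))
    rw [mul_comm]
    refine le_trans (mul_le_mul_right ?_ _) hm
    rw [Measure.restrict_apply (measurableSet_le measurable_const hFm)]
    calc volume S ≤ volume ({z | ENNReal.ofReal (Real.exp (s / D) * L.length) ≤ F z} ∩
          Metric.closedBall 0 R ∪ {z : ℂ | p.eval z = 0}) := by
          refine measure_mono fun z hz => ?_
          rcases hpt z hz with h | h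
          · refine Or.inl ⟨?_, hz.1⟩
            rw [Set.mem_ofPred_eq, hF]
            refine (ENNReal.ofReal_le_ofReal h).trans ?_
            rw [ENNReal.ofReal_sum_of_nonneg (fun i _ => by positivity)]
            refine Finset.sum_le_sum fun i _ => ?_
            rw [ENNReal.ofReal_add (by positivity) (by positivity), ENNReal.ofReal_one,
              ENNReal.ofReal_mul (by positivity)]
          · exact Or.inr h
      _ ≤ _ := (measure_union_le _ _).trans (by rw [hnull, add_zero])
  have hfin := hmeas.trans hFint
  have hlenE : ENNReal.ofReal (L.length : ℝ) = (L.length : ℝ≥0∞) := ENNReal.ofReal_natCast _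
  rw [ENNReal.ofReal_mul (Real.exp_pos _).le, hlenE, ← mul_assoc, mul_comm (L.length : ℝ≥0∞)] at hfin
  have hfin2 : volume S * ENNReal.ofReal (Real.exp (s / D)) ≤
      ENNReal.ofReal (|V| + 1 + |2 * R| * C₁) := by
    refine (ENNReal.mul_le_mul_iff_left ?_ ?_).1 hfin
    · exact_mod_cast hd
    · exact ENNReal.natCast_ne_top _
  calc volume S = volume S * ENNReal.ofReal (Real.exp (s / D)) *
        ENNReal.ofReal (Real.exp (-s / D)) := by
        rw [mul_assoc, ← ENNReal.ofReal_mul (Real.exp_pos _).le, ← Real.exp_add, neg_div,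
          add_neg_cancel, Real.exp_zero, ENNReal.ofReal_one, mul_one]
    _ ≤ ENNReal.ofReal (|V| + 1 + |2 * R| * C₁) * ENNReal.ofReal (Real.exp (-s / D)) := by gcongr
    _ = _ := (ENNReal.ofReal_mul (by positivity)).symm


/-- The subharmonicity of `log |f|` along one circle. -/
theorem log_norm_le_circleAverage {f : ℂ → ℂ} {c : ℂ} {r : ℝ} (hr : 0 < r)
    (hf : AnalyticOnNhd ℂ f (Metric.closedBall c r)) (hc : f c ≠ 0) :
    Real.log ‖f c‖ ≤ Real.circleAverage (fun z => Real.log ‖f z‖) c r := by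
  have hf' : AnalyticOnNhd ℂ f (Metric.closedBall c |r|) := by rwa [abs_of_pos hr]
  have h := AnalyticOnNhd.circleAverage_log_norm hr.ne' hf' hc
  rw [h]
  refine le_add_of_nonneg_left (finsum_nonneg fun u => ?_)
  by_cases hu : u ∈ Metric.closedBall c |r|
  · have h1 : (0 : ℝ) ≤ (MeromorphicOn.divisor f (Metric.closedBall c |r|) u : ℝ) := by
      exact_mod_cast MeromorphicOn.AnalyticOnNhd.divisor_nonneg hf' u
    refine mul_nonneg h1 ?_
    rcases eq_or_ne c u with rfl | hne
    · simp
    · apply Real.log_nonneg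
      have h2 : 0 < ‖c - u‖ := norm_pos_iff.2 (sub_ne_zero.2 hne)
      rw [← div_eq_mul_inv, one_le_div h2, ← dist_eq_norm, dist_comm]
      rwa [abs_of_pos hr] at hu
  · rw [Function.locallyFinsuppWithin.apply_eq_zero_of_notMem _ hu]
    simp

theorem volume_circle_small_le {f : ℂ → ℂ} {c : ℂ} {r T : ℝ} {E : Set ℂ} (hr : 0 < r)
    (hf : AnalyticOnNhd ℂ f (Metric.closedBall c r))
    (h1 : ∀ z ∈ Metric.closedBall c r, ‖f z‖ ≤ 1) (hE : MeasurableSet E) (hT : 0 < T)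
    (hs : ∀ z ∈ E, ‖f z‖ ≤ Real.exp (-T)) (hc : f c ≠ 0) :
    ∫⁻ θ in Set.Ioo (-Real.pi) Real.pi, E.indicator 1 (circleMap c r θ) ≤
      ENNReal.ofReal (2 * Real.pi * (-Real.log ‖f c‖) / T) := by
  have hπ := Real.pi_pos
  set G : ℂ → ℝ := fun z => E.indicator (fun _ => -T) z with hG
  set g : ℂ → ℝ := fun z => if f z = 0 then G z else Real.log ‖f z‖ with hg
  have hsph : Metric.sphere c |r| ⊆ Metric.closedBall c r := by
    rw [abs_of_pos hr]; exact Metric.sphere_subset_closedBall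
  have hcod : (fun z => Real.log ‖f z‖) =ᶠ[Filter.codiscreteWithin (Metric.sphere c |r|)] g := by
    have h0 : f ⁻¹' {0}ᶜ ∈ Filter.codiscreteWithin (Metric.closedBall c r) :=
      AnalyticOnNhd.preimage_zero_mem_codiscreteWithin hf hc (Metric.mem_closedBall_self hr.le)
        (Metric.isConnected_closedBall hr.le)
    filter_upwards [Filter.codiscreteWithin_mono hsph h0] with z hz
    have : f z ≠ 0 := hz
    simp [hg, this]
  have hint : CircleIntegrable (fun z => Real.log ‖f z‖) c r :=
    MeromorphicOn.circleIntegrable_log_norm fun z hz => (hf z (hsph hz)).meromorphicAt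
  have hgint : CircleIntegrable g c r := hint.congr_codiscreteWithin hcod
  have hGm : Measurable G := measurable_const.indicator hE
  have hGint : CircleIntegrable G c r := by
    have hm : Measurable fun θ => G (circleMap c r θ) :=
      hGm.comp (continuous_circleMap c r).measurable
    refine IntervalIntegrable.mono_fun (f := fun _ => T) intervalIntegrable_const
      hm.aestronglyMeasurable (Filter.Eventually.of_forall fun θ => ?_)
    simp only [hG, Set.indicator]
    split_ifs <;> simp
  have hgG : Real.circleAverage g c r ≤ Real.circleAverage G c r := by
    refine Real.circleAverage_mono hgint hGint fun z hz => ?_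
    simp only [hg]
    split_ifs with h0
    · exact le_rfl
    · have hpos : 0 < ‖f z‖ := norm_pos_iff.2 h0
      by_cases hzE : z ∈ E
      · rw [hG]; dsimp only; rw [Set.indicator_of_mem hzE]
        exact (Real.log_le_log hpos (hs z hzE)).trans (by rw [Real.log_exp])
      · rw [hG]; dsimp only; rw [Set.indicator_of_notMem hzE]
        exact Real.log_nonpos hpos.le (h1 z (hsph hz))
  have hlog := log_norm_le_circleAverage hr hf hc
  rw [Real.circleAverage_congr_codiscreteWithin hcod hr.ne'] at hlog
  have hfin := hlog.trans hgG
  rw [Real.circleAverage_eq_integral_add (-Real.pi),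
    intervalIntegral.integral_comp_add_right (fun θ => G (circleMap c r θ)), smul_eq_mul,
    show 0 + -Real.pi = -Real.pi by ring, show 2 * Real.pi + -Real.pi = Real.pi by ring,
    intervalIntegral.integral_of_le (by linarith), integral_Ioc_eq_integral_Ioo] at hfin
  set S := (fun θ => circleMap c r θ) ⁻¹' E with hS
  have hSm : MeasurableSet S := (continuous_circleMap c r).measurable hE
  have e1 : (fun θ => G (circleMap c r θ)) = S.indicator fun _ => -T := by
    ext θ; rfl
  rw [e1, integral_indicator hSm, setIntegral_const, smul_eq_mul] at hfin
  have e2 : (fun θ => E.indicator (1 : ℂ → ℝ≥0∞) (circleMap c r θ)) = S.indicator 1 := by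
    ext θ; rfl
  rw [e2, lintegral_indicator_one hSm]
  rw [ENNReal.le_ofReal_iff_toReal_le (measure_ne_top _ _)]
  · rw [le_div_iff₀ hT]
    change (volume.restrict (Set.Ioo (-Real.pi) Real.pi)).real S * T ≤ _
    have h4 : 2 * Real.pi * Real.log ‖f c‖ ≤
        2 * Real.pi * ((2 * Real.pi)⁻¹ *
          ((volume.restrict (Set.Ioo (-Real.pi) Real.pi)).real S * -T)) := by gcongr
    rw [mul_inv_cancel_left₀ (by positivity)] at h4
    linarith
  · have : Real.log ‖f c‖ ≤ 0 :=
      Real.log_nonpos (norm_nonneg _) (h1 c (Metric.mem_closedBall_self hr.le))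
    exact div_nonneg (mul_nonneg (by positivity) (by linarith)) hT.le

/-- An analytic function bounded by `1` on a disc and by `e^{-T}` on a subset of area `α` is bounded
by `exp (-T α / (π r²))` at the centre. -/
theorem norm_center_le_exp {f : ℂ → ℂ} {c : ℂ} {r T α : ℝ} {E : Set ℂ} (hr : 0 < r)
    (hf : AnalyticOnNhd ℂ f (Metric.closedBall c r))
    (h1 : ∀ z ∈ Metric.closedBall c r, ‖f z‖ ≤ 1) (hE : MeasurableSet E)
    (hEr : E ⊆ Metric.closedBall c r) (hT : 0 ≤ T)
    (hs : ∀ z ∈ E, ‖f z‖ ≤ Real.exp (-T)) (hα : ENNReal.ofReal α ≤ volume E) :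
    ‖f c‖ ≤ Real.exp (-(T * α / (Real.pi * r ^ 2))) := by
  have hπ := Real.pi_pos
  by_cases hc : f c = 0
  · rw [hc, norm_zero]; positivity
  rcases hT.eq_or_lt with rfl | hT
  · simpa using h1 c (Metric.mem_closedBall_self hr.le)
  set Λ := -Real.log ‖f c‖ with hΛ
  have hΛ0 : 0 ≤ Λ := by
    have : Real.log ‖f c‖ ≤ 0 :=
      Real.log_nonpos (norm_nonneg _) (h1 c (Metric.mem_closedBall_self hr.le))
    linarith
  have hvol : volume E ≤ ENNReal.ofReal (Real.pi * r ^ 2 * Λ / T) := by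
    rw [← lintegral_indicator_one hE, lintegral_eq_polar c (measurable_one.indicator hE)]
    have hcirc : ∀ ρ ∈ Set.Ioi (0 : ℝ), ENNReal.ofReal ρ *
        ∫⁻ θ in Set.Ioo (-Real.pi) Real.pi, E.indicator 1 (circleMap c ρ θ) ≤
        (Set.Ioc 0 r).indicator (fun ρ => ENNReal.ofReal (2 * Real.pi * Λ / T * ρ)) ρ := by
      intro ρ hρ
      rw [Set.mem_Ioi] at hρ
      by_cases hρr : ρ ≤ r
      · rw [Set.indicator_of_mem (show ρ ∈ Set.Ioc 0 r from ⟨hρ, hρr⟩), mul_comm,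
          ENNReal.ofReal_mul (by positivity)]
        gcongr
        have hsub := Metric.closedBall_subset_closedBall (x := c) hρr
        exact volume_circle_small_le hρ (hf.mono hsub) (fun z hz => h1 z (hsub hz)) hE hT hs hc
      · have : ∀ θ, E.indicator (1 : ℂ → ℝ≥0∞) (circleMap c ρ θ) = 0 := by
          intro θ
          refine Set.indicator_of_notMem (fun h => hρr ?_) _
          simpa [circleMap, abs_of_pos hρ] using hEr h
        simp [this]
    refine (setLIntegral_mono_ae (Measurable.indicator (by fun_prop)
      measurableSet_Ioc).aemeasurable (Filter.Eventually.of_forall hcirc)).trans ?_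
    refine (setLIntegral_le_lintegral _ _).trans ?_
    rw [lintegral_indicator measurableSet_Ioc, ← ofReal_integral_eq_lintegral_ofReal]
    · rw [← intervalIntegral.integral_of_le hr.le, intervalIntegral.integral_const_mul, integral_id]
      apply ENNReal.ofReal_le_ofReal
      apply le_of_eq; ring
    · have : Continuous fun ρ : ℝ => 2 * Real.pi * Λ / T * ρ := by fun_prop
      exact (this.intervalIntegrable 0 r).1
    · rw [Filter.EventuallyLE, ae_restrict_iff' measurableSet_Ioc]
      exact Filter.Eventually.of_forall fun ρ hρ =>
        mul_nonneg (div_nonneg (mul_nonneg (by positivity) hΛ0) hT.le) hρ.1.le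
  have h2 := hα.trans hvol
  have h2' : α ≤ Real.pi * r ^ 2 * Λ / T :=
    (ENNReal.ofReal_le_ofReal_iff
      (div_nonneg (mul_nonneg (by positivity) hΛ0) hT.le)).1 h2
  have h3 : T * α / (Real.pi * r ^ 2) ≤ Λ := by
    rw [div_le_iff₀ (by positivity)]
    rw [le_div_iff₀ hT] at h2'
    linarith
  rw [← Real.log_le_iff_le_exp (norm_pos_iff.2 hc)]
  linarith

theorem analyticAt_weyl {c : ℂ} {a κ : ℝ} {z : ℂ} (hc : ‖c‖ = 1) (ha : 0 < a) (hκ : 0 < κ)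
    (l : List (ℂ × ℂ)) (hl : ∀ y ∈ l, HalfPlane c a κ z y) :
    AnalyticAt ℂ (fun z => weyl z l) z := by
  induction l with
  | nil => simpa using analyticAt_const
  | cons y l ih =>
    have h := ih fun y hy => hl y (by simp [hy])
    have h0 := ((HalfPlane.weyl_aux hc ha hκ (y :: l) hl).2.2 (by simp)).1
    simp only [weyl_cons] at h0 ⊢
    exact ((analyticAt_id.sub analyticAt_const).sub (analyticAt_const.mul h)).inv
      (fun h => h0 (by simpa using h))

theorem analyticAt_weylInf {C ρ : ℝ} {ζ : ℂ} (hC : 0 ≤ C) (hρ1 : ρ ≤ 1) (hCρ : C * ρ ≤ 1 / 8)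
    (hζ : ‖ζ‖ ≤ ρ) (l : List (ℂ × ℂ)) (hl : ∀ y ∈ l, ‖y‖ ≤ C) :
    AnalyticAt ℂ (fun ζ => weylInf ζ l) ζ := by
  induction l with
  | nil => simpa using analyticAt_const
  | cons y l ih =>
    have hl' : ∀ y ∈ l, ‖y‖ ≤ C := fun y hy => hl y (by simp [hy])
    have h1 := (weylInf_denom_bounds hC hρ1 hCρ hζ l hl' y (hl y (by simp))).1
    simp only [weylInf_cons]
    refine ((analyticAt_const.sub (analyticAt_const.mul analyticAt_id)).sub
      ((analyticAt_const.mul (analyticAt_id.pow 2)).mul (ih hl'))).inv ?_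
    intro h0
    simp only [id_eq, Pi.mul_apply, Pi.sub_apply, Pi.pow_apply] at h0
    rw [h0, norm_zero] at h1
    norm_num at h1

set_option maxHeartbeats 1000000 in
/-- Propagation of smallness: if two Weyl functions are exponentially close on a set of positive
area in a half-plane of hyperbolicity, then they are exponentially close near infinity. -/
theorem exists_weylInf_close {C R τ κ ρ α : ℝ} (hC : 0 ≤ C) (hκ : 0 < κ) (hκ2 : κ ≤ 2)
    (hρ : 0 < ρ) (hρ1 : ρ ≤ 1) (hCρ : C * ρ ≤ 1 / 8) (hα : 0 < α) :
    ∃ η > 0, ∃ B : ℝ, ∀ (c : ℂ) (a : ℝ) (l l' : List (ℂ × ℂ)) (E : Set ℂ) (T : ℝ),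
      ‖c‖ = 1 → 0 < a → (∀ y ∈ l, ‖y‖ ≤ C) → (∀ y ∈ l', ‖y‖ ≤ C) →
      (∀ z : ℂ, τ ≤ (c * z).re → (∀ y ∈ l, HalfPlane c a κ z y) ∧ ∀ y ∈ l', HalfPlane c a κ z y) →
      MeasurableSet E → (∀ z ∈ E, ‖z‖ ≤ R ∧ τ + κ ≤ (c * z).re) → ENNReal.ofReal α ≤ volume E →
      0 ≤ T → (∀ z ∈ E, ‖weyl z l - weyl z l'‖ ≤ Real.exp (-T)) →
      ∀ ζ : ℂ, ‖ζ‖ = ρ / 4 → ‖weylInf ζ l - weylInf ζ l'‖ ≤ 4 * Real.exp (B - η * T) := by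
  have hπ := Real.pi_pos
  -- `Y` is the distance from the origin of the centre of a large disc in the half-plane
  obtain ⟨Y, hY1, hY2, hY3, hY4, hYR⟩ : ∃ Y : ℝ, 8 / ρ ≤ Y ∧ κ ≤ Y ∧ κ ≤ Y - τ ∧
      R ^ 2 + κ ^ 2 ≤ κ * (Y - τ) ∧ R ≤ Y := by
    have hev : ∀ᶠ Y : ℝ in atTop, 8 / ρ ≤ Y ∧ κ ≤ Y ∧ κ + τ ≤ Y ∧
        (R ^ 2 + κ ^ 2) / κ + τ ≤ Y ∧ R ≤ Y :=
      (eventually_ge_atTop _).and ((eventually_ge_atTop _).and ((eventually_ge_atTop _).and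
        ((eventually_ge_atTop _).and (eventually_ge_atTop _))))
    obtain ⟨Y, h1, h2, h3, h4, h5⟩ := hev.exists
    refine ⟨Y, h1, h2, by linarith, ?_, h5⟩
    have h6 : (R ^ 2 + κ ^ 2) / κ ≤ Y - τ := by linarith
    rwa [div_le_iff₀ hκ, mul_comm] at h6
  have hY0 : 0 < Y := hκ.trans_le hY2
  have hρY : 8 ≤ ρ * Y := by rwa [div_le_iff₀ hρ, mul_comm] at hY1
  set s := Y - τ with hs
  have hs0 : 0 < s := hκ.trans_le hY3
  have hsr : 0 < s - κ / 4 := by linarith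
  -- the two contraction exponents, and the radius of the intermediate disc in the `ζ`-plane
  set σ₁ := α / (Real.pi * (s - κ / 4) ^ 2) with hσ₁
  set r₂ := κ / (8 * Y ^ 2) with hr₂
  have hr₂0 : 0 < r₂ := by positivity
  set σ₂ := Real.pi * r₂ ^ 2 / (Real.pi * (ρ / 2) ^ 2) with hσ₂
  have hσ₁0 : 0 < σ₁ := by positivity
  have hσ₂0 : 0 < σ₂ := by positivity
  set b := |Real.log (Y / κ)| with hb
  refine ⟨σ₂ * σ₁, by positivity, σ₂ * b, ?_⟩
  intro c a l l' E T hc ha hl hl' hhp hE hEz hEα hT hET ζ hζ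
  have hc0 : c ≠ 0 := by rintro rfl; simp at hc
  set w : ℂ := (starRingEnd ℂ) c * Y with hw
  have hcw : c * w = Y := by
    rw [hw, ← mul_assoc, Complex.mul_conj, Complex.normSq_eq_norm_sq, hc]; simp
  have hwn : ‖w‖ = Y := by rw [hw]; simp [hc, abs_of_pos hY0]
  have hre : ∀ z : ℂ, Y - ‖z - w‖ ≤ (c * z).re := by
    intro z
    have h1 : c * z = Y + c * (z - w) := by rw [mul_sub, hcw]; ring
    have h2 := Complex.abs_re_le_norm (c * (z - w))
    rw [norm_mul, hc, one_mul] at h2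
    rw [h1, Complex.add_re, Complex.ofReal_re]
    linarith [(abs_le.1 h2).1]
  have hball : ∀ z : ℂ, ‖z - w‖ ≤ s → τ ≤ (c * z).re := fun z hz => by
    have := hre z; linarith
  -- first disc
  have hEw : ∀ z ∈ E, ‖z - w‖ ≤ s - κ / 2 := by
    intro z hz
    obtain ⟨hzR, hzτ⟩ := hEz z hz
    have hcase : (c * z).re ≤ Y := by
      refine (Complex.re_le_norm _).trans ?_
      rw [norm_mul, hc, one_mul]; exact hzR.trans hYR
    have h1 : ‖z - w‖ ^ 2 = ((c * z).re - Y) ^ 2 + (c * z).im ^ 2 := by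
      have : ‖z - w‖ = ‖c * z - Y‖ := by
        rw [← hcw, ← mul_sub, norm_mul, hc, one_mul]
      rw [this, ← Complex.normSq_eq_norm_sq, Complex.normSq_apply]
      simp; ring
    have h2 : (c * z).im ^ 2 ≤ R ^ 2 := by
      have h3 := Complex.abs_im_le_norm (c * z)
      rw [norm_mul, hc, one_mul] at h3
      rw [← sq_abs]
      have := h3.trans hzR
      gcongr
    have h4 : (Y - (c * z).re) ^ 2 ≤ (s - κ) ^ 2 :=
      pow_le_pow_left₀ (by linarith) (by linarith) 2
    refine le_of_sq_le_sq ?_ (by linarith)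
    rw [h1]
    nlinarith
  have hmid : ∀ w' : ℂ, ‖w' - w‖ ≤ κ / 4 →
      ‖weyl w' l - weyl w' l'‖ ≤ 2 / κ * Real.exp (-(σ₁ * T)) := by
    intro w' hw'
    have hsub : ∀ z ∈ Metric.closedBall w' (s - κ / 4), τ ≤ (c * z).re := by
      intro z hz
      rw [Metric.mem_closedBall, dist_eq_norm] at hz
      refine hball z ?_
      have := norm_add_le (z - w') (w' - w)
      rw [sub_add_sub_cancel] at this
      linarith
    have h := norm_center_le_exp (f := fun z => (κ / 2 : ℂ) * (weyl z l - weyl z l')) (c := w')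
      (r := s - κ / 4) (T := T) (α := α) (E := E) hsr ?_ ?_ hE ?_ hT ?_ hEα
    · rw [norm_mul] at h
      have e : ‖(κ / 2 : ℂ)‖ = κ / 2 := by
        rw [norm_div, Complex.norm_real, Real.norm_of_nonneg hκ.le]; simp
      rw [e] at h
      have e2 : T * α / (Real.pi * (s - κ / 4) ^ 2) = σ₁ * T := by rw [hσ₁]; ring
      rw [e2] at h
      rw [div_mul_eq_mul_div, le_div_iff₀ hκ]
      linarith
    · intro z hz
      obtain ⟨h1, h2⟩ := hhp z (hsub z hz)
      exact analyticAt_const.mul ((analyticAt_weyl hc ha hκ l h1).sub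
        (analyticAt_weyl hc ha hκ l' h2))
    · intro z hz
      obtain ⟨h1, h2⟩ := hhp z (hsub z hz)
      have h3 := HalfPlane.norm_weyl_le hc ha hκ l h1
      have h4 := HalfPlane.norm_weyl_le hc ha hκ l' h2
      have e : ‖(κ / 2 : ℂ)‖ = κ / 2 := by
        rw [norm_div, Complex.norm_real, Real.norm_of_nonneg hκ.le]; simp
      rw [norm_mul, e]
      have h5 := norm_sub_le (weyl z l) (weyl z l')
      calc κ / 2 * ‖weyl z l - weyl z l'‖ ≤ κ / 2 * (κ⁻¹ + κ⁻¹) := by gcongr; linarith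
        _ = 1 := by field_simp; norm_num
    · intro z hz
      rw [Metric.mem_closedBall, dist_eq_norm]
      have := norm_add_le (z - w) (w - w')
      rw [sub_add_sub_cancel, norm_sub_rev w w'] at this
      linarith [hEw z hz]
    · intro z hz
      have e : ‖(κ / 2 : ℂ)‖ = κ / 2 := by
        rw [norm_div, Complex.norm_real, Real.norm_of_nonneg hκ.le]; simp
      rw [norm_mul, e]
      have := hET z hz
      have := norm_nonneg (weyl z l - weyl z l')
      nlinarith
  -- second disc, in the chart `ζ = 1 / z`
  have hwne : w ≠ 0 := by rw [← norm_pos_iff, hwn]; exact hY0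
  have hE2 : ∀ ξ ∈ Metric.closedBall w⁻¹ r₂, ‖weylInf ξ l - weylInf ξ l'‖ ≤
      4 * Real.exp (-(σ₁ * T - b)) := by
    intro ξ hξ
    rw [Metric.mem_closedBall, dist_eq_norm] at hξ
    have hr₂Y : r₂ ≤ 1 / (2 * Y) := by
      rw [hr₂, div_le_div_iff₀ (by positivity) (by positivity)]
      nlinarith
    have hξ1 : 1 / (2 * Y) ≤ ‖ξ‖ := by
      have h1 := norm_sub_norm_le w⁻¹ (w⁻¹ - ξ)
      rw [sub_sub_cancel, norm_inv, hwn, norm_sub_rev] at h1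
      have : Y⁻¹ = 1 / (2 * Y) + 1 / (2 * Y) := by field_simp; norm_num
      linarith
    have hξ0 : ξ ≠ 0 := by
      rw [← norm_pos_iff]; exact lt_of_lt_of_le (by positivity) hξ1
    have hclose : ‖ξ⁻¹ - w‖ ≤ κ / 4 := by
      have e : ξ⁻¹ - w = (w⁻¹ - ξ) * ξ⁻¹ * w := by field_simp
      rw [e, norm_mul, norm_mul, hwn, norm_inv, norm_sub_rev]
      have h2 : ‖ξ‖⁻¹ ≤ 2 * Y := by
        rw [inv_le_comm₀ (norm_pos_iff.2 hξ0) (by positivity)]; simpa using hξ1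
      calc _ ≤ r₂ * (2 * Y) * Y := by gcongr
        _ = κ / 4 := by rw [hr₂]; field_simp; norm_num
    have h3 := hmid _ hclose
    rw [weyl_eq_mul_weylInf (inv_ne_zero hξ0), weyl_eq_mul_weylInf (inv_ne_zero hξ0), inv_inv,
      ← mul_sub, norm_mul] at h3
    have h4 : ‖weylInf ξ l - weylInf ξ l'‖ ≤ 4 * (Y / κ) * Real.exp (-(σ₁ * T)) := by
      have h5 : 1 / (2 * Y) * ‖weylInf ξ l - weylInf ξ l'‖ ≤
          2 / κ * Real.exp (-(σ₁ * T)) := (by gcongr : _ ≤ _).trans h3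
      rw [div_mul_eq_mul_div, one_mul, div_le_iff₀ (by positivity)] at h5
      calc _ ≤ _ := h5
        _ = _ := by ring
    refine h4.trans ?_
    have h6 : Y / κ ≤ Real.exp b := by
      rw [← Real.log_le_iff_le_exp (by positivity)]; exact le_abs_self _
    have h7 : Real.exp (-(σ₁ * T - b)) = Real.exp b * Real.exp (-(σ₁ * T)) := by
      rw [← Real.exp_add]; ring_nf
    rw [h7, mul_assoc]
    gcongr
  have hlarge : ∀ ξ : ℂ, ‖ξ‖ ≤ ρ → ‖weylInf ξ l - weylInf ξ l'‖ ≤ 4 := by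
    intro ξ hξ
    have h1 := weylInf_bounds hC hρ1 hCρ hξ l hl
    have h2 := weylInf_bounds hC hρ1 hCρ hξ l' hl'
    have h3 := norm_sub_le (weylInf ξ l) (weylInf ξ l')
    linarith [h1.1, h2.1]
  by_cases hsign : σ₁ * T - b < 0
  · refine (hlarge ζ (by rw [hζ]; linarith)).trans ?_
    have : 0 ≤ σ₂ * b - σ₂ * σ₁ * T := by
      have := mul_nonneg hσ₂0.le (neg_nonneg.2 hsign.le)
      linarith
    linarith [Real.one_le_exp this]
  push Not at hsign
  have h := norm_center_le_exp (f := fun ξ => (1 / 4 : ℂ) * (weylInf ξ l - weylInf ξ l')) (c := ζ)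
    (r := ρ / 2) (T := σ₁ * T - b) (α := Real.pi * r₂ ^ 2) (E := Metric.closedBall w⁻¹ r₂)
    (by positivity) ?_ ?_ Metric.isClosed_closedBall.measurableSet ?_ hsign ?_ ?_
  · rw [norm_mul] at h
    have e2 : (σ₁ * T - b) * (Real.pi * r₂ ^ 2) / (Real.pi * (ρ / 2) ^ 2) =
      -(σ₂ * b - σ₂ * σ₁ * T) := by rw [hσ₂]; ring
    rw [e2, neg_neg] at h
    norm_num at h
    linarith
  · intro ξ hξ
    have hξ' : ‖ξ‖ ≤ ρ := by
      rw [Metric.mem_closedBall, dist_eq_norm] at hξ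
      have := norm_add_le (ξ - ζ) ζ
      rw [sub_add_cancel] at this
      linarith
    exact analyticAt_const.mul ((analyticAt_weylInf hC hρ1 hCρ hξ' l hl).sub
      (analyticAt_weylInf hC hρ1 hCρ hξ' l' hl'))
  · intro ξ hξ
    have hξ' : ‖ξ‖ ≤ ρ := by
      rw [Metric.mem_closedBall, dist_eq_norm] at hξ
      have := norm_add_le (ξ - ζ) ζ
      rw [sub_add_cancel] at this
      linarith
    have := hlarge ξ hξ'
    rw [norm_mul]
    norm_num
    linarith
  · intro ξ hξ
    rw [Metric.mem_closedBall, dist_eq_norm] at hξ ⊢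
    have h1 := norm_sub_le (ξ - w⁻¹) (ζ - w⁻¹)
    have h2 := norm_sub_le ζ w⁻¹
    rw [sub_sub_sub_cancel_right] at h1
    rw [norm_inv, hwn] at h2
    have h3 : Y⁻¹ ≤ ρ / 8 := by
      rw [inv_le_comm₀ hY0 (by positivity), inv_div]; exact hY1
    have h4 : r₂ ≤ ρ / 16 := by
      have : r₂ ≤ Y⁻¹ / 8 := by
        rw [hr₂, div_le_iff₀ (by positivity)]
        calc κ ≤ Y := hY2
          _ = _ := by field_simp
      linarith
    linarith
  · intro ξ hξ
    have := hE2 ξ hξ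
    rw [norm_mul]
    norm_num at this ⊢
    linarith
  · rw [Complex.volume_closedBall, ENNReal.ofReal_mul hπ.le, mul_comm,
      ENNReal.ofReal_pow hr₂0.le, ← NNReal.coe_real_pi, ENNReal.ofReal_coe_nnreal]


/-! ### Exchanging two intervals of sample points -/

/-- The uniform distribution on `[0, 1]`, as a measure on the real line. -/
noncomputable def unif : Measure ℝ := volume.restrict (Set.Icc 0 1)

instance : IsProbabilityMeasure unif := ⟨by simp [unif]⟩

/-- The law of `n` independent uniform points. -/
noncomputable abbrev unifPi (n : ℕ) : Measure (Fin n → ℝ) := Measure.pi fun _ => unif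

/-- The involution of the line that exchanges `[p, p + r)` and `[q, q + r)` by translations. -/
noncomputable def exch (p q r x : ℝ) : ℝ :=
  if x ∈ Set.Ico p (p + r) then x + (q - p) else if x ∈ Set.Ico q (q + r) then x - (q - p) else x

section exch

variable {p q r x : ℝ}

theorem exch_of_mem_left (h : x ∈ Set.Ico p (p + r)) : exch p q r x = x + (q - p) := if_pos h

theorem exch_of_mem_right (hpq : p + r ≤ q) (h : x ∈ Set.Ico q (q + r)) :
    exch p q r x = x - (q - p) := by
  rw [exch, if_neg, if_pos h]
  rintro ⟨_, h2⟩
  linarith [h.1]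

theorem exch_of_notMem (h1 : x ∉ Set.Ico p (p + r)) (h2 : x ∉ Set.Ico q (q + r)) :
    exch p q r x = x := by
  rw [exch, if_neg h1, if_neg h2]

theorem exch_mem_right (h : x ∈ Set.Ico p (p + r)) : exch p q r x ∈ Set.Ico q (q + r) := by
  rw [exch_of_mem_left h]
  exact ⟨by linarith [h.1], by linarith [h.2]⟩

theorem exch_mem_left (hpq : p + r ≤ q) (h : x ∈ Set.Ico q (q + r)) :
    exch p q r x ∈ Set.Ico p (p + r) := by
  rw [exch_of_mem_right hpq h]
  exact ⟨by linarith [h.1], by linarith [h.2]⟩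

theorem exch_exch (hpq : p + r ≤ q) (x : ℝ) : exch p q r (exch p q r x) = x := by
  by_cases h1 : x ∈ Set.Ico p (p + r)
  · rw [exch_of_mem_right hpq (exch_mem_right h1), exch_of_mem_left h1]; ring
  by_cases h2 : x ∈ Set.Ico q (q + r)
  · rw [exch_of_mem_left (exch_mem_left hpq h2), exch_of_mem_right hpq h2]; ring
  rw [exch_of_notMem h1 h2, exch_of_notMem h1 h2]

theorem exch_mem_left_iff (hpq : p + r ≤ q) :
    exch p q r x ∈ Set.Ico p (p + r) ↔ x ∈ Set.Ico q (q + r) := by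
  refine ⟨fun h => ?_, exch_mem_left hpq⟩
  have := exch_mem_right (q := q) h
  rwa [exch_exch hpq] at this

/-- Membership in a set that contains both exchanged intervals or neither is not changed. -/
theorem exch_mem_iff (hpq : p + r ≤ q) {J : Set ℝ}
    (hJ : (Set.Ico p (p + r) ∪ Set.Ico q (q + r) ⊆ J) ∨
      Disjoint J (Set.Ico p (p + r) ∪ Set.Ico q (q + r))) : exch p q r x ∈ J ↔ x ∈ J := by
  by_cases h : x ∈ Set.Ico p (p + r) ∪ Set.Ico q (q + r)
  · have h' : exch p q r x ∈ Set.Ico p (p + r) ∪ Set.Ico q (q + r) :=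
      h.elim (fun h => Or.inr (exch_mem_right h)) fun h => Or.inl (exch_mem_left hpq h)
    rcases hJ with hJ | hJ
    · exact ⟨fun _ => hJ h, fun _ => hJ h'⟩
    · exact ⟨fun h2 => (Set.disjoint_left.1 hJ h2 h').elim,
        fun h2 => (Set.disjoint_left.1 hJ h2 h).elim⟩
  · rw [exch_of_notMem (fun h2 => h (Or.inl h2)) fun h2 => h (Or.inr h2)]

theorem measurable_exch : Measurable (exch p q r) :=
  Measurable.ite measurableSet_Ico (by fun_prop)
    (Measurable.ite measurableSet_Ico (by fun_prop) measurable_id)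

theorem measurePreserving_exch (hp : 0 ≤ p) (hpq : p + r ≤ q) (hq : q + r ≤ 1) :
    MeasurePreserving (exch p q r) unif unif := by
  refine ⟨measurable_exch, Measure.ext fun E hE => ?_⟩
  set A := Set.Ico p (p + r) with hA
  set B := Set.Ico q (q + r) with hB
  have hAm : MeasurableSet A := measurableSet_Ico
  have hBm : MeasurableSet B := measurableSet_Ico
  have hE' : MeasurableSet (exch p q r ⁻¹' E) := measurable_exch hE
  rw [Measure.map_apply measurable_exch hE, unif, Measure.restrict_apply hE',
    Measure.restrict_apply hE]
  have key : ∀ X : Set ℝ, volume (X ∩ Set.Icc 0 1) =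
      volume (X ∩ A) + (volume (X ∩ B) + volume (((X ∩ Set.Icc 0 1) \ A) \ B)) := by
    intro X
    rw [← measure_inter_add_sdiff (X ∩ Set.Icc 0 1) hAm,
      ← measure_inter_add_sdiff ((X ∩ Set.Icc 0 1) \ A) hBm]
    congr 2
    · ext x
      simp only [Set.mem_inter_iff, Set.mem_Icc, hA, Set.mem_Ico]
      constructor
      · rintro ⟨⟨h1, _⟩, h2⟩; exact ⟨h1, h2⟩
      · rintro ⟨h1, h2⟩; exact ⟨⟨h1, by linarith, by linarith⟩, h2⟩
    · congr 1
      ext x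
      simp only [Set.mem_inter_iff, Set.mem_sdiff, Set.mem_Icc, hA, hB, Set.mem_Ico]
      constructor
      · rintro ⟨⟨⟨h1, _⟩, h3⟩, h2⟩; exact ⟨h1, h2⟩
      · rintro ⟨h1, h2⟩
        exact ⟨⟨⟨h1, by linarith, by linarith⟩, fun h => by linarith [h.2]⟩, h2⟩
  have e1 : volume (exch p q r ⁻¹' E ∩ A) = volume (E ∩ B) := by
    rw [← measure_preimage_add_right volume (q - p) (E ∩ B)]
    congr 1
    ext x
    simp only [Set.mem_inter_iff, Set.mem_preimage]
    constructor
    · rintro ⟨h1, h2⟩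
      have h3 := exch_mem_right (q := q) h2
      rw [exch_of_mem_left h2] at h1 h3
      exact ⟨h1, h3⟩
    · rintro ⟨h1, h2⟩
      have h3 : x ∈ A := ⟨by linarith [h2.1], by linarith [h2.2]⟩
      rw [exch_of_mem_left h3]
      exact ⟨h1, h3⟩
  have e2 : volume (exch p q r ⁻¹' E ∩ B) = volume (E ∩ A) := by
    rw [← measure_preimage_add_right volume (-(q - p)) (E ∩ A)]
    congr 1
    ext x
    simp only [Set.mem_inter_iff, Set.mem_preimage]
    constructor
    · rintro ⟨h1, h2⟩
      have h3 := exch_mem_left hpq h2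
      rw [exch_of_mem_right hpq h2] at h1 h3
      exact ⟨h1, h3⟩
    · rintro ⟨h1, h2⟩
      have h3 : x ∈ B := ⟨by linarith [h2.1], by linarith [h2.2]⟩
      rw [exch_of_mem_right hpq h3]
      exact ⟨h1, h3⟩
  have e3 : ((exch p q r ⁻¹' E ∩ Set.Icc 0 1) \ A) \ B = ((E ∩ Set.Icc 0 1) \ A) \ B := by
    ext x
    simp only [Set.mem_inter_iff, Set.mem_preimage, Set.mem_sdiff]
    constructor <;> rintro ⟨⟨⟨h1, h2⟩, h3⟩, h4⟩ <;> refine ⟨⟨⟨?_, h2⟩, h3⟩, h4⟩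
    · rwa [exch_of_notMem h3 h4] at h1
    · rwa [exch_of_notMem h3 h4]
  rw [key, key, e1, e2, e3, ← add_assoc, ← add_assoc, add_comm (volume (E ∩ B))]

end exch

/-- Applies the exchange to the points with index in `T`. -/
noncomputable def flip (p q r : ℝ) {n : ℕ} (T : Finset (Fin n)) (u : Fin n → ℝ) (i : Fin n) : ℝ :=
  if i ∈ T then exch p q r (u i) else u i

open Classical in
/-- The indices of the points in `J`. -/
noncomputable def idx {n : ℕ} (u : Fin n → ℝ) (J : Set ℝ) : Finset (Fin n) :=
  Finset.univ.filter fun i => u i ∈ J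

@[simp] theorem mem_idx {n : ℕ} {u : Fin n → ℝ} {J : Set ℝ} {i : Fin n} :
    i ∈ idx u J ↔ u i ∈ J := by simp [idx]

/-- The number of points in `J`. -/
noncomputable def count {n : ℕ} (u : Fin n → ℝ) (J : Set ℝ) : ℕ := (idx u J).card

theorem count_le {n : ℕ} (u : Fin n → ℝ) (J : Set ℝ) : count u J ≤ n :=
  (Finset.card_le_univ _).trans (by simp)

section flip

variable {p q r : ℝ} {n : ℕ}

theorem measurePreserving_flip (hp : 0 ≤ p) (hpq : p + r ≤ q) (hq : q + r ≤ 1)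
    (T : Finset (Fin n)) : MeasurePreserving (flip p q r T) (unifPi n) (unifPi n) := by
  have h : ∀ i : Fin n, MeasurePreserving (if i ∈ T then exch p q r else id) unif unif := by
    intro i
    split_ifs
    · exact measurePreserving_exch hp hpq hq
    · exact MeasurePreserving.id _
  have h2 := measurePreserving_pi (fun _ : Fin n => unif) (fun _ => unif) h
  convert h2 using 1
  ext u i
  simp only [flip]
  split_ifs <;> rfl

theorem flip_flip (hpq : p + r ≤ q) (T : Finset (Fin n)) (u : Fin n → ℝ) :
    flip p q r T (flip p q r T u) = u := by
  ext i
  simp only [flip]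
  split_ifs
  · exact exch_exch hpq _
  · rfl

theorem flip_mem_iff (hpq : p + r ≤ q) {J : Set ℝ}
    (hJ : (Set.Ico p (p + r) ∪ Set.Ico q (q + r) ⊆ J) ∨
      Disjoint J (Set.Ico p (p + r) ∪ Set.Ico q (q + r))) (T : Finset (Fin n)) (u : Fin n → ℝ)
    (i : Fin n) : flip p q r T u i ∈ J ↔ u i ∈ J := by
  simp only [flip]
  split_ifs
  · exact exch_mem_iff hpq hJ
  · rfl

theorem count_flip (hpq : p + r ≤ q) {J : Set ℝ}
    (hJ : (Set.Ico p (p + r) ∪ Set.Ico q (q + r) ⊆ J) ∨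
      Disjoint J (Set.Ico p (p + r) ∪ Set.Ico q (q + r))) (T : Finset (Fin n)) (u : Fin n → ℝ) :
    count (flip p q r T u) J = count u J := by
  unfold count
  congr 1
  ext i
  rw [mem_idx, mem_idx, flip_mem_iff hpq hJ]

theorem choose_mul_four_pow_le (k j M : ℕ) (hM : 2 * k ≤ M) :
    M.choose j * 4 ^ k ≤ k.centralBinom * 2 ^ M := by
  induction M, hM using Nat.le_induction generalizing j with
  | base =>
    have h := Nat.choose_le_centralBinom j k
    have : (2 : ℕ) ^ (2 * k) = 4 ^ k := by rw [pow_mul]; norm_num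
    rw [this]
    exact Nat.mul_le_mul_right _ h
  | succ M _ ih =>
    cases j with
    | zero =>
      have := ih 0
      simp only [Nat.choose_zero_right] at this ⊢
      rw [pow_succ]; nlinarith [Nat.zero_le (k.centralBinom * 2 ^ M)]
    | succ j =>
      rw [Nat.choose_succ_succ, pow_succ]
      have h1 := ih j
      have h2 := ih (j + 1)
      simp only [Nat.succ_eq_add_one]
      nlinarith

theorem centralBinom_sq_mul_le (k : ℕ) : k.centralBinom ^ 2 * (2 * k + 1) ≤ 16 ^ k := by
  induction k with
  | zero => simp
  | succ k ih =>
    have h := Nat.succ_mul_centralBinom_succ k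
    have h2 : 0 < (k + 1) ^ 2 := by positivity
    refine Nat.le_of_mul_le_mul_left ?_ h2
    calc (k + 1) ^ 2 * ((k + 1).centralBinom ^ 2 * (2 * (k + 1) + 1))
        = ((k + 1) * (k + 1).centralBinom) ^ 2 * (2 * k + 3) := by ring
      _ = 4 * (k.centralBinom ^ 2 * (2 * k + 1)) * ((2 * k + 1) * (2 * k + 3)) := by rw [h]; ring
      _ ≤ 4 * 16 ^ k * (4 * (k + 1) ^ 2) := by
        exact Nat.mul_le_mul (Nat.mul_le_mul_left 4 ih) (by nlinarith)
      _ = _ := by ring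

/-- At most a fraction `(2k + 1)^{-1/2}` of the flips lead to a given number of points in the first
interval, once the two intervals together hold at least `2k` points: that number is binomial. -/
theorem card_flip_count_le (hpq : p + r ≤ q) (u : Fin n → ℝ) (k j : ℕ)
    (hk : 2 * k ≤ count u (Set.Ico p (p + r) ∪ Set.Ico q (q + r))) :
    ((Finset.univ.filter fun T : Finset (Fin n) =>
      count (flip p q r T u) (Set.Ico p (p + r)) = j).card : ℝ) ≤
      2 ^ n / Real.sqrt (2 * k + 1) := by
  classical
  set A := Set.Ico p (p + r) with hA
  set B := Set.Ico q (q + r) with hB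
  set S := idx u (A ∪ B) with hS
  have hScard : S.card = count u (A ∪ B) := rfl
  have hAB : ∀ x, x ∈ A → x ∉ B := fun x h1 h2 => by linarith [h1.2, h2.1]
  set Q : Finset (Fin n) → Finset (Fin n) := fun T => idx (flip p q r T u) A with hQ
  have hmemQ : ∀ T i, i ∈ Q T ↔ (i ∉ T ∧ u i ∈ A) ∨ (i ∈ T ∧ u i ∈ B) := by
    intro T i
    simp only [hQ, mem_idx, flip]
    by_cases h : i ∈ T
    · simp only [h, if_true, not_true, false_and, true_and, false_or]
      exact exch_mem_left_iff hpq
    · simp [h]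
  have hcard : (Finset.univ.filter fun T : Finset (Fin n) => count (flip p q r T u) A = j).card ≤
      S.card.choose j * 2 ^ (n - S.card) := by
    have : (Finset.powersetCard j S ×ˢ Sᶜ.powerset).card = S.card.choose j * 2 ^ (n - S.card) := by
      rw [Finset.card_product, Finset.card_powersetCard, Finset.card_powerset, Finset.card_compl,
        Fintype.card_fin]
    rw [← this]
    refine Finset.card_le_card_of_injOn (fun T => (Q T, T \ S)) ?_ ?_
    · intro T hT
      simp only [Finset.coe_filter, Finset.mem_univ, true_and, Set.mem_ofPred_eq] at hT
      simp only [Finset.coe_product, Set.mem_prod, Finset.mem_coe, Finset.mem_powersetCard,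
        Finset.mem_powerset]
      refine ⟨⟨fun i hi => ?_, ?_⟩, fun i hi => ?_⟩
      · rw [hmemQ] at hi
        rw [hS, mem_idx]
        exact hi.elim (fun h => Or.inl h.2) fun h => Or.inr h.2
      · rw [← hT, count]
      · rw [Finset.mem_compl]; exact (Finset.mem_sdiff.1 hi).2
    · intro T _ T' _ h
      simp only [Prod.mk.injEq] at h
      ext i
      by_cases hi : i ∈ S
      · have h1 : i ∈ Q T ↔ i ∈ Q T' := by rw [h.1]
        rw [hmemQ, hmemQ] at h1
        rw [hS, mem_idx] at hi
        rcases hi with hi | hi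
        · have := hAB _ hi
          tauto
        · have : u i ∉ A := fun h => hAB _ h hi
          tauto
      · have h1 : i ∈ T \ S ↔ i ∈ T' \ S := by rw [h.2]
        simpa [hi] using h1
  have hSn : S.card ≤ n := (Finset.card_le_univ _).trans (by simp)
  have h1 := choose_mul_four_pow_le k j S.card (by rw [hScard]; exact hk)
  have h2 : S.card.choose j * 2 ^ (n - S.card) * 4 ^ k ≤ k.centralBinom * 2 ^ n := by
    calc _ = S.card.choose j * 4 ^ k * 2 ^ (n - S.card) := by ring
      _ ≤ k.centralBinom * 2 ^ S.card * 2 ^ (n - S.card) := Nat.mul_le_mul_right _ h1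
      _ = _ := by rw [mul_assoc, ← pow_add, Nat.add_sub_cancel' hSn]
  have h3 : (k.centralBinom : ℝ) * Real.sqrt (2 * k + 1) ≤ 4 ^ k := by
    have h4 := centralBinom_sq_mul_le k
    have h5 : ((k.centralBinom : ℝ) * Real.sqrt (2 * k + 1)) ^ 2 ≤ (4 ^ k) ^ 2 := by
      rw [mul_pow, Real.sq_sqrt (by positivity), ← pow_mul, mul_comm k, pow_mul]
      norm_num
      exact_mod_cast h4
    exact le_of_sq_le_sq h5 (by positivity)
  have hs : 0 < Real.sqrt (2 * k + 1) := Real.sqrt_pos.2 (by positivity)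
  rw [le_div_iff₀ hs]
  have h6 : ((Finset.univ.filter fun T : Finset (Fin n) => count (flip p q r T u) A = j).card : ℝ)
      * 4 ^ k ≤ k.centralBinom * 2 ^ n := by exact_mod_cast (Nat.mul_le_mul_right _ hcard).trans h2
  have h7 : (0 : ℝ) < 4 ^ k := by positivity
  refine le_of_mul_le_mul_right ?_ h7
  calc _ = ((Finset.univ.filter fun T : Finset (Fin n) =>
        count (flip p q r T u) A = j).card : ℝ) * 4 ^ k * Real.sqrt (2 * k + 1) := by ring
    _ ≤ k.centralBinom * 2 ^ n * Real.sqrt (2 * k + 1) := by gcongr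
    _ = (k.centralBinom * Real.sqrt (2 * k + 1)) * 2 ^ n := by ring
    _ ≤ 4 ^ k * 2 ^ n := by gcongr
    _ = _ := by ring

/-- A second moment bound: sets of which most pairs have a small intersection are small on
average. -/
theorem sum_volume_le_of_inter_le {ι : Type*} [Fintype ι] {W : ι → Set ℂ}
    {Z : Set ℂ} (hW : ∀ i, MeasurableSet (W i)) (hWZ : ∀ i, W i ⊆ Z) (hZ : MeasurableSet Z)
    (hZf : volume Z ≠ ∞) (N : ι → ℕ) {κ α t : ℝ} (hα : 0 ≤ α) (ht : 0 < t)
    (hN : ∀ j, ((Finset.univ.filter fun i => N i = j).card : ℝ) ≤ κ * Fintype.card ι)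
    (hsep : ∀ i j, N i ≠ N j → volume.real (W i ∩ W j) ≤ α) :
    ∑ i, volume.real (W i) ≤
      Fintype.card ι * ((t * volume.real Z + (κ * volume.real Z + α) / t) / 2) := by
  set m : ℝ := ((Fintype.card ι : ℕ) : ℝ) with hm
  rcases isEmpty_or_nonempty ι with he | he
  · simp [hm]
  have hm0 : 0 < m := by rw [hm]; exact_mod_cast Fintype.card_pos
  have hint : ∀ E : Set ℂ, MeasurableSet E → E ⊆ Z →
      Integrable (E.indicator (1 : ℂ → ℝ)) volume := fun E hE hEZ =>
    (integrable_indicator_iff hE).2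
      (integrableOn_const (measure_ne_top_of_subset hEZ hZf))
  have hval : ∀ E : Set ℂ, MeasurableSet E → ∫ z, E.indicator (1 : ℂ → ℝ) z = volume.real E :=
    fun E hE => integral_indicator_one hE
  -- the pairs
  have hpair : ∀ i, ∑ j, volume.real (W i ∩ W j) ≤ m * (κ * volume.real Z + α) := by
    intro i
    have h1 : ∀ j, volume.real (W i ∩ W j) ≤
        (if N j = N i then volume.real Z else 0) + α := by
      intro j
      split_ifs with h
      · have := measureReal_mono (μ := volume) (Set.inter_subset_left.trans (hWZ i) :
          W i ∩ W j ⊆ Z) hZf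
        linarith
      · rw [zero_add]; exact hsep i j (Ne.symm h)
    refine (Finset.sum_le_sum fun j _ => h1 j).trans ?_
    rw [Finset.sum_add_distrib, Finset.sum_const, Finset.card_univ, nsmul_eq_mul, ← hm,
      ← Finset.sum_filter, Finset.sum_const, nsmul_eq_mul]
    have h2 := mul_le_mul_of_nonneg_right (hN (N i)) (measureReal_nonneg (μ := volume) (s := Z))
    linarith
  have hpt : ∀ z, 2 * t * ∑ i, (W i).indicator (1 : ℂ → ℝ) z ≤
      m * t ^ 2 * Z.indicator (1 : ℂ → ℝ) z +
        m⁻¹ * ∑ i, ∑ j, (W i ∩ W j).indicator (1 : ℂ → ℝ) z := by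
    intro z
    have h1 : ∑ i, ∑ j, (W i ∩ W j).indicator (1 : ℂ → ℝ) z =
        (∑ i, (W i).indicator (1 : ℂ → ℝ) z) ^ 2 := by
      rw [sq, Finset.sum_mul_sum]
      refine Finset.sum_congr rfl fun i _ => Finset.sum_congr rfl fun j _ => ?_
      rw [Set.inter_indicator_one]; rfl
    rw [h1]
    set F := ∑ i, (W i).indicator (1 : ℂ → ℝ) z with hF
    by_cases hz : z ∈ Z
    · rw [Set.indicator_of_mem hz, Pi.one_apply, mul_one]
      have : 0 ≤ m⁻¹ * (m * t - F) ^ 2 := by positivity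
      have e : m⁻¹ * (m * t - F) ^ 2 = m * t ^ 2 - 2 * t * F + m⁻¹ * F ^ 2 := by
        field_simp; ring
      linarith
    · have : F = 0 := Finset.sum_eq_zero fun i _ =>
        Set.indicator_of_notMem (fun h => hz (hWZ i h)) _
      rw [this, Set.indicator_of_notMem hz]; simp
  have hI := integral_mono (μ := volume) ?_ ?_ hpt
  · rw [integral_const_mul, integral_finsetSum _ fun i _ => hint _ (hW i) (hWZ i),
      integral_add, integral_const_mul, integral_const_mul, integral_finsetSum, hval _ hZ] at hI
    · simp_rw [hval _ (hW _)] at hI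
      have h3 : ∑ i, ∫ z, ∑ j, (W i ∩ W j).indicator (1 : ℂ → ℝ) z ≤
          m * (m * (κ * volume.real Z + α)) := by
        have : ∀ i, ∫ z, ∑ j, (W i ∩ W j).indicator (1 : ℂ → ℝ) z ≤
            m * (κ * volume.real Z + α) := by
          intro i
          rw [integral_finsetSum _ fun j _ =>
            hint _ ((hW i).inter (hW j)) (Set.inter_subset_left.trans (hWZ i))]
          simp_rw [hval _ ((hW _).inter (hW _))]
          exact hpair i
        refine (Finset.sum_le_sum fun i _ => this i).trans ?_
        rw [Finset.sum_const, Finset.card_univ, nsmul_eq_mul]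
      have h4 : m⁻¹ * ∑ i, ∫ z, ∑ j, (W i ∩ W j).indicator (1 : ℂ → ℝ) z ≤
          m * (κ * volume.real Z + α) := by
        calc _ ≤ m⁻¹ * (m * (m * (κ * volume.real Z + α))) := by gcongr
          _ = _ := by field_simp
      have h5 : 2 * t * ∑ i, volume.real (W i) ≤
          m * t ^ 2 * volume.real Z + m * (κ * volume.real Z + α) := hI.trans (by gcongr)
      have h6 : (2 * t) * (m * ((t * volume.real Z + (κ * volume.real Z + α) / t) / 2)) =
          m * t ^ 2 * volume.real Z + m * (κ * volume.real Z + α) := by field_simp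
      rw [← h6] at h5
      exact le_of_mul_le_mul_left h5 (by positivity)
    · intro i _
      exact integrable_finsetSum _ fun j _ =>
        hint _ ((hW i).inter (hW j)) (Set.inter_subset_left.trans (hWZ i))
    · exact (hint Z hZ subset_rfl).const_mul _
    · exact (integrable_finsetSum _ fun i _ => integrable_finsetSum _ fun j _ =>
        hint _ ((hW i).inter (hW j)) (Set.inter_subset_left.trans (hWZ i))).const_mul _
  · exact (integrable_finsetSum _ fun i _ => hint _ (hW i) (hWZ i)).const_mul _
  · exact ((hint Z hZ subset_rfl).const_mul _).add
      ((integrable_finsetSum _ fun i _ => integrable_finsetSum _ fun j _ =>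
        hint _ ((hW i).inter (hW j)) (Set.inter_subset_left.trans (hWZ i))).const_mul _)

/-- Averaging over the flips: a set `W` of pairs `(u, z)` is small if flips that change the number
of points in the first interval lead to nearly disjoint sections of `W`. -/
theorem measureReal_le_of_flip (hp : 0 ≤ p) (hpq : p + r ≤ q) (hq : q + r ≤ 1)
    {W : Set ((Fin n → ℝ) × ℂ)} (hW : MeasurableSet W) {G : Set (Fin n → ℝ)}
    (hG : MeasurableSet G) {Z : Set ℂ} (hZ : MeasurableSet Z) (hZf : volume Z ≠ ∞)
    (hWZ : W ⊆ G ×ˢ Z) (hGT : ∀ T, ∀ u ∈ G, flip p q r T u ∈ G) (k : ℕ)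
    (hk : ∀ u ∈ G, 2 * k ≤ count u (Set.Ico p (p + r) ∪ Set.Ico q (q + r))) {α t : ℝ}
    (hα : 0 ≤ α) (ht : 0 < t)
    (hsep : ∀ u ∈ G, ∀ T T' : Finset (Fin n),
      count (flip p q r T u) (Set.Ico p (p + r)) ≠ count (flip p q r T' u) (Set.Ico p (p + r)) →
      volume.real ({z | (flip p q r T u, z) ∈ W} ∩ {z | (flip p q r T' u, z) ∈ W}) ≤ α) :
    ((unifPi n).prod volume).real W ≤
      (t * volume.real Z + (volume.real Z / Real.sqrt (2 * k + 1) + α) / t) / 2 := by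
  set c := (t * volume.real Z + (volume.real Z / Real.sqrt (2 * k + 1) + α) / t) / 2 with hc
  have hc0 : 0 ≤ c := by positivity
  set m : (Fin n → ℝ) → ℝ≥0∞ := fun u => volume {z | (u, z) ∈ W} with hm
  have hmm : Measurable m := measurable_measure_prodMk_left hW
  have hsub : ∀ u, {z | (u, z) ∈ W} ⊆ Z := fun u z hz => (hWZ hz).2
  have hfin : ∀ u, m u ≠ ∞ := fun u => measure_ne_top_of_subset (hsub u) hZf
  have hmeas : ((unifPi n).prod volume) W = ∫⁻ u in G, m u ∂unifPi n := by
    rw [Measure.prod_apply hW, ← lintegral_indicator hG]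
    refine lintegral_congr fun u => ?_
    by_cases hu : u ∈ G
    · rw [Set.indicator_of_mem hu]; rfl
    · rw [Set.indicator_of_notMem hu]
      have : Prod.mk u ⁻¹' W = ∅ := by
        ext z; simp only [Set.mem_preimage, Set.mem_empty_iff_false, iff_false]
        exact fun h => hu (hWZ h).1
      rw [this, measure_empty]
  have hflip : ∀ T, ∫⁻ u in G, m (flip p q r T u) ∂unifPi n = ∫⁻ u in G, m u ∂unifPi n := by
    intro T
    have hpre : flip p q r T ⁻¹' G = G := by
      ext u
      refine ⟨fun h => ?_, hGT T u⟩
      have := hGT T _ h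
      rwa [flip_flip hpq] at this
    have h := (measurePreserving_flip hp hpq hq T).setLIntegral_comp_preimage hG hmm
    rwa [hpre] at h
  have hpoint : ∀ u ∈ G, ∑ T, m (flip p q r T u) ≤ ENNReal.ofReal (2 ^ n * c) := by
    intro u hu
    have h := sum_volume_le_of_inter_le (W := fun T => {z | (flip p q r T u, z) ∈ W}) (Z := Z)
      (fun T => measurable_prodMk_left hW) (fun T => hsub _) hZ hZf
      (fun T => count (flip p q r T u) (Set.Ico p (p + r)))
      (κ := 1 / Real.sqrt (2 * k + 1)) hα ht (fun j => ?_) (fun T T' hne => hsep u hu T T' hne)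
    · rw [← ENNReal.ofReal_toReal (a := ∑ T, m (flip p q r T u))
        (ENNReal.sum_ne_top.2 fun T _ => hfin _)]
      apply ENNReal.ofReal_le_ofReal
      rw [ENNReal.toReal_sum fun T _ => hfin _]
      refine h.trans (le_of_eq ?_)
      rw [hc, Fintype.card_finset, Fintype.card_fin]
      push_cast; ring
    · have := card_flip_count_le hpq u k j (hk u hu)
      rw [Fintype.card_finset, Fintype.card_fin]
      push_cast
      convert this using 1
      ring
  have hsum : (2 : ℝ≥0∞) ^ n * ∫⁻ u in G, m u ∂unifPi n ≤ 2 ^ n * ENNReal.ofReal c := by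
    calc (2 : ℝ≥0∞) ^ n * ∫⁻ u in G, m u ∂unifPi n
        = ∑ T : Finset (Fin n), ∫⁻ u in G, m (flip p q r T u) ∂unifPi n := by
          simp_rw [hflip]; simp
      _ = ∫⁻ u in G, ∑ T : Finset (Fin n), m (flip p q r T u) ∂unifPi n := by
          rw [lintegral_finsetSum']
          exact fun T _ =>
            (hmm.comp (measurePreserving_flip hp hpq hq T).measurable).aemeasurable
      _ ≤ ∫⁻ u in G, ENNReal.ofReal (2 ^ n * c) ∂unifPi n :=
          setLIntegral_mono measurable_const hpoint
      _ ≤ ENNReal.ofReal (2 ^ n * c) := by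
          rw [setLIntegral_const]
          exact mul_le_of_le_one_right' prob_le_one
      _ = _ := by
          rw [ENNReal.ofReal_mul (by positivity), ENNReal.ofReal_pow (by norm_num)]
          norm_num
  rw [ENNReal.mul_le_mul_iff_right (by positivity) (by finiteness)] at hsum
  rw [measureReal_def, hmeas]
  exact ENNReal.toReal_le_of_le_ofReal hc0 hsum

end flip


/-! ### Sorted samples -/

/-- The points `u i` in `J`, with repetitions, in increasing order. -/
noncomputable def seg {n : ℕ} (u : Fin n → ℝ) (J : Set ℝ) : List ℝ :=
  ((idx u J).val.map u).sort

section seg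

variable {n : ℕ} {u : Fin n → ℝ}

theorem mem_seg {J : Set ℝ} {x : ℝ} : x ∈ seg u J ↔ ∃ i, u i ∈ J ∧ u i = x := by
  simp [seg]

theorem mem_of_mem_seg {J : Set ℝ} {x : ℝ} (h : x ∈ seg u J) : x ∈ J := by
  obtain ⟨i, hi, rfl⟩ := mem_seg.1 h; exact hi

theorem length_seg (J : Set ℝ) : (seg u J).length = count u J := by
  simp [seg, count]

theorem seg_eq_of_perm {J : Set ℝ} {l : List ℝ} (h1 : l.Pairwise (· ≤ ·))
    (h2 : (l : Multiset ℝ) = (idx u J).val.map u) : seg u J = l := by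
  refine List.Perm.eq_of_pairwise' (r := (· ≤ ·)) (Multiset.pairwise_sort _ _) h1 ?_
  rw [← Multiset.coe_eq_coe, h2, seg, Multiset.sort_eq]

theorem seg_union {J₁ J₂ : Set ℝ} (h : ∀ x ∈ J₁, ∀ y ∈ J₂, x < y) :
    seg u (J₁ ∪ J₂) = seg u J₁ ++ seg u J₂ := by
  refine seg_eq_of_perm ?_ ?_
  · rw [List.pairwise_append]
    exact ⟨Multiset.pairwise_sort _ _, Multiset.pairwise_sort _ _, fun x hx y hy =>
      (h x (mem_of_mem_seg hx) y (mem_of_mem_seg hy)).le⟩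
  · have hd : Disjoint (idx u J₁) (idx u J₂) := by
      rw [Finset.disjoint_left]
      intro i h1 h2
      exact lt_irrefl _ (h _ (mem_idx.1 h1) _ (mem_idx.1 h2))
    have e : idx u (J₁ ∪ J₂) = (idx u J₁).disjUnion (idx u J₂) hd := by
      ext i; simp
    rw [e, Finset.disjUnion_val, Multiset.map_add, ← Multiset.coe_add, seg, seg,
      Multiset.sort_eq, Multiset.sort_eq]

theorem count_union {J₁ J₂ : Set ℝ} (h : ∀ x ∈ J₁, ∀ y ∈ J₂, x < y) :
    count u (J₁ ∪ J₂) = count u J₁ + count u J₂ := by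
  rw [← length_seg, seg_union h, List.length_append, length_seg, length_seg]

theorem seg_Iio_append {s t : ℝ} (h : s ≤ t) :
    seg u (Set.Iio t) = seg u (Set.Iio s) ++ seg u (Set.Ico s t) := by
  rw [← seg_union, Set.Iio_union_Ico_eq_Iio h]
  intro x hx y hy
  exact lt_of_lt_of_le hx hy.1

theorem seg_Ico_append {s t v : ℝ} (h : s ≤ t) (h' : t ≤ v) :
    seg u (Set.Ico s v) = seg u (Set.Ico s t) ++ seg u (Set.Ico t v) := by
  rw [← seg_union, Set.Ico_union_Ico_eq_Ico h h']
  intro x hx y hy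
  exact lt_of_lt_of_le hx.2 hy.1

theorem seg_flip {p q r : ℝ} {J : Set ℝ}
    (hJ : Disjoint J (Set.Ico p (p + r) ∪ Set.Ico q (q + r))) (T : Finset (Fin n))
    (hpq : p + r ≤ q) : seg (flip p q r T u) J = seg u J := by
  have h1 : idx (flip p q r T u) J = idx u J := by
    ext i; rw [mem_idx, mem_idx, flip_mem_iff hpq (Or.inr hJ)]
  rw [seg, seg, h1]
  congr 1
  refine Multiset.map_congr rfl fun i hi => ?_
  have hi' : u i ∈ J := mem_idx.1 hi
  have h2 : u i ∉ Set.Ico p (p + r) ∪ Set.Ico q (q + r) := Set.disjoint_left.1 hJ hi'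
  rw [flip]
  split_ifs
  · exact exch_of_notMem (fun h => h2 (Or.inl h)) fun h => h2 (Or.inr h)
  · rfl

open Classical in
theorem seg_eq_filter {σ' : Equiv.Perm (Fin n)} (h : Monotone (u ∘ σ')) (J : Set ℝ) :
    seg u J = (((List.finRange n).map σ').map u).filter fun x => x ∈ J := by
  refine seg_eq_of_perm ?_ ?_
  · refine List.Pairwise.filter _ ?_
    rw [List.map_map, List.pairwise_map]
    exact (List.pairwise_lt_finRange n).imp fun hab => h hab.le
  · rw [← Multiset.filter_coe, ← Multiset.map_coe, Multiset.filter_map, ← Multiset.map_coe]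
    congr 1
    rw [idx, Finset.filter_val]
    congr 1
    have h2 : (Multiset.map σ' ((List.finRange n : List (Fin n)) : Multiset (Fin n))) =
        (Finset.univ.map σ'.toEmbedding).val := by
      rw [Finset.map_val]; rfl
    rw [h2, Finset.map_univ_equiv]

/-- The order statistics of points of the unit interval, as a sorted list of reals. -/
theorem seg_coe_eq_ofFn (u : Fin n → I) :
    seg (fun i => (u i : ℝ)) (Set.Iio 2) = List.ofFn fun i => (orderStat u i : ℝ) := by
  refine seg_eq_of_perm ?_ ?_
  · rw [List.pairwise_ofFn]
    intro i j hij
    exact Tuple.monotone_sort u hij.le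
  · have h1 : idx (fun i => (u i : ℝ)) (Set.Iio 2) = Finset.univ := by
      ext i; simp only [mem_idx, Set.mem_Iio, Finset.mem_univ, iff_true]
      linarith [(u i).2.2]
    rw [h1, List.ofFn_eq_map, ← Multiset.map_coe]
    have h2 : (Multiset.map (Tuple.sort u) ((List.finRange n : List (Fin n)) :
        Multiset (Fin n))) = (Finset.univ.map (Tuple.sort u).toEmbedding).val := by
      rw [Finset.map_val]; rfl
    rw [Finset.map_univ_equiv] at h2
    rw [← h2, Multiset.map_map]
    rfl

end seg

/-! ### Measurability -/

section measurability

variable {n : ℕ} {X : Type*} [MeasurableSpace X]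

theorem measurableSet_monotone_comp (σ' : Equiv.Perm (Fin n)) :
    MeasurableSet {u : Fin n → ℝ | Monotone (u ∘ σ')} := by
  have : {u : Fin n → ℝ | Monotone (u ∘ σ')} = ⋂ i, ⋂ j, ⋂ _ : i ≤ j, {u | u (σ' i) ≤ u (σ' j)} := by
    ext u; simp [Monotone]
  rw [this]
  exact MeasurableSet.iInter fun i => MeasurableSet.iInter fun j => MeasurableSet.iInter fun _ =>
    measurableSet_le (measurable_pi_apply _) (measurable_pi_apply _)

open Classical in
theorem measurable_run_filter {h : ℝ → ℂ × ℂ} (hh : Measurable h) {J : Set ℝ}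
    (hJ : MeasurableSet J) {u : X → Fin n → ℝ} (hu : Measurable u) {z : X → ℂ} (hz : Measurable z)
    (L : List (Fin n)) {v : X → ℂ × ℂ} (hv : Measurable v) :
    Measurable fun p => run (z p) (v p) (((L.map (u p)).filter fun x => x ∈ J).map h) := by
  induction L generalizing v with
  | nil => simpa using hv
  | cons i L ih =>
    have hui : Measurable fun p => u p i := (measurable_pi_apply i).comp hu
    have hstep : Measurable fun p => step (z p) (v p) (h (u p i)) := by
      have := hh.comp hui
      unfold step
      fun_prop
    have e : (fun p => run (z p) (v p) ((((i :: L).map (u p)).filter fun x => x ∈ J).map h)) =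
        fun p => if u p i ∈ J
          then run (z p) (step (z p) (v p) (h (u p i))) (((L.map (u p)).filter fun x => x ∈ J).map h)
          else run (z p) (v p) (((L.map (u p)).filter fun x => x ∈ J).map h) := by
      ext1 p
      by_cases hi : u p i ∈ J <;> simp [hi]
    rw [e]
    exact Measurable.ite (hui hJ) (ih hstep) (ih hv)

/-- The transfer product along the samples in `J` is a measurable function of the samples. -/
theorem measurable_run_seg {h : ℝ → ℂ × ℂ} (hh : Measurable h) {J : Set ℝ}
    (hJ : MeasurableSet J) {u : X → Fin n → ℝ} (hu : Measurable u) {z : X → ℂ} (hz : Measurable z)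
    {v : X → ℂ × ℂ} (hv : Measurable v) :
    Measurable fun p => run (z p) (v p) ((seg (u p) J).map h) := by
  classical
  intro E hE
  have : (fun p => run (z p) (v p) ((seg (u p) J).map h)) ⁻¹' E = ⋃ σ' : Equiv.Perm (Fin n),
      u ⁻¹' {u | Monotone (u ∘ σ')} ∩ (fun p => run (z p) (v p)
        (((((List.finRange n).map σ').map (u p)).filter fun x => x ∈ J).map h)) ⁻¹' E := by
    ext p
    simp only [Set.mem_preimage, Set.mem_iUnion, Set.mem_inter_iff, Set.mem_ofPred_eq]
    constructor
    · intro hp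
      have hm := Tuple.monotone_sort (u p)
      refine ⟨Tuple.sort (u p), hm, ?_⟩
      rwa [← seg_eq_filter hm]
    · rintro ⟨σ', hm, hp⟩
      rwa [← seg_eq_filter hm] at hp
  rw [this]
  exact MeasurableSet.iUnion fun σ' => (hu (measurableSet_monotone_comp σ')).inter
    (measurable_run_filter hh hJ hu hz _ hv hE)

theorem measurable_contP_seg {h : ℝ → ℂ × ℂ} (hh : Measurable h) {J : Set ℝ}
    (hJ : MeasurableSet J) {u : X → Fin n → ℝ} (hu : Measurable u) {z : X → ℂ}
    (hz : Measurable z) : Measurable fun p => contP (z p) ((seg (u p) J).map h) := by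
  have := (measurable_run_seg hh hJ hu hz (measurable_const (a := ((1 : ℂ), (0 : ℂ))))).fst
  simpa [run_fst] using this

theorem measurable_count {J : Set ℝ} (hJ : MeasurableSet J) :
    Measurable fun u : Fin n → ℝ => count u J := by
  classical
  have : (fun u : Fin n → ℝ => count u J) = fun u => ∑ i, if u i ∈ J then 1 else 0 := by
    ext u; rw [count, idx, Finset.card_filter]
  rw [this]
  exact Finset.measurable_sum _ fun i _ =>
    Measurable.ite (measurable_pi_apply i hJ) measurable_const measurable_const

end measurability

/-! ### The law of large numbers for counts -/

/-- The weak law of large numbers for the number of samples in a set. -/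
theorem tendsto_count {J : Set ℝ} (hJ : MeasurableSet J) {δ : ℝ} (hδ : 0 < δ) :
    Tendsto (fun n : ℕ => (unifPi n).real {u | δ * n ≤ |(count u J : ℝ) - n * unif.real J|})
      atTop (𝓝 0) := by
  have hbound : ∀ n : ℕ, 0 < n →
      (unifPi n).real {u | δ * n ≤ |(count u J : ℝ) - n * unif.real J|} ≤ 1 / (δ ^ 2) / n := by
    intro n hn
    have hn' : (0 : ℝ) < n := by exact_mod_cast hn
    set Y : ℝ → ℝ := J.indicator 1 with hY
    have hYm : Measurable Y := measurable_one.indicator hJ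
    set Xf : Fin n → (Fin n → ℝ) → ℝ := fun i u => Y (u i) with hXf
    have hXm : ∀ i, Measurable (Xf i) := fun i => hYm.comp (measurable_pi_apply i)
    have hXb : ∀ i u, Xf i u ∈ Set.Icc (0 : ℝ) 1 := by
      intro i u
      simp only [hXf, hY, Set.indicator]
      split_ifs <;> simp
    have hL2 : ∀ i, MemLp (Xf i) 2 (unifPi n) := fun i =>
      memLp_of_bounded (Filter.Eventually.of_forall (hXb i)) (hXm i).aestronglyMeasurable 2
    have hind : iIndepFun Xf (unifPi n) :=
      iIndepFun_pi (X := fun _ => Y) fun _ => hYm.aemeasurable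
    have hvar : variance (∑ i, Xf i) (unifPi n) ≤ n := by
      rw [IndepFun.variance_sum (fun i _ => hL2 i) fun i _ j _ hij => hind.indepFun hij]
      refine (Finset.sum_le_sum (g := fun _ => 1) fun i _ => ?_).trans (by simp)
      have := variance_le_sq_of_bounded (Filter.Eventually.of_forall (hXb i))
        (hXm i).aemeasurable (μ := unifPi n)
      refine this.trans (by norm_num)
    have hmean : ∫ u, (∑ i, Xf i) u ∂unifPi n = n * unif.real J := by
      simp only [Finset.sum_apply]
      rw [integral_finsetSum _ fun i _ => (hL2 i).integrable (by norm_num)]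
      have : ∀ i, ∫ u, Xf i u ∂unifPi n = unif.real J := by
        intro i
        have h := integral_map (μ := unifPi n) (φ := Function.eval i)
          (measurable_pi_apply i).aemeasurable hYm.aestronglyMeasurable
        rw [(measurePreserving_eval (fun _ : Fin n => unif) i).map_eq, hY,
          integral_indicator_one hJ] at h
        exact h.symm
      simp [this]
    have hcount : ∀ u, (∑ i, Xf i) u = count u J := by
      intro u
      classical
      rw [count, idx, Finset.card_filter]
      simp only [Finset.sum_apply, hXf, hY, Set.indicator, Pi.one_apply]
      push_cast
      rfl
    have hcheb := meas_ge_le_variance_div_sq (memLp_finsetSum' _ fun i _ => hL2 i :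
      MemLp (∑ i, Xf i) 2 (unifPi n)) (c := δ * n) (by positivity)
    simp_rw [hmean, hcount] at hcheb
    refine ENNReal.toReal_le_of_le_ofReal (by positivity) (hcheb.trans ?_)
    apply ENNReal.ofReal_le_ofReal
    calc _ ≤ (n : ℝ) / (δ * n) ^ 2 := by gcongr
      _ = _ := by field_simp
  refine squeeze_zero' (Filter.Eventually.of_forall fun _ => measureReal_nonneg)
    ((Filter.eventually_gt_atTop 0).mono fun n hn => hbound n hn) ?_
  exact tendsto_const_div_atTop_nhds_zero_nat _


/-! ### Randomness inside a block of samples -/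

/-- The Jacobi parameters of the samples in `[s, t)`, in increasing order of the samples. -/
noncomputable def blk (h : ℝ → ℂ × ℂ) {n : ℕ} (u : Fin n → ℝ) (s t : ℝ) : List (ℂ × ℂ) :=
  (seg u (Set.Ico s t)).map h

/-- The transfer vector accumulated before `s`. -/
noncomputable def pre (h : ℝ → ℂ × ℂ) {n : ℕ} (u : Fin n → ℝ) (s : ℝ) (z : ℂ) : ℂ × ℂ :=
  run z (1, 0) ((seg u (Set.Iio s)).map h)

theorem length_blk (h : ℝ → ℂ × ℂ) {n : ℕ} (u : Fin n → ℝ) (s t : ℝ) :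
    (blk h u s t).length = count u (Set.Ico s t) := by
  rw [blk, List.length_map, length_seg]

theorem pre_eq_run (h : ℝ → ℂ × ℂ) {n : ℕ} (u : Fin n → ℝ) {s t : ℝ} (hst : s ≤ t) (z : ℂ) :
    pre h u t z = run z (pre h u s z) (blk h u s t) := by
  rw [pre, seg_Iio_append hst, List.map_append, run_append]; rfl

theorem exists_of_mem_blk {h : ℝ → ℂ × ℂ} {n : ℕ} {u : Fin n → ℝ} {s t : ℝ} {y : ℂ × ℂ}
    (hy : y ∈ blk h u s t) : ∃ x ∈ Set.Ico s t, h x = y := by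
  obtain ⟨x, hx, rfl⟩ := List.mem_map.1 hy
  exact ⟨x, mem_of_mem_seg hx, rfl⟩

theorem unif_real_Ico {s t : ℝ} (hs : 0 ≤ s) (hst : s ≤ t) (ht : t ≤ 1) :
    unif.real (Set.Ico s t) = t - s := by
  rw [measureReal_def, unif, Measure.restrict_apply measurableSet_Ico,
    Set.inter_eq_left.2 (show Set.Ico s t ⊆ Set.Icc 0 1 from
      fun x hx => ⟨hs.trans hx.1, hx.2.le.trans ht⟩), Real.volume_Ico,
    ENNReal.toReal_ofReal (by linarith)]

theorem tendsto_count_lt {J : Set ℝ} (hJ : MeasurableSet J) {a : ℝ} (ha : a < unif.real J) :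
    Tendsto (fun n : ℕ => (unifPi n).real {u | (count u J : ℝ) < a * n}) atTop (𝓝 0) := by
  refine squeeze_zero (fun _ => measureReal_nonneg) (fun n => measureReal_mono fun u hu => ?_)
    (tendsto_count hJ (sub_pos.2 ha))
  rw [Set.mem_ofPred_eq] at hu ⊢
  rw [abs_sub_comm]
  refine le_trans ?_ (le_abs_self _)
  nlinarith

theorem tendsto_lt_count {J : Set ℝ} (hJ : MeasurableSet J) {a : ℝ} (ha : unif.real J < a) :
    Tendsto (fun n : ℕ => (unifPi n).real {u | a * n < (count u J : ℝ)}) atTop (𝓝 0) := by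
  refine squeeze_zero (fun _ => measureReal_nonneg) (fun n => measureReal_mono fun u hu => ?_)
    (tendsto_count hJ (sub_pos.2 ha))
  rw [Set.mem_ofPred_eq] at hu ⊢
  refine le_trans ?_ (le_abs_self _)
  nlinarith

theorem measurableSet_count {n : ℕ} {J : Set ℝ} (hJ : MeasurableSet J) (E : Set ℕ) :
    MeasurableSet {u : Fin n → ℝ | count u J ∈ E} := measurable_count hJ (MeasurableSet.of_discrete)

/-- At `s` the product `c d` does not vanish and the parameters are not constant to the right of
`s`: the samples to the right of `s` carry enough randomness. -/
def Moving (h : ℝ → ℂ × ℂ) (s : ℝ) : Prop :=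
  (h s).2 ≠ 0 ∧ ∀ δ > 0, ∃ x ∈ Set.Ioo s (s + δ), h x ≠ h s

/-- If the number of samples in the first of two exchanged intervals differs between two
configurations, then the Weyl functions of the blocks differ by more than `e^{-η n}` somewhere on
a circle around infinity. -/
theorem exists_separation {h : ℝ → ℂ × ℂ} (hh : Continuous h) {C ρ s t η : ℝ} (hC : 0 ≤ C)
    (hhC : ∀ x, ‖h x‖ ≤ C) (hρ : 0 < ρ) (hρ1 : ρ ≤ 1) (hCρ : C * ρ ≤ 1 / 8) (hs : 0 ≤ s)
    (hs1 : s < 1) (hst : s < t) (hmov : Moving h s) (hη : 0 < η) :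
    ∃ p q r : ℝ, s ≤ p ∧ 0 < r ∧ p + r ≤ q ∧ q + r ≤ t ∧ q + r ≤ 1 ∧
    ∃ G : (n : ℕ) → Set (Fin n → ℝ), (∀ n, MeasurableSet (G n)) ∧
      (∀ n T, ∀ u ∈ G n, flip p q r T u ∈ G n) ∧
      Tendsto (fun n => (unifPi n).real (G n)ᶜ) atTop (𝓝 0) ∧
      (∀ k : ℕ, ∀ᶠ n in atTop, ∀ u ∈ G n,
        2 * k ≤ count u (Set.Ico p (p + r) ∪ Set.Ico q (q + r))) ∧
      (∀ n, ∀ u ∈ G n, (count u (Set.Ico s t) : ℝ) ≤ 2 * unif.real (Set.Ico s t) * n) ∧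
      ∀ᶠ n in atTop, ∀ u ∈ G n, ∀ T T' : Finset (Fin n),
        count (flip p q r T u) (Set.Ico p (p + r)) ≠ count (flip p q r T' u) (Set.Ico p (p + r)) →
        ∃ ζ : ℂ, ‖ζ‖ = ρ ∧ Real.exp (-(η * n)) <
          ‖weylInf ζ (blk h (flip p q r T u) s t) - weylInf ζ (blk h (flip p q r T' u) s t)‖ := by
  obtain ⟨hγ, hmov⟩ := hmov
  set g := ‖(h s).2‖ / 2 with hg
  have hg0 : 0 < g := half_pos (norm_pos_iff.2 hγ)
  set K := max (8 / ρ ^ 2) (24 / (ρ ^ 2 * g)) with hK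
  have hK1 : 1 < K := by
    refine lt_of_lt_of_le ?_ (le_max_left _ _)
    rw [lt_div_iff₀ (by positivity)]; nlinarith
  have hlogK : 0 < Real.log K := Real.log_pos hK1
  -- the window to the right of `s` in which the exchanged intervals lie
  obtain ⟨δ, hδ0, hδg, hδt, hδ1, hδη⟩ : ∃ δ > 0, (∀ x ∈ Set.Ico s (s + δ), g ≤ ‖(h x).2‖) ∧
      s + δ < t ∧ s + δ < 1 ∧ 2 * δ * Real.log K ≤ η / 2 := by
    have hc : Tendsto (fun x => ‖(h x).2‖) (𝓝 s) (𝓝 ‖(h s).2‖) :=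
      (hh.snd.norm).continuousAt
    have hev := hc.eventually (lt_mem_nhds (show g < ‖(h s).2‖ by rw [hg]; linarith))
    obtain ⟨δ₁, hδ₁, hball⟩ := Metric.eventually_nhds_iff.1 hev
    refine ⟨min (min δ₁ ((t - s) / 2)) (min ((1 - s) / 2) (η / 4 / Real.log K)), ?_, ?_, ?_, ?_, ?_⟩
    · exact lt_min (lt_min hδ₁ (by linarith)) (lt_min (by linarith) (by positivity))
    · intro x hx
      refine (hball ?_).le
      rw [Real.dist_eq, abs_of_nonneg (by linarith [hx.1])]
      have : min (min δ₁ ((t - s) / 2)) (min ((1 - s) / 2) (η / 4 / Real.log K)) ≤ δ₁ :=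
        (min_le_left _ _).trans (min_le_left _ _)
      linarith [hx.2]
    · have : min (min δ₁ ((t - s) / 2)) (min ((1 - s) / 2) (η / 4 / Real.log K)) ≤ (t - s) / 2 :=
        (min_le_left _ _).trans (min_le_right _ _)
      linarith
    · have : min (min δ₁ ((t - s) / 2)) (min ((1 - s) / 2) (η / 4 / Real.log K)) ≤ (1 - s) / 2 :=
        (min_le_right _ _).trans (min_le_left _ _)
      linarith
    · have : min (min δ₁ ((t - s) / 2)) (min ((1 - s) / 2) (η / 4 / Real.log K)) ≤
          η / 4 / Real.log K := (min_le_right _ _).trans (min_le_right _ _)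
      have h2 := mul_le_mul_of_nonneg_right this hlogK.le
      rw [div_mul_cancel₀ _ hlogK.ne'] at h2
      linarith
  obtain ⟨q, hq, hqne⟩ := hmov δ hδ0
  set θ := ‖h q - h s‖ / 2 with hθ
  have hθ0 : 0 < θ := half_pos (norm_pos_iff.2 (sub_ne_zero.2 hqne))
  obtain ⟨r, hr0, hrq, hrδ, hrs, hrq'⟩ : ∃ r > 0, s + r ≤ q ∧ q + r < s + δ ∧
      (∀ x ∈ Set.Ico s (s + r), ‖h x - h s‖ ≤ θ / 2) ∧
      ∀ x ∈ Set.Ico q (q + r), ‖h x - h q‖ ≤ θ / 2 := by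
    obtain ⟨δ₁, hδ₁, hb₁⟩ := Metric.continuousAt_iff.1 (hh.continuousAt (x := s)) (θ / 2)
      (by positivity)
    obtain ⟨δ₂, hδ₂, hb₂⟩ := Metric.continuousAt_iff.1 (hh.continuousAt (x := q)) (θ / 2)
      (by positivity)
    have hev : ∀ᶠ r : ℝ in 𝓝[>] 0, r < q - s ∧ r < s + δ - q ∧ r < δ₁ ∧ r < δ₂ :=
      ((eventually_lt_nhds (by linarith [hq.1])).and ((eventually_lt_nhds (by linarith [hq.2])).and
        ((eventually_lt_nhds hδ₁).and (eventually_lt_nhds hδ₂)))).filter_mono nhdsWithin_le_nhds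
    obtain ⟨r, ⟨h1, h2, h3, h4⟩, h5⟩ := (hev.and self_mem_nhdsWithin).exists
    refine ⟨r, h5, by linarith, by linarith, fun x hx => ?_, fun x hx => ?_⟩
    · rw [← dist_eq_norm]
      refine (hb₁ ?_).le
      rw [Real.dist_eq, abs_of_nonneg (by linarith [hx.1])]; linarith [hx.2]
    · rw [← dist_eq_norm]
      refine (hb₂ ?_).le
      rw [Real.dist_eq, abs_of_nonneg (by linarith [hx.1])]; linarith [hx.2]
  set A := Set.Ico s (s + r) with hA
  set B := Set.Ico q (q + r) with hB
  have hABm : MeasurableSet (A ∪ B) := measurableSet_Ico.union measurableSet_Ico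
  have hAB : ∀ a b, a ≤ s → q + r ≤ b → A ∪ B ⊆ Set.Ico a b := by
    rintro a b ha hb x (hx | hx)
    · exact ⟨ha.trans hx.1, by linarith [hx.2]⟩
    · exact ⟨by linarith [hx.1], by linarith [hx.2]⟩
  have hdisj : ∀ a b, (b ≤ s ∨ q + r ≤ a ∨ (s + r ≤ a ∧ b ≤ q)) →
      Disjoint (Set.Ico a b) (A ∪ B) := by
    intro a b hab
    rw [Set.disjoint_left]
    rintro x ⟨hx1, hx2⟩ (⟨hx3, hx4⟩ | ⟨hx3, hx4⟩) <;> rcases hab with h | h | h <;>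
      linarith
  have hν : unif.real (Set.Ico s (q + r)) < 2 * δ := by
    rw [unif_real_Ico hs (by linarith) (by linarith)]; linarith
  have hνst : 0 < unif.real (Set.Ico s t) := by
    have h1 : unif.real (Set.Ico s (s + δ)) = δ := by
      rw [unif_real_Ico hs (by linarith) (by linarith)]; ring
    have h2 := measureReal_mono (μ := unif) (Set.Ico_subset_Ico_right hδt.le :
      Set.Ico s (s + δ) ⊆ Set.Ico s t)
    linarith
  have hνtail : 0 < unif.real (Set.Ico (q + r) t) := by
    have h1 : unif.real (Set.Ico (q + r) (s + δ)) = s + δ - (q + r) := by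
      rw [unif_real_Ico (by linarith [hq.1]) (by linarith) (by linarith)]
    have h2 := measureReal_mono (μ := unif) (Set.Ico_subset_Ico_right hδt.le :
      Set.Ico (q + r) (s + δ) ⊆ Set.Ico (q + r) t)
    linarith
  have hνAB : r / 2 < unif.real (A ∪ B) := by
    have h1 : unif.real A = r := by
      rw [hA, unif_real_Ico hs (by linarith) (by linarith)]; ring
    have h2 := measureReal_mono (μ := unif) (Set.subset_union_left : A ⊆ A ∪ B)
    linarith
  set G : (n : ℕ) → Set (Fin n → ℝ) := fun n =>
    {u | (count u (Set.Ico s (q + r)) : ℝ) ≤ 2 * δ * n ∧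
      unif.real (Set.Ico (q + r) t) / 2 * n ≤ count u (Set.Ico (q + r) t) ∧
      r / 2 * n ≤ count u (A ∪ B) ∧
      (count u (Set.Ico s t) : ℝ) ≤ 2 * unif.real (Set.Ico s t) * n} with hG
  refine ⟨s, q, r, le_rfl, hr0, hrq, by linarith, by linarith, G, ?_, ?_, ?_, ?_, ?_, ?_⟩
  · intro n
    exact (measurableSet_count measurableSet_Ico {k | (k : ℝ) ≤ _}).inter
      ((measurableSet_count measurableSet_Ico {k | _ ≤ (k : ℝ)}).inter
      ((measurableSet_count hABm {k | _ ≤ (k : ℝ)}).inter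
        (measurableSet_count measurableSet_Ico {k | (k : ℝ) ≤ _})))
  · rintro n T u ⟨h1, h2, h3, h4⟩
    refine ⟨?_, ?_, ?_, ?_⟩
    · rwa [count_flip hrq (Or.inl (hAB _ _ le_rfl le_rfl))]
    · rwa [count_flip hrq (Or.inr (hdisj _ _ (Or.inr (Or.inl le_rfl))))]
    · rwa [count_flip hrq (Or.inl subset_rfl)]
    · rwa [count_flip hrq (Or.inl (hAB _ _ le_rfl (by linarith)))]
  · have e1 := tendsto_lt_count measurableSet_Ico hν
    have e2 := tendsto_count_lt (J := Set.Ico (q + r) t) measurableSet_Ico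
      (half_lt_self hνtail)
    have e3 := tendsto_count_lt hABm hνAB
    have e4 := tendsto_lt_count (J := Set.Ico s t) measurableSet_Ico
      (show unif.real (Set.Ico s t) < 2 * unif.real (Set.Ico s t) by linarith)
    have e := (e1.add e2).add (e3.add e4)
    simp only [add_zero] at e
    refine squeeze_zero (fun _ => measureReal_nonneg) (fun n => ?_) e
    refine le_trans (measureReal_mono (s₂ := ({u | 2 * δ * n < (count u (Set.Ico s (q + r)) : ℝ)} ∪
      {u | (count u (Set.Ico (q + r) t) : ℝ) < unif.real (Set.Ico (q + r) t) / 2 * n}) ∪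
      ({u | (count u (A ∪ B) : ℝ) < r / 2 * n} ∪
        {u | 2 * unif.real (Set.Ico s t) * n < (count u (Set.Ico s t) : ℝ)})) ?_) ?_
    · intro u hu
      by_contra hcon
      simp only [Set.mem_union, Set.mem_ofPred_eq, not_or, not_lt] at hcon
      exact hu ⟨hcon.1.1, hcon.1.2, hcon.2.1, hcon.2.2⟩
    · exact (measureReal_union_le _ _).trans
        (add_le_add (measureReal_union_le _ _) (measureReal_union_le _ _))
  · intro k
    have : Tendsto (fun n : ℕ => r / 2 * (n : ℝ)) atTop atTop :=
      tendsto_natCast_atTop_atTop.const_mul_atTop (by positivity)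
    filter_upwards [this.eventually_ge_atTop ((2 * k : ℕ) : ℝ)] with n hn u hu
    exact_mod_cast hn.trans hu.2.2.1
  · intro n u hu; exact hu.2.2.2
  -- the two lists share their first, third and fifth parts
  have hlarge : ∀ᶠ n : ℕ in atTop, ((n : ℝ) + 1) * Real.exp (-(η / 2 * n)) < θ ∧
      0 < unif.real (Set.Ico (q + r) t) / 2 * (n : ℝ) := by
    have h1 : Tendsto (fun n : ℕ => ((n : ℝ) + 1) * Real.exp (-(η / 2 * n))) atTop (𝓝 0) := by
      have h2 := (Real.tendsto_pow_mul_exp_neg_atTop_nhds_zero 1).comp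
        (tendsto_natCast_atTop_atTop.const_mul_atTop (half_pos hη) :
          Tendsto (fun n : ℕ => η / 2 * (n : ℝ)) atTop atTop)
      have h3 := (Real.tendsto_exp_neg_atTop_nhds_zero).comp
        (tendsto_natCast_atTop_atTop.const_mul_atTop (half_pos hη) :
          Tendsto (fun n : ℕ => η / 2 * (n : ℝ)) atTop atTop)
      have h4 := (h2.const_mul (2 / η)).add h3
      rw [mul_zero, zero_add] at h4
      refine h4.congr fun n => ?_
      simp only [Function.comp, pow_one]
      field_simp
    exact (h1.eventually_lt_const hθ0).and ((eventually_gt_atTop 0).mono fun n hn => by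
      have : (0 : ℝ) < n := by exact_mod_cast hn
      positivity)
  filter_upwards [hlarge] with n hn u hu T T' hne
  obtain ⟨hn1, hn2⟩ := hn
  obtain ⟨hu1, hu2, -, -⟩ := hu
  by_contra hcon
  push Not at hcon
  have main : ∀ T T' : Finset (Fin n), (∀ ζ : ℂ, ‖ζ‖ = ρ →
      ‖weylInf ζ (blk h (flip s q r T u) s t) - weylInf ζ (blk h (flip s q r T' u) s t)‖ ≤
        Real.exp (-(η * n))) →
      ¬ count (flip s q r T u) A < count (flip s q r T' u) A := by
    intro T T' hcon hlt
    have hsplit : ∀ T, blk h (flip s q r T u) s t = [] ++ ((seg (flip s q r T u) A).map h ++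
        ((seg u (Set.Ico (s + r) q)).map h ++ ((seg (flip s q r T u) B).map h ++
          (seg u (Set.Ico (q + r) t)).map h))) := by
      intro T
      rw [blk, seg_Ico_append (t := s + r) (by linarith) (by linarith),
        seg_Ico_append (s := s + r) (t := q) hrq (by linarith),
        seg_Ico_append (s := q) (t := q + r) (by linarith) (by linarith),
        seg_flip (hdisj _ _ (Or.inr (Or.inr ⟨le_rfl, le_rfl⟩))) T hrq,
        seg_flip (hdisj (q + r) t (Or.inr (Or.inl le_rfl))) T hrq]
      simp [hA, hB]
    have hsum : ∀ T, count (flip s q r T u) A + count (flip s q r T u) B = count u (A ∪ B) := by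
      intro T
      rw [← count_union, count_flip hrq (Or.inl subset_rfl)]
      intro x hx y hy; linarith [hx.2, hy.1]
    set k := count u (Set.Ico s (q + r)) with hk
    have hktot : count u (A ∪ B) + count u (Set.Ico (s + r) q) = k := by
      rw [← hsum ∅]
      have e : flip s q r ∅ u = u := by ext i; simp [flip]
      rw [e, hk, ← length_seg (Set.Ico s (q + r)),
        seg_Ico_append (t := s + r) (by linarith) (by linarith),
        seg_Ico_append (s := s + r) (t := q) hrq (by linarith), List.length_append,
        List.length_append, length_seg, length_seg, length_seg]
      ring
    have htail : 0 < count u (Set.Ico (q + r) t) := by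
      exact_mod_cast hn2.trans_le hu2
    have hlen : ∀ T, k < (blk h (flip s q r T u) s t).length := by
      intro T
      rw [length_blk, count_flip hrq (Or.inl (hAB _ _ le_rfl (by linarith))),
        ← length_seg, seg_Ico_append (t := q + r) (by linarith) (by linarith), List.length_append,
        length_seg, length_seg]
      omega
    have hbound : ∀ T, ∀ y ∈ blk h (flip s q r T u) s t, ‖y‖ ≤ C := by
      intro T y hy
      obtain ⟨x, _, rfl⟩ := exists_of_mem_blk hy
      exact hhC x
    have hgk : ∀ i < k, g ≤ ‖((blk h (flip s q r T u) s t).getD i 0).2‖ := by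
      intro i hi
      have e : blk h (flip s q r T u) s t = (seg (flip s q r T u) (Set.Ico s (q + r))).map h ++
          (seg (flip s q r T u) (Set.Ico (q + r) t)).map h := by
        rw [blk, seg_Ico_append (t := q + r) (by linarith) (by linarith), List.map_append]
      have hi' : i < ((seg (flip s q r T u) (Set.Ico s (q + r))).map h).length := by
        rw [List.length_map, length_seg, count_flip hrq (Or.inl (hAB _ _ le_rfl le_rfl))]
        exact hi
      rw [e, List.getD_append _ _ _ _ hi', List.getD_eq_getElem _ _ hi', List.getElem_map]
      have hm := mem_of_mem_seg (List.getElem_mem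
        (by simpa using hi' : i < (seg (flip s q r T u) (Set.Ico s (q + r))).length))
      exact hδg _ ⟨hm.1, by linarith [hm.2]⟩
    have hclose := norm_sub_le_of_weylInf_close hC hρ hρ1 hCρ hg0 (le_max_left _ _)
      (le_max_right _ _) (Real.exp_pos (-(η * n))).le k _ _ (hbound T) (hbound T') (hlen T)
      (hlen T') hgk hcon
    rw [← hK, hsplit T, hsplit T'] at hclose
    have hKk : K ^ k * Real.exp (-(η * n)) ≤ Real.exp (-(η / 2 * n)) := by
      have h1 : K ^ k ≤ Real.exp (η / 2 * n) := by
        rw [← Real.exp_log (pow_pos (by linarith : 0 < K) k), Real.exp_le_exp, Real.log_pow]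
        calc (k : ℝ) * Real.log K ≤ 2 * δ * n * Real.log K := by gcongr
          _ = 2 * δ * Real.log K * n := by ring
          _ ≤ _ := by gcongr
      calc _ ≤ Real.exp (η / 2 * n) * Real.exp (-(η * n)) := by gcongr
        _ = _ := by rw [← Real.exp_add]; ring_nf
    have hfin := le_of_shifted_close (S := Metric.closedBall (h s) (θ / 2)) (θ := θ)
      (e := K ^ k * Real.exp (-(η * n))) (by positivity) [] ((seg (flip s q r T u) A).map h)
      ((seg u (Set.Ico (s + r) q)).map h) ((seg (flip s q r T u) B).map h)
      ((seg u (Set.Ico (q + r) t)).map h) ((seg (flip s q r T' u) A).map h)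
      ((seg (flip s q r T' u) B).map h) ((seg u (Set.Ico (q + r) t)).map h) ?_ ?_ ?_ ?_ ?_
    · have h5 : ((((seg (flip s q r T u) A).map h).length +
          ((seg u (Set.Ico (s + r) q)).map h).length + 1 : ℕ) : ℝ) ≤ (n : ℝ) + 1 := by
        rw [List.length_map, List.length_map, length_seg, length_seg]
        have h6 := hsum T
        have h7 : k ≤ n := count_le _ _
        have : count (flip s q r T u) A + count u (Set.Ico (s + r) q) + 1 ≤ n + 1 := by omega
        exact_mod_cast this
      have : θ ≤ ((n : ℝ) + 1) * Real.exp (-(η / 2 * n)) :=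
        hfin.trans (mul_le_mul h5 hKk (by positivity) (by positivity))
      linarith
    · simpa [length_seg] using hlt
    · simp only [List.length_map, length_seg]; rw [hsum, hsum]
    · intro y hy
      obtain ⟨x, hx, rfl⟩ := List.mem_map.1 hy
      rw [mem_closedBall_iff_norm]
      exact hrs x (mem_of_mem_seg hx)
    · intro y hy w hw
      obtain ⟨x, hx, rfl⟩ := List.mem_map.1 hy
      rw [mem_closedBall_iff_norm] at hw
      have h1 := hrq' x (mem_of_mem_seg hx)
      have h2 : h q - h s = -(h x - h q) + ((h x - w) + (w - h s)) := by abel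
      have h3 : 2 * θ ≤ θ / 2 + (‖h x - w‖ + θ / 2) := by
        calc 2 * θ = ‖h q - h s‖ := by rw [hθ]; ring
          _ ≤ ‖-(h x - h q)‖ + ‖(h x - w) + (w - h s)‖ := by rw [h2]; exact norm_add_le _ _
          _ ≤ _ := by
            rw [norm_neg]
            exact add_le_add h1 ((norm_add_le _ _).trans (by gcongr))
      linarith
    · intro i hi
      refine hclose i (lt_of_lt_of_le hi ?_)
      simp only [List.length_nil, List.length_map, length_seg]
      have := hsum T
      omega
  rcases lt_or_gt_of_ne hne with hlt | hgt
  · exact main T T' hcon hlt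
  · refine main T' T (fun ζ hζ => ?_) hgt
    rw [norm_sub_rev]; exact hcon ζ hζ


/-! ### Blocks rarely cancel the transfer vector -/

section blocks

variable {h : ℝ → ℂ × ℂ} {C : ℝ} {s t : ℝ}

theorem measurable_pre (hh : Continuous h) (n : ℕ) (s : ℝ) :
    Measurable fun p : (Fin n → ℝ) × ℂ => pre h p.1 s p.2 :=
  measurable_run_seg hh.measurable measurableSet_Iio measurable_fst measurable_snd
    measurable_const

theorem measurable_run_blk (hh : Continuous h) (n : ℕ) (s t : ℝ) :
    Measurable fun p : (Fin n → ℝ) × ℂ => run p.2 (pre h p.1 s p.2) (blk h p.1 s t) :=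
  measurable_run_seg hh.measurable measurableSet_Ico measurable_fst measurable_snd
    (measurable_pre hh n s)

theorem measurable_contP_blk (hh : Continuous h) (n : ℕ) (s t : ℝ) :
    Measurable fun p : (Fin n → ℝ) × ℂ => contP p.2 (blk h p.1 s t) :=
  measurable_contP_seg hh.measurable measurableSet_Ico measurable_fst measurable_snd

theorem norm_le_of_mem_blk (hhC : ∀ x, ‖h x‖ ≤ C) {n : ℕ} {u : Fin n → ℝ} :
    ∀ y ∈ blk h u s t, ‖y‖ ≤ C := by
  intro y hy
  obtain ⟨x, _, rfl⟩ := exists_of_mem_blk hy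
  exact hhC x

theorem prod_measureReal_le {n : ℕ} {W : Set ((Fin n → ℝ) × ℂ)} {E : Set (Fin n → ℝ)} {Z : Set ℂ}
    (hZf : volume Z ≠ ∞) (hW : W ⊆ E ×ˢ Z) :
    ((unifPi n).prod volume).real W ≤ (unifPi n).real E * volume.real Z := by
  have h1 : ((unifPi n).prod volume) (E ×ˢ Z) = unifPi n E * volume Z := Measure.prod_prod _ _
  have h2 : ((unifPi n).prod volume) (E ×ˢ Z) ≠ ∞ := by
    rw [h1]; exact ENNReal.mul_ne_top (measure_ne_top _ _) hZf
  refine (measureReal_mono hW h2).trans (le_of_eq ?_)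
  rw [measureReal_def, h1, ENNReal.toReal_mul]; rfl

/-- The exchange argument for a block that starts at a moving point: sets of pairs (samples, spectral
parameter) whose sections are nearly disjoint for separated configurations are small. -/
theorem eventually_measureReal_le_of_separated (hh : Continuous h) {ρ η : ℝ} (hC : 0 ≤ C)
    (hhC : ∀ x, ‖h x‖ ≤ C) (hρ : 0 < ρ) (hρ1 : ρ ≤ 1) (hCρ : C * ρ ≤ 1 / 8) (hs : 0 ≤ s)
    (hs1 : s < 1) (hst : s < t) (hmov : Moving h s) (hη : 0 < η) {Z : Set ℂ}
    (hZ : MeasurableSet Z) (hZf : volume Z ≠ ∞) {W : (n : ℕ) → Set ((Fin n → ℝ) × ℂ)}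
    (hW : ∀ n, MeasurableSet (W n)) (hWZ : ∀ n, ∀ p ∈ W n, p.2 ∈ Z) {α x δ : ℝ} (hα : 0 ≤ α)
    (hx : 0 < x) (hδ : 0 < δ)
    (hsep : ∀ᶠ n : ℕ in atTop, ∀ u u' : Fin n → ℝ, (∀ z, pre h u s z = pre h u' s z) →
      (count u (Set.Ico s t) : ℝ) ≤ 2 * unif.real (Set.Ico s t) * n →
      (count u' (Set.Ico s t) : ℝ) ≤ 2 * unif.real (Set.Ico s t) * n →
      ∀ ζ : ℂ, ‖ζ‖ = ρ → Real.exp (-(η * n)) < ‖weylInf ζ (blk h u s t) - weylInf ζ (blk h u' s t)‖ →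
      volume.real ({z | (u, z) ∈ W n} ∩ {z | (u', z) ∈ W n}) ≤ α) :
    ∀ᶠ n : ℕ in atTop,
      ((unifPi n).prod volume).real (W n) ≤ (x * volume.real Z + α / x) / 2 + δ := by
  obtain ⟨p, q, r, hp, hr, hpq, hqt, hq1, G, hGm, hGT, hGlim, hGk, hGc, hGsep⟩ :=
    exists_separation hh hC hhC hρ hρ1 hCρ hs hs1 hst hmov hη
  set V := volume.real Z with hV
  have hV0 : 0 ≤ V := measureReal_nonneg
  -- enough exchangeable points make collisions of the counts negligible
  obtain ⟨k, hk⟩ : ∃ k : ℕ, V / Real.sqrt (2 * k + 1) / x / 2 ≤ δ / 2 := by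
    have h1 : Tendsto (fun k : ℕ => V / Real.sqrt (2 * k + 1) / x / 2) atTop (𝓝 0) := by
      have h2 : Tendsto (fun k : ℕ => Real.sqrt (2 * (k : ℝ) + 1)) atTop atTop :=
        Real.tendsto_sqrt_atTop.comp (tendsto_atTop_add_const_right _ _
          (tendsto_natCast_atTop_atTop.const_mul_atTop (by norm_num)))
      have := ((tendsto_const_nhds (x := V)).div_atTop h2).div_const x |>.div_const 2
      simpa using this
    obtain ⟨k, hk⟩ := (h1.eventually_le_const (half_pos hδ)).exists
    exact ⟨k, hk⟩
  have hG' : ∀ᶠ n in atTop, (unifPi n).real (G n)ᶜ * V ≤ δ / 2 := by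
    have := hGlim.mul_const V
    rw [zero_mul] at this
    exact this.eventually_le_const (half_pos hδ)
  filter_upwards [hsep, hGk k, hGsep, hG'] with n hsep hGk hGsep hG'
  have h1 : ((unifPi n).prod volume).real (W n ∩ (G n ×ˢ Set.univ)) ≤
      (x * V + (V / Real.sqrt (2 * k + 1) + α) / x) / 2 := by
    refine measureReal_le_of_flip (hs.trans hp) hpq hq1 ((hW n).inter ((hGm n).prod .univ))
      (hGm n) hZ hZf ?_ (hGT n) k hGk hα hx ?_
    · rintro ⟨u, z⟩ ⟨h1, h2⟩
      exact ⟨h2.1, hWZ n _ h1⟩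
    · intro u hu T T' hne
      obtain ⟨ζ, hζ, hlt⟩ := hGsep u hu T T' hne
      have hpre : ∀ T z, pre h (flip p q r T u) s z = pre h u s z := by
        intro T z
        rw [pre, pre, seg_flip _ T hpq]
        rw [Set.disjoint_left]
        rintro y hy (⟨h1, _⟩ | ⟨h1, _⟩)
        · exact not_lt.2 (hp.trans h1) hy
        · rw [Set.mem_Iio] at hy; linarith
      refine le_trans (measureReal_mono ?_ ?_) (hsep _ _ (fun z => (hpre T z).trans (hpre T' z).symm)
        (hGc n _ (hGT n T u hu)) (hGc n _ (hGT n T' u hu)) ζ hζ hlt)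
      · rintro z ⟨h1, h2⟩; exact ⟨h1.1, h2.1⟩
      · exact measure_ne_top_of_subset (fun z hz => hWZ n _ hz.1) hZf
  have h2 : ((unifPi n).prod volume).real (W n ∩ ((G n)ᶜ ×ˢ Set.univ)) ≤
      (unifPi n).real (G n)ᶜ * V :=
    prod_measureReal_le hZf fun q hq => ⟨hq.2.1, hWZ n _ hq.1⟩
  have h3 : W n = (W n ∩ (G n ×ˢ Set.univ)) ∪ (W n ∩ ((G n)ᶜ ×ˢ Set.univ)) := by
    rw [← Set.inter_union_distrib_left, ← Set.union_prod, Set.union_compl_self, Set.univ_prod_univ,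
      Set.inter_univ]
  rw [h3]
  refine (measureReal_union_le _ _).trans ?_
  have e : (x * V + (V / Real.sqrt (2 * k + 1) + α) / x) / 2 =
      (x * V + α / x) / 2 + V / Real.sqrt (2 * k + 1) / x / 2 := by ring
  linarith

/-- Before `s`, the second component of the transfer vector vanishes with high probability. -/
def LeftFree (h : ℝ → ℂ × ℂ) (s : ℝ) : Prop :=
  Tendsto (fun n : ℕ => (unifPi n).real {u | ¬ ∀ z, (pre h u s z).2 = 0}) atTop (𝓝 0)

theorem unifPi_neg_null (n : ℕ) : (unifPi n) {u | ¬ ∀ i, 0 ≤ u i} = 0 := by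
  have : {u : Fin n → ℝ | ¬ ∀ i, 0 ≤ u i} = ⋃ i, Function.eval i ⁻¹' Set.Iio 0 := by
    ext u; simp
  rw [this, measure_iUnion_null_iff]
  intro i
  rw [(measurePreserving_eval (fun _ : Fin n => unif) i).measure_preimage
    measurableSet_Iio.nullMeasurableSet, unif, Measure.restrict_apply measurableSet_Iio]
  have : Set.Iio (0 : ℝ) ∩ Set.Icc 0 1 = ∅ := by
    ext x; simp only [Set.mem_inter_iff, Set.mem_Iio, Set.mem_Icc, Set.mem_empty_iff_false,
      iff_false]
    rintro ⟨h1, h2, _⟩; linarith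
  rw [this, measure_empty]

theorem pre_zero (h : ℝ → ℂ × ℂ) {n : ℕ} {u : Fin n → ℝ} (hu : ∀ i, 0 ≤ u i) (z : ℂ) :
    pre h u 0 z = (1, 0) := by
  have : seg u (Set.Iio 0) = [] := by
    rw [List.eq_nil_iff_forall_not_mem]
    intro x hx
    obtain ⟨i, hi, -⟩ := mem_seg.1 hx
    exact absurd (Set.mem_Iio.1 hi) (not_lt.2 (hu i))
  rw [pre, this]
  rfl

theorem leftFree_zero : LeftFree h 0 := by
  refine Tendsto.congr (fun n => ?_) tendsto_const_nhds
  symm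
  rw [measureReal_eq_zero_iff]
  refine measure_mono_null (fun u hu => ?_) (unifPi_neg_null n)
  intro h0
  refine hu fun z => ?_
  rw [pre_zero h h0]

theorem run_snd_eq_zero (z : ℂ) (v : ℂ × ℂ) {l : List (ℂ × ℂ)} (hl : l ≠ [])
    (h0 : ∀ y ∈ l, y.2 = 0) : (run z v l).2 = 0 := by
  induction l using List.reverseRecOn with
  | nil => exact absurd rfl hl
  | append_singleton l y _ =>
    rw [run_append, run_cons, run_nil, step]
    simp [h0 y (by simp)]

theorem leftFree_of_vanishing {δ : ℝ} (hδ : 0 < δ) (hs : 0 ≤ s - δ) (hs1 : s ≤ 1)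
    (h0 : ∀ x ∈ Set.Ico (s - δ) s, (h x).2 = 0) : LeftFree h s := by
  have hν : 0 < unif.real (Set.Ico (s - δ) s) := by
    rw [unif_real_Ico hs (by linarith) hs1]; linarith
  have hlim := tendsto_count_lt (J := Set.Ico (s - δ) s) measurableSet_Ico (half_lt_self hν)
  refine squeeze_zero' (Eventually.of_forall fun _ => measureReal_nonneg) ?_ hlim
  filter_upwards [eventually_gt_atTop 0] with n hn
  refine measureReal_mono fun u hu => ?_
  rw [Set.mem_ofPred_eq] at hu ⊢
  by_contra hcon
  refine hu fun z => ?_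
  rw [pre_eq_run h u (show s - δ ≤ s by linarith)]
  refine run_snd_eq_zero _ _ ?_ fun y hy => ?_
  · intro hnil
    have h1 := length_blk h u (s - δ) s
    rw [hnil, List.length_nil] at h1
    rw [← h1] at hcon
    apply hcon
    have : (0 : ℝ) < n := by exact_mod_cast hn
    push_cast
    positivity
  · obtain ⟨x, hx, rfl⟩ := exists_of_mem_blk hy
    exact h0 x hx

/-- The points at which a block may start. -/
def Admissible (h : ℝ → ℂ × ℂ) (s : ℝ) : Prop := LeftFree h s ∨ (0 ≤ s ∧ s < 1 ∧ Moving h s)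

theorem exists_small_radius (hC : 0 ≤ C) :
    ∃ ρ : ℝ, 0 < ρ ∧ ρ ≤ 1 ∧ C * ρ ≤ 1 / 8 := by
  refine ⟨1 / (8 * (C + 1)), by positivity, ?_, ?_⟩
  · rw [div_le_one (by positivity)]; linarith
  · rw [mul_one_div, div_le_div_iff₀ (by positivity) (by positivity)]; linarith

/-- In a half-plane of hyperbolicity, the transfer vector that enters a block is rarely almost
annihilated by it. -/
theorem tendsto_measureReal_resonant (hh : Continuous h) (hC : 0 ≤ C) (hhC : ∀ x, ‖h x‖ ≤ C)
    (hst : s < t) (hs : Admissible h s) {c : ℂ} {a κ R τ η : ℝ} (hc : ‖c‖ = 1) (ha : 0 < a)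
    (hκ : 0 < κ) (hκ2 : κ ≤ 2)
    (hhp : ∀ z, τ ≤ (c * z).re → ∀ x ∈ Set.Ico s t, HalfPlane c a κ z (h x)) (hη : 0 < η) :
    Tendsto (fun n : ℕ => ((unifPi n).prod volume).real {p | (‖p.2‖ ≤ R ∧ τ + κ ≤ (c * p.2).re) ∧
      ‖(run p.2 (pre h p.1 s p.2) (blk h p.1 s t)).1‖ <
        Real.exp (-(η * n)) * ‖pre h p.1 s p.2‖ * ‖contP p.2 (blk h p.1 s t)‖}) atTop (𝓝 0) := by
  set Z : Set ℂ := {z | ‖z‖ ≤ R ∧ τ + κ ≤ (c * z).re} with hZ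
  have hZm : MeasurableSet Z :=
    (measurableSet_le measurable_norm measurable_const).inter
      (measurableSet_le measurable_const (Complex.measurable_re.comp (measurable_const_mul c)))
  have hZf : volume Z ≠ ∞ := by
    refine measure_ne_top_of_subset (show Z ⊆ Metric.closedBall (0 : ℂ) R from fun z hz => ?_)
      measure_closedBall_lt_top.ne
    rw [mem_closedBall_zero_iff]; exact hz.1
  rcases hs with hfree | ⟨hs0, hs1, hmov⟩
  · have := hfree.mul_const (volume.real Z)
    rw [zero_mul] at this
    refine squeeze_zero (fun _ => measureReal_nonneg) (fun n => ?_) this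
    refine prod_measureReal_le hZf ?_
    rintro ⟨u, z⟩ ⟨hz, hlt⟩
    refine ⟨fun hall => ?_, hz⟩
    dsimp only at hlt hz
    have h0 := hall z
    rw [run_fst, h0, zero_mul, sub_zero, norm_mul] at hlt
    have h1 : ‖pre h u s z‖ = ‖(pre h u s z).1‖ := by
      rw [Prod.norm_def, h0, norm_zero, max_eq_left (norm_nonneg _)]
    rw [h1, mul_assoc] at hlt
    have h2 : Real.exp (-(η * n)) ≤ 1 := Real.exp_le_one_iff.2 (by
      have : (0 : ℝ) ≤ n := by positivity
      have := mul_nonneg hη.le this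
      linarith)
    have h3 : 0 ≤ ‖(pre h u s z).1‖ * ‖contP z (blk h u s t)‖ := by positivity
    nlinarith
  obtain ⟨ρ, hρ, hρ1, hCρ⟩ := exists_small_radius hC
  have hWm : ∀ n, MeasurableSet {p : (Fin n → ℝ) × ℂ | p.2 ∈ Z ∧
      ‖(run p.2 (pre h p.1 s p.2) (blk h p.1 s t)).1‖ <
      Real.exp (-(η * n)) * ‖pre h p.1 s p.2‖ * ‖contP p.2 (blk h p.1 s t)‖} := by
    intro n
    have h1 : MeasurableSet {p : (Fin n → ℝ) × ℂ |
        ‖(run p.2 (pre h p.1 s p.2) (blk h p.1 s t)).1‖ <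
        Real.exp (-(η * n)) * ‖pre h p.1 s p.2‖ * ‖contP p.2 (blk h p.1 s t)‖} :=
      measurableSet_lt (measurable_run_blk hh n s t).fst.norm
        ((measurable_const.mul (measurable_pre hh n s).norm).mul
          (measurable_contP_blk hh n s t).norm)
    exact (measurable_snd hZm).inter h1
  rw [Metric.tendsto_atTop']
  intro δ hδ
  set V := volume.real Z with hV
  have hV0 : 0 ≤ V := measureReal_nonneg
  set x := δ / (4 * (V + 1)) with hx
  have hx0 : 0 < x := by positivity
  set α := x * (δ / 4) with hα
  have hα0 : 0 < α := by positivity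
  obtain ⟨ν, hν, B, hclose⟩ := exists_weylInf_close (R := R) (τ := τ) hC hκ hκ2 hρ hρ1 hCρ hα0
  have hev := eventually_measureReal_le_of_separated (W := fun n => {p : (Fin n → ℝ) × ℂ |
      p.2 ∈ Z ∧ ‖(run p.2 (pre h p.1 s p.2) (blk h p.1 s t)).1‖ <
        Real.exp (-(η * n)) * ‖pre h p.1 s p.2‖ * ‖contP p.2 (blk h p.1 s t)‖})
    hh (ρ := ρ / 4) (η := ν * (η / 2) / 2) hC hhC (by positivity) (by linarith) (by linarith)
    hs0 hs1 hst hmov (by positivity) hZm hZf ?_ (fun n p hp => hp.1) hα0.le hx0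
    (show 0 < δ / 4 by positivity) ?_
  · obtain ⟨N, hN⟩ := eventually_atTop.1 hev
    refine ⟨N, fun n hn => ?_⟩
    rw [Real.dist_0_eq_abs, abs_of_nonneg measureReal_nonneg]
    refine (hN n hn.le).trans_lt ?_
    have h1 : x * V ≤ δ / 4 := by
      rw [hx, div_mul_eq_mul_div, div_le_div_iff₀ (by positivity) (by positivity)]
      nlinarith
    have h2 : α / x = δ / 4 := by rw [hα]; field_simp
    rw [h2]; linarith
  · exact hWm
  · have hl1 : ∀ᶠ n : ℕ in atTop, 4 / κ * Real.exp (-(η / 2 * n)) ≤ 1 ∧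
        4 * Real.exp (B - ν * (η / 2) / 2 * n) ≤ 1 ∧ Real.exp (-(η * n)) ≤ 1 / 2 := by
      have e1 : ∀ b : ℝ, 0 < b → Tendsto (fun n : ℕ => Real.exp (-(b * n))) atTop (𝓝 0) := by
        intro b hb
        exact Real.tendsto_exp_neg_atTop_nhds_zero.comp
          (tendsto_natCast_atTop_atTop.const_mul_atTop hb)
      have e2 := (e1 (η / 2) (by positivity)).const_mul (4 / κ)
      have e3 := (e1 (ν * (η / 2) / 2) (by positivity)).const_mul (4 * Real.exp B)
      have e4 := e1 η hη
      rw [mul_zero] at e2 e3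
      filter_upwards [e2.eventually_le_const one_pos, e3.eventually_le_const one_pos,
        e4.eventually_le_const one_half_pos] with n h2 h3 h4
      refine ⟨h2, ?_, h4⟩
      rw [sub_eq_add_neg, Real.exp_add, ← mul_assoc]; exact h3
    filter_upwards [hl1] with n hn u u' hpre _ _ ζ hζ hlt
    obtain ⟨hn1, hn2, hn3⟩ := hn
    by_contra hcon
    push Not at hcon
    set E := {z | (u, z) ∈ {p : (Fin n → ℝ) × ℂ | p.2 ∈ Z ∧
        ‖(run p.2 (pre h p.1 s p.2) (blk h p.1 s t)).1‖ <
        Real.exp (-(η * n)) * ‖pre h p.1 s p.2‖ * ‖contP p.2 (blk h p.1 s t)‖}} ∩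
      {z | (u', z) ∈ {p : (Fin n → ℝ) × ℂ | p.2 ∈ Z ∧
        ‖(run p.2 (pre h p.1 s p.2) (blk h p.1 s t)).1‖ <
        Real.exp (-(η * n)) * ‖pre h p.1 s p.2‖ * ‖contP p.2 (blk h p.1 s t)‖}} with hE
    have hEm : MeasurableSet E :=
      (measurable_prodMk_left (hWm n)).inter (measurable_prodMk_left (hWm n))
    have hlist : ∀ u : Fin n → ℝ, ∀ z, τ ≤ (c * z).re → ∀ y ∈ blk h u s t, HalfPlane c a κ z y := by
      intro u z hz y hy
      obtain ⟨x, hx, rfl⟩ := exists_of_mem_blk hy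
      exact hhp z hz x hx
    have hfin := hclose c a (blk h u s t) (blk h u' s t) E (η / 2 * n) hc ha
      (norm_le_of_mem_blk hhC) (norm_le_of_mem_blk hhC)
      (fun z hz => ⟨hlist u z hz, hlist u' z hz⟩) hEm (fun z hz => hz.1.1) ?_ (by positivity) ?_ ζ hζ
    · have h1 : 4 * Real.exp (B - ν * (η / 2 * n)) ≤ Real.exp (-(ν * (η / 2) / 2 * n)) := by
        have e : B - ν * (η / 2 * n) = (B - ν * (η / 2) / 2 * n) + -(ν * (η / 2) / 2 * n) := by ring
        rw [e, Real.exp_add, ← mul_assoc]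
        exact mul_le_of_le_one_left (Real.exp_pos _).le hn2
      linarith
    · rw [ENNReal.ofReal_le_iff_le_toReal
        (measure_ne_top_of_subset (fun z hz => hz.1.1) hZf)]
      exact hcon.le
    · rintro z ⟨⟨hz, h1⟩, ⟨_, h2⟩⟩
      dsimp only at h1 h2 hz
      rw [← hpre z] at h2
      have hzτ : τ ≤ (c * z).re := by linarith [hz.2]
      set v := pre h u s z with hv
      have key : ∀ l : List (ℂ × ℂ), (∀ y ∈ l, HalfPlane c a κ z y) →
          ‖(run z v l).1‖ < Real.exp (-(η * n)) * ‖v‖ * ‖contP z l‖ →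
          ‖v.1 - v.2 * weyl z l‖ ≤ Real.exp (-(η * n)) * ‖v‖ ∧ 0 < ‖v‖ := by
        intro l hl hlt
        obtain ⟨hP, hQ, -⟩ := HalfPlane.weyl_aux hc ha hκ l hl
        have hP0 : 0 < ‖contP z l‖ := norm_pos_iff.2 hP
        rw [run_fst, hQ] at hlt
        have e : v.1 * contP z l - v.2 * (weyl z l * contP z l) =
          (v.1 - v.2 * weyl z l) * contP z l := by ring
        rw [e, norm_mul] at hlt
        refine ⟨(lt_of_mul_lt_mul_right hlt hP0.le).le, ?_⟩
        by_contra h0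
        have : ‖v‖ = 0 := le_antisymm (not_lt.1 h0) (norm_nonneg _)
        rw [this, mul_zero, zero_mul] at hlt
        exact not_lt.2 (by positivity) hlt
      obtain ⟨k1, hv0⟩ := key _ (hlist u z hzτ) h1
      obtain ⟨k2, -⟩ := key _ (hlist u' z hzτ) h2
      have hm := HalfPlane.norm_weyl_le hc ha hκ _ (hlist u z hzτ)
      -- the second component is comparable to the whole vector
      have hv2 : κ / 2 * ‖v‖ ≤ ‖v.2‖ := by
        by_contra hsmall
        push Not at hsmall
        have h3 : ‖v.2‖ < ‖v‖ := by nlinarith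
        have h4 : ‖v.1‖ = ‖v‖ := by
          rw [Prod.norm_def] at h3 ⊢
          rcases le_total ‖v.1‖ ‖v.2‖ with h | h
          · rw [max_eq_right h] at h3; exact absurd h3 (lt_irrefl _)
          · rw [max_eq_left h]
        have h5 := norm_sub_norm_le v.1 (v.2 * weyl z (blk h u s t))
        rw [norm_mul, h4] at h5
        have h6 : ‖v.2‖ * ‖weyl z (blk h u s t)‖ < κ / 2 * ‖v‖ * κ⁻¹ :=
          lt_of_le_of_lt (mul_le_mul_of_nonneg_left hm (norm_nonneg _))
            (mul_lt_mul_of_pos_right hsmall (by positivity))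
        have h7 : κ / 2 * ‖v‖ * κ⁻¹ = ‖v‖ / 2 := by field_simp
        have h8 : Real.exp (-(η * n)) * ‖v‖ ≤ 1 / 2 * ‖v‖ := by gcongr
        linarith
      have h9 : ‖v.2‖ * ‖weyl z (blk h u s t) - weyl z (blk h u' s t)‖ ≤
          2 * (Real.exp (-(η * n)) * ‖v‖) := by
        rw [← norm_mul]
        have e : v.2 * (weyl z (blk h u s t) - weyl z (blk h u' s t)) =
          (v.1 - v.2 * weyl z (blk h u' s t)) - (v.1 - v.2 * weyl z (blk h u s t)) := by ring
        rw [e]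
        refine (norm_sub_le _ _).trans ?_
        linarith
      have h10 : κ / 2 * ‖v‖ * ‖weyl z (blk h u s t) - weyl z (blk h u' s t)‖ ≤
          2 * (Real.exp (-(η * n)) * ‖v‖) :=
        (mul_le_mul_of_nonneg_right hv2 (norm_nonneg _)).trans h9
      have h11 : ‖weyl z (blk h u s t) - weyl z (blk h u' s t)‖ ≤
          4 / κ * Real.exp (-(η * n)) := by
        refine le_of_mul_le_mul_left ?_ (show 0 < κ / 2 * ‖v‖ by positivity)
        refine h10.trans (le_of_eq ?_)
        field_simp; norm_num
      refine h11.trans ?_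
      have e : -(η * n) = -(η / 2 * n) + -(η / 2 * n) := by ring
      rw [e, Real.exp_add, ← mul_assoc]
      exact mul_le_of_le_one_left (Real.exp_pos _).le hn1

end blocks


/-! ### A bound for blocks without hyperbolicity -/

theorem contP_near_infinity {C ρ : ℝ} {ζ : ℂ} (hC : 0 ≤ C) (hρ : ρ ≤ 1 / 4) (hCρ : C * ρ ≤ 1 / 8)
    (hζ0 : ζ ≠ 0) (hζ : ‖ζ‖ ≤ ρ) (l : List (ℂ × ℂ)) (hl : ∀ y ∈ l, ‖y‖ ≤ C) :
    1 ≤ ‖contP ζ⁻¹ l‖ ∧ contQ ζ⁻¹ l = ζ * weylInf ζ l * contP ζ⁻¹ l := by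
  induction l with
  | nil => simp
  | cons y l ih =>
    have hl' : ∀ y ∈ l, ‖y‖ ≤ C := fun y hy => hl y (by simp [hy])
    obtain ⟨h1, h2⟩ := ih hl'
    have h3 := (weylInf_bounds hC (by linarith) hCρ hζ l hl').2 y (hl y (by simp))
    set D := 1 - y.1 * ζ - y.2 * ζ ^ 2 * weylInf ζ l with hD
    have h4 : 1 / 2 ≤ ‖D‖ := by
      have := norm_sub_norm_le (1 : ℂ) (1 - D)
      rw [sub_sub_cancel, norm_one, norm_sub_rev] at this
      linarith
    have hD0 : D ≠ 0 := by rw [← norm_pos_iff]; linarith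
    have e : contP ζ⁻¹ (y :: l) = ζ⁻¹ * D * contP ζ⁻¹ l := by
      rw [contP_cons, h2, hD]; field_simp
    constructor
    · rw [e, norm_mul, norm_mul, norm_inv]
      have h5 : 4 ≤ ‖ζ‖⁻¹ := by
        rw [le_inv_comm₀ (by norm_num) (norm_pos_iff.2 hζ0)]; linarith
      have h6 : 2 ≤ ‖ζ‖⁻¹ * ‖D‖ := by nlinarith
      nlinarith
    · rw [contQ_cons, e, weylInf_cons, ← hD]
      field_simp

/-- If the same vector is almost annihilated by two blocks, then the cross product of their
continuants is small. -/
theorem norm_cross_le {z : ℂ} {v : ℂ × ℂ} {l l' : List (ℂ × ℂ)} {e M : ℝ}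
    (hl : ‖(run z v l).1‖ < e * ‖v‖) (hl' : ‖(run z v l').1‖ < e * ‖v‖)
    (hP : ‖contP z l‖ ≤ M) (hP' : ‖contP z l'‖ ≤ M) (hQ : ‖contQ z l‖ ≤ M)
    (hQ' : ‖contQ z l'‖ ≤ M) :
    ‖contP z l * contQ z l' - contP z l' * contQ z l‖ ≤ 2 * M * e := by
  set Δ := contP z l * contQ z l' - contP z l' * contQ z l with hΔ
  have hv : 0 < ‖v‖ := by
    by_contra h0
    have : ‖v‖ = 0 := le_antisymm (not_lt.1 h0) (norm_nonneg _)
    rw [this, mul_zero] at hl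
    exact not_lt.2 (norm_nonneg _) hl
  have e1 : v.1 * Δ = contQ z l' * (run z v l).1 - contQ z l * (run z v l').1 := by
    rw [run_fst, run_fst, hΔ]; ring
  have e2 : v.2 * Δ = contP z l' * (run z v l).1 - contP z l * (run z v l').1 := by
    rw [run_fst, run_fst, hΔ]; ring
  have hM : 0 ≤ M := (norm_nonneg _).trans hP
  have key : ∀ a b : ℂ, ‖a‖ ≤ M → ‖b‖ ≤ M →
      ‖a * (run z v l).1 - b * (run z v l').1‖ ≤ 2 * M * e * ‖v‖ := by
    intro a b ha hb
    refine (norm_sub_le _ _).trans ?_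
    rw [norm_mul, norm_mul]
    have h1 := mul_le_mul ha hl.le (norm_nonneg _) hM
    have h2 := mul_le_mul hb hl'.le (norm_nonneg _) hM
    linarith
  have h1 := key _ _ hQ' hQ
  have h2 := key _ _ hP' hP
  rw [← e1, norm_mul] at h1
  rw [← e2, norm_mul] at h2
  refine le_of_mul_le_mul_left ?_ hv
  have : ‖v‖ * ‖Δ‖ ≤ 2 * M * e * ‖v‖ := by
    rw [Prod.norm_def (x := v), max_mul_of_nonneg _ _ (norm_nonneg _)]
    exact max_le h1 h2
  linarith

theorem prod_measureReal_le_of_section {n : ℕ} {W : Set ((Fin n → ℝ) × ℂ)} (hW : MeasurableSet W)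
    {c : ℝ} (hc : 0 ≤ c) (h : ∀ u, volume {z | (u, z) ∈ W} ≤ ENNReal.ofReal c) :
    ((unifPi n).prod volume).real W ≤ c := by
  rw [measureReal_def, Measure.prod_apply hW]
  refine ENNReal.toReal_le_of_le_ofReal hc ?_
  refine (lintegral_mono h).trans ?_
  rw [lintegral_const, measure_univ, mul_one]

theorem le_half_add_div {m x y w : ℝ} (hx : 0 < x) (hm : 0 ≤ m) (hy : m ≤ y) (hw : m ≤ w) :
    m ≤ (x * y + w / x) / 2 := by
  have h1 : x * m + m / x ≤ x * y + w / x := by gcongr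
  have h2 : 2 * m ≤ x * m + m / x := by
    have : 0 ≤ m * (x - 1) ^ 2 / x := by positivity
    have e : m * (x - 1) ^ 2 / x = x * m + m / x - 2 * m := by field_simp; ring
    linarith
  linarith

/-- Without hyperbolicity, the probability that a block shrinks the transfer vector by a factor
`e^{-K ε n}`, where `ε` is the length of the block, decays exponentially in `K`. -/
theorem exists_crude_bound {C : ℝ} (R : ℝ) (hC : 0 ≤ C) : ∃ C₀ : ℝ, 0 < C₀ ∧
    ∀ (h : ℝ → ℂ × ℂ) (s t : ℝ) (Z : Set ℂ) (K x δ : ℝ), Continuous h → (∀ x, ‖h x‖ ≤ C) → s < t →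
      Admissible h s → 0 < unif.real (Set.Ico s t) → MeasurableSet Z →
      Z ⊆ Metric.closedBall 0 R → 0 ≤ K → 0 < x → 0 < δ →
      ∀ᶠ n : ℕ in atTop, ((unifPi n).prod volume).real {p | p.2 ∈ Z ∧
        ‖(run p.2 (pre h p.1 s p.2) (blk h p.1 s t)).1‖ <
          Real.exp (-(K * unif.real (Set.Ico s t) * n)) * ‖pre h p.1 s p.2‖} ≤
        (x * volume.real Z + C₀ * Real.exp (-K / 8) / x) / 2 + δ := by
  obtain ⟨ρ', hρ', hρ'1, hCρ'⟩ := exists_small_radius hC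
  set ρ := ρ' / 4 with hρdef
  have hρ : 0 < ρ := by positivity
  have hρ4 : ρ ≤ 1 / 4 := by linarith
  have hCρ : C * ρ ≤ 1 / 8 := by
    have : C * ρ' = 4 * (C * ρ) := by rw [hρdef]; ring
    have : 0 ≤ C * ρ := by positivity
    linarith
  set R₁ := max R ρ⁻¹ with hR₁
  obtain ⟨C₁, hC₁, hremez⟩ := exists_volume_polynomial_small_le R₁
  set M := R₁ + C + 1 with hM
  have hR₁0 : 0 < R₁ := (inv_pos.2 hρ).trans_le (le_max_right _ _)
  have hM1 : 1 ≤ M := by linarith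
  have hlogM : 0 ≤ Real.log M := Real.log_nonneg hM1
  set K₀ := 8 * Real.log M + 1 with hK₀
  set V₀ := volume.real (Metric.closedBall (0 : ℂ) R) with hV₀
  have hV₀0 : 0 ≤ V₀ := measureReal_nonneg
  refine ⟨C₁ + V₀ * Real.exp (K₀ / 8), by positivity, ?_⟩
  intro h s t Z K x δ hh hhC hst hs hε hZ hZR hK hx hδ
  set ε := unif.real (Set.Ico s t) with hεdef
  have hZf : volume Z ≠ ∞ := measure_ne_top_of_subset hZR measure_closedBall_lt_top.ne
  set V := volume.real Z with hV
  have hV0 : 0 ≤ V := measureReal_nonneg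
  have hVV₀ : V ≤ V₀ := measureReal_mono hZR measure_closedBall_lt_top.ne
  set W : (n : ℕ) → Set ((Fin n → ℝ) × ℂ) := fun n => {p | p.2 ∈ Z ∧
        ‖(run p.2 (pre h p.1 s p.2) (blk h p.1 s t)).1‖ <
          Real.exp (-(K * ε * n)) * ‖pre h p.1 s p.2‖} with hWdef
  have hWm : ∀ n, MeasurableSet (W n) := by
    intro n
    have h1 : MeasurableSet {p : (Fin n → ℝ) × ℂ |
        ‖(run p.2 (pre h p.1 s p.2) (blk h p.1 s t)).1‖ <
        Real.exp (-(K * ε * n)) * ‖pre h p.1 s p.2‖} :=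
      measurableSet_lt (measurable_run_blk hh n s t).fst.norm
        (measurable_const.mul (measurable_pre hh n s).norm)
    exact (measurable_snd hZ).inter h1
  -- for small `K` the claim is trivial
  rcases lt_or_ge K K₀ with hKK | hKK
  · refine Eventually.of_forall fun n => ?_
    have h1 : ((unifPi n).prod volume).real (W n) ≤ V := by
      have := prod_measureReal_le (W := W n) (E := Set.univ) hZf fun p hp => ⟨Set.mem_univ _, hp.1⟩
      simpa using this
    have h2 : V ≤ (x * V + (C₁ + V₀ * Real.exp (K₀ / 8)) * Real.exp (-K / 8) / x) / 2 := by
      refine le_half_add_div hx hV0 le_rfl (hVV₀.trans ?_)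
      have h3 : 1 ≤ Real.exp (K₀ / 8) * Real.exp (-K / 8) := by
        rw [← Real.exp_add]; apply Real.one_le_exp; linarith
      have h4 : 0 ≤ C₁ * Real.exp (-K / 8) := by positivity
      nlinarith
    linarith
  have hK0 : 0 < K := by linarith
  have hC₁le : C₁ * Real.exp (-K / 8) ≤ (C₁ + V₀ * Real.exp (K₀ / 8)) * Real.exp (-K / 8) := by
    gcongr
    have : 0 ≤ V₀ * Real.exp (K₀ / 8) := by positivity
    linarith
  have hζ : ‖(ρ : ℂ)‖ = ρ := by simp [abs_of_pos hρ]
  rcases hs with hfree | ⟨hs0, hs1, hmov⟩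
  · have hcnt := tendsto_lt_count (J := Set.Ico s t) measurableSet_Ico
      (show unif.real (Set.Ico s t) < 2 * ε by rw [← hεdef]; linarith)
    have hsum := (hfree.add hcnt).mul_const V
    rw [add_zero, zero_mul] at hsum
    filter_upwards [hsum.eventually_le_const hδ, eventually_gt_atTop 0] with n hn hn0
    have hn0' : (0 : ℝ) < n := by exact_mod_cast hn0
    set E := {u : Fin n → ℝ | ¬ ∀ z, (pre h u s z).2 = 0} ∪
      {u | 2 * ε * n < (count u (Set.Ico s t) : ℝ)} with hE
    -- outside the exceptional event the block polynomial itself is small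
    have hpoly : ∀ u : Fin n → ℝ, u ∉ E → {z | (u, z) ∈ W n} ⊆ {z ∈ Metric.closedBall (0 : ℂ) R₁ |
        ‖(contPoly (blk h u s t)).1.eval z‖ ≤
          Real.exp (-(K * ε * n)) * ‖(contPoly (blk h u s t)).1.eval (ρ : ℂ)⁻¹‖} := by
      rintro u hu z ⟨hz, hlt⟩
      dsimp only at hz hlt
      simp only [hE, Set.mem_union, Set.mem_ofPred_eq, not_or, not_not] at hu
      have h0 := hu.1 z
      have h1 : ‖pre h u s z‖ = ‖(pre h u s z).1‖ := by
        rw [Prod.norm_def, h0, norm_zero, max_eq_left (norm_nonneg _)]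
      rw [run_fst, h0, zero_mul, sub_zero, norm_mul, h1, mul_comm] at hlt
      refine ⟨Metric.closedBall_subset_closedBall (le_max_left _ _) (hZR hz), ?_⟩
      have h2 := lt_of_mul_lt_mul_right hlt (norm_nonneg _)
      have h3 := (contP_near_infinity hC hρ4 hCρ (by exact_mod_cast hρ.ne') hζ.le
        (blk h u s t) (norm_le_of_mem_blk hhC)).1
      refine h2.le.trans ?_
      exact le_mul_of_one_le_right (Real.exp_pos _).le h3
    have hsec : ∀ u : Fin n → ℝ, u ∉ E → volume {z | (u, z) ∈ W n} ≤
        ENNReal.ofReal (C₁ * Real.exp (-K / 8)) := by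
      intro u hu
      refine (measure_mono (hpoly u hu)).trans ?_
      have hu' := hu
      simp only [hE, Set.mem_union, Set.mem_ofPred_eq, not_or, not_not, not_lt] at hu'
      have h3 := (contP_near_infinity hC hρ4 hCρ (by exact_mod_cast hρ.ne') hζ.le
        (blk h u s t) (norm_le_of_mem_blk hhC)).1
      refine (hremez (contPoly (blk h u s t)).1 (2 * ε * n) (K * ε * n) (ρ : ℂ)⁻¹ ?_ (by positivity)
        (by positivity) ?_ ?_).trans ?_
      · have h4 := (natDegree_contPoly (blk h u s t)).1
        rw [length_blk] at h4
        exact le_trans (by exact_mod_cast h4) hu'.2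
      · rw [norm_inv, hζ]; exact le_max_right _ _
      · intro h0
        rw [contP, h0, norm_zero] at h3
        linarith
      · apply ENNReal.ofReal_le_ofReal
        refine mul_le_mul_of_nonneg_left (Real.exp_le_exp.2 ?_) hC₁.le
        have e : -(K * ε * n) / (2 * ε * n) = -K / 2 := by field_simp
        rw [e]; linarith
    set F := {u : Fin n → ℝ | ENNReal.ofReal (C₁ * Real.exp (-K / 8)) <
      volume {z | (u, z) ∈ W n}} with hF
    have hFm : MeasurableSet F :=
      measurableSet_lt measurable_const (measurable_measure_prodMk_left (hWm n))
    have hFE : F ⊆ E := fun u hu => by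
      by_contra hcon
      exact not_lt.2 (hsec u hcon) hu
    have h1 : ((unifPi n).prod volume).real (W n ∩ F ×ˢ Set.univ) ≤ δ := by
      refine (prod_measureReal_le (E := E) hZf fun p hp => ⟨hFE hp.2.1, hp.1.1⟩).trans
        (le_trans ?_ hn)
      exact mul_le_mul_of_nonneg_right (measureReal_union_le _ _) hV0
    have h2 : ((unifPi n).prod volume).real (W n ∩ Fᶜ ×ˢ Set.univ) ≤ C₁ * Real.exp (-K / 8) := by
      refine prod_measureReal_le_of_section ((hWm n).inter (hFm.compl.prod .univ)) (by positivity)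
        fun u => ?_
      by_cases hu : u ∈ F
      · have : {z | (u, z) ∈ W n ∩ Fᶜ ×ˢ (Set.univ : Set ℂ)} = ∅ := by
          ext z; simp [hu]
        rw [this, measure_empty]; exact zero_le
      · refine (measure_mono fun z hz => ?_).trans (not_lt.1 hu)
        exact hz.1
    have h3 : ((unifPi n).prod volume).real (W n ∩ Fᶜ ×ˢ Set.univ) ≤ V := by
      have := prod_measureReal_le (W := W n ∩ Fᶜ ×ˢ Set.univ) (E := Set.univ) hZf
        fun p hp => ⟨Set.mem_univ _, hp.1.1⟩
      simpa using this
    have h4 := le_half_add_div hx measureReal_nonneg h3 (h2.trans hC₁le)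
    have h5 : W n = (W n ∩ F ×ˢ Set.univ) ∪ (W n ∩ Fᶜ ×ˢ Set.univ) := by
      rw [← Set.inter_union_distrib_left, ← Set.union_prod, Set.union_compl_self,
        Set.univ_prod_univ, Set.inter_univ]
    change ((unifPi n).prod volume).real (W n) ≤ _
    rw [h5]
    refine (measureReal_union_le _ _).trans ?_
    linarith
  · have hmain := eventually_measureReal_le_of_separated (W := W) hh (ρ := ρ) (η := K * ε / 8) hC hhC
      hρ (by linarith) hCρ hs0 hs1 hst hmov (by positivity) hZ hZf hWm (fun n p hp => hp.1)
      (show 0 ≤ C₁ * Real.exp (-K / 8) by positivity) hx hδ ?_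
    · filter_upwards [hmain] with n hn
      refine hn.trans ?_
      have : C₁ * Real.exp (-K / 8) / x ≤
          (C₁ + V₀ * Real.exp (K₀ / 8)) * Real.exp (-K / 8) / x := by gcongr
      linarith
    have hlarge : ∀ᶠ n : ℕ in atTop, 2 * Real.exp (-(K * ε / 8 * n)) ≤ ρ := by
      have e1 : Tendsto (fun n : ℕ => Real.exp (-(K * ε / 8 * n))) atTop (𝓝 0) :=
        Real.tendsto_exp_neg_atTop_nhds_zero.comp
          (tendsto_natCast_atTop_atTop.const_mul_atTop (by positivity))
      have e2 := e1.const_mul 2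
      rw [mul_zero] at e2
      exact e2.eventually_le_const hρ
    filter_upwards [hlarge, eventually_gt_atTop 0] with n hn hn0 u u' hpre hcu hcu' ζ hζ' hlt
    have hn0' : (0 : ℝ) < n := by exact_mod_cast hn0
    set l := blk h u s t with hl
    set l' := blk h u' s t with hl'
    have hlC : ∀ y ∈ l, ‖y‖ ≤ C := norm_le_of_mem_blk hhC
    have hlC' : ∀ y ∈ l', ‖y‖ ≤ C := norm_le_of_mem_blk hhC
    have hζ0 : ζ ≠ 0 := by rw [← norm_pos_iff, hζ']; exact hρ
    obtain ⟨hP, hQ⟩ := contP_near_infinity hC hρ4 hCρ hζ0 hζ'.le l hlC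
    obtain ⟨hP', hQ'⟩ := contP_near_infinity hC hρ4 hCρ hζ0 hζ'.le l' hlC'
    set Δ : Polynomial ℂ := (contPoly l).1 * (contPoly l').2 - (contPoly l').1 * (contPoly l).2
      with hΔ
    have heval : ∀ z, Δ.eval z = contP z l * contQ z l' - contP z l' * contQ z l := by
      intro z; simp [hΔ, contP, contQ]
    have hlen : (l.length : ℝ) ≤ 2 * ε * n := by rw [hl, length_blk]; exact hcu
    have hlen' : (l'.length : ℝ) ≤ 2 * ε * n := by rw [hl', length_blk]; exact hcu'
    have hdeg : (Δ.natDegree : ℝ) ≤ 4 * ε * n := by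
      have h1 : Δ.natDegree ≤ l.length + l'.length := by
        refine (Polynomial.natDegree_sub_le _ _).trans (max_le ?_ ?_)
        · exact Polynomial.natDegree_mul_le_of_le (natDegree_contPoly l).1 (natDegree_contPoly l').2
        · rw [add_comm]
          exact Polynomial.natDegree_mul_le_of_le (natDegree_contPoly l').1 (natDegree_contPoly l).2
      have h2 : (Δ.natDegree : ℝ) ≤ l.length + l'.length := by exact_mod_cast h1
      linarith
    have hbig : ρ * Real.exp (-(K * ε / 8 * n)) ≤ ‖Δ.eval ζ⁻¹‖ := by
      have e : Δ.eval ζ⁻¹ = contP ζ⁻¹ l * contP ζ⁻¹ l' * ζ * (weylInf ζ l' - weylInf ζ l) := by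
        rw [heval, hQ, hQ']; ring
      rw [e, norm_mul, norm_mul, norm_mul, hζ', norm_sub_rev]
      have h1 : ρ ≤ ‖contP ζ⁻¹ l‖ * ‖contP ζ⁻¹ l'‖ * ρ := by
        have : 1 ≤ ‖contP ζ⁻¹ l‖ * ‖contP ζ⁻¹ l'‖ := by nlinarith
        nlinarith
      exact mul_le_mul h1 hlt.le (Real.exp_pos _).le (by positivity)
    have hsub : {z | (u, z) ∈ W n} ∩ {z | (u', z) ∈ W n} ⊆ {z ∈ Metric.closedBall (0 : ℂ) R₁ |
        ‖Δ.eval z‖ ≤ Real.exp (-(K * ε / 2 * n)) * ‖Δ.eval ζ⁻¹‖} := by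
      rintro z ⟨⟨hz, h1⟩, ⟨_, h2⟩⟩
      dsimp only at hz h1 h2
      rw [← hpre z] at h2
      have hzR : z ∈ Metric.closedBall (0 : ℂ) R₁ :=
        Metric.closedBall_subset_closedBall (le_max_left _ _) (hZR hz)
      refine ⟨hzR, ?_⟩
      rw [mem_closedBall_zero_iff] at hzR
      have hpow : ∀ k : ℕ, (k : ℝ) ≤ 2 * ε * n → M ^ k ≤ Real.exp (K * ε / 4 * n) := by
        intro k hk
        rw [← Real.exp_log (pow_pos (by linarith : 0 < M) k), Real.exp_le_exp, Real.log_pow]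
        calc (k : ℝ) * Real.log M ≤ 2 * ε * n * Real.log M := by gcongr
          _ ≤ 2 * ε * n * (K / 8) := by gcongr; linarith
          _ = _ := by ring
      have h3 := norm_cross_le h1 h2
        ((norm_contP_le hzR le_rfl l hlC).trans (hpow _ hlen))
        ((norm_contP_le hzR le_rfl l' hlC').trans (hpow _ hlen'))
        ((norm_contQ_le hzR le_rfl l hlC).trans (hpow _ hlen))
        ((norm_contQ_le hzR le_rfl l' hlC').trans (hpow _ hlen'))
      rw [heval]
      refine h3.trans ?_
      calc 2 * Real.exp (K * ε / 4 * n) * Real.exp (-(K * ε * n))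
          = 2 * Real.exp (-(K * ε / 8 * n)) *
            (Real.exp (-(K * ε / 2 * n)) * Real.exp (-(K * ε / 8 * n))) := by
            rw [mul_assoc 2, mul_assoc 2, ← Real.exp_add, ← Real.exp_add, ← Real.exp_add]
            ring_nf
        _ ≤ ρ * (Real.exp (-(K * ε / 2 * n)) * Real.exp (-(K * ε / 8 * n))) := by gcongr
        _ = Real.exp (-(K * ε / 2 * n)) * (ρ * Real.exp (-(K * ε / 8 * n))) := by ring
        _ ≤ _ := by gcongr
    have hfinal := (measure_mono hsub).trans (hremez Δ (4 * ε * n) (K * ε / 2 * n) ζ⁻¹ hdeg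
      (by positivity) (by positivity) (by rw [norm_inv, hζ']; exact le_max_right _ _) (by
        rw [← norm_pos_iff]; exact lt_of_lt_of_le (by positivity) hbig))
    have e : -(K * ε / 2 * n) / (4 * ε * n) = -K / 8 := by field_simp; norm_num
    rw [e] at hfinal
    exact ENNReal.toReal_le_of_le_ofReal (by positivity) hfinal


/-! ### Partitions into blocks with admissible left endpoints -/

/-- An open interval without admissible points is one on which the parameters are constant. -/
theorem exists_admissible_or_eq {h : ℝ → ℂ × ℂ} (hh : Continuous h) {a b : ℝ} (ha : 0 ≤ a)
    (hab : a < b) (hb : b ≤ 1) :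
    (∃ s ∈ Set.Ioo a b, Admissible h s) ∨ ∀ x ∈ Set.Icc a b, h x = h a := by
  by_contra hcon
  push Not at hcon
  obtain ⟨hno, x₁, hx₁, hne⟩ := hcon
  -- `c d ≠ 0` at points arbitrarily close to the left of any interior point
  have hdense : ∀ x ∈ Set.Ioo a b, ∃ y ∈ Set.Ioo a x, (h y).2 ≠ 0 := by
    intro x hx
    by_contra hall
    push Not at hall
    refine hno x hx (Or.inl (leftFree_of_vanishing (δ := (x - a) / 2) (by linarith [hx.1])
      (by linarith [hx.1]) (by linarith [hx.2]) fun y hy => hall y ⟨?_, hy.2⟩))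
    linarith [hy.1, hx.1]
  -- to the right of such a point the parameters are constant
  have hconst : ∀ x ∈ Set.Ioo a b, (h x).2 ≠ 0 → ∀ y ∈ Set.Icc x b, h y = h x := by
    intro x hx hγ
    have hcl : IsClosed ({y | h y = h x} ∩ Set.Icc x b) :=
      (isClosed_eq hh continuous_const).inter isClosed_Icc
    refine hcl.Icc_subset_of_forall_mem_nhdsWithin rfl ?_
    rintro y ⟨hy, hy1, hy2⟩
    rw [Set.mem_ofPred_eq] at hy
    have hyab : y ∈ Set.Ioo a b := ⟨hx.1.trans_le hy1, hy2⟩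
    have hnm : ¬ Moving h y := fun hm =>
      hno y hyab (Or.inr ⟨ha.trans hyab.1.le, hyab.2.trans_le hb, hm⟩)
    rw [Moving, not_and] at hnm
    have := hnm (by rw [hy]; exact hγ)
    push Not at this
    obtain ⟨δ, hδ, hall⟩ := this
    refine Filter.mem_of_superset (Ioo_mem_nhdsGT (show y < y + δ by linarith)) fun w hw => ?_
    exact (hall w hw).trans hy
  have hIoo : ∀ x ∈ Set.Ioo a b, h x = h b := by
    intro x hx
    obtain ⟨y, hy, hγ⟩ := hdense x hx
    have hyab : y ∈ Set.Ioo a b := ⟨hy.1, hy.2.trans hx.2⟩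
    rw [hconst y hyab hγ x ⟨hy.2.le, hx.2.le⟩, hconst y hyab hγ b ⟨hyab.2.le, le_rfl⟩]
  have hcl : Set.EqOn h (fun _ => h b) (closure (Set.Ioo a b)) :=
    Set.EqOn.closure hIoo hh continuous_const
  rw [closure_Ioo hab.ne] at hcl
  exact hne ((hcl hx₁).trans (hcl ⟨le_rfl, hab.le⟩).symm)

/-- A partition of `[0, 2)` into blocks with admissible left endpoints in `[0, 1)` and small
oscillation of the parameters. The right endpoint `2` is a convenient point beyond all samples. -/
theorem exists_partition {h : ℝ → ℂ × ℂ} (hh : Continuous h)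
    (hh1 : ∀ x, 1 ≤ x → h x = h 1) {δ : ℝ} (hδ : 0 < δ) :
    ∃ (r : ℕ) (p : ℕ → ℝ), p 0 = 0 ∧ p r = 2 ∧ ∀ i < r, p i < p (i + 1) ∧ 0 ≤ p i ∧ p i < 1 ∧
      Admissible h (p i) ∧ ∀ x ∈ Set.Ico (p i) (p (i + 1)), ‖h x - h (p i)‖ ≤ δ := by
  have huc : ∃ Q : ℕ, 0 < Q ∧ ∀ x ∈ Set.Icc (0 : ℝ) 1, ∀ y ∈ Set.Icc (0 : ℝ) 1,
      |x - y| ≤ 1 / Q → ‖h x - h y‖ ≤ δ / 2 := by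
    have := isCompact_Icc.uniformContinuousOn_of_continuous (hh.continuousOn (s := Set.Icc 0 1))
    obtain ⟨e, he, hall⟩ := Metric.uniformContinuousOn_iff.1 this (δ / 2) (half_pos hδ)
    obtain ⟨Q, hQ⟩ := exists_nat_one_div_lt he
    refine ⟨Q + 1, Nat.succ_pos _, fun x hx y hy hxy => ?_⟩
    rw [← dist_eq_norm]
    refine (hall x hx y hy ?_).le
    rw [Real.dist_eq]
    push_cast at hxy
    linarith
  obtain ⟨Q, hQ, hosc⟩ := huc
  have hQ' : (0 : ℝ) < Q := by exact_mod_cast hQ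
  have step : ∀ j ≤ Q, ∃ (r : ℕ) (p : ℕ → ℝ), p 0 = 0 ∧ p r ≤ j / Q ∧
      (∀ i < r, p i < p (i + 1) ∧ ∀ x ∈ Set.Ico (p i) (p (i + 1)), ‖h x - h (p i)‖ ≤ δ) ∧
      (∀ i ≤ r, 0 ≤ p i ∧ p i < 1 ∧ Admissible h (p i)) ∧
      ∀ x ∈ Set.Icc (p r) (j / Q), ‖h x - h (p r)‖ ≤ δ / 2 := by
    intro j
    induction j with
    | zero =>
      intro _
      refine ⟨0, fun _ => 0, rfl, by simp, fun i hi => absurd hi (Nat.not_lt_zero _),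
        fun i _ => ⟨le_rfl, one_pos, Or.inl leftFree_zero⟩, fun x hx => ?_⟩
      simp only [CharP.cast_eq_zero, zero_div, Set.Icc_self, Set.mem_singleton_iff] at hx
      rw [hx, sub_self, norm_zero]; positivity
    | succ j ih =>
      intro hj
      obtain ⟨r, p, hp0, hpr, hblock, hadm, hlast⟩ := ih (by omega)
      have hj0 : (0 : ℝ) ≤ j / Q := by positivity
      have hjj : (j : ℝ) / Q < (j + 1 : ℕ) / Q := by
        rw [div_lt_div_iff_of_pos_right hQ']; push_cast; linarith
      have hj1 : ((j + 1 : ℕ) : ℝ) / Q ≤ 1 := by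
        rw [div_le_one hQ']; exact_mod_cast hj
      have hwidth : ((j + 1 : ℕ) : ℝ) / Q - j / Q = 1 / Q := by
        rw [← sub_div]; push_cast; ring
      rcases exists_admissible_or_eq hh hj0 hjj hj1 with ⟨s, hs, hsadm⟩ | hconst
      · refine ⟨r + 1, fun i => if i ≤ r then p i else s, by simp [hp0], (if_neg (by omega)).trans_le hs.2.le,
          ?_, ?_, ?_⟩
        · intro i hi
          have hir : i ≤ r := by omega
          rcases hir.eq_or_lt with rfl | hlt
          · simp only [le_refl, if_true, Nat.not_succ_le_self, if_false]
            refine ⟨hpr.trans_lt hs.1, fun x hx => ?_⟩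
            rcases le_total x (j / Q) with hxj | hxj
            · exact (hlast x ⟨hx.1, hxj⟩).trans (by linarith)
            · have h1 := hosc x ⟨hj0.trans hxj, by linarith [hx.2, hs.2]⟩ (j / Q)
                ⟨hj0, by linarith⟩ (by
                  rw [abs_of_nonneg (by linarith)]; linarith [hx.2, hs.2])
              have h2 := hlast (j / Q) ⟨hpr, le_rfl⟩
              have e : h x - h (p i) = (h x - h (j / Q)) + (h (j / Q) - h (p i)) := by abel
              rw [e]
              exact (norm_add_le _ _).trans (by linarith)
          · have h1 : i + 1 ≤ r := hlt
            simp only [hir, h1, if_true]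
            exact hblock i hlt
        · intro i hi
          by_cases hir : i ≤ r
          · simp only [hir, if_true]; exact hadm i hir
          · simp only [hir, if_false]
            exact ⟨hj0.trans hs.1.le, hs.2.trans_le hj1, hsadm⟩
        · intro x hx
          simp only [Nat.not_succ_le_self, if_false] at hx ⊢
          refine hosc x ⟨by linarith [hx.1, hs.1], by linarith [hx.2]⟩ s
            ⟨by linarith [hs.1], by linarith [hs.2]⟩ ?_
          rw [abs_of_nonneg (by linarith [hx.1])]
          linarith [hx.2, hs.1]
      · refine ⟨r, p, hp0, by linarith, hblock, hadm, fun x hx => ?_⟩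
        rcases le_total x (j / Q) with hxj | hxj
        · exact hlast x ⟨hx.1, hxj⟩
        · rw [hconst x ⟨hxj, hx.2⟩]
          exact hlast _ ⟨hpr, le_rfl⟩
  obtain ⟨r, p, hp0, hpr, hblock, hadm, hlast⟩ := step Q le_rfl
  have hQQ : (Q : ℝ) / Q = 1 := div_self hQ'.ne'
  rw [hQQ] at hpr hlast
  refine ⟨r + 1, fun i => if i ≤ r then p i else 2, by simp [hp0], by simp, fun i hi => ?_⟩
  have hir : i ≤ r := by omega
  obtain ⟨h1, h2, h3⟩ := hadm i hir
  rcases hir.eq_or_lt with rfl | hlt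
  · simp only [le_refl, if_true, Nat.not_succ_le_self, if_false]
    refine ⟨by linarith, h1, h2, h3, fun x hx => ?_⟩
    rcases le_total x 1 with hx1 | hx1
    · exact (hlast x ⟨hx.1, hx1⟩).trans (by linarith)
    · rw [hh1 x hx1]
      exact (hlast 1 ⟨hpr, le_rfl⟩).trans (by linarith)
  · have h4 : i + 1 ≤ r := hlt
    simp only [hir, h4, if_true]
    exact ⟨(hblock i hlt).1, h1, h2, h3, (hblock i hlt).2⟩


/-! ### The logarithmic potential of the arcsine measure -/

theorem sq_log_le {t : ℝ} (ht : 0 ≤ t) : Real.log t ^ 2 ≤ 4 * (t + t⁻¹) := by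
  rcases ht.eq_or_lt with rfl | ht
  · simp
  have key : ∀ s : ℝ, 1 ≤ s → Real.log s ^ 2 ≤ 4 * s := by
    intro s hs
    have hs0 : (0 : ℝ) < s := by linarith
    have h1 : Real.log s = 2 * Real.log √s := by rw [Real.log_sqrt hs0.le]; ring
    have h2 : Real.log √s ≤ √s := (Real.log_le_sub_one_of_pos (Real.sqrt_pos.2 hs0)).trans (by linarith)
    have h3 : 0 ≤ Real.log √s := Real.log_nonneg (Real.one_le_sqrt.2 hs)
    have h4 := Real.sq_sqrt hs0.le
    rw [h1]
    nlinarith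
  rcases le_total 1 t with h | h
  · have := key t h
    have : 0 < t⁻¹ := by positivity
    linarith
  · have := key t⁻¹ (by rw [← inv_one]; gcongr)
    rw [Real.log_inv, neg_sq] at this
    linarith

/-- `log |z - ζ|` is uniformly integrable on bounded sets, uniformly in the pole. -/
theorem exists_lintegral_abs_log_le (R : ℝ) : ∃ C : ℝ, 0 < C ∧ ∀ ζ : ℂ, ‖ζ‖ ≤ R →
    ∀ S ⊆ Metric.closedBall (0 : ℂ) R, ∀ A : ℝ, 0 < A →
      ∫⁻ z in S, ENNReal.ofReal |Real.log ‖z - ζ‖| ≤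
        ENNReal.ofReal (A * volume.real S + C / A) := by
  obtain ⟨C₁, hC₁, hint⟩ := exists_lintegral_inv_norm_sub_le R
  have hVtop : volume (Metric.closedBall (0 : ℂ) R) ≠ ∞ := measure_closedBall_lt_top.ne
  set V := volume.real (Metric.closedBall (0 : ℂ) R)
  refine ⟨4 * (2 * |R| * V + C₁), by positivity, fun ζ hζ S hS A hA => ?_⟩
  have hSR : ∀ z ∈ Metric.closedBall (0 : ℂ) R, ‖z - ζ‖ ≤ 2 * |R| := fun z hz => by
    have := norm_sub_le z ζ
    have h2 : ‖z‖ ≤ R := mem_closedBall_zero_iff.1 hz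
    linarith [le_abs_self R]
  have hpt : ∀ z ∈ Metric.closedBall (0 : ℂ) R, ENNReal.ofReal |Real.log ‖z - ζ‖| ≤
      ENNReal.ofReal A + ENNReal.ofReal (4 / A) *
        (ENNReal.ofReal (2 * |R|) + ENNReal.ofReal ‖z - ζ‖⁻¹) := by
    intro z hz
    rw [← ENNReal.ofReal_add (by positivity) (by positivity),
      ← ENNReal.ofReal_mul (by positivity), ← ENNReal.ofReal_add hA.le (by positivity)]
    refine ENNReal.ofReal_le_ofReal ?_
    have h1 := sq_log_le (norm_nonneg (z - ζ))
    have h2 : |Real.log ‖z - ζ‖| ≤ A + Real.log ‖z - ζ‖ ^ 2 / A := by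
      have h3 : |Real.log ‖z - ζ‖| * A ≤ A * A + Real.log ‖z - ζ‖ ^ 2 := by
        rw [← sq_abs (Real.log _)]
        nlinarith [sq_nonneg (|Real.log ‖z - ζ‖| - A), abs_nonneg (Real.log ‖z - ζ‖)]
      rw [← sub_nonneg] at h3 ⊢
      have : A + Real.log ‖z - ζ‖ ^ 2 / A - |Real.log ‖z - ζ‖| =
        (A * A + Real.log ‖z - ζ‖ ^ 2 - |Real.log ‖z - ζ‖| * A) / A := by field_simp
      rw [this]; positivity
    have h4 : Real.log ‖z - ζ‖ ^ 2 / A ≤ 4 / A * (2 * |R| + ‖z - ζ‖⁻¹) := by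
      rw [div_mul_eq_mul_div]
      gcongr
      exact h1.trans (by gcongr; exact hSR z hz)
    linarith
  have hmeas : Measurable fun z : ℂ => ENNReal.ofReal ‖z - ζ‖⁻¹ := by fun_prop
  have hsub : (volume.restrict S : Measure ℂ) ≤ volume.restrict (Metric.closedBall (0 : ℂ) R) :=
    Measure.restrict_mono hS le_rfl
  have hStop : volume S ≠ ∞ := ((measure_mono hS).trans_lt measure_closedBall_lt_top).ne
  calc ∫⁻ z in S, ENNReal.ofReal |Real.log ‖z - ζ‖|
      ≤ ∫⁻ z in S, (ENNReal.ofReal A + ENNReal.ofReal (4 / A) *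
        (ENNReal.ofReal (2 * |R|) + ENNReal.ofReal ‖z - ζ‖⁻¹)) := by
        refine lintegral_mono_ae ?_
        refine Measure.absolutelyContinuous_of_le hsub ?_
        filter_upwards [ae_restrict_mem Metric.isClosed_closedBall.measurableSet] with z hz
        exact hpt z hz
    _ = ENNReal.ofReal A * volume S + ∫⁻ z in S, ENNReal.ofReal (4 / A) *
        (ENNReal.ofReal (2 * |R|) + ENNReal.ofReal ‖z - ζ‖⁻¹) := by
        rw [lintegral_add_left measurable_const, lintegral_const, Measure.restrict_apply_univ]
    _ ≤ ENNReal.ofReal A * volume S + ∫⁻ z in Metric.closedBall (0 : ℂ) R,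
        ENNReal.ofReal (4 / A) * (ENNReal.ofReal (2 * |R|) + ENNReal.ofReal ‖z - ζ‖⁻¹) := by
        gcongr
    _ = ENNReal.ofReal A * volume S + ENNReal.ofReal (4 / A) * (ENNReal.ofReal (2 * |R|) *
        volume (Metric.closedBall (0 : ℂ) R) + ∫⁻ z in Metric.closedBall (0 : ℂ) R,
          ENNReal.ofReal ‖z - ζ‖⁻¹) := by
        rw [lintegral_const_mul _ (by fun_prop), lintegral_add_left measurable_const,
          lintegral_const, Measure.restrict_apply_univ]
    _ ≤ ENNReal.ofReal A * volume S + ENNReal.ofReal (4 / A) * (ENNReal.ofReal (2 * |R|) *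
        volume (Metric.closedBall (0 : ℂ) R) + ENNReal.ofReal C₁) := by
        gcongr
        exact hint ζ
    _ = ENNReal.ofReal (A * volume.real S + 4 * (2 * |R| * V + C₁) / A) := by
        rw [← ENNReal.ofReal_toReal hVtop, ← ENNReal.ofReal_toReal hStop]
        change _ * ENNReal.ofReal (volume.real S) + _ * (_ * ENNReal.ofReal V + _) = _
        rw [← ENNReal.ofReal_mul hA.le, ← ENNReal.ofReal_mul (by positivity),
          ← ENNReal.ofReal_add (by positivity) hC₁.le, ← ENNReal.ofReal_mul (by positivity),
          ← ENNReal.ofReal_add (by positivity) (by positivity)]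
        congr 1
        ring

/-- The uniform distribution on the angles `(0, π)`. Its image under the cosine is the arcsine
distribution. -/
noncomputable def angle : Measure ℝ := ENNReal.ofReal Real.pi⁻¹ • volume.restrict (Set.Ioo 0 Real.pi)

instance : IsProbabilityMeasure angle := ⟨by
  rw [angle, Measure.smul_apply, Measure.restrict_apply_univ, Real.volume_Ioo, smul_eq_mul, sub_zero,
    ← ENNReal.ofReal_mul (by positivity), inv_mul_cancel₀ Real.pi_ne_zero, ENNReal.ofReal_one]⟩

/-- The point at angle `θ` of the segment with endpoints `β ± 2√γ`, where `y = (β, γ)`. -/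
noncomputable def segPt (y : ℂ × ℂ) (θ : ℝ) : ℂ := y.1 + 2 * Complex.sqrt y.2 * (Real.cos θ : ℂ)

theorem sqrt_mul_self_eq (w : ℂ) : Complex.sqrt w * Complex.sqrt w = w := by
  rw [← sq]
  exact Complex.cpow_nat_inv_pow w two_ne_zero

theorem norm_sqrt_sq (w : ℂ) : ‖Complex.sqrt w‖ ^ 2 = ‖w‖ := by
  rw [sq, ← norm_mul, sqrt_mul_self_eq]

theorem norm_segPt_le {C : ℝ} {y : ℂ × ℂ} (hy : ‖y‖ ≤ C) (θ : ℝ) : ‖segPt y θ‖ ≤ 2 * C + 1 := by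
  have h1 : ‖y.1‖ ≤ C := (norm_fst_le _).trans hy
  have h2 : ‖y.2‖ ≤ C := (norm_snd_le _).trans hy
  have h3 := norm_sqrt_sq y.2
  have h4 : ‖Complex.sqrt y.2‖ * 2 ≤ C + 1 := by nlinarith [sq_nonneg (‖Complex.sqrt y.2‖ - 1)]
  have h5 : ‖(Real.cos θ : ℂ)‖ ≤ 1 := by
    rw [Complex.norm_real, Real.norm_eq_abs]; exact Real.abs_cos_le_one θ
  have h6 : ‖2 * Complex.sqrt y.2 * (Real.cos θ : ℂ)‖ ≤ C + 1 := by
    rw [norm_mul, norm_mul, Complex.norm_ofNat]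
    nlinarith [norm_nonneg (Complex.sqrt y.2), norm_nonneg (Real.cos θ : ℂ)]
  exact (norm_add_le _ _).trans (by linarith)

theorem measurable_sqrt : Measurable Complex.sqrt := by
  unfold Complex.sqrt
  fun_prop

theorem measurable_segPt : Measurable fun p : (ℂ × ℂ) × ℝ => segPt p.1 p.2 := by
  unfold segPt
  have h : Measurable fun p : (ℂ × ℂ) × ℝ => Complex.sqrt p.1.2 := measurable_sqrt.comp (by fun_prop)
  fun_prop

/-- The logarithmic potential at `z` of the arcsine measure on the segment `[β - 2√γ, β + 2√γ]`,
where `y = (β, γ)`. -/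
noncomputable def segPot (y : ℂ × ℂ) (z : ℂ) : ℝ := ∫ θ, Real.log ‖z - segPt y θ‖ ∂angle

theorem measurable_log_sub_segPt :
    Measurable fun p : ((ℂ × ℂ) × ℂ) × ℝ => Real.log ‖p.1.2 - segPt p.1.1 p.2‖ := by
  have h : Measurable fun p : ((ℂ × ℂ) × ℂ) × ℝ => segPt p.1.1 p.2 :=
    measurable_segPt.comp (f := fun p : ((ℂ × ℂ) × ℂ) × ℝ => (p.1.1, p.2)) (by fun_prop)
  have h2 : Measurable fun p : ((ℂ × ℂ) × ℂ) × ℝ => p.1.2 := by fun_prop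
  exact Real.measurable_log.comp (h2.sub h).norm

theorem measurable_segPot : Measurable fun p : (ℂ × ℂ) × ℂ => segPot p.1 p.2 :=
  (measurable_log_sub_segPt.stronglyMeasurable.integral_prod_right (ν := angle)).measurable

/-- The double integral of `|log |z - w||` over `z ∈ S` and the arcsine measure is small when `S`
has small area. -/
theorem exists_lintegral_abs_segPot_le (C R : ℝ) : ∃ C' : ℝ, 0 < C' ∧ ∀ y : ℂ × ℂ, ‖y‖ ≤ C →
    ∀ S ⊆ Metric.closedBall (0 : ℂ) R, ∀ A : ℝ, 0 < A →
      ∫⁻ z in S, ENNReal.ofReal |segPot y z| ≤ ENNReal.ofReal (A * volume.real S + C' / A) ∧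
      ∫⁻ z in S, ∫⁻ θ, ENNReal.ofReal |Real.log ‖z - segPt y θ‖| ∂angle ≤
        ENNReal.ofReal (A * volume.real S + C' / A) := by
  obtain ⟨C', hC', h⟩ := exists_lintegral_abs_log_le (max R (2 * C + 1))
  refine ⟨C', hC', fun y hy S hS A hA => ?_⟩
  have h2 : ∫⁻ z in S, ∫⁻ θ, ENNReal.ofReal |Real.log ‖z - segPt y θ‖| ∂angle ≤
        ENNReal.ofReal (A * volume.real S + C' / A) := by
    have hm : Measurable fun p : ℂ × ℝ => Real.log ‖p.1 - segPt y p.2‖ :=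
      measurable_log_sub_segPt.comp (f := fun p : ℂ × ℝ => ((y, p.1), p.2)) (by fun_prop)
    rw [lintegral_lintegral_swap hm.abs.ennreal_ofReal.aemeasurable]
    calc _ ≤ ∫⁻ θ, ENNReal.ofReal (A * volume.real S + C' / A) ∂angle := by
          refine lintegral_mono fun θ => ?_
          exact h _ ((norm_segPt_le hy θ).trans (le_max_right _ _)) S
            (hS.trans (Metric.closedBall_subset_closedBall (le_max_left _ _))) A hA
      _ = _ := by simp
  refine ⟨le_trans (lintegral_mono fun z => ?_) h2, h2⟩
  have := enorm_integral_le_lintegral_enorm (μ := angle) fun θ => Real.log ‖z - segPt y θ‖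
  simp only [Real.enorm_eq_ofReal_abs] at this
  exact this

theorem integral_angle_log_norm_one_sub {τ : ℂ} (hτ : ‖τ‖ ≤ 1) :
    ∫ θ in (0 : ℝ)..Real.pi, (Real.log ‖circleMap 0 1 θ - τ‖ +
      Real.log ‖circleMap 0 1 (-θ) - τ‖) = 0 := by
  have h := circleAverage_log_norm_sub_const_eq_posLog (a := τ)
  rw [(Real.posLog_eq_zero_iff _).2 (by rwa [abs_of_nonneg (norm_nonneg _)]),
    Real.circleAverage_def] at h
  have hper : Function.Periodic (fun θ => Real.log ‖circleMap 0 1 θ - τ‖) (2 * Real.pi) := fun θ => by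
    simp only [periodic_circleMap 0 1 θ]
  have hint : ∀ x y, IntervalIntegrable (fun θ => Real.log ‖circleMap 0 1 θ - τ‖) volume x y := by
    intro x y
    have : IntervalIntegrable (fun θ => Real.log ‖circleMap 0 1 θ - τ‖) volume 0 (0 + 2 * Real.pi) := by
      rw [zero_add]
      exact circleIntegrable_log_norm_sub_const (a := τ) (c := 0) 1
    exact hper.intervalIntegrable (by positivity) this x y
  have h0 : ∫ θ in (0 : ℝ)..2 * Real.pi, Real.log ‖circleMap 0 1 θ - τ‖ = 0 := by
    have hpi : (2 * Real.pi)⁻¹ ≠ 0 := by positivity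
    simpa [hpi] using h
  have h1 := hper.intervalIntegral_add_eq (-Real.pi) 0
  rw [zero_add, h0, show -Real.pi + 2 * Real.pi = Real.pi by ring,
    ← intervalIntegral.integral_add_adjacent_intervals (hint _ 0) (hint 0 _)] at h1
  have h2 : ∫ θ in (0 : ℝ)..Real.pi, Real.log ‖circleMap 0 1 (-θ) - τ‖ =
      ∫ θ in -Real.pi..0, Real.log ‖circleMap 0 1 θ - τ‖ := by
    rw [intervalIntegral.integral_comp_neg (fun θ => Real.log ‖circleMap 0 1 θ - τ‖), neg_zero]
  rw [intervalIntegral.integral_add (hint _ _), h2, add_comm, h1]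
  have h3 := (hint (-0) (-Real.pi)).comp_mul_left (c := -1)
  simpa using h3

/-- The logarithmic potential is `log |ρ|`, where `ρ` is the larger root of
`ρ + γ / ρ = z - β`. -/
theorem IsRoot.segPot_eq {c : ℂ} {a κ : ℝ} {z : ℂ} (hc : ‖c‖ = 1) (ha : 0 < a) (hκ : 0 < κ)
    {y : ℂ × ℂ} {ρ : ℂ} (h0 : HalfPlane c a κ z y) (hρ : IsRoot c a κ z y ρ) :
    segPot y z = Real.log ‖ρ‖ := by
  have hρ0 : 0 < ‖ρ‖ := hκ.trans_le (hρ.le_norm hc ha)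
  have hρne : ρ ≠ 0 := norm_pos_iff.1 hρ0
  set s := Complex.sqrt y.2 with hs
  have hss : s * s = y.2 := sqrt_mul_self_eq _
  set τ := s / ρ with hτ
  have hτ1 : ‖τ‖ ≤ 1 := by
    have h1 := hρ.norm_div_le hc ha hκ h0
    rw [← hss, norm_div, norm_mul, div_le_iff₀ hρ0] at h1
    rw [hτ, norm_div, div_le_one hρ0]
    nlinarith [norm_nonneg s]
  have hre : (c * s).re ^ 2 ≤ a ^ 2 := by
    refine le_trans (le_of_eq ?_) h0.1
    have e1 : (c ^ 2 * y.2) = (c * s) ^ 2 := by rw [← hss]; ring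
    have e2 : ‖y.2‖ = (c * s).re ^ 2 + (c * s).im ^ 2 := by
      have : ‖y.2‖ = ‖c * s‖ ^ 2 := by rw [← hss, norm_mul, norm_mul, hc]; ring
      rw [this, Complex.sq_norm, Complex.normSq_apply]; ring
    rw [e1, e2, sq (c * s), Complex.mul_re (c * s) (c * s)]
    ring
  have hne : ∀ θ : ℝ, z - segPt y θ ≠ 0 := by
    intro θ h
    have h1 : z - y.1 = 2 * s * (Real.cos θ : ℂ) := by
      rw [segPt] at h; linear_combination h
    have h2 := h0.2
    have h3 : (c * (z - y.1)).re = 2 * Real.cos θ * (c * s).re := by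
      rw [h1, show c * (2 * s * (Real.cos θ : ℂ)) = ((2 * Real.cos θ : ℝ) : ℂ) * (c * s) by
        push_cast; ring, Complex.re_ofReal_mul]
    have h4 : |(c * s).re| ≤ a := abs_le_of_sq_le_sq hre ha.le
    have h5 : |2 * Real.cos θ * (c * s).re| ≤ 2 * a := by
      rw [abs_mul, abs_mul, abs_two]
      have := Real.abs_cos_le_one θ
      nlinarith [abs_nonneg (c * s).re, abs_nonneg (Real.cos θ)]
    have := (le_abs_self _).trans h5
    linarith
  have hfac : ∀ θ : ℝ, ‖z - segPt y θ‖ =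
      ‖ρ‖ * (‖circleMap 0 1 θ - τ‖ * ‖circleMap 0 1 (-θ) - τ‖) := by
    intro θ
    have h1 : z - y.1 = ρ + s * s / ρ := by rw [hss]; exact hρ.1
    have h3 : circleMap 0 1 θ + circleMap 0 1 (-θ) = 2 * (Real.cos θ : ℂ) := by
      simp only [circleMap, zero_add, Complex.ofReal_one, one_mul, Complex.ofReal_cos, Complex.cos,
        Complex.ofReal_neg]
      ring
    have h4 : circleMap 0 1 θ * circleMap 0 1 (-θ) = 1 := by
      simp only [circleMap, zero_add, Complex.ofReal_one, one_mul, ← Complex.exp_add]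
      simp
    rw [← norm_mul, ← norm_mul]
    congr 1
    have : z - segPt y θ = (z - y.1) - s * (2 * (Real.cos θ : ℂ)) := by rw [segPt]; ring
    rw [this, h1, ← h3, hτ]
    have : (circleMap 0 1 θ - s / ρ) * (circleMap 0 1 (-θ) - s / ρ) =
      1 - s / ρ * (circleMap 0 1 θ + circleMap 0 1 (-θ)) + s / ρ * (s / ρ) := by
      rw [← h4]; ring
    rw [this]
    field_simp
    ring
  have hlog : ∀ θ : ℝ, Real.log ‖z - segPt y θ‖ = Real.log ‖ρ‖ +
      (Real.log ‖circleMap 0 1 θ - τ‖ + Real.log ‖circleMap 0 1 (-θ) - τ‖) := by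
    intro θ
    have h1 : ‖z - segPt y θ‖ ≠ 0 := norm_ne_zero_iff.2 (hne θ)
    rw [hfac θ] at h1 ⊢
    have h2 := right_ne_zero_of_mul h1
    rw [Real.log_mul hρ0.ne' h2, Real.log_mul (left_ne_zero_of_mul h2) (right_ne_zero_of_mul h2)]
  have hcont : Continuous fun θ : ℝ => Real.log ‖z - segPt y θ‖ := by
    refine Continuous.log ?_ fun θ => norm_ne_zero_iff.2 (hne θ)
    unfold segPt
    fun_prop
  rw [segPot, angle, integral_smul_measure, ← integral_Ioc_eq_integral_Ioo,
    ← intervalIntegral.integral_of_le Real.pi_pos.le]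
  have hsum : ∫ θ in (0 : ℝ)..Real.pi, Real.log ‖z - segPt y θ‖ = Real.pi * Real.log ‖ρ‖ := by
    have h1 : ∫ θ in (0 : ℝ)..Real.pi, (Real.log ‖z - segPt y θ‖ - Real.log ‖ρ‖) = 0 := by
      refine Eq.trans ?_ (integral_angle_log_norm_one_sub hτ1)
      refine intervalIntegral.integral_congr fun θ _ => ?_
      simp only [hlog θ]; ring
    rw [intervalIntegral.integral_sub (hcont.intervalIntegrable _ _) (by simp),
      intervalIntegral.integral_const, sub_zero, smul_eq_mul] at h1
    linarith
  rw [hsum, ENNReal.toReal_ofReal (by positivity), smul_eq_mul, ← mul_assoc,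
    inv_mul_cancel₀ Real.pi_ne_zero, one_mul]


/-! ### Finitely many half-planes cover the plane up to a small set -/

/-- `|Re(c √γ)|`, half the extent of the segment `[-2√γ, 2√γ]` in the direction `c`, in a form that
is visibly continuous in `γ`. -/
noncomputable def width (c : ℂ) (y : ℂ × ℂ) : ℝ := √(((c ^ 2 * y.2).re + ‖y.2‖) / 2)

theorem width_nonneg (c : ℂ) (y : ℂ × ℂ) : 0 ≤ width c y := Real.sqrt_nonneg _

theorem sq_width {c : ℂ} (hc : ‖c‖ = 1) (y : ℂ × ℂ) :
    width c y ^ 2 = ((c ^ 2 * y.2).re + ‖y.2‖) / 2 := by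
  refine Real.sq_sqrt ?_
  have h := (Complex.abs_re_le_norm (c ^ 2 * y.2))
  rw [norm_mul, norm_pow, hc, one_pow, one_mul] at h
  linarith [neg_abs_le (c ^ 2 * y.2).re]

theorem continuous_width : Continuous fun p : ℂ × (ℂ × ℂ) => width p.1 p.2 := by
  unfold width
  fun_prop

/-- The `j`-th member of a dense sequence of directions. -/
noncomputable def dir (j : ℕ) : ℂ := (TopologicalSpace.denseSeq Circle j : ℂ)

theorem norm_dir (j : ℕ) : ‖dir j‖ = 1 := Circle.norm_coe _

/-- The points of `closedBall 0 R` that are within `κ` of the segment of `y` as seen from each of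
the first `q` directions. -/
def nearSeg (R κ : ℝ) (q : ℕ) (y : ℂ × ℂ) : Set ℂ :=
  {z | z ∈ Metric.closedBall (0 : ℂ) R ∧
    ∀ j < q, (dir j * (z - y.1)).re ≤ 2 * width (dir j) y + κ}

theorem nearSeg_subset (R κ : ℝ) (q : ℕ) (y : ℂ × ℂ) :
    nearSeg R κ q y ⊆ Metric.closedBall (0 : ℂ) R := fun _ h => h.1

theorem measurableSet_nearSeg (R κ : ℝ) (q : ℕ) (y : ℂ × ℂ) : MeasurableSet (nearSeg R κ q y) := by
  have : nearSeg R κ q y = Metric.closedBall (0 : ℂ) R ∩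
      ⋂ j, ⋂ (_ : j < q), {z | (dir j * (z - y.1)).re ≤ 2 * width (dir j) y + κ} := by
    ext z
    simp [nearSeg]
  rw [this]
  refine Metric.isClosed_closedBall.measurableSet.inter ?_
  refine MeasurableSet.iInter fun j => MeasurableSet.iInter fun _ => ?_
  exact (isClosed_le (by fun_prop) (by fun_prop)).measurableSet

theorem nearSeg_mono {R κ κ' : ℝ} {q q' : ℕ} (hκ : κ ≤ κ') (hq : q' ≤ q) (y : ℂ × ℂ) :
    nearSeg R κ q y ⊆ nearSeg R κ' q' y :=
  fun _ h => ⟨h.1, fun j hj => (h.2 j (hj.trans_le hq)).trans (by linarith)⟩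

theorem volume_line {c : ℂ} (hc : c ≠ 0) (w : ℂ) : volume {z : ℂ | (c * (z - w)).re = 0} = 0 := by
  let f : ℂ →ₗ[ℝ] ℝ := Complex.reLm ∘ₗ (LinearMap.mulLeft ℝ c)
  have hf : LinearMap.ker f ≠ ⊤ := by
    intro h
    have : f c⁻¹ = 0 := by
      rw [← LinearMap.mem_ker, h]; trivial
    simp [f, hc] at this
  have h0 := Measure.addHaar_submodule (volume : Measure ℂ) (LinearMap.ker f) hf
  have h1 : {z : ℂ | (c * (z - w)).re = 0} = (fun z => z - w) ⁻¹' (LinearMap.ker f : Set ℂ) := by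
    ext z
    simp [f]
  rw [h1]
  simp only [sub_eq_add_neg]
  rw [measure_preimage_add_right, h0]

theorem iInter_nearSeg_null (R : ℝ) (y : ℂ × ℂ) :
    volume (⋂ n : ℕ, nearSeg R (1 / ((n : ℝ) + 1)) n y) = 0 := by
  -- a direction orthogonal to the segment
  obtain ⟨c, hc, hw⟩ : ∃ c : ℂ, ‖c‖ = 1 ∧ (c ^ 2 * y.2).re = -‖y.2‖ := by
    rcases eq_or_ne y.2 0 with h | h
    · exact ⟨1, by simp, by simp [h]⟩
    set s := Complex.sqrt y.2
    have hss : s * s = y.2 := sqrt_mul_self_eq _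
    have hs0 : s ≠ 0 := fun h0 => h (by rw [← hss, h0, mul_zero])
    have hs1 : (‖s‖ : ℂ) ≠ 0 := by exact_mod_cast (norm_pos_iff.2 hs0).ne'
    refine ⟨Complex.I * (starRingEnd ℂ) s / ‖s‖, ?_, ?_⟩
    · have : ‖s‖ ≠ 0 := (norm_pos_iff.2 hs0).ne'
      simp [this]
    · have e : (Complex.I * (starRingEnd ℂ) s / ‖s‖) ^ 2 * y.2 = ((-‖y.2‖ : ℝ) : ℂ) := by
        have h1 : s * (starRingEnd ℂ) s = (‖s‖ : ℂ) ^ 2 := by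
          rw [Complex.mul_conj, Complex.normSq_eq_norm_sq]; push_cast; rfl
        have h2 : (‖y.2‖ : ℝ) = ‖s‖ ^ 2 := by rw [← hss, norm_mul, sq]
        rw [h2, ← hss]
        push_cast
        rw [div_pow, mul_pow, Complex.I_sq]
        field_simp
        linear_combination (-(s * (starRingEnd ℂ) s) - (‖s‖ : ℂ) ^ 2) * h1
      rw [e, Complex.ofReal_re]
  have hc0 : c ≠ 0 := by rw [← norm_pos_iff, hc]; exact one_pos
  refine measure_mono_null (fun z hz => ?_) (volume_line hc0 y.1)
  have hj : ∀ j : ℕ, (dir j * (z - y.1)).re ≤ 2 * width (dir j) y := by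
    intro j
    refine le_of_forall_pos_le_add fun ε hε => ?_
    obtain ⟨n, hn⟩ := exists_nat_one_div_lt hε
    have h1 := Set.mem_iInter.1 hz (max n (j + 1))
    have h2 := h1.2 j (by simp)
    have h3 : (1 : ℝ) / (((max n (j + 1) : ℕ) : ℝ) + 1) ≤ 1 / ((n : ℝ) + 1) := by
      gcongr
      exact le_max_left _ _
    linarith
  have hall : ∀ x : Circle, ((x : ℂ) * (z - y.1)).re ≤ 2 * width (x : ℂ) y := by
    intro x
    refine (TopologicalSpace.denseRange_denseSeq Circle).induction_on
      (p := fun x : Circle => ((x : ℂ) * (z - y.1)).re ≤ 2 * width (x : ℂ) y) x ?_ hj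
    have h1 : Continuous fun x : Circle => width (x : ℂ) y :=
      continuous_width.comp (f := fun x : Circle => ((x : ℂ), y)) (by fun_prop)
    exact isClosed_le (by fun_prop) (by fun_prop)
  have hzero : width c y = 0 := by rw [width, hw]; simp
  have hzero' : width (-c) y = 0 := by rw [width, neg_sq, hw]; simp
  have h1 := hall ⟨c, mem_sphere_zero_iff_norm.2 hc⟩
  have h2 := hall ⟨-c, mem_sphere_zero_iff_norm.2 (by rwa [norm_neg])⟩
  simp only [hzero, hzero', neg_mul, Complex.neg_re] at h1 h2
  exact le_antisymm (by linarith) (by linarith)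

theorem exists_nearSeg_small (C R : ℝ) {δ : ℝ} (hδ : 0 < δ) :
    ∃ κ : ℝ, 0 < κ ∧ κ ≤ 1 ∧ ∃ q : ℕ, ∀ y : ℂ × ℂ, ‖y‖ ≤ C →
      volume.real (nearSeg R κ q y) ≤ δ := by
  have hcomp : IsCompact (Metric.closedBall (0 : ℂ × ℂ) C) := isCompact_closedBall _ _
  suffices h : ∃ κ : ℝ, 0 < κ ∧ κ ≤ 1 ∧ ∃ q : ℕ, ∀ y ∈ Metric.closedBall (0 : ℂ × ℂ) C,
      volume.real (nearSeg R κ q y) ≤ δ by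
    obtain ⟨κ, h1, h2, q, h3⟩ := h
    exact ⟨κ, h1, h2, q, fun y hy => h3 y (mem_closedBall_zero_iff.2 hy)⟩
  have hfin : ∀ κ q y, volume (nearSeg R κ q y) ≠ ∞ := fun κ q y =>
    ((measure_mono (nearSeg_subset R κ q y)).trans_lt measure_closedBall_lt_top).ne
  refine hcomp.induction_on (p := fun s => ∃ κ : ℝ, 0 < κ ∧ κ ≤ 1 ∧ ∃ q : ℕ, ∀ y ∈ s,
      volume.real (nearSeg R κ q y) ≤ δ) ?_ ?_ ?_ ?_
  · exact ⟨1, one_pos, le_rfl, 0, by simp⟩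
  · rintro s t hst ⟨κ, h1, h2, q, h3⟩
    exact ⟨κ, h1, h2, q, fun y hy => h3 y (hst hy)⟩
  · rintro s t ⟨κ, h1, h2, q, h3⟩ ⟨κ', h1', h2', q', h3'⟩
    refine ⟨min κ κ', lt_min h1 h1', (min_le_left _ _).trans h2, max q q', ?_⟩
    rintro y (hy | hy)
    · exact (measureReal_mono (nearSeg_mono (min_le_left _ _) (le_max_left _ _) y)
        (hfin _ _ _)).trans (h3 y hy)
    · exact (measureReal_mono (nearSeg_mono (min_le_right _ _) (le_max_right _ _) y)
        (hfin _ _ _)).trans (h3' y hy)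
  · intro y₀ _
    have hanti : Antitone fun n : ℕ => nearSeg R (1 / ((n : ℝ) + 1)) n y₀ := fun m n hmn =>
      nearSeg_mono (by gcongr) hmn y₀
    have htend := tendsto_measure_iInter_atTop (μ := (volume : Measure ℂ))
      (fun n : ℕ => (measurableSet_nearSeg R (1 / ((n : ℝ) + 1)) n y₀).nullMeasurableSet) hanti
      ⟨0, hfin _ _ _⟩
    rw [iInter_nearSeg_null] at htend
    obtain ⟨n, hn⟩ := (htend.eventually (gt_mem_nhds (ENNReal.ofReal_pos.2 hδ))).exists
    set κ : ℝ := 1 / ((n : ℝ) + 1)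
    have hκ : 0 < κ := by positivity
    have hκ1 : κ ≤ 1 := by
      simp only [κ]
      rw [div_le_one (by positivity)]
      linarith [Nat.cast_nonneg (α := ℝ) n]
    have hnear : ∀ᶠ y in 𝓝 y₀, ∀ j < n,
        2 * width (dir j) y + (dir j * y.1).re <
          2 * width (dir j) y₀ + (dir j * y₀.1).re + κ / 2 := by
      have : ∀ j : ℕ, ∀ᶠ y in 𝓝 y₀, 2 * width (dir j) y + (dir j * y.1).re <
          2 * width (dir j) y₀ + (dir j * y₀.1).re + κ / 2 := by
        intro j
        have h1 : Continuous fun y : ℂ × ℂ => width (dir j) y :=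
          continuous_width.comp (f := fun y : ℂ × ℂ => (dir j, y)) (by fun_prop)
        have h2 : Continuous fun y : ℂ × ℂ => 2 * width (dir j) y + (dir j * y.1).re := by fun_prop
        exact h2.continuousAt.eventually (gt_mem_nhds (by linarith))
      have h := (Finset.range n).eventually_all.2 fun j (_ : j ∈ Finset.range n) => this j
      simpa using h
    refine ⟨_, mem_nhdsWithin_of_mem_nhds hnear, κ / 2, by positivity, by linarith, n,
      fun y hy => ?_⟩
    have hsub : nearSeg R (κ / 2) n y ⊆ nearSeg R κ n y₀ := by
      refine fun z hz => ⟨hz.1, fun j hj => ?_⟩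
      have h1 := hz.2 j hj
      have h2 := hy j hj
      rw [mul_sub, Complex.sub_re] at h1 ⊢
      linarith
    refine (measureReal_mono hsub (hfin _ _ _)).trans ?_
    exact ENNReal.toReal_le_of_le_ofReal hδ.le hn.le


/-! ### The cost of a block with poorly placed spectral parameter -/

/-- The pairs of a sample `u` and a parameter `z ∈ Z` for which the first component decreases by
more than the factor `exp (-K n)` along the block `[s, t)`. -/
def lossSet (h : ℝ → ℂ × ℂ) (s t : ℝ) (Z : Set ℂ) (n : ℕ) (K : ℝ) : Set ((Fin n → ℝ) × ℂ) :=
  {p | p.2 ∈ Z ∧ ‖(run p.2 (pre h p.1 s p.2) (blk h p.1 s t)).1‖ <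
    Real.exp (-(K * n)) * ‖pre h p.1 s p.2‖}

theorem measurableSet_lossSet {h : ℝ → ℂ × ℂ} (hh : Continuous h) (s t : ℝ) {Z : Set ℂ}
    (hZ : MeasurableSet Z) (n : ℕ) (K : ℝ) : MeasurableSet (lossSet h s t Z n K) := by
  have h1 : MeasurableSet {p : (Fin n → ℝ) × ℂ |
      ‖(run p.2 (pre h p.1 s p.2) (blk h p.1 s t)).1‖ <
        Real.exp (-(K * n)) * ‖pre h p.1 s p.2‖} :=
    measurableSet_lt (measurable_run_blk hh n s t).fst.norm
      ((measurable_pre hh n s).norm.const_mul _)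
  exact (measurable_snd hZ).inter h1

theorem prod_measure_slab_ne_top (n : ℕ) {Z : Set ℂ} (hZf : volume Z ≠ ∞) :
    ((unifPi n).prod volume) {p : (Fin n → ℝ) × ℂ | p.2 ∈ Z} ≠ ∞ := by
  have : {p : (Fin n → ℝ) × ℂ | p.2 ∈ Z} = Set.univ ×ˢ Z := by ext; simp
  rw [this, Measure.prod_prod, measure_univ, one_mul]
  exact hZf

theorem exists_loss {C : ℝ} (R : ℝ) (hC : 0 ≤ C) {ρ : ℝ} (hρ : 0 < ρ) : ∃ δ' : ℝ, 0 < δ' ∧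
    ∀ (h : ℝ → ℂ × ℂ) (s t : ℝ) (Z : Set ℂ) (δ : ℝ), Continuous h → (∀ x, ‖h x‖ ≤ C) → s < t →
      Admissible h s → 0 < unif.real (Set.Ico s t) → MeasurableSet Z →
      Z ⊆ Metric.closedBall 0 R → volume.real Z ≤ δ' → 0 < δ →
      ∀ᶠ n : ℕ in atTop, ∃ W : (Fin n → ℝ) × ℂ → ℝ, Measurable W ∧ (∀ p, 0 ≤ W p) ∧
        ∫⁻ p in {p | p.2 ∈ Z}, ENNReal.ofReal (W p) ∂((unifPi n).prod volume) ≤ ENNReal.ofReal ρ ∧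
        ((unifPi n).prod volume).real {p | p.2 ∈ Z ∧
          ‖(run p.2 (pre h p.1 s p.2) (blk h p.1 s t)).1‖ <
            Real.exp (-(W p * unif.real (Set.Ico s t) * n)) * ‖pre h p.1 s p.2‖} ≤ δ := by
  obtain ⟨C₀, hC₀, hcrude⟩ := exists_crude_bound R hC
  -- the bound at level `K` is used with the parameter `x q ^ K`
  set q : ℝ := Real.exp (-(1 / 16))
  have hq0 : 0 < q := Real.exp_pos _
  have hq1 : q < 1 := Real.exp_lt_one_iff.2 (by norm_num)
  have hsum : Summable fun K : ℕ => q ^ K := summable_geometric_of_lt_one hq0.le hq1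
  set S := ∑' K : ℕ, q ^ K
  have hS1 : 1 ≤ S := by
    have := hsum.sum_le_tsum (Finset.range 1) fun i _ => by positivity
    simpa using this
  have hS : 0 < S := by linarith
  set x := 2 * C₀ * S / ρ with hx
  have hx0 : 0 < x := by positivity
  refine ⟨ρ / (2 * x * S), by positivity, ?_⟩
  intro h s t Z δ hh hhC hst hs hε hZ hZR hZδ hδ
  set ε := unif.real (Set.Ico s t)
  set B := (x * volume.real Z + C₀ / x) / 2 with hB
  have hB0 : 0 < B := by positivity
  have hBS : B * S ≤ ρ / 2 := by
    have h1 : x * volume.real Z * S ≤ ρ / 2 := by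
      calc x * volume.real Z * S ≤ x * (ρ / (2 * x * S)) * S := by gcongr
        _ = ρ / 2 := by field_simp
    have h2 : C₀ / x * S = ρ / 2 := by rw [hx]; field_simp
    rw [hB]; linarith
  obtain ⟨m, hm⟩ : ∃ m : ℕ, B * q ^ m ≤ δ / 2 := by
    obtain ⟨m, hm⟩ := exists_pow_lt_of_lt_one (show 0 < δ / 2 / B by positivity) hq1
    exact ⟨m, by rw [lt_div_iff₀ hB0] at hm; linarith⟩
  set δ₀ := min (δ / 2) (ρ / (2 * (m + 1))) with hδ₀
  have hδ₀0 : 0 < δ₀ := by positivity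
  have hZf : volume Z ≠ ∞ := ((measure_mono hZR).trans_lt measure_closedBall_lt_top).ne
  have hlev : ∀ᶠ n : ℕ in atTop, ∀ K ∈ Finset.range (m + 1),
      ((unifPi n).prod volume).real (lossSet h s t Z n (K * ε)) ≤ B * q ^ K + δ₀ := by
    refine (Finset.range (m + 1)).eventually_all.2 fun K _ => ?_
    filter_upwards [hcrude h s t Z K (x * q ^ K) δ₀ hh hhC hst hs hε hZ hZR (by positivity)
      (by positivity) hδ₀0] with n hn
    refine hn.trans (le_of_eq ?_)
    have h1 : Real.exp (-(K : ℝ) / 8) = q ^ K * q ^ K := by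
      rw [← Real.exp_nat_mul, ← Real.exp_add]
      congr 1; ring
    rw [h1, hB]
    field_simp
  filter_upwards [hlev] with n hn
  have hF : ∀ K : ℕ, MeasurableSet (lossSet h s t Z n (K * ε)) := fun K =>
    measurableSet_lossSet hh s t hZ n _
  have hFsub : ∀ K : ℕ, lossSet h s t Z n (K * ε) ⊆ {p | p.2 ∈ Z} := fun K p hp => hp.1
  have hfin : ∀ K : ℕ, ((unifPi n).prod volume) (lossSet h s t Z n (K * ε)) ≠ ∞ := fun K =>
    ((measure_mono (hFsub K)).trans_lt (prod_measure_slab_ne_top n hZf).lt_top).ne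
  refine ⟨fun p => ∑ K ∈ Finset.range m, (lossSet h s t Z n (K * ε)).indicator (fun _ => 1) p,
    ?_, ?_, ?_, ?_⟩
  · exact Finset.measurable_fun_sum _ fun K _ => measurable_const.indicator (hF K)
  · exact fun p => Finset.sum_nonneg fun K _ => Set.indicator_nonneg (fun _ _ => zero_le_one) p
  · have h1 : ∀ p : (Fin n → ℝ) × ℂ, ENNReal.ofReal (∑ K ∈ Finset.range m,
        (lossSet h s t Z n (K * ε)).indicator (fun _ => (1 : ℝ)) p) =
        ∑ K ∈ Finset.range m, (lossSet h s t Z n (K * ε)).indicator (fun _ => (1 : ℝ≥0∞)) p := by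
      intro p
      rw [ENNReal.ofReal_sum_of_nonneg fun K _ =>
        Set.indicator_nonneg (fun _ _ => zero_le_one) p]
      refine Finset.sum_congr rfl fun K _ => ?_
      by_cases hp : p ∈ lossSet h s t Z n (K * ε) <;> simp [hp]
    simp_rw [h1]
    rw [lintegral_finsetSum _ fun K _ => measurable_const.indicator (hF K)]
    calc _ ≤ ∑ K ∈ Finset.range m, ENNReal.ofReal (B * q ^ K + δ₀) := by
          refine Finset.sum_le_sum fun K hK => ?_
          rw [lintegral_indicator_const (hF K), one_mul, Measure.restrict_apply (hF K),
            Set.inter_eq_left.2 (hFsub K), ← ENNReal.ofReal_toReal (hfin K)]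
          refine ENNReal.ofReal_le_ofReal (hn K ?_)
          rw [Finset.mem_range] at hK ⊢
          omega
      _ = ENNReal.ofReal (∑ K ∈ Finset.range m, (B * q ^ K + δ₀)) :=
          (ENNReal.ofReal_sum_of_nonneg fun K _ => by positivity).symm
      _ ≤ ENNReal.ofReal ρ := by
          refine ENNReal.ofReal_le_ofReal ?_
          rw [Finset.sum_add_distrib, ← Finset.mul_sum, Finset.sum_const, Finset.card_range,
            nsmul_eq_mul]
          have h2 : ∑ K ∈ Finset.range m, q ^ K ≤ S :=
            hsum.sum_le_tsum _ fun i _ => by positivity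
          have h3 : (m : ℝ) * δ₀ ≤ ρ / 2 := by
            calc (m : ℝ) * δ₀ ≤ (m + 1) * (ρ / (2 * (m + 1))) := by
                  gcongr
                  · linarith
                  · exact min_le_right _ _
              _ = ρ / 2 := by field_simp
          nlinarith
  · refine le_trans (measureReal_mono (s₂ := lossSet h s t Z n (m * ε)) ?_ (hfin m)) ?_
    · rintro p ⟨hpZ, hp⟩
      by_contra hpm
      -- the losses are nested, so their number is the first level that is not exceeded
      classical
      have hex : ∃ K : ℕ, p ∉ lossSet h s t Z n (K * ε) := ⟨m, hpm⟩
      have hK := Nat.find_spec hex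
      have hle : Nat.find hex ≤ m := Nat.find_min' hex hpm
      refine hK ⟨hpZ, hp.trans_le ?_⟩
      gcongr
      calc ((Nat.find hex : ℕ) : ℝ) = ∑ K ∈ Finset.range (Nat.find hex),
            (lossSet h s t Z n (K * ε)).indicator (fun _ => (1 : ℝ)) p := by
            rw [Finset.sum_congr rfl (g := fun _ => (1 : ℝ))]
            · simp
            · intro K hK
              have : p ∈ lossSet h s t Z n (K * ε) :=
                not_not.1 (Nat.find_min hex (Finset.mem_range.1 hK))
              simp [this]
        _ ≤ _ := Finset.sum_le_sum_of_subset_of_nonneg (Finset.range_mono hle) fun K _ _ =>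
            Set.indicator_nonneg (fun _ _ => zero_le_one) p
    · refine (hn m (by simp)).trans ?_
      have := min_le_left (δ / 2) (ρ / (2 * (m + 1)))
      linarith


/-! ### Growth along one block -/

theorem halfPlane_of_near {c z : ℂ} {κ : ℝ} {y y₀ : ℂ × ℂ} (hc : ‖c‖ = 1) (hκ : 0 < κ) (hκ1 : κ ≤ 1)
    (hy : ‖y - y₀‖ ≤ κ ^ 2) (hz : 2 * width c y₀ + 4 * κ ≤ (c * (z - y₀.1)).re) :
    HalfPlane c (width c y₀ + κ) κ z y := by
  have h1 : ‖y.1 - y₀.1‖ ≤ κ ^ 2 := (norm_fst_le (y - y₀)).trans hy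
  have h2 : ‖y.2 - y₀.2‖ ≤ κ ^ 2 := (norm_snd_le (y - y₀)).trans hy
  have hκκ : κ ^ 2 ≤ κ := by nlinarith
  constructor
  · have e1 : (c ^ 2 * y.2).re - (c ^ 2 * y₀.2).re ≤ κ ^ 2 := by
      rw [← Complex.sub_re, ← mul_sub]
      refine (Complex.re_le_norm _).trans ?_
      rwa [norm_mul, norm_pow, hc, one_pow, one_mul]
    have e2 : ‖y.2‖ - ‖y₀.2‖ ≤ κ ^ 2 := (norm_sub_norm_le _ _).trans h2
    have e3 := sq_width hc y₀
    have e4 := width_nonneg c y₀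
    nlinarith
  · have e1 : (c * (y.1 - y₀.1)).re ≤ κ ^ 2 := by
      refine (Complex.re_le_norm _).trans ?_
      rwa [norm_mul, hc, one_mul]
    have e2 : c * (z - y.1) = c * (z - y₀.1) - c * (y.1 - y₀.1) := by ring
    rw [e2, Complex.sub_re]
    linarith

theorem neg_two_mul_le_log {θ : ℝ} (hθ0 : 0 ≤ θ) (hθ1 : θ ≤ 1 / 2) : -(2 * θ) ≤ Real.log (1 - θ) := by
  have h1 : 0 < 1 - θ := by linarith
  have h2 := Real.one_sub_inv_le_log_of_pos h1
  refine le_trans ?_ h2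
  have h3 : (1 - θ)⁻¹ ≤ 1 + 2 * θ := by
    rw [inv_le_iff_one_le_mul₀ h1]
    nlinarith
  linarith

/-- The contribution of the parameters in `[s, t)` to the logarithmic potential of the mixture of
arcsine measures. -/
noncomputable def blockPot (h : ℝ → ℂ × ℂ) (s t : ℝ) (z : ℂ) : ℝ :=
  ∫ x in Set.Ico s t, segPot (h x) z ∂unif

theorem measurable_segPot_comp {h : ℝ → ℂ × ℂ} (hh : Continuous h) :
    Measurable fun p : ℂ × ℝ => segPot (h p.2) p.1 :=
  measurable_segPot.comp ((hh.measurable.comp measurable_snd).prodMk measurable_fst)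

theorem measurable_blockPot {h : ℝ → ℂ × ℂ} (hh : Continuous h) (s t : ℝ) :
    Measurable (blockPot h s t) :=
  ((measurable_segPot_comp hh).stronglyMeasurable.integral_prod_right
    (ν := unif.restrict (Set.Ico s t))).measurable

theorem lintegral_abs_blockPot_le {h : ℝ → ℂ × ℂ} (hh : Continuous h) (s t : ℝ) {Z : Set ℂ} {B : ℝ}
    (hB : ∀ x, ∫⁻ z in Z, ENNReal.ofReal |segPot (h x) z| ≤ ENNReal.ofReal B) :
    ∫⁻ z in Z, ENNReal.ofReal |blockPot h s t z| ≤
      ENNReal.ofReal (unif.real (Set.Ico s t) * B) := by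
  calc ∫⁻ z in Z, ENNReal.ofReal |blockPot h s t z|
      ≤ ∫⁻ z in Z, ∫⁻ x in Set.Ico s t, ENNReal.ofReal |segPot (h x) z| ∂unif := by
        refine lintegral_mono fun z => ?_
        have := enorm_integral_le_lintegral_enorm (μ := unif.restrict (Set.Ico s t))
          fun x => segPot (h x) z
        simp only [Real.enorm_eq_ofReal_abs] at this
        exact this
    _ = ∫⁻ x in Set.Ico s t, (∫⁻ z in Z, ENNReal.ofReal |segPot (h x) z|) ∂unif :=
        lintegral_lintegral_swap (measurable_segPot_comp hh).abs.ennreal_ofReal.aemeasurable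
    _ ≤ ∫⁻ x in Set.Ico s t, ENNReal.ofReal B ∂unif := lintegral_mono fun x => hB x
    _ = ENNReal.ofReal (unif.real (Set.Ico s t) * B) := by
        rw [lintegral_const, Measure.restrict_apply_univ, mul_comm,
          ENNReal.ofReal_mul measureReal_nonneg, ofReal_measureReal]

theorem IsRoot.abs_blockPot_sub_le {h : ℝ → ℂ × ℂ} (hh : Continuous h) {s t : ℝ} {c z ρ : ℂ}
    {a κ δ θ : ℝ} (hc : ‖c‖ = 1) (ha : 0 < a) (hκ : 0 < κ)
    (hhp : ∀ x ∈ Set.Ico s t, HalfPlane c a κ z (h x)) (h0 : HalfPlane c a κ z (h s))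
    (hρ : IsRoot c a κ z (h s) ρ) (hδ : ∀ x ∈ Set.Ico s t, ‖h x - h s‖ ≤ δ)
    (hθ : δ * (1 + κ⁻¹) / κ ≤ θ) (hθ1 : θ ≤ 1 / 2) :
    |blockPot h s t z - unif.real (Set.Ico s t) * Real.log ‖ρ‖| ≤
      2 * θ * unif.real (Set.Ico s t) := by
  have hclose : ∀ x ∈ Set.Ico s t, ‖segPot (h x) z - Real.log ‖ρ‖‖ ≤ 2 * θ := by
    intro x hx
    obtain ⟨r, hr⟩ := (hhp x hx).exists_isRoot hc ha hκ
    rw [hr.segPot_eq hc ha hκ (hhp x hx)]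
    exact IsRoot.abs_log_sub_le hc ha hκ h0 hr hρ (hδ x hx) hθ hθ1
  have hm : Measurable fun x => segPot (h x) z :=
    (measurable_segPot_comp hh).comp (f := fun x : ℝ => (z, x)) (by fun_prop)
  have hint : IntegrableOn (fun x => segPot (h x) z - Real.log ‖ρ‖) (Set.Ico s t) unif :=
    Measure.integrableOn_of_bounded (measure_ne_top _ _)
      (hm.sub_const _).aestronglyMeasurable
      ((ae_restrict_iff' measurableSet_Ico).2 (ae_of_all _ hclose))
  have hconst : IntegrableOn (fun _ => Real.log ‖ρ‖) (Set.Ico s t) unif := by simp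
  have h1 := norm_setIntegral_le_of_norm_le_const (μ := unif) (measure_lt_top _ (Set.Ico s t))
    hclose
  have h2 : blockPot h s t z = ∫ x in Set.Ico s t, (segPot (h x) z - Real.log ‖ρ‖) ∂unif +
      ∫ _ in Set.Ico s t, Real.log ‖ρ‖ ∂unif := by
    rw [← integral_add hint hconst]
    simp [blockPot]
  rw [h2, setIntegral_const, smul_eq_mul, add_sub_cancel_right]
  exact h1

/-- Two-sided growth bounds along a block on which the parameters are nearly constant and the
spectral parameter is non-resonant. -/
theorem IsRoot.run_bounds {c z ρ : ℂ} {a κ C δ θ : ℝ} {y₀ : ℂ × ℂ} (hc : ‖c‖ = 1) (ha : 0 < a)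
    (hκ : 0 < κ) (h0 : HalfPlane c a κ z y₀) (hC : ‖y₀‖ ≤ C) (hρ : IsRoot c a κ z y₀ ρ)
    (hθ : δ * (1 + C / κ ^ 2 + κ⁻¹) / κ ≤ θ) (hθ0 : 0 ≤ θ) (hθ1 : θ ≤ 1 / 2) (l : List (ℂ × ℂ))
    (hl : ∀ y ∈ l, HalfPlane c a κ z y) (hδ : ∀ y ∈ l, ‖y - y₀‖ ≤ δ) (hCl : ∀ y ∈ l, ‖y‖ ≤ C)
    (v : ℂ × ℂ) {η n ε w L : ℝ} (hL : |Real.log ‖ρ‖| ≤ L) (hη : 0 ≤ η) (hn : 0 ≤ n)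
    (hN : |l.length - n * ε| ≤ η * n) (hw : |w - ε * Real.log ‖ρ‖| ≤ 2 * θ * ε)
    (hres : Real.exp (-(η * n)) * ‖v‖ * ‖contP z l‖ ≤ ‖(run z v l).1‖) :
    Real.exp (n * (w - 4 * θ * ε - η * (L + 2)) -
        Real.log ((1 + C / κ) * ((1 + κ⁻¹) * (1 + C / κ ^ 2)))) * ‖v‖ ≤ ‖(run z v l).1‖ ∧
      ‖run z v l‖ ≤ Real.exp (n * (w + 4 * θ * ε + η * (L + 2)) +
        Real.log ((1 + C / κ) * ((1 + κ⁻¹) * (1 + C / κ ^ 2)))) * ‖v‖ := by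
  have hC0 : 0 ≤ C := (norm_nonneg _).trans hC
  have hρ0 : 0 < ‖ρ‖ := hκ.trans_le (hρ.le_norm hc ha)
  set A := 1 + C / κ ^ 2
  have hA : 0 < A := by positivity
  set A' := (1 + C / κ) * ((1 + κ⁻¹) * A)
  have hAA' : A ≤ A' := by
    have h1 : 1 ≤ 1 + C / κ := by have : 0 ≤ C / κ := by positivity
                                  linarith
    have h2 : 1 ≤ 1 + κ⁻¹ := by have : 0 ≤ κ⁻¹ := by positivity
                                linarith
    calc A ≤ (1 + κ⁻¹) * A := le_mul_of_one_le_left hA.le h2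
      _ ≤ _ := le_mul_of_one_le_left (by positivity) h1
  have hA' : 0 < A' := hA.trans_le hAA'
  set N : ℝ := (l.length : ℝ)
  set Λ := Real.log ‖ρ‖
  obtain ⟨hN1, hN2⟩ := abs_le.1 hN
  obtain ⟨hw1, hw2⟩ := abs_le.1 hw
  obtain ⟨hL1, hL2⟩ := abs_le.1 hL
  have hηn : 0 ≤ η * n := by positivity
  have hL0 : 0 ≤ L := (abs_nonneg _).trans hL
  have hNΛ : |N * Λ - n * ε * Λ| ≤ η * n * L := by
    rw [← sub_mul, abs_mul]; gcongr
  obtain ⟨hNΛ1, hNΛ2⟩ := abs_le.1 hNΛ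
  have hNθ : N * (2 * θ) ≤ n * (2 * θ * ε) + η * n := by
    nlinarith
  constructor
  · have h1 := hρ.le_norm_contP hc ha hκ h0 hC hθ (by linarith) l hl hδ
    have h2 : Real.exp (N * (Λ - 2 * θ)) ≤ (‖ρ‖ * (1 - θ)) ^ l.length := by
      have h3 : 0 < ‖ρ‖ * (1 - θ) := mul_pos hρ0 (by linarith)
      rw [← Real.exp_log (pow_pos h3 _), Real.log_pow, Real.log_mul hρ0.ne' (by linarith)]
      refine Real.exp_le_exp.2 ?_
      have := neg_two_mul_le_log hθ0 hθ1
      gcongr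
      linarith
    have h3 : Real.exp (N * (Λ - 2 * θ) - Real.log A') ≤ ‖contP z l‖ := by
      rw [Real.exp_sub, Real.exp_log hA', div_le_iff₀ hA']
      refine (h2.trans h1).trans ?_
      rw [mul_comm]
      gcongr
    refine le_trans ?_ hres
    calc _ ≤ Real.exp (-(η * n) + (N * (Λ - 2 * θ) - Real.log A')) * ‖v‖ := by
          gcongr
          nlinarith
      _ = Real.exp (-(η * n)) * ‖v‖ * Real.exp (N * (Λ - 2 * θ) - Real.log A') := by
          rw [Real.exp_add]; ring
      _ ≤ _ := by gcongr
  · refine (hρ.norm_run_le hc ha hκ h0 hC hθ hθ0 (by linarith) l hl hδ hCl v).trans ?_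
    gcongr
    have h2 : (‖ρ‖ * (1 + θ)) ^ l.length ≤ Real.exp (N * (Λ + θ)) := by
      have h3 : 0 < ‖ρ‖ * (1 + θ) := by positivity
      rw [← Real.exp_log (pow_pos h3 _), Real.log_pow, Real.log_mul hρ0.ne' (by linarith)]
      refine Real.exp_le_exp.2 ?_
      have := Real.log_le_sub_one_of_pos (show 0 < 1 + θ by linarith)
      gcongr
      linarith
    rw [Real.exp_add, Real.exp_log hA', mul_comm]
    gcongr
    refine h2.trans (Real.exp_le_exp.2 ?_)
    have hNθ' : N * θ ≤ n * (2 * θ * ε) + η * n := by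
      have : 0 ≤ N * θ := by positivity
      linarith
    nlinarith


theorem lintegral_slab {n : ℕ} (Z : Set ℂ) {f : ℂ → ℝ≥0∞} (hf : Measurable f) :
    ∫⁻ p in {p : (Fin n → ℝ) × ℂ | p.2 ∈ Z}, f p.2 ∂((unifPi n).prod volume) = ∫⁻ z in Z, f z := by
  have h1 : {p : (Fin n → ℝ) × ℂ | p.2 ∈ Z} = Set.univ ×ˢ Z := by ext; simp
  rw [h1, ← Measure.prod_restrict, Measure.restrict_univ,
    lintegral_prod (fun p : (Fin n → ℝ) × ℂ => f p.2) (hf.comp measurable_snd).aemeasurable]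
  simp

theorem measurableSet_slab (n : ℕ) {Z : Set ℂ} (hZ : MeasurableSet Z) :
    MeasurableSet {p : (Fin n → ℝ) × ℂ | p.2 ∈ Z} := measurable_snd hZ

theorem IsRoot.norm_le {c z ρ : ℂ} {a κ C R : ℝ} {y : ℂ × ℂ} (hc : ‖c‖ = 1) (ha : 0 < a)
    (hκ : 0 < κ) (hρ : IsRoot c a κ z y ρ) (hy : ‖y‖ ≤ C) (hz : ‖z‖ ≤ R) :
    ‖ρ‖ ≤ R + C + C / κ := by
  have hρκ := hρ.le_norm hc ha
  have hC0 : 0 ≤ C := (norm_nonneg _).trans hy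
  have h1 : ρ = z - y.1 - y.2 / ρ := by rw [hρ.1]; ring
  have h2 : ‖y.2 / ρ‖ ≤ C / κ := by
    rw [norm_div]
    gcongr
    exact (norm_snd_le _).trans hy
  have h3 : ‖y.1‖ ≤ C := (norm_fst_le _).trans hy
  calc ‖ρ‖ = ‖z - y.1 - y.2 / ρ‖ := by rw [← h1]
    _ ≤ ‖z‖ + ‖y.1‖ + ‖y.2 / ρ‖ := (norm_sub_le _ _).trans (by gcongr; exact norm_sub_le _ _)
    _ ≤ _ := by linarith

theorem abs_log_le_of_mem {a b x : ℝ} (ha : 0 < a) (hax : a ≤ x) (hxb : x ≤ b) :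
    |Real.log x| ≤ |Real.log a| + |Real.log b| := by
  have h1 := Real.log_le_log ha hax
  have h2 := Real.log_le_log (ha.trans_le hax) hxb
  rw [abs_le]
  constructor
  · linarith [neg_abs_le (Real.log a), abs_nonneg (Real.log b)]
  · linarith [le_abs_self (Real.log b), abs_nonneg (Real.log a)]

/-- Bounds along a block for which nothing better than the level `W` is known. -/
theorem run_bounds_of_loss {n : ℕ} {R C W ε η δ w : ℝ} {z : ℂ} {v : ℂ × ℂ} {l : List (ℂ × ℂ)}
    (hC : 0 ≤ C) (hz : ‖z‖ ≤ R) (hCl : ∀ y ∈ l, ‖y‖ ≤ C) (hN : (l.length : ℝ) ≤ n * ε + η * n)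
    (hδ : η * Real.log (R + C + 1) ≤ δ) (hδ0 : 0 ≤ δ) (hW : 0 ≤ W) (hε : 0 ≤ ε)
    (hloss : Real.exp (-(W * ε * n)) * ‖v‖ ≤ ‖(run z v l).1‖) :
    Real.exp (n * (w - (|w| + (W + Real.log (R + C + 1)) * ε) - δ)) * ‖v‖ ≤ ‖(run z v l).1‖ ∧
      ‖run z v l‖ ≤
        Real.exp (n * (w + (|w| + (W + Real.log (R + C + 1)) * ε) + δ)) * ‖v‖ := by
  have hR : 0 ≤ R := (norm_nonneg _).trans hz
  have hlog : 0 ≤ Real.log (R + C + 1) := Real.log_nonneg (by linarith)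
  have hn : (0 : ℝ) ≤ n := n.cast_nonneg
  have h1 := neg_abs_le w
  have h2 := le_abs_self w
  constructor
  · refine le_trans ?_ hloss
    gcongr
    have : 0 ≤ n * (Real.log (R + C + 1) * ε + δ) := by positivity
    nlinarith
  · refine (norm_run_le hz le_rfl l hCl v).trans ?_
    gcongr
    have hpos : 0 < R + C + 1 := by linarith
    rw [← Real.exp_log (pow_pos hpos _), Real.log_pow]
    refine Real.exp_le_exp.2 ?_
    calc (l.length : ℝ) * Real.log (R + C + 1) ≤ (n * ε + η * n) * Real.log (R + C + 1) := by gcongr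
      _ = n * (ε * Real.log (R + C + 1)) + n * (η * Real.log (R + C + 1)) := by ring
      _ ≤ n * (ε * Real.log (R + C + 1)) + n * δ := by gcongr
      _ ≤ _ := by
        have : 0 ≤ n * (W * ε) := by positivity
        nlinarith

/-- Growth along a block on which the parameters are nearly constant: up to `exp (o(n))`, both the
first component and the norm are multiplied by `exp (n w)`, where `w` is the contribution of the
block to the potential, with an exponential error whose mean is a small multiple of the mass of the
block. -/
theorem exists_block_estimate {C : ℝ} (R : ℝ) (hC : 0 ≤ C) {ρ : ℝ} (hρ : 0 < ρ) :
    ∃ δ₁ : ℝ, 0 < δ₁ ∧ ∀ (h : ℝ → ℂ × ℂ) (s t δ : ℝ), Continuous h → (∀ x, ‖h x‖ ≤ C) → s < t →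
      0 ≤ s → s < 1 → Admissible h s → (∀ x ∈ Set.Ico s t, ‖h x - h s‖ ≤ δ₁) → 0 < δ →
      ∀ᶠ n : ℕ in atTop, ∃ Y : (Fin n → ℝ) × ℂ → ℝ, Measurable Y ∧ (∀ p, 0 ≤ Y p) ∧
        ∫⁻ p in {p | p.2 ∈ Metric.closedBall (0 : ℂ) R}, ENNReal.ofReal (Y p)
          ∂((unifPi n).prod volume) ≤ ENNReal.ofReal (ρ * unif.real (Set.Ico s t)) ∧
        ((unifPi n).prod volume).real {p | p.2 ∈ Metric.closedBall (0 : ℂ) R ∧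
          ¬ (Real.exp (n * (blockPot h s t p.2 - Y p - δ)) * ‖pre h p.1 s p.2‖ ≤
              ‖(run p.2 (pre h p.1 s p.2) (blk h p.1 s t)).1‖ ∧
            ‖run p.2 (pre h p.1 s p.2) (blk h p.1 s t)‖ ≤
              Real.exp (n * (blockPot h s t p.2 + Y p + δ)) * ‖pre h p.1 s p.2‖)} ≤ δ := by
  set V := volume.real (Metric.closedBall (0 : ℂ) R)
  have hV0 : 0 ≤ V := measureReal_nonneg
  have hVtop : volume (Metric.closedBall (0 : ℂ) R) ≠ ∞ := measure_closedBall_lt_top.ne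
  obtain ⟨C', hC', hpot⟩ := exists_lintegral_abs_segPot_le C R
  set ρ₀ := ρ / 5
  have hρ₀ : 0 < ρ₀ := by positivity
  set A := C' / ρ₀
  have hA : 0 < A := by positivity
  have hC'A : C' / A = ρ₀ := by simp only [A]; field_simp
  obtain ⟨δ'', hδ'', hloss⟩ := exists_loss R hC hρ₀
  set M := Real.log (|R| + C + 1)
  have hM : 0 ≤ M := Real.log_nonneg (by linarith [abs_nonneg R])
  set δz := min δ'' (min (ρ₀ / A) (ρ₀ / (M + 1)))
  have hδz : 0 < δz := by positivity
  obtain ⟨κ', hκ', hκ'1, q, hnear⟩ := exists_nearSeg_small C R hδz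
  set κ := κ' / 5
  have hκ : 0 < κ := by positivity
  have hκ1 : κ ≤ 1 := by simp only [κ]; linarith
  set θ := min (1 / 2) (ρ₀ / (4 * (V + 1)))
  have hθ0 : 0 < θ := by positivity
  have hθ1 : θ ≤ 1 / 2 := min_le_left _ _
  have hθV : 4 * θ * V ≤ ρ₀ := by
    calc 4 * θ * V ≤ 4 * (ρ₀ / (4 * (V + 1))) * (V + 1) := by
          gcongr
          · exact min_le_right _ _
          · linarith
      _ = ρ₀ := by field_simp
  set D := 1 + C / κ ^ 2 + κ⁻¹
  have hD : 0 < D := by positivity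
  refine ⟨min (κ ^ 2) (θ * κ / D), by positivity, ?_⟩
  intro h s t δ hh hhC hst hs0 hs1 hadm hosc hδ
  set δ₁ := min (κ ^ 2) (θ * κ / D)
  have hδ₁0 : 0 < δ₁ := by positivity
  have hδ₁κ : δ₁ ≤ κ ^ 2 := min_le_left _ _
  have hδ₁θ : δ₁ * D / κ ≤ θ := by
    calc δ₁ * D / κ ≤ (θ * κ / D) * D / κ := by gcongr; exact min_le_right _ _
      _ = θ := by field_simp
  have hδ₁θ' : δ₁ * (1 + κ⁻¹) / κ ≤ θ := by
    refine le_trans ?_ hδ₁θ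
    gcongr
    have : 0 ≤ C / κ ^ 2 := by positivity
    simp only [D]; linarith
  set ε := unif.real (Set.Ico s t)
  have hε : 0 < ε := by
    have h1 : unif.real (Set.Ico s (min t 1)) ≤ ε :=
      measureReal_mono (Set.Ico_subset_Ico_right (min_le_left _ _)) (measure_ne_top _ _)
    rw [unif_real_Ico hs0 (le_min hst.le hs1.le) (min_le_right _ _)] at h1
    have : s < min t 1 := lt_min hst hs1
    linarith
  set Z := nearSeg R κ' q (h s)
  have hZm : MeasurableSet Z := measurableSet_nearSeg _ _ _ _
  have hZR : Z ⊆ Metric.closedBall 0 R := nearSeg_subset _ _ _ _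
  have hZδ : volume.real Z ≤ δz := hnear _ (hhC s)
  set L := |Real.log κ| + |Real.log (R + C + C / κ)|
  set lA := Real.log ((1 + C / κ) * ((1 + κ⁻¹) * (1 + C / κ ^ 2)))
  -- the tolerance for the number of samples in the block
  obtain ⟨η, hη, hη1, hη2⟩ : ∃ η : ℝ, 0 < η ∧ η * (L + 2) ≤ δ / 2 ∧ η * M ≤ δ := by
    have hL : 0 ≤ L := by positivity
    refine ⟨min (δ / 2 / (L + 2)) (δ / (M + 1)), by positivity, ?_, ?_⟩
    · calc _ ≤ δ / 2 / (L + 2) * (L + 2) := by gcongr; exact min_le_left _ _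
        _ = δ / 2 := by field_simp
    · calc _ ≤ δ / (M + 1) * (M + 1) := by
            gcongr
            · exact min_le_right _ _
            · linarith
        _ = δ := by field_simp
  -- the exceptional sets
  let E₁ : (n : ℕ) → Set (Fin n → ℝ) := fun n =>
    {u | η * n ≤ |(count u (Set.Ico s t) : ℝ) - n * ε|}
  have hE₁ : Tendsto (fun n => (unifPi n).real (E₁ n) * V) atTop (𝓝 0) := by
    simpa using (tendsto_count (measurableSet_Ico (a := s) (b := t)) hη).mul_const V
  let a : ℕ → ℝ := fun j => width (dir j) (h s) + κ
  have ha : ∀ j, 0 < a j := fun j => add_pos_of_nonneg_of_pos (width_nonneg _ _) hκ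
  let τ : ℕ → ℝ := fun j => 2 * width (dir j) (h s) + 4 * κ + (dir j * (h s).1).re
  have hhp : ∀ j z, τ j ≤ (dir j * z).re → ∀ x ∈ Set.Ico s t,
      HalfPlane (dir j) (a j) κ z (h x) := by
    intro j z hz x hx
    refine halfPlane_of_near (norm_dir j) hκ hκ1 ((hosc x hx).trans hδ₁κ) ?_
    rw [mul_sub, Complex.sub_re]
    simp only [τ] at hz
    linarith
  let E₂ : (n j : ℕ) → Set ((Fin n → ℝ) × ℂ) := fun n j =>
    {p | (‖p.2‖ ≤ R ∧ τ j + κ ≤ (dir j * p.2).re) ∧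
      ‖(run p.2 (pre h p.1 s p.2) (blk h p.1 s t)).1‖ <
        Real.exp (-(η * n)) * ‖pre h p.1 s p.2‖ * ‖contP p.2 (blk h p.1 s t)‖}
  have hE₂ : Tendsto (fun n => ∑ j ∈ Finset.range q, ((unifPi n).prod volume).real (E₂ n j))
      atTop (𝓝 0) := by
    have := tendsto_finsetSum (Finset.range q) fun j _ =>
      tendsto_measureReal_resonant hh hC hhC hst hadm (R := R) (norm_dir j) (ha j) hκ
        (by linarith) (hhp j) hη
    rwa [Finset.sum_const_zero] at this
  have hlarge : ∀ᶠ n : ℕ in atTop, lA ≤ n * (δ / 2) :=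
    (tendsto_natCast_atTop_atTop.atTop_mul_const (by positivity : 0 < δ / 2)).eventually_ge_atTop lA
  filter_upwards [hE₁.eventually (ge_mem_nhds (show 0 < δ / 3 by positivity)),
    hE₂.eventually (ge_mem_nhds (show 0 < δ / 3 by positivity)), hlarge,
    hloss h s t Z (δ / 3) hh hhC hst hadm hε hZm hZR (hZδ.trans (min_le_left _ _)) (by positivity)]
    with n hn₁ hn₂ hnA hnW
  obtain ⟨W, hWm, hW0, hWint, hWloss⟩ := hnW
  have hslab := measurableSet_slab n hZm
  classical
  refine ⟨fun p => if p.2 ∈ Z then |blockPot h s t p.2| + (W p + M) * ε else 4 * θ * ε,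
    ?_, ?_, ?_, ?_⟩
  · refine Measurable.ite hslab ?_ measurable_const
    have : Measurable fun p : (Fin n → ℝ) × ℂ => blockPot h s t p.2 :=
      (measurable_blockPot hh s t).comp measurable_snd
    exact this.abs.add ((hWm.add_const M).mul_const ε)
  · intro p
    have := hW0 p
    dsimp only
    split_ifs <;> positivity
  · set m := (unifPi n).prod (volume : Measure ℂ)
    have hsplit : ∀ p : (Fin n → ℝ) × ℂ, ENNReal.ofReal
        (if p.2 ∈ Z then |blockPot h s t p.2| + (W p + M) * ε else 4 * θ * ε) ≤
        ENNReal.ofReal (4 * θ * ε) + {p : (Fin n → ℝ) × ℂ | p.2 ∈ Z}.indicator (fun p =>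
          ENNReal.ofReal |blockPot h s t p.2| + (ENNReal.ofReal ε * ENNReal.ofReal (W p) +
            ENNReal.ofReal (M * ε))) p := by
      intro p
      have := hW0 p
      by_cases hp : p.2 ∈ Z
      · rw [if_pos hp, Set.indicator_of_mem (by exact hp), ← ENNReal.ofReal_mul hε.le,
          ← ENNReal.ofReal_add (by positivity) (by positivity),
          ← ENNReal.ofReal_add (by positivity) (by positivity),
          ← ENNReal.ofReal_add (by positivity) (by positivity)]
        refine ENNReal.ofReal_le_ofReal ?_
        have : 0 ≤ 4 * θ * ε := by positivity
        linarith
      · rw [if_neg hp]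
        exact le_self_add
    have hmB : Measurable fun p : (Fin n → ℝ) × ℂ => ENNReal.ofReal |blockPot h s t p.2| :=
      ((measurable_blockPot hh s t).comp measurable_snd).abs.ennreal_ofReal
    have hmW : Measurable fun p : (Fin n → ℝ) × ℂ => ENNReal.ofReal (W p) := hWm.ennreal_ofReal
    have hconst : ∀ (S : Set ℂ), volume S ≠ ∞ → ∀ x : ℝ, 0 ≤ x →
        ∫⁻ p in {p : (Fin n → ℝ) × ℂ | p.2 ∈ S}, ENNReal.ofReal x ∂m =
          ENNReal.ofReal (x * volume.real S) := by
      intro S hS x hx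
      rw [lintegral_slab S (f := fun _ => ENNReal.ofReal x) measurable_const, lintegral_const,
        Measure.restrict_apply_univ, ENNReal.ofReal_mul hx, ofReal_measureReal hS]
    have hZf : volume Z ≠ ∞ := ((measure_mono hZR).trans_lt measure_closedBall_lt_top).ne
    calc _ ≤ ∫⁻ p in {p : (Fin n → ℝ) × ℂ | p.2 ∈ Metric.closedBall (0 : ℂ) R},
          (ENNReal.ofReal (4 * θ * ε) + {p : (Fin n → ℝ) × ℂ | p.2 ∈ Z}.indicator (fun p =>
          ENNReal.ofReal |blockPot h s t p.2| + (ENNReal.ofReal ε * ENNReal.ofReal (W p) +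
            ENNReal.ofReal (M * ε))) p) ∂m := lintegral_mono hsplit
      _ = ENNReal.ofReal (4 * θ * ε * V) + ∫⁻ p in {p : (Fin n → ℝ) × ℂ | p.2 ∈ Z},
          (ENNReal.ofReal |blockPot h s t p.2| + (ENNReal.ofReal ε * ENNReal.ofReal (W p) +
            ENNReal.ofReal (M * ε))) ∂m := by
          rw [lintegral_add_left measurable_const, hconst _ hVtop _ (by positivity),
            lintegral_indicator hslab, Measure.restrict_restrict hslab, Set.inter_eq_left.2]
          exact fun p hp => hZR hp
      _ = ENNReal.ofReal (4 * θ * ε * V) + ((∫⁻ z in Z, ENNReal.ofReal |blockPot h s t z|) +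
          (ENNReal.ofReal ε * ∫⁻ p in {p : (Fin n → ℝ) × ℂ | p.2 ∈ Z}, ENNReal.ofReal (W p) ∂m +
            ENNReal.ofReal (M * ε * volume.real Z))) := by
          rw [lintegral_add_left hmB, lintegral_add_left (hmW.const_mul _),
            lintegral_const_mul _ hmW, hconst _ hZf _ (by positivity),
            lintegral_slab Z (measurable_blockPot hh s t).abs.ennreal_ofReal]
      _ ≤ ENNReal.ofReal (ρ₀ * ε) + (ENNReal.ofReal (2 * ρ₀ * ε) +
          (ENNReal.ofReal ε * ENNReal.ofReal ρ₀ + ENNReal.ofReal (ρ₀ * ε))) := by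
          have h1 : 4 * θ * ε * V ≤ ρ₀ * ε := by nlinarith
          have h2 : volume.real Z ≤ ρ₀ / A :=
            hZδ.trans ((min_le_right _ _).trans (min_le_left _ _))
          have h3 : volume.real Z ≤ ρ₀ / (M + 1) :=
            hZδ.trans ((min_le_right _ _).trans (min_le_right _ _))
          have h4 : M * ε * volume.real Z ≤ ρ₀ * ε := by
            calc M * ε * volume.real Z ≤ (M + 1) * ε * (ρ₀ / (M + 1)) := by gcongr; linarith
              _ = ρ₀ * ε := by field_simp
          have h5 : ∫⁻ z in Z, ENNReal.ofReal |blockPot h s t z| ≤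
              ENNReal.ofReal (2 * ρ₀ * ε) := by
            refine (lintegral_abs_blockPot_le hh s t fun x =>
              (hpot (h x) (hhC x) Z hZR A hA).1).trans ?_
            refine ENNReal.ofReal_le_ofReal ?_
            have : A * volume.real Z ≤ ρ₀ := by
              rw [le_div_iff₀ hA] at h2; linarith
            rw [hC'A]
            nlinarith
          gcongr
      _ = ENNReal.ofReal (ρ * ε) := by
          rw [← ENNReal.ofReal_mul hε.le, ← ENNReal.ofReal_add (by positivity) (by positivity),
            ← ENNReal.ofReal_add (by positivity) (by positivity),
            ← ENNReal.ofReal_add (by positivity) (by positivity)]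
          congr 1
          simp only [ρ₀]; ring
  · set m := (unifPi n).prod (volume : Measure ℂ)
    set E₃ := {p : (Fin n → ℝ) × ℂ | p.2 ∈ Z ∧
          ‖(run p.2 (pre h p.1 s p.2) (blk h p.1 s t)).1‖ <
            Real.exp (-(W p * ε * n)) * ‖pre h p.1 s p.2‖}
    set B : Set ((Fin n → ℝ) × ℂ) := E₁ n ×ˢ Metric.closedBall (0 : ℂ) R
    have hBle : m.real B ≤ δ / 3 := (prod_measureReal_le hVtop subset_rfl).trans hn₁
    have hUle : m.real (⋃ j ∈ Finset.range q, E₂ n j) ≤ δ / 3 :=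
      (measureReal_biUnion_finset_le _ _).trans hn₂
    have hfin := prod_measure_slab_ne_top n hVtop
    have hUfin : m (B ∪ ((⋃ j ∈ Finset.range q, E₂ n j) ∪ E₃)) ≠ ∞ := by
      refine ((measure_mono ?_).trans_lt hfin.lt_top).ne
      rintro p (hp | hp | hp)
      · exact hp.2
      · simp only [Set.mem_iUnion] at hp
        obtain ⟨j, _, hp⟩ := hp
        exact mem_closedBall_zero_iff.2 hp.1.1
      · exact hZR hp.1
    have hsub : {p : (Fin n → ℝ) × ℂ | p.2 ∈ Metric.closedBall (0 : ℂ) R ∧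
          ¬ (Real.exp (n * (blockPot h s t p.2 - (if p.2 ∈ Z then |blockPot h s t p.2| +
            (W p + M) * ε else 4 * θ * ε) - δ)) * ‖pre h p.1 s p.2‖ ≤
              ‖(run p.2 (pre h p.1 s p.2) (blk h p.1 s t)).1‖ ∧
            ‖run p.2 (pre h p.1 s p.2) (blk h p.1 s t)‖ ≤
              Real.exp (n * (blockPot h s t p.2 + (if p.2 ∈ Z then |blockPot h s t p.2| +
            (W p + M) * ε else 4 * θ * ε) + δ)) * ‖pre h p.1 s p.2‖)} ⊆
        B ∪ ((⋃ j ∈ Finset.range q, E₂ n j) ∪ E₃) := by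
      rintro ⟨u, z⟩ ⟨hz, hp⟩
      by_contra hcon
      simp only [Set.mem_union, not_or] at hcon
      obtain ⟨hc₁, hc₂, hc₃⟩ := hcon
      refine hp ?_
      dsimp only at hz ⊢
      have hzR : ‖z‖ ≤ R := mem_closedBall_zero_iff.1 hz
      have hcount : |((blk h u s t).length : ℝ) - n * ε| ≤ η * n := by
        rw [length_blk]
        by_contra hcc
        exact hc₁ ⟨(not_le.1 hcc).le, hz⟩
      have hCl : ∀ y ∈ blk h u s t, ‖y‖ ≤ C := norm_le_of_mem_blk hhC
      by_cases hzZ : z ∈ Z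
      · simp only [if_pos hzZ]
        have hR0 : |R| = R := abs_of_nonneg ((norm_nonneg _).trans hzR)
        have hl : Real.exp (-(W (u, z) * ε * n)) * ‖pre h u s z‖ ≤
            ‖(run z (pre h u s z) (blk h u s t)).1‖ := by
          by_contra hcc
          exact hc₃ ⟨hzZ, not_le.1 hcc⟩
        simp only [M, hR0] at hη2 ⊢
        refine run_bounds_of_loss hC hzR hCl ?_ hη2 hδ.le (hW0 _) hε.le hl
        linarith [(abs_le.1 hcount).2]
      · simp only [if_neg hzZ]
        obtain ⟨j, hjq, hj⟩ : ∃ j < q, 2 * width (dir j) (h s) + κ' <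
            (dir j * (z - (h s).1)).re := by
          by_contra! hcc
          exact hzZ ⟨hz, hcc⟩
        have hτj : τ j + κ ≤ (dir j * z).re := by
          rw [mul_sub, Complex.sub_re] at hj
          simp only [τ]
          have : κ' = 5 * κ := by simp only [κ]; ring
          linarith
        have hhpj := hhp j z (by linarith)
        have h0 : HalfPlane (dir j) (a j) κ z (h s) := hhpj s ⟨le_rfl, hst⟩
        obtain ⟨r, hr⟩ := h0.exists_isRoot (norm_dir j) (ha j) hκ
        have hL : |Real.log ‖r‖| ≤ L := abs_log_le_of_mem hκ (hr.le_norm (norm_dir j) (ha j))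
          (hr.norm_le (norm_dir j) (ha j) hκ (hhC s) hzR)
        have hw := hr.abs_blockPot_sub_le hh (norm_dir j) (ha j) hκ hhpj h0 hosc hδ₁θ' hθ1
        have hres : Real.exp (-(η * n)) * ‖pre h u s z‖ * ‖contP z (blk h u s t)‖ ≤
            ‖(run z (pre h u s z) (blk h u s t)).1‖ := by
          by_contra hcc
          refine hc₂ ?_
          simp only [Set.mem_iUnion]
          exact ⟨j, Finset.mem_range.2 hjq, ⟨hzR, hτj⟩, not_le.1 hcc⟩
        have hkey := hr.run_bounds (norm_dir j) (ha j) hκ h0 (hhC s) hδ₁θ hθ0.le hθ1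
          (blk h u s t) (fun y hy => by
            obtain ⟨x, hx, rfl⟩ := exists_of_mem_blk hy
            exact hhpj x hx) (fun y hy => by
            obtain ⟨x, hx, rfl⟩ := exists_of_mem_blk hy
            exact hosc x hx) hCl (pre h u s z) hL hη.le n.cast_nonneg hcount hw hres
        have hbudget : n * (η * (L + 2)) + lA ≤ n * δ := by
          have : (n : ℝ) * (η * (L + 2)) ≤ n * (δ / 2) := by gcongr
          linarith
        refine ⟨le_trans ?_ hkey.1, hkey.2.trans ?_⟩
        · gcongr
          change _ ≤ _ - lA
          linarith
        · gcongr
          change _ + lA ≤ _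
          linarith
    refine (measureReal_mono hsub hUfin).trans ?_
    have h1 := measureReal_union_le (μ := m) B ((⋃ j ∈ Finset.range q, E₂ n j) ∪ E₃)
    have h2 := measureReal_union_le (μ := m) (⋃ j ∈ Finset.range q, E₂ n j) E₃
    linarith


/-! ### Convergence of the logarithmic potentials -/

/-- Composition of growth bounds along consecutive blocks. -/
theorem norm_bounds_of_steps {x : ℕ → ℂ × ℂ} {lo hi : ℕ → ℝ} {n : ℝ} {r : ℕ} (h0 : ‖x 0‖ = 1)
    (hlo : ∀ i < r, Real.exp (n * lo i) * ‖x i‖ ≤ ‖(x (i + 1)).1‖)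
    (hhi : ∀ i < r, ‖x (i + 1)‖ ≤ Real.exp (n * hi i) * ‖x i‖) (hr : r ≠ 0) :
    Real.exp (n * ∑ i ∈ Finset.range r, lo i) ≤ ‖(x r).1‖ ∧
      ‖x r‖ ≤ Real.exp (n * ∑ i ∈ Finset.range r, hi i) := by
  have key : ∀ k ≤ r, Real.exp (n * ∑ i ∈ Finset.range k, lo i) ≤ ‖x k‖ ∧
      (k ≠ 0 → Real.exp (n * ∑ i ∈ Finset.range k, lo i) ≤ ‖(x k).1‖) ∧
      ‖x k‖ ≤ Real.exp (n * ∑ i ∈ Finset.range k, hi i) := by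
    intro k
    induction k with
    | zero => simp [h0]
    | succ k ih =>
      intro hk
      obtain ⟨h1, -, h2⟩ := ih (by omega)
      have h3 : Real.exp (n * ∑ i ∈ Finset.range (k + 1), lo i) ≤ ‖(x (k + 1)).1‖ := by
        refine le_trans ?_ (hlo k (by omega))
        rw [Finset.sum_range_succ, mul_add, Real.exp_add, mul_comm]
        gcongr
      refine ⟨h3.trans (norm_fst_le _), fun _ => h3, (hhi k (by omega)).trans ?_⟩
      rw [Finset.sum_range_succ, mul_add, Real.exp_add, mul_comm]
      gcongr
  exact ⟨(key r le_rfl).2.1 hr, (key r le_rfl).2.2⟩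

theorem blockPot_eq_sum {h : ℝ → ℂ × ℂ} {z : ℂ} (hz : Integrable (fun x => segPot (h x) z) unif)
    {p : ℕ → ℝ} {r : ℕ} (hp : ∀ i < r, p i < p (i + 1)) :
    blockPot h (p 0) (p r) z = ∑ i ∈ Finset.range r, blockPot h (p i) (p (i + 1)) z := by
  have key : ∀ k ≤ r, p 0 ≤ p k ∧
      blockPot h (p 0) (p k) z = ∑ i ∈ Finset.range k, blockPot h (p i) (p (i + 1)) z := by
    intro k
    induction k with
    | zero => simp [blockPot]
    | succ k ih =>
      intro hk
      obtain ⟨h1, h2⟩ := ih (by omega)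
      have h3 := hp k (by omega)
      refine ⟨by linarith, ?_⟩
      rw [Finset.sum_range_succ, ← h2, blockPot, ← Set.Ico_union_Ico_eq_Ico h1 h3.le,
        setIntegral_union (Set.Ico_disjoint_Ico_same) measurableSet_Ico hz.integrableOn
          hz.integrableOn]
      rfl
  exact (key r le_rfl).2

theorem sum_unif_real_le {p : ℕ → ℝ} {r : ℕ} (hp : ∀ i < r, p i < p (i + 1)) :
    ∑ i ∈ Finset.range r, unif.real (Set.Ico (p i) (p (i + 1))) ≤ 1 := by
  have key : ∀ k ≤ r, p 0 ≤ p k ∧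
      ∑ i ∈ Finset.range k, unif.real (Set.Ico (p i) (p (i + 1))) =
        unif.real (Set.Ico (p 0) (p k)) := by
    intro k
    induction k with
    | zero => simp
    | succ k ih =>
      intro hk
      obtain ⟨h1, h2⟩ := ih (by omega)
      have h3 := hp k (by omega)
      refine ⟨by linarith, ?_⟩
      rw [Finset.sum_range_succ, h2, ← Set.Ico_union_Ico_eq_Ico h1 h3.le,
        measureReal_union Set.Ico_disjoint_Ico_same measurableSet_Ico]
  rw [(key r le_rfl).2]
  exact measureReal_le_one

theorem ae_integrable_segPot {h : ℝ → ℂ × ℂ} (hh : Continuous h) {C : ℝ} (hhC : ∀ x, ‖h x‖ ≤ C)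
    (R : ℝ) : ∀ᵐ z ∂(volume.restrict (Metric.closedBall (0 : ℂ) R)),
      Integrable (fun x => segPot (h x) z) unif := by
  obtain ⟨C', hC', hpot⟩ := exists_lintegral_abs_segPot_le C R
  have hm := measurable_segPot_comp hh
  have hfin : ∫⁻ z in Metric.closedBall (0 : ℂ) R, ∫⁻ x, ENNReal.ofReal |segPot (h x) z| ∂unif
      ≠ ∞ := by
    rw [lintegral_lintegral_swap hm.abs.ennreal_ofReal.aemeasurable]
    refine ((lintegral_mono fun x => (hpot (h x) (hhC x) _ subset_rfl 1 one_pos).1).trans_lt ?_).ne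
    simp
  have hm2 : Measurable fun z => ∫⁻ x, ENNReal.ofReal |segPot (h x) z| ∂unif :=
    hm.abs.ennreal_ofReal.lintegral_prod_right'
  filter_upwards [ae_lt_top hm2 hfin] with z hz
  refine ⟨(hm.comp (f := fun x : ℝ => (z, x)) (by fun_prop)).aestronglyMeasurable, ?_⟩
  rw [HasFiniteIntegral]
  simpa only [Real.enorm_eq_ofReal_abs] using hz

/-- The normalized logarithms of the moduli of the characteristic polynomials converge, in measure
with respect to the sample and the spectral parameter, to the potential of the mixture of arcsine
measures. -/
theorem tendsto_measureReal_log_norm_contP {h : ℝ → ℂ × ℂ} (hh : Continuous h) {C : ℝ} (hC : 0 ≤ C)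
    (hhC : ∀ x, ‖h x‖ ≤ C) (hh1 : ∀ x, 1 ≤ x → h x = h 1) (R : ℝ) {δ : ℝ} (hδ : 0 < δ) :
    Tendsto (fun n : ℕ => ((unifPi n).prod volume).real {p | p.2 ∈ Metric.closedBall (0 : ℂ) R ∧
      δ ≤ |Real.log ‖contP p.2 ((seg p.1 (Set.Iio 2)).map h)‖ / n - blockPot h 0 2 p.2|})
      atTop (𝓝 0) := by
  rw [Metric.tendsto_atTop']
  suffices hs : ∀ δ₀ : ℝ, 0 < δ₀ → ∀ᶠ n : ℕ in atTop,
      ((unifPi n).prod volume).real {p | p.2 ∈ Metric.closedBall (0 : ℂ) R ∧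
        δ ≤ |Real.log ‖contP p.2 ((seg p.1 (Set.Iio 2)).map h)‖ / n - blockPot h 0 2 p.2|} ≤
          δ₀ by
    intro e he
    obtain ⟨N, hN⟩ := eventually_atTop.1 (hs (e / 2) (by positivity))
    refine ⟨N, fun n hn => ?_⟩
    rw [Real.dist_0_eq_abs, abs_of_nonneg measureReal_nonneg]
    linarith [hN n hn.le]
  intro δ₀ hδ₀
  obtain ⟨δ₁, hδ₁, hblock⟩ := exists_block_estimate R hC (show 0 < δ * δ₀ / 4 by positivity)
  obtain ⟨r, p, hp0, hpr, hp⟩ := exists_partition hh hh1 hδ₁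
  have hr : r ≠ 0 := by
    rintro rfl
    rw [hp0] at hpr
    norm_num at hpr
  set δ' := min (δ / (4 * r)) (δ₀ / (2 * r))
  have hr0 : (0 : ℝ) < r := by exact_mod_cast Nat.pos_of_ne_zero hr
  have hδ' : 0 < δ' := by positivity
  have hδ'1 : r * δ' ≤ δ / 4 := by
    calc r * δ' ≤ r * (δ / (4 * r)) := by gcongr; exact min_le_left _ _
      _ = δ / 4 := by field_simp
  have hδ'2 : r * δ' ≤ δ₀ / 2 := by
    calc r * δ' ≤ r * (δ₀ / (2 * r)) := by gcongr; exact min_le_right _ _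
      _ = δ₀ / 2 := by field_simp
  have hev := (Finset.range r).eventually_all.2 fun i (hi : i ∈ Finset.range r) => by
    obtain ⟨h1, h2, h3, h4, h5⟩ := hp i (Finset.mem_range.1 hi)
    exact hblock h (p i) (p (i + 1)) δ' hh hhC h1 h2 h3 h4 h5 hδ'
  filter_upwards [hev, eventually_gt_atTop 0] with n hn hn0
  have hn0' : (0 : ℝ) < n := by exact_mod_cast hn0
  choose! Y hYm hY0 hYint hYfail using hn
  set m := (unifPi n).prod (volume : Measure ℂ)
  have hVtop : volume (Metric.closedBall (0 : ℂ) R) ≠ ∞ := measure_closedBall_lt_top.ne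
  have hfin := prod_measure_slab_ne_top n hVtop
  set slab : Set ((Fin n → ℝ) × ℂ) := {p | p.2 ∈ Metric.closedBall (0 : ℂ) R}
  have hslab : MeasurableSet slab := measurableSet_slab n Metric.isClosed_closedBall.measurableSet
  let F : ℕ → Set ((Fin n → ℝ) × ℂ) := fun i => {q | q.2 ∈ Metric.closedBall (0 : ℂ) R ∧
          ¬ (Real.exp (n * (blockPot h (p i) (p (i + 1)) q.2 - Y i q - δ')) *
              ‖pre h q.1 (p i) q.2‖ ≤
              ‖(run q.2 (pre h q.1 (p i) q.2) (blk h q.1 (p i) (p (i + 1)))).1‖ ∧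
            ‖run q.2 (pre h q.1 (p i) q.2) (blk h q.1 (p i) (p (i + 1)))‖ ≤
              Real.exp (n * (blockPot h (p i) (p (i + 1)) q.2 + Y i q + δ')) *
                ‖pre h q.1 (p i) q.2‖)}
  let Ys : (Fin n → ℝ) × ℂ → ℝ := fun q => ∑ i ∈ Finset.range r, Y i q
  let G : Set ((Fin n → ℝ) × ℂ) := slab ∩ {q | ENNReal.ofReal (δ / 2) ≤ ENNReal.ofReal (Ys q)}
  let N₁ : Set ((Fin n → ℝ) × ℂ) := {u | ¬ ∀ i, 0 ≤ u i} ×ˢ Metric.closedBall (0 : ℂ) R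
  let N₂ : Set ((Fin n → ℝ) × ℂ) := Set.univ ×ˢ {z | z ∈ Metric.closedBall (0 : ℂ) R ∧
    ¬ Integrable (fun x => segPot (h x) z) unif}
  have hN₁ : m N₁ = 0 := by
    rw [Measure.prod_prod, unifPi_neg_null, zero_mul]
  have hN₂ : m N₂ = 0 := by
    have h1 := ae_integrable_segPot hh hhC R
    rw [ae_restrict_iff' Metric.isClosed_closedBall.measurableSet, ae_iff] at h1
    have h2 : {z | z ∈ Metric.closedBall (0 : ℂ) R ∧
        ¬ Integrable (fun x => segPot (h x) z) unif} = {z | ¬ (z ∈ Metric.closedBall (0 : ℂ) R →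
          Integrable (fun x => segPot (h x) z) unif)} := by
      ext z; simp only [Set.mem_ofPred_eq, Classical.not_imp]
    rw [Measure.prod_prod, h2, h1, mul_zero]
  have hYsm : Measurable fun q => ENNReal.ofReal (Ys q) :=
    (Finset.measurable_fun_sum _ fun i hi => hYm i hi).ennreal_ofReal
  have hYs : ∫⁻ q in slab, ENNReal.ofReal (Ys q) ∂m ≤ ENNReal.ofReal (δ * δ₀ / 4) := by
    have h1 : ∀ q, ENNReal.ofReal (Ys q) = ∑ i ∈ Finset.range r, ENNReal.ofReal (Y i q) :=
      fun q => ENNReal.ofReal_sum_of_nonneg fun i hi => hY0 i hi q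
    simp_rw [h1]
    rw [lintegral_finsetSum' _ fun i hi => (hYm i hi).ennreal_ofReal.aemeasurable]
    refine (Finset.sum_le_sum fun i hi => hYint i hi).trans ?_
    rw [← ENNReal.ofReal_sum_of_nonneg fun i _ => by positivity, ← Finset.mul_sum]
    refine ENNReal.ofReal_le_ofReal ?_
    exact mul_le_of_le_one_right (by positivity) (sum_unif_real_le fun i hi => (hp i hi).1)
  have hG : m.real G ≤ δ₀ / 2 := by
    have h1 := mul_meas_ge_le_lintegral₀ (μ := m.restrict slab) hYsm.aemeasurable
      (ENNReal.ofReal (δ / 2))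
    rw [Measure.restrict_apply' hslab, Set.inter_comm] at h1
    have h2 := h1.trans hYs
    have h3 : m G ≤ ENNReal.ofReal (δ₀ / 2) := by
      have e : ENNReal.ofReal (δ * δ₀ / 4) = ENNReal.ofReal (δ / 2) * ENNReal.ofReal (δ₀ / 2) := by
        rw [← ENNReal.ofReal_mul (by positivity)]; congr 1; ring
      rw [e] at h2
      exact (ENNReal.mul_le_mul_iff_right (ENNReal.ofReal_pos.2 (by positivity)).ne'
        ENNReal.ofReal_ne_top).1 h2
    exact ENNReal.toReal_le_of_le_ofReal (by positivity) h3
  have hFs : m.real (⋃ i ∈ Finset.range r, F i) ≤ δ₀ / 2 := by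
    refine (measureReal_biUnion_finset_le _ _).trans ?_
    refine (Finset.sum_le_sum fun i hi => hYfail i hi).trans ?_
    rwa [Finset.sum_const, Finset.card_range, nsmul_eq_mul]
  have hsub : {q : (Fin n → ℝ) × ℂ | q.2 ∈ Metric.closedBall (0 : ℂ) R ∧
      δ ≤ |Real.log ‖contP q.2 ((seg q.1 (Set.Iio 2)).map h)‖ / n - blockPot h 0 2 q.2|} ⊆
      ((⋃ i ∈ Finset.range r, F i) ∪ G) ∪ (N₁ ∪ N₂) := by
    rintro ⟨u, z⟩ ⟨hz, hbad⟩
    by_contra hcon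
    simp only [Set.mem_union, not_or] at hcon
    obtain ⟨⟨hcF, hcG⟩, hc₁, hc₂⟩ := hcon
    dsimp only at hz hbad
    have hu : ∀ i, 0 ≤ u i := by
      by_contra hcc
      exact hc₁ ⟨hcc, hz⟩
    have hint : Integrable (fun x => segPot (h x) z) unif := by
      by_contra hcc
      exact hc₂ ⟨trivial, hz, hcc⟩
    have hYlt : Ys (u, z) < δ / 2 := by
      by_contra hcc
      exact hcG ⟨hz, ENNReal.ofReal_le_ofReal (not_lt.1 hcc)⟩
    have hstep : ∀ i < r, Real.exp (n * (blockPot h (p i) (p (i + 1)) z - Y i (u, z) - δ')) *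
              ‖pre h u (p i) z‖ ≤ ‖(pre h u (p (i + 1)) z).1‖ ∧
            ‖pre h u (p (i + 1)) z‖ ≤
              Real.exp (n * (blockPot h (p i) (p (i + 1)) z + Y i (u, z) + δ')) *
                ‖pre h u (p i) z‖ := by
      intro i hi
      rw [pre_eq_run h u (hp i hi).1.le]
      by_contra hcc
      refine hcF ?_
      simp only [Set.mem_iUnion]
      exact ⟨i, Finset.mem_range.2 hi, hz, hcc⟩
    have hx0 : ‖pre h u (p 0) z‖ = 1 := by
      rw [hp0, pre_zero h hu]; simp
    obtain ⟨hlow, hupp⟩ := norm_bounds_of_steps (x := fun i => pre h u (p i) z) (r := r) hx0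
      (fun i hi => (hstep i hi).1) (fun i hi => (hstep i hi).2) hr
    have hpot := blockPot_eq_sum hint fun i hi => (hp i hi).1
    rw [hp0, hpr] at hpot
    have hfst : (pre h u (p r) z).1 = contP z ((seg u (Set.Iio 2)).map h) := by
      rw [hpr, pre, run_fst]; simp
    have hsl : ∑ i ∈ Finset.range r, (blockPot h (p i) (p (i + 1)) z - Y i (u, z) - δ') =
        blockPot h 0 2 z - Ys (u, z) - r * δ' := by
      rw [hpot]; simp [Ys, Finset.sum_sub_distrib]
    have hsu : ∑ i ∈ Finset.range r, (blockPot h (p i) (p (i + 1)) z + Y i (u, z) + δ') =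
        blockPot h 0 2 z + Ys (u, z) + r * δ' := by
      rw [hpot]; simp [Ys, Finset.sum_add_distrib]
    rw [hfst, hsl] at hlow
    have hupp' := (norm_fst_le _).trans hupp
    rw [hfst, hsu] at hupp'
    set P := ‖contP z ((seg u (Set.Iio 2)).map h)‖
    have hP : 0 < P := (Real.exp_pos _).trans_le hlow
    have h1 : blockPot h 0 2 z - Ys (u, z) - r * δ' ≤ Real.log P / n := by
      rw [le_div_iff₀ hn0', mul_comm]
      exact (Real.le_log_iff_exp_le hP).2 hlow
    have h2 : Real.log P / n ≤ blockPot h 0 2 z + Ys (u, z) + r * δ' := by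
      rw [div_le_iff₀ hn0', mul_comm]
      exact (Real.log_le_iff_le_exp hP).2 hupp'
    have : |Real.log P / n - blockPot h 0 2 z| < δ := by
      rw [abs_lt]; constructor <;> linarith
    linarith
  have hUfin : m (((⋃ i ∈ Finset.range r, F i) ∪ G) ∪ (N₁ ∪ N₂)) ≠ ∞ := by
    refine ((measure_mono (t := slab) ?_).trans_lt hfin.lt_top).ne
    rintro q ((hq | hq) | (hq | hq))
    · simp only [Set.mem_iUnion] at hq
      obtain ⟨i, _, hq⟩ := hq
      exact hq.1
    · exact hq.1
    · exact hq.2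
    · exact hq.2.1
  refine (measureReal_mono hsub hUfin).trans ?_
  have h1 := measureReal_union_le (μ := m) ((⋃ i ∈ Finset.range r, F i) ∪ G) (N₁ ∪ N₂)
  have h2 := measureReal_union_le (μ := m) (⋃ i ∈ Finset.range r, F i) G
  have h3 : m.real (N₁ ∪ N₂) = 0 := by
    rw [measureReal_eq_zero_iff (((measure_union_le _ _).trans_lt (by simp [hN₁, hN₂])).ne)]
    exact measure_union_null hN₁ hN₂
  linarith


/-! ### Continuous functions as superpositions of logarithms -/

theorem integrable_mul_log {X : Type*} [MeasurableSpace X] (ν : Measure X) [IsProbabilityMeasure ν]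
    {R M : ℝ} {φ : X × ℂ → ℝ} (hφ : Measurable φ) (hM : ∀ p, |φ p| ≤ M)
    (hR : ∀ p, p.2 ∉ Metric.closedBall (0 : ℂ) R → φ p = 0) {ζ : X → ℂ} (hζ : Measurable ζ)
    (hζR : ∀ᵐ x ∂ν, ‖ζ x‖ ≤ R) :
    Integrable (fun p : X × ℂ => φ p * Real.log ‖p.2 - ζ p.1‖) (ν.prod volume) := by
  obtain ⟨C, hC, hlog⟩ := exists_lintegral_abs_log_le R
  have hm : Measurable fun p : X × ℂ => φ p * Real.log ‖p.2 - ζ p.1‖ := by fun_prop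
  refine ⟨hm.aestronglyMeasurable, ?_⟩
  rw [HasFiniteIntegral, lintegral_prod _ hm.enorm.aemeasurable]
  set B := 1 * volume.real (Metric.closedBall (0 : ℂ) R) + C / 1
  have hbound : ∀ᵐ x ∂ν, ∫⁻ z : ℂ, ‖φ (x, z) * Real.log ‖z - ζ x‖‖ₑ ≤
      ENNReal.ofReal M * ENNReal.ofReal B := by
    filter_upwards [hζR] with x hx
    calc ∫⁻ z : ℂ, ‖φ (x, z) * Real.log ‖z - ζ x‖‖ₑ
        ≤ ∫⁻ z : ℂ, (Metric.closedBall (0 : ℂ) R).indicator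
            (fun z => ENNReal.ofReal M * ENNReal.ofReal |Real.log ‖z - ζ x‖|) z := by
          refine lintegral_mono fun z => ?_
          by_cases hz : z ∈ Metric.closedBall (0 : ℂ) R
          · rw [Set.indicator_of_mem hz, enorm_mul, Real.enorm_eq_ofReal_abs,
              Real.enorm_eq_ofReal_abs]
            gcongr
            exact hM _
          · rw [hR (x, z) hz]; simp
      _ = ENNReal.ofReal M * ∫⁻ z in Metric.closedBall (0 : ℂ) R,
            ENNReal.ofReal |Real.log ‖z - ζ x‖| := by
          rw [lintegral_indicator Metric.isClosed_closedBall.measurableSet,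
            lintegral_const_mul _ (by fun_prop)]
      _ ≤ _ := by
          gcongr
          exact hlog _ hx _ subset_rfl 1 one_pos
  refine (lintegral_mono_ae hbound).trans_lt ?_
  rw [lintegral_const, measure_univ, mul_one]
  exact ENNReal.mul_lt_top ENNReal.ofReal_lt_top ENNReal.ofReal_lt_top

/-- The uniform distribution on the angles `(0, 2π]`. -/
noncomputable def turn : Measure ℝ :=
  ENNReal.ofReal (2 * Real.pi)⁻¹ • volume.restrict (Set.Ioc 0 (2 * Real.pi))

instance : IsProbabilityMeasure turn := ⟨by
  rw [turn, Measure.smul_apply, Measure.restrict_apply_univ, Real.volume_Ioc, smul_eq_mul, sub_zero,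
    ← ENNReal.ofReal_mul (by positivity), inv_mul_cancel₀ (by positivity), ENNReal.ofReal_one]⟩

theorem integral_turn (f : ℂ → ℝ) (c : ℂ) (r : ℝ) :
    ∫ θ, f (circleMap c r θ) ∂turn = Real.circleAverage f c r := by
  rw [Real.circleAverage_def, turn, integral_smul_measure, ENNReal.toReal_ofReal (by positivity),
    intervalIntegral.integral_of_le (by positivity)]

/-- The logarithmic potential at `a` of the uniform distribution on the circle of radius `s`
about `0`. -/
noncomputable def circlePot (s : ℝ) (a : ℂ) : ℝ := Real.log s + Real.posLog (s⁻¹ * ‖a‖)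

theorem continuous_circlePot (s : ℝ) : Continuous (circlePot s) := by
  unfold circlePot
  fun_prop

theorem integral_turn_log {s : ℝ} (hs : 0 < s) (a : ℂ) :
    ∫ θ, Real.log ‖circleMap 0 s θ - a‖ ∂turn = circlePot s a := by
  rw [integral_turn (fun z => Real.log ‖z - a‖),
    circleAverage_log_norm_sub_const_eq_log_radius_add_posLog hs.ne', zero_sub, norm_neg, circlePot]

/-- The average of `f` over the circle of radius `s` about a point. -/
noncomputable def circleMean (s : ℝ) (f : ℂ → ℝ) (z : ℂ) : ℝ :=
  ∫ θ, f (z - circleMap 0 s θ) ∂turn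

section circleMean

variable {f : ℂ → ℝ} {M R s : ℝ}

theorem measurable_circleMean (hf : Measurable f) (s : ℝ) : Measurable (circleMean s f) := by
  have : Measurable fun p : ℂ × ℝ => f (p.1 - circleMap 0 s p.2) :=
    hf.comp (by fun_prop)
  exact (this.stronglyMeasurable.integral_prod_right (ν := turn)).measurable

theorem abs_circleMean_le (hM : ∀ z, |f z| ≤ M) (s : ℝ) (z : ℂ) : |circleMean s f z| ≤ M := by
  have := norm_integral_le_of_norm_le_const (μ := turn) (f := fun θ => f (z - circleMap 0 s θ))
    (C := M) (ae_of_all _ fun θ => hM _)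
  simpa [circleMean] using this

theorem mem_closedBall_of_sub_circleMap (hs : 0 ≤ s) {z : ℂ} {θ : ℝ}
    (h : z - circleMap 0 s θ ∈ Metric.closedBall (0 : ℂ) R) :
    z ∈ Metric.closedBall (0 : ℂ) (R + s) := by
  rw [mem_closedBall_zero_iff] at h ⊢
  have h1 : ‖circleMap 0 s θ‖ = s := by simp [abs_of_nonneg hs]
  calc ‖z‖ = ‖(z - circleMap 0 s θ) + circleMap 0 s θ‖ := by rw [sub_add_cancel]
    _ ≤ _ := (norm_add_le _ _).trans (by rw [h1]; gcongr)

theorem circleMean_eq_zero (hs : 0 ≤ s) (hR : ∀ z, z ∉ Metric.closedBall (0 : ℂ) R → f z = 0) {z : ℂ}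
    (hz : z ∉ Metric.closedBall (0 : ℂ) (R + s)) : circleMean s f z = 0 := by
  rw [circleMean]
  refine integral_eq_zero_of_ae (ae_of_all _ fun θ => hR _ fun h => hz ?_)
  exact mem_closedBall_of_sub_circleMap hs h

/-- Averaging over circles is self-adjoint. -/
theorem integral_circleMean_mul_log (hf : Measurable f) (hM : ∀ z, |f z| ≤ M)
    (hR : ∀ z, z ∉ Metric.closedBall (0 : ℂ) R → f z = 0) (hs : 0 < s) (w : ℂ) :
    Integrable (fun z => circleMean s f z * Real.log ‖z - w‖) ∧
    Integrable (fun z => f z * circlePot s (w - z)) ∧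
    ∫ z, circleMean s f z * Real.log ‖z - w‖ = ∫ z, f z * circlePot s (w - z) := by
  set R' := max R 0 + s + ‖w‖
  have hR1 : R + s ≤ R' := by
    have := le_max_left R 0; have := norm_nonneg w; simp only [R']; linarith
  have hR2 : ‖w‖ + s ≤ R' := by have := le_max_right R 0; simp only [R']; linarith
  have hR3 : R ≤ R' := by linarith
  have i1 : Integrable (fun p : ℝ × ℂ => f (p.2 - circleMap 0 s p.1) * Real.log ‖p.2 - w‖)
      (turn.prod volume) := by
    refine integrable_mul_log turn (R := R') (M := M) (ζ := fun _ => w)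
      (φ := fun p : ℝ × ℂ => f (p.2 - circleMap 0 s p.1)) (hf.comp (by fun_prop))
      (fun p => hM _) (fun p hp => hR _ fun h => hp ?_) measurable_const
      (ae_of_all _ fun _ => by linarith)
    exact Metric.closedBall_subset_closedBall hR1 (mem_closedBall_of_sub_circleMap hs.le h)
  have i2 : Integrable (fun p : ℝ × ℂ => f p.2 * Real.log ‖p.2 - (w - circleMap 0 s p.1)‖)
      (turn.prod volume) := by
    refine integrable_mul_log turn (R := R') (M := M) (ζ := fun θ => w - circleMap 0 s θ)
      (φ := fun p : ℝ × ℂ => f p.2) (hf.comp (by fun_prop)) (fun p => hM _)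
      (fun p hp => hR _ fun h => hp (Metric.closedBall_subset_closedBall hR3 h)) (by fun_prop)
      (ae_of_all _ fun θ => ?_)
    refine (norm_sub_le _ _).trans ?_
    simpa [abs_of_pos hs] using hR2
  have e1 : (fun z => circleMean s f z * Real.log ‖z - w‖) =
      fun z => ∫ θ, f (z - circleMap 0 s θ) * Real.log ‖z - w‖ ∂turn := by
    funext z
    rw [integral_mul_const, circleMean]
  have e2 : (fun z => f z * circlePot s (w - z)) =
      fun z => ∫ θ, f z * Real.log ‖z - (w - circleMap 0 s θ)‖ ∂turn := by
    funext z
    rw [integral_const_mul, ← integral_turn_log hs]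
    simp only [sub_sub_eq_add_sub, add_comm z]
  refine ⟨?_, ?_, ?_⟩
  · rw [e1]; exact i1.integral_prod_right
  · rw [e2]; exact i2.integral_prod_right
  · rw [e1, e2, ← integral_prod_symm _ i1, ← integral_prod_symm _ i2, integral_prod _ i1,
      integral_prod _ i2]
    refine integral_congr_ae (ae_of_all _ fun θ => ?_)
    have := integral_sub_right_eq_self (μ := (volume : Measure ℂ))
      (fun z => f z * Real.log ‖z - (w - circleMap 0 s θ)‖) (circleMap 0 s θ)
    dsimp only
    rw [← this]
    simp only [sub_sub_sub_cancel_right]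

end circleMean

/-- The potential of the circle of radius `2r` minus that of the circle of radius `r`. -/
noncomputable def bump (r : ℝ) (a : ℂ) : ℝ := circlePot (2 * r) a - circlePot r a

theorem bump_eq_zero {r : ℝ} (hr : 0 < r) {a : ℂ} (ha : 2 * r ≤ ‖a‖) : bump r a = 0 := by
  have ha0 : 0 < ‖a‖ := by linarith
  have h1 : 1 ≤ |(2 * r)⁻¹ * ‖a‖| := by
    rw [abs_of_pos (by positivity), inv_mul_eq_div, one_le_div (by positivity)]; exact ha
  have h2 : 1 ≤ |r⁻¹ * ‖a‖| := by
    rw [abs_of_pos (by positivity), inv_mul_eq_div, one_le_div hr]; linarith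
  rw [bump, circlePot, circlePot, Real.posLog_eq_log h1, Real.posLog_eq_log h2,
    Real.log_mul (by positivity) ha0.ne', Real.log_mul (by positivity) ha0.ne', Real.log_inv,
    Real.log_inv]
  ring

theorem bump_pos {r : ℝ} (hr : 0 < r) {a : ℂ} (ha : ‖a‖ < 2 * r) : 0 < bump r a := by
  have h1 : Real.posLog ((2 * r)⁻¹ * ‖a‖) = 0 := by
    rw [Real.posLog_eq_zero_iff, abs_of_nonneg (by positivity), inv_mul_eq_div,
      div_le_one (by positivity)]
    exact ha.le
  rw [bump, circlePot, circlePot, h1, Real.log_mul two_ne_zero hr.ne']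
  have h2 : Real.posLog (r⁻¹ * ‖a‖) < Real.log 2 := by
    rw [Real.posLog_eq_log_max_one (by positivity)]
    refine Real.log_lt_log (by positivity) (max_lt (by norm_num) ?_)
    rw [inv_mul_eq_div, div_lt_iff₀ hr]
    exact ha
  linarith

theorem bump_nonneg {r : ℝ} (hr : 0 < r) (a : ℂ) : 0 ≤ bump r a := by
  rcases lt_or_ge ‖a‖ (2 * r) with h | h
  · exact (bump_pos hr h).le
  · exact (bump_eq_zero hr h).ge

theorem continuous_bump (r : ℝ) : Continuous (bump r) :=
  (continuous_circlePot _).sub (continuous_circlePot _)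

theorem integrable_bump {r : ℝ} (hr : 0 < r) : Integrable (bump r) := by
  refine (continuous_bump r).integrable_of_hasCompactSupport ?_
  refine HasCompactSupport.intro (isCompact_closedBall (0 : ℂ) (2 * r)) fun a ha => ?_
  rw [mem_closedBall_zero_iff, not_le] at ha
  exact bump_eq_zero hr ha.le

theorem integral_bump_pos {r : ℝ} (hr : 0 < r) : 0 < ∫ a, bump r a := by
  rw [integral_pos_iff_support_of_nonneg (bump_nonneg hr) (integrable_bump hr)]
  refine (Metric.measure_ball_pos volume (0 : ℂ) (show 0 < 2 * r by positivity)).trans_le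
    (measure_mono fun a ha => ?_)
  rw [mem_ball_zero_iff] at ha
  exact (bump_pos hr ha).ne'

/-- On a disc, every continuous function is a uniform limit of logarithmic potentials of bounded
compactly supported densities. -/
theorem exists_log_approx {f : ℂ → ℝ} (hf : Continuous f) (R₀ : ℝ) {ε : ℝ} (hε : 0 < ε) :
    ∃ (R : ℝ) (G : ℝ) (g : ℂ → ℝ), R₀ ≤ R ∧ 0 ≤ G ∧ Measurable g ∧ (∀ z, |g z| ≤ G) ∧
      (∀ z, z ∉ Metric.closedBall (0 : ℂ) R → g z = 0) ∧
      ∀ w, ‖w‖ ≤ R₀ → |(∫ z, g z * Real.log ‖z - w‖) - f w| ≤ ε := by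
  set R₁ := |R₀| + 1
  have hcomp : IsCompact (Metric.closedBall (0 : ℂ) R₁) := isCompact_closedBall _ _
  obtain ⟨δ, hδ, hδf⟩ := Metric.uniformContinuousOn_iff.1
    (hcomp.uniformContinuousOn_of_continuous hf.continuousOn) ε hε
  obtain ⟨M, hM⟩ := hcomp.exists_bound_of_continuousOn hf.continuousOn
  have hM0 : 0 ≤ M := (norm_nonneg _).trans
    (hM 0 (by rw [mem_closedBall_zero_iff, norm_zero]; positivity))
  set r := min 1 δ / 2 with hr_def
  have hr : 0 < r := by positivity
  have hr1 : 2 * r ≤ 1 := by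
    have := min_le_left 1 δ; rw [hr_def]; linarith
  have hrδ : 2 * r ≤ δ := by
    have := min_le_right 1 δ; rw [hr_def]; linarith
  set f₁ := (Metric.closedBall (0 : ℂ) R₁).indicator f with hf₁_def
  have hf₁ : Measurable f₁ := hf.measurable.indicator Metric.isClosed_closedBall.measurableSet
  have hf₁M : ∀ z, |f₁ z| ≤ M := by
    intro z
    by_cases hz : z ∈ Metric.closedBall (0 : ℂ) R₁
    · rw [hf₁_def, Set.indicator_of_mem hz]; exact hM z hz
    · rw [hf₁_def, Set.indicator_of_notMem hz, abs_zero]; exact hM0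
  have hf₁R : ∀ z, z ∉ Metric.closedBall (0 : ℂ) R₁ → f₁ z = 0 := fun z hz =>
    Set.indicator_of_notMem hz _
  set m := ∫ a, bump r a
  have hm : 0 < m := integral_bump_pos hr
  refine ⟨R₁ + 1, (2 * M) / m, fun z => (circleMean (2 * r) f₁ z - circleMean r f₁ z) / m, ?_,
    by positivity, ?_, ?_, ?_, ?_⟩
  · have := le_abs_self R₀; simp only [R₁]; linarith
  · exact ((measurable_circleMean hf₁ _).sub (measurable_circleMean hf₁ _)).div_const _
  · intro z
    rw [abs_div, abs_of_pos hm]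
    gcongr
    refine (abs_sub _ _).trans ?_
    have h1 := abs_circleMean_le hf₁M (2 * r) z
    have h2 := abs_circleMean_le hf₁M r z
    linarith
  · intro z hz
    have h1 : z ∉ Metric.closedBall (0 : ℂ) (R₁ + 2 * r) := fun h =>
      hz (Metric.closedBall_subset_closedBall (by linarith) h)
    have h2 : z ∉ Metric.closedBall (0 : ℂ) (R₁ + r) := fun h =>
      hz (Metric.closedBall_subset_closedBall (by linarith) h)
    dsimp only
    rw [circleMean_eq_zero (by positivity) hf₁R h1, circleMean_eq_zero hr.le hf₁R h2]
    simp
  · intro w hw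
    obtain ⟨a1, a2, a3⟩ := integral_circleMean_mul_log hf₁ hf₁M hf₁R (show 0 < 2 * r by positivity) w
    obtain ⟨b1, b2, b3⟩ := integral_circleMean_mul_log hf₁ hf₁M hf₁R hr w
    have hb : Integrable fun z => bump r (w - z) := (integrable_bump hr).comp_sub_left w
    have hbm : ∫ z, bump r (w - z) = m := integral_sub_left_eq_self (bump r) volume w
    have hfb : Integrable fun z => f₁ z * bump r (w - z) := by
      refine (a2.sub b2).congr (ae_of_all _ fun z => ?_)
      simp only [bump, Pi.sub_apply]; ring
    have e1 : ∫ z, (circleMean (2 * r) f₁ z - circleMean r f₁ z) / m * Real.log ‖z - w‖ =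
        (∫ z, f₁ z * bump r (w - z)) / m := by
      have : ∀ z, (circleMean (2 * r) f₁ z - circleMean r f₁ z) / m * Real.log ‖z - w‖ =
          (circleMean (2 * r) f₁ z * Real.log ‖z - w‖ - circleMean r f₁ z * Real.log ‖z - w‖) / m :=
        fun z => by ring
      simp_rw [this]
      rw [integral_div, integral_sub a1 b1, a3, b3, ← integral_sub a2 b2]
      congr 1
      refine integral_congr_ae (ae_of_all _ fun z => ?_)
      simp only [bump]; ring
    have e2 : (∫ z, f₁ z * bump r (w - z)) - f w * m = ∫ z, (f₁ z - f w) * bump r (w - z) := by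
      rw [← hbm, ← integral_const_mul, ← integral_sub hfb (hb.const_mul _)]
      refine integral_congr_ae (ae_of_all _ fun z => ?_)
      dsimp only
      ring
    have e3 : |∫ z, (f₁ z - f w) * bump r (w - z)| ≤ ε * m := by
      rw [← hbm, ← integral_const_mul, ← Real.norm_eq_abs]
      refine norm_integral_le_of_norm_le (hb.const_mul ε) (ae_of_all _ fun z => ?_)
      rw [norm_mul, Real.norm_eq_abs, Real.norm_eq_abs, abs_of_nonneg (bump_nonneg hr _)]
      rcases lt_or_ge ‖w - z‖ (2 * r) with h | h
      · refine mul_le_mul_of_nonneg_right ?_ (bump_nonneg hr _)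
        have hwR : w ∈ Metric.closedBall (0 : ℂ) R₁ := by
          rw [mem_closedBall_zero_iff]
          have := le_abs_self R₀; simp only [R₁]; linarith
        have hzR : z ∈ Metric.closedBall (0 : ℂ) R₁ := by
          rw [mem_closedBall_zero_iff]
          have h3 : ‖z‖ ≤ ‖w‖ + ‖w - z‖ := by
            have := norm_sub_le w (w - z); rwa [sub_sub_cancel] at this
          have := le_abs_self R₀; simp only [R₁]; linarith
        rw [hf₁_def, Set.indicator_of_mem hzR, ← Real.dist_eq]
        refine (hδf z hzR w hwR ?_).le
        rw [dist_comm, dist_eq_norm]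
        linarith
      · rw [bump_eq_zero hr h]; simp
    dsimp only
    rw [e1]
    have : (∫ z, f₁ z * bump r (w - z)) / m - f w = ((∫ z, f₁ z * bump r (w - z)) - f w * m) / m := by
      field_simp
    rw [this, e2, abs_div, abs_of_pos hm, div_le_iff₀ hm]
    exact e3


/-- The logarithmic potential of a measure. -/
noncomputable def logPot (m : Measure ℂ) (z : ℂ) : ℝ := ∫ w, Real.log ‖z - w‖ ∂m

theorem measurable_log_norm_sub : Measurable fun p : ℂ × ℂ => Real.log ‖p.1 - p.2‖ := by fun_prop

theorem measurable_logPot (m : Measure ℂ) [SFinite m] : Measurable (logPot m) :=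
  (measurable_log_norm_sub.stronglyMeasurable.integral_prod_right (ν := m)).measurable

theorem lintegral_abs_logPot_le {m : Measure ℂ} [IsProbabilityMeasure m] {S : Set ℂ} {B : ℝ}
    (h : ∀ᵐ w ∂m, ∫⁻ z in S, ENNReal.ofReal |Real.log ‖z - w‖| ≤ ENNReal.ofReal B) :
    ∫⁻ z in S, ENNReal.ofReal |logPot m z| ≤ ENNReal.ofReal B := by
  calc ∫⁻ z in S, ENNReal.ofReal |logPot m z|
      ≤ ∫⁻ z in S, ∫⁻ w, ENNReal.ofReal |Real.log ‖z - w‖| ∂m := by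
        refine lintegral_mono fun z => ?_
        have := enorm_integral_le_lintegral_enorm (μ := m) fun w => Real.log ‖z - w‖
        simp only [Real.enorm_eq_ofReal_abs] at this
        exact this
    _ = ∫⁻ w, (∫⁻ z in S, ENNReal.ofReal |Real.log ‖z - w‖|) ∂m :=
        lintegral_lintegral_swap measurable_log_norm_sub.abs.ennreal_ofReal.aemeasurable
    _ ≤ ∫⁻ _, ENNReal.ofReal B ∂m := lintegral_mono_ae h
    _ = ENNReal.ofReal B := by simp

theorem abs_integral_sub_integral_mul_logPot_le {m : Measure ℂ} [IsProbabilityMeasure m]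
    {f g : ℂ → ℝ} {R R₀ G ε : ℝ} (hf : Continuous f) (hR : R₀ ≤ R) (hg : Measurable g)
    (hG : ∀ z, |g z| ≤ G) (hgR : ∀ z, z ∉ Metric.closedBall (0 : ℂ) R → g z = 0)
    (happ : ∀ w, ‖w‖ ≤ R₀ → |(∫ z, g z * Real.log ‖z - w‖) - f w| ≤ ε)
    (hm : ∀ᵐ w ∂m, ‖w‖ ≤ R₀) :
    Integrable (fun z => g z * logPot m z) ∧ |∫ w, f w ∂m - ∫ z, g z * logPot m z| ≤ ε := by
  have hi : Integrable (fun p : ℂ × ℂ => g p.2 * Real.log ‖p.2 - p.1‖) (m.prod volume) :=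
    integrable_mul_log m (R := R) (M := G) (ζ := id) (φ := fun p : ℂ × ℂ => g p.2)
      (hg.comp measurable_snd) (fun p => hG _) (fun p hp => hgR _ hp) measurable_id
      (hm.mono fun w hw => hw.trans hR)
  have e : (fun z => g z * logPot m z) = fun z => ∫ w, g z * Real.log ‖z - w‖ ∂m := by
    funext z
    rw [integral_const_mul, logPot]
  have hfint : Integrable f m := by
    obtain ⟨M, hM⟩ := (isCompact_closedBall (0 : ℂ) R₀).exists_bound_of_continuousOn hf.continuousOn
    refine Integrable.of_bound hf.aestronglyMeasurable M (hm.mono fun w hw => hM w ?_)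
    exact mem_closedBall_zero_iff.2 hw
  refine ⟨by rw [e]; exact hi.integral_prod_right, ?_⟩
  rw [e, ← integral_prod_symm _ hi, integral_prod _ hi, ← integral_sub hfint hi.integral_prod_left,
    ← Real.norm_eq_abs]
  have := norm_integral_le_of_norm_le_const (μ := m)
    (f := fun w => f w - ∫ z, g z * Real.log ‖z - w‖) (C := ε) (hm.mono fun w hw => by
      rw [Real.norm_eq_abs, abs_sub_comm]; exact happ w hw)
  simpa using this

/-- Two probability measures on a disc whose logarithmic potentials are close outside a small set
are close in the weak topology. -/
theorem exists_logPot_close {f : ℂ → ℝ} (hf : Continuous f) (R₀ : ℝ) {ε : ℝ} (hε : 0 < ε) :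
    ∃ (R δ η : ℝ), 0 < δ ∧ 0 < η ∧ ∀ (m m' : Measure ℂ) [IsProbabilityMeasure m]
      [IsProbabilityMeasure m'], (∀ᵐ w ∂m, ‖w‖ ≤ R₀) → (∀ᵐ w ∂m', ‖w‖ ≤ R₀) →
      volume.real {z | z ∈ Metric.closedBall (0 : ℂ) R ∧ δ ≤ |logPot m z - logPot m' z|} < η →
      |∫ w, f w ∂m - ∫ w, f w ∂m'| < ε := by
  obtain ⟨R, G, g, hR, hG0, hg, hG, hgR, happ⟩ := exists_log_approx hf R₀ (show 0 < ε / 8 by positivity)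
  obtain ⟨C, hC, hlog⟩ := exists_lintegral_abs_log_le R
  set V := volume.real (Metric.closedBall (0 : ℂ) R)
  have hV0 : 0 ≤ V := measureReal_nonneg
  set e := ε / (8 * (G + 1)) with he_def
  have he : 0 < e := by positivity
  have heG : G * e ≤ ε / 8 := by
    calc G * e ≤ (G + 1) * e := by gcongr; linarith
      _ = ε / 8 := by rw [he_def]; field_simp
  set A := C / e with hA_def
  have hA : 0 < A := by positivity
  have hCA : C / A = e := by rw [hA_def]; field_simp
  refine ⟨R, e / (V + 1), e / A, by positivity, by positivity, ?_⟩
  intro m m' _ _ hm hm' hS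
  set δ := e / (V + 1)
  have hδV : δ * V ≤ e := by
    calc δ * V ≤ δ * (V + 1) := by gcongr; linarith
      _ = e := by simp only [δ]; field_simp
  set S := {z | z ∈ Metric.closedBall (0 : ℂ) R ∧ δ ≤ |logPot m z - logPot m' z|}
  have hSR : S ⊆ Metric.closedBall 0 R := fun z hz => hz.1
  have hSm : MeasurableSet S := by
    have h1 : MeasurableSet {z | δ ≤ |logPot m z - logPot m' z|} :=
      measurableSet_le measurable_const ((measurable_logPot m).sub (measurable_logPot m')).abs
    exact Metric.isClosed_closedBall.measurableSet.inter h1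
  have hVtop : volume (Metric.closedBall (0 : ℂ) R) ≠ ∞ := measure_closedBall_lt_top.ne
  have hpotS : ∀ (k : Measure ℂ) [IsProbabilityMeasure k], (∀ᵐ w ∂k, ‖w‖ ≤ R₀) →
      ∫⁻ z in S, ENNReal.ofReal |logPot k z| ≤ ENNReal.ofReal (2 * e) := by
    intro k _ hk
    refine lintegral_abs_logPot_le (hk.mono fun w hw => ?_)
    refine (hlog w (hw.trans hR) S hSR A hA).trans (ENNReal.ofReal_le_ofReal ?_)
    have : A * volume.real S ≤ A * (e / A) := by gcongr
    rw [mul_div_cancel₀ _ hA.ne'] at this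
    linarith
  obtain ⟨i1, h1⟩ := abs_integral_sub_integral_mul_logPot_le hf hR hg hG hgR happ hm
  obtain ⟨i2, h2⟩ := abs_integral_sub_integral_mul_logPot_le hf hR hg hG hgR happ hm'
  have hpt : ∀ z, ‖g z * logPot m z - g z * logPot m' z‖ₑ ≤
      (Metric.closedBall (0 : ℂ) R).indicator (fun _ => ENNReal.ofReal (G * δ)) z +
        S.indicator (fun z => ENNReal.ofReal G * (ENNReal.ofReal |logPot m z| +
          ENNReal.ofReal |logPot m' z|)) z := by
    intro z
    by_cases hz : z ∈ Metric.closedBall (0 : ℂ) R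
    · rw [Set.indicator_of_mem hz, Real.enorm_eq_ofReal_abs, ← mul_sub, abs_mul]
      by_cases hzS : z ∈ S
      · rw [Set.indicator_of_mem hzS, ← ENNReal.ofReal_add (abs_nonneg _) (abs_nonneg _),
          ← ENNReal.ofReal_mul hG0]
        refine le_trans (ENNReal.ofReal_le_ofReal ?_) le_add_self
        exact mul_le_mul (hG z) (abs_sub _ _) (abs_nonneg _) hG0
      · refine le_trans (ENNReal.ofReal_le_ofReal ?_) le_self_add
        have : |logPot m z - logPot m' z| ≤ δ := by
          by_contra hcc
          exact hzS ⟨hz, (not_le.1 hcc).le⟩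
        exact mul_le_mul (hG z) this (abs_nonneg _) hG0
    · rw [hgR z hz]; simp
  have h3 : |(∫ z, g z * logPot m z) - ∫ z, g z * logPot m' z| ≤ 5 * (ε / 8) := by
    rw [← integral_sub i1 i2]
    have hsum : Measurable fun z => ENNReal.ofReal |logPot m z| + ENNReal.ofReal |logPot m' z| :=
      (measurable_logPot m).abs.ennreal_ofReal.add (measurable_logPot m').abs.ennreal_ofReal
    have hle := (enorm_integral_le_lintegral_enorm (μ := (volume : Measure ℂ))
      fun z => g z * logPot m z - g z * logPot m' z).trans (lintegral_mono hpt)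
    rw [lintegral_add_left (measurable_const.indicator Metric.isClosed_closedBall.measurableSet),
      lintegral_indicator_const Metric.isClosed_closedBall.measurableSet,
      lintegral_indicator hSm, lintegral_const_mul _ hsum,
      lintegral_add_left (measurable_logPot m).abs.ennreal_ofReal,
      ← ofReal_measureReal hVtop] at hle
    have hle2 := hle.trans (add_le_add le_rfl (mul_le_mul_right (add_le_add (hpotS m hm)
      (hpotS m' hm')) (ENNReal.ofReal G)))
    rw [← ENNReal.ofReal_add (by positivity) (by positivity), ← ENNReal.ofReal_mul hG0,
      ← ENNReal.ofReal_mul (by positivity), ← ENNReal.ofReal_add (by positivity) (by positivity),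
      Real.enorm_eq_ofReal_abs, ENNReal.ofReal_le_ofReal_iff (by positivity)] at hle2
    refine hle2.trans ?_
    have : G * (δ * V) ≤ G * e := by gcongr
    change G * δ * V + _ ≤ _
    nlinarith
  rw [abs_lt]
  obtain ⟨h1a, h1b⟩ := abs_le.1 h1
  obtain ⟨h2a, h2b⟩ := abs_le.1 h2
  obtain ⟨h3a, h3b⟩ := abs_le.1 h3
  constructor <;> linarith


/-! ### The mixture of arcsine measures and its potential -/

theorem arcsineReal_eq_map : arcsineReal = angle.map Real.cos := by
  refine Measure.ext fun s hs => ?_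
  have himg : Real.cos '' Set.Ioo 0 Real.pi = Set.Ioo (-1) 1 := by
    have := Real.cosPartialHomeomorph.image_source_eq_target
    exact this
  have hder : ∀ x ∈ Set.Ioo 0 Real.pi,
      HasDerivWithinAt Real.cos (-Real.sin x) (Set.Ioo 0 Real.pi) x := fun x _ =>
    (Real.hasDerivAt_cos x).hasDerivWithinAt
  have hinj : Set.InjOn Real.cos (Set.Ioo 0 Real.pi) := Real.injOn_cos.mono Set.Ioo_subset_Icc_self
  have hpre : MeasurableSet (Real.cos ⁻¹' s) := Real.measurable_cos hs
  rw [arcsineReal, withDensity_apply _ hs, Measure.map_apply Real.measurable_cos hs,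
    ← lintegral_indicator hs, ← himg,
    lintegral_image_eq_lintegral_abs_deriv_mul measurableSet_Ioo hder hinj, angle,
    Measure.smul_apply, smul_eq_mul, ← lintegral_indicator_const hpre]
  refine setLIntegral_congr_fun measurableSet_Ioo fun θ hθ => ?_
  have hsin : 0 < Real.sin θ := Real.sin_pos_of_pos_of_lt_pi hθ.1 hθ.2
  by_cases h : Real.cos θ ∈ s
  · rw [Set.indicator_of_mem h, Set.indicator_of_mem (by exact h),
      ← ENNReal.ofReal_mul (abs_nonneg _)]
    congr 1
    rw [abs_neg, abs_of_pos hsin, ← Real.sin_sq, Real.sqrt_sq hsin.le]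
    field_simp
  · rw [Set.indicator_of_notMem h, Set.indicator_of_notMem (by exact h), mul_zero]

section mixture

variable (b c d : C(I, ℂ))

/-- The pair `(b, c d)` as a function on the line, constant outside `[0, 1]`. -/
noncomputable def lineParams (x : ℝ) : ℂ × ℂ := params b c d (Set.projIcc 0 1 zero_le_one x)

theorem continuous_lineParams : Continuous (lineParams b c d) := by
  have : Continuous (params b c d) := by
    unfold params
    fun_prop
  exact this.comp continuous_projIcc

theorem lineParams_of_one_le {x : ℝ} (hx : 1 ≤ x) : lineParams b c d x = lineParams b c d 1 := by
  rw [lineParams, lineParams, Set.projIcc_of_right_le _ hx, Set.projIcc_right]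

theorem lineParams_coe (x : I) : lineParams b c d x = params b c d x := by
  rw [lineParams, Set.projIcc_val]

theorem exists_norm_lineParams_le : ∃ C : ℝ, 0 ≤ C ∧ ∀ x, ‖lineParams b c d x‖ ≤ C := by
  have hc : Continuous (params b c d) := by
    unfold params
    fun_prop
  obtain ⟨C, hC⟩ := isCompact_univ.exists_bound_of_continuousOn hc.continuousOn
  exact ⟨C, (norm_nonneg _).trans (hC 0 trivial), fun x => hC _ trivial⟩

theorem arcsineAt_eq_map (x : I) : arcsineAt b c d x = angle.map (segPt (params b c d x)) := by
  rw [arcsineAt, arcsineSegment, arcsineReal_eq_map,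
    Measure.map_map (by fun_prop) Real.measurable_cos]
  congr 1
  funext θ
  simp only [Function.comp_apply, segPt, params, mul_comm (c x) (d x)]
  ring

theorem measurable_segPt_lineParams :
    Measurable fun p : ℝ × ℝ => segPt (lineParams b c d p.1) p.2 :=
  measurable_segPt.comp
    (((continuous_lineParams b c d).measurable.comp measurable_fst).prodMk measurable_snd)

theorem arcsineMixture_eq_map : arcsineMixture b c d =
    (unif.prod angle).map fun p => segPt (lineParams b c d p.1) p.2 := by
  have hm := measurable_segPt_lineParams b c d
  refine Measure.ext fun s hs => ?_
  rw [arcsineMixture_apply b c d hs, Measure.map_apply hm hs, Measure.prod_apply (hm hs)]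
  have h1 : MeasurePreserving ((↑) : I → ℝ) volume unif := unitInterval.measurePreserving_coe
  rw [← h1.lintegral_comp (measurable_measure_prodMk_left (hm hs))]
  refine lintegral_congr fun x => ?_
  have h2 : Measurable (segPt (params b c d x)) :=
    measurable_segPt.comp (f := fun θ : ℝ => (params b c d x, θ)) (by fun_prop)
  rw [arcsineAt_eq_map, Measure.map_apply h2 hs]
  simp only [Set.preimage_preimage, lineParams_coe]

instance : IsProbabilityMeasure (arcsineMixture b c d) := by
  rw [arcsineMixture_eq_map]
  exact Measure.isProbabilityMeasure_map (measurable_segPt_lineParams b c d).aemeasurable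

theorem ae_arcsineMixture_norm_le {C : ℝ} (hC : ∀ x, ‖lineParams b c d x‖ ≤ C) :
    ∀ᵐ w ∂(arcsineMixture b c d), ‖w‖ ≤ 2 * C + 1 := by
  rw [arcsineMixture_eq_map, ae_map_iff (measurable_segPt_lineParams b c d).aemeasurable
    (measurableSet_le measurable_norm measurable_const)]
  exact ae_of_all _ fun p => norm_segPt_le (hC _) _

theorem ae_logPot_arcsineMixture_eq (R : ℝ) :
    ∀ᵐ z ∂(volume.restrict (Metric.closedBall (0 : ℂ) R)),
      logPot (arcsineMixture b c d) z = blockPot (lineParams b c d) 0 2 z := by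
  obtain ⟨C, -, hC⟩ := exists_norm_lineParams_le b c d
  obtain ⟨C', hC', hpot⟩ := exists_lintegral_abs_segPot_le C R
  have hseg := measurable_segPt_lineParams b c d
  have hm : Measurable fun q : ℂ × (ℝ × ℝ) =>
      Real.log ‖q.1 - segPt (lineParams b c d q.2.1) q.2.2‖ :=
    Real.measurable_log.comp (measurable_fst.sub (hseg.comp measurable_snd)).norm
  have hfin : ∫⁻ z in Metric.closedBall (0 : ℂ) R, ∫⁻ p : ℝ × ℝ,
      ENNReal.ofReal |Real.log ‖z - segPt (lineParams b c d p.1) p.2‖| ∂(unif.prod angle) ≠ ∞ := by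
    have h1 : ∀ z : ℂ, ∫⁻ p : ℝ × ℝ,
        ENNReal.ofReal |Real.log ‖z - segPt (lineParams b c d p.1) p.2‖| ∂(unif.prod angle) =
        ∫⁻ x, ∫⁻ θ, ENNReal.ofReal |Real.log ‖z - segPt (lineParams b c d x) θ‖| ∂angle ∂unif := by
      intro z
      have h2 : Measurable fun p : ℝ × ℝ => Real.log ‖z - segPt (lineParams b c d p.1) p.2‖ :=
        hm.comp (f := fun p : ℝ × ℝ => (z, p)) (by fun_prop)
      rw [lintegral_prod _ h2.abs.ennreal_ofReal.aemeasurable]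
    simp_rw [h1]
    rw [lintegral_lintegral_swap]
    · refine ((lintegral_mono fun x => (hpot _ (hC x) _ subset_rfl 1 one_pos).2).trans_lt ?_).ne
      simp
    · have h2 : Measurable fun q : (ℂ × ℝ) × ℝ =>
          ENNReal.ofReal |Real.log ‖q.1.1 - segPt (lineParams b c d q.1.2) q.2‖| :=
        (hm.comp (f := fun q : (ℂ × ℝ) × ℝ => (q.1.1, (q.1.2, q.2)))
          (by fun_prop)).abs.ennreal_ofReal
      exact h2.lintegral_prod_right'.aemeasurable
  filter_upwards [ae_lt_top hm.abs.ennreal_ofReal.lintegral_prod_right' hfin] with z hz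
  have hmz : Measurable fun p : ℝ × ℝ => Real.log ‖z - segPt (lineParams b c d p.1) p.2‖ :=
    hm.comp (f := fun p : ℝ × ℝ => (z, p)) (by fun_prop)
  have hint : Integrable (fun p : ℝ × ℝ => Real.log ‖z - segPt (lineParams b c d p.1) p.2‖)
      (unif.prod angle) := by
    refine ⟨hmz.aestronglyMeasurable, ?_⟩
    rw [HasFiniteIntegral]
    simpa only [Real.enorm_eq_ofReal_abs] using hz
  have hlog : Measurable fun w : ℂ => Real.log ‖z - w‖ := by fun_prop
  rw [logPot, arcsineMixture_eq_map, integral_map hseg.aemeasurable hlog.aestronglyMeasurable,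
    integral_prod _ hint, blockPot]
  have h3 : unif.restrict (Set.Ico 0 2) = unif := by
    rw [unif, Measure.restrict_restrict measurableSet_Ico, Set.inter_eq_right.2]
    exact fun x hx => ⟨hx.1, by linarith [hx.2]⟩
  rw [h3]
  rfl

end mixture

/-! ### The eigenvalue-counting measure and its potential -/

theorem integral_sum_dirac (f : ℂ → ℝ) (s : Multiset ℂ) :
    Integrable f (s.map fun z => Measure.dirac z).sum ∧
      ∫ w, f w ∂(s.map fun z => Measure.dirac z).sum = (s.map f).sum := by
  induction s using Multiset.induction_on with
  | empty => simp
  | cons a s ih =>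
    have ha : Integrable f (Measure.dirac a) := integrable_dirac enorm_lt_top
    rw [Multiset.map_cons, Multiset.sum_cons, Multiset.map_cons, Multiset.sum_cons]
    exact ⟨ha.add_measure ih.1, by rw [integral_add_measure ha ih.1, ih.2, integral_dirac]⟩

theorem sum_dirac_apply (s : Multiset ℂ) {t : Set ℂ} (ht : MeasurableSet t) :
    (s.map fun z => Measure.dirac z).sum t = (s.map fun z => t.indicator (1 : ℂ → ℝ≥0∞) z).sum := by
  induction s using Multiset.induction_on with
  | empty => simp
  | cons a s ih =>
    rw [Multiset.map_cons, Multiset.sum_cons, Multiset.map_cons, Multiset.sum_cons,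
      Measure.add_apply, ih, Measure.dirac_apply' _ ht]

theorem card_roots_charpoly {n : ℕ} (M : Matrix (Fin n) (Fin n) ℂ) :
    M.charpoly.roots.card = n := by
  rw [← (IsAlgClosed.splits M.charpoly).natDegree_eq_card_roots, Matrix.charpoly_natDegree_eq_dim,
    Fintype.card_fin]

theorem isProbabilityMeasure_eigenvalueMeasure {n : ℕ} (hn : n ≠ 0) (M : Matrix (Fin n) (Fin n) ℂ) :
    IsProbabilityMeasure (eigenvalueMeasure M) := ⟨by
  rw [eigenvalueMeasure, Measure.smul_apply, sum_dirac_apply _ MeasurableSet.univ]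
  simp only [Set.indicator_univ, Pi.one_apply, Multiset.map_const', Multiset.sum_replicate,
    card_roots_charpoly, smul_eq_mul, nsmul_eq_mul, mul_one]
  exact ENNReal.inv_mul_cancel (by exact_mod_cast hn) (ENNReal.natCast_ne_top n)⟩

theorem ae_eigenvalueMeasure_norm_le {n : ℕ} {M : Matrix (Fin n) (Fin n) ℂ} {R : ℝ}
    (h : ∀ z, M.charpoly.eval z = 0 → ‖z‖ ≤ R) : ∀ᵐ w ∂(eigenvalueMeasure M), ‖w‖ ≤ R := by
  have hm : MeasurableSet {w : ℂ | ¬ ‖w‖ ≤ R} :=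
    (measurableSet_le measurable_norm measurable_const).compl
  rw [ae_iff, eigenvalueMeasure, Measure.smul_apply, sum_dirac_apply _ hm, smul_eq_mul]
  refine mul_eq_zero_of_right _ (Multiset.sum_eq_zero fun x hx => ?_)
  obtain ⟨z, hz, rfl⟩ := Multiset.mem_map.1 hx
  refine Set.indicator_of_notMem (fun hc : ¬ ‖z‖ ≤ R => hc ?_) _
  exact h z (Polynomial.isRoot_of_mem_roots hz)

theorem logPot_eigenvalueMeasure {n : ℕ} (M : Matrix (Fin n) (Fin n) ℂ) {z : ℂ}
    (hz : z ∉ M.charpoly.roots) :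
    logPot (eigenvalueMeasure M) z = Real.log ‖M.charpoly.eval z‖ / n := by
  rw [logPot, eigenvalueMeasure, integral_smul_measure, (integral_sum_dirac _ _).2,
    (IsAlgClosed.splits M.charpoly).eval_eq_prod_roots_of_monic M.charpoly_monic]
  have h1 : ‖(M.charpoly.roots.map fun w => z - w).prod‖ =
      (M.charpoly.roots.map fun w => ‖z - w‖).prod := by
    have := map_multiset_prod (normHom : ℂ →*₀ ℝ) (M.charpoly.roots.map fun w => z - w)
    rw [Multiset.map_map] at this
    exact this
  rw [h1, Real.log_multiset_prod, Multiset.map_map]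
  · simp [div_eq_inv_mul]
  · intro x hx
    obtain ⟨w, hw, rfl⟩ := Multiset.mem_map.1 hx
    rw [norm_ne_zero_iff, sub_ne_zero]
    rintro rfl
    exact hz hw

theorem ae_logPot_eigenvalueMeasure {n : ℕ} (M : Matrix (Fin n) (Fin n) ℂ) :
    ∀ᵐ z : ℂ, logPot (eigenvalueMeasure M) z = Real.log ‖M.charpoly.eval z‖ / n := by
  have h : ∀ᵐ z : ℂ, z ∉ (M.charpoly.roots.toFinset : Set ℂ) :=
    (Finset.countable_toSet _).ae_notMem volume
  filter_upwards [h] with z hz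
  exact logPot_eigenvalueMeasure M (by simpa using hz)

theorem exists_contP_ne_zero {C : ℝ} (hC : 0 ≤ C) : ∃ R : ℝ, ∀ (l : List (ℂ × ℂ)),
    (∀ y ∈ l, ‖y‖ ≤ C) → ∀ z, contP z l = 0 → ‖z‖ ≤ R := by
  obtain ⟨ρ, hρ, hρ1, hCρ⟩ := exists_small_radius hC
  set r := min ρ (1 / 4)
  have hr : 0 < r := by positivity
  refine ⟨r⁻¹, fun l hl z hz => ?_⟩
  by_contra! hcon
  have hz0 : z ≠ 0 := by
    rintro rfl
    rw [norm_zero] at hcon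
    exact absurd hcon (not_lt.2 (by positivity))
  have h1 := (contP_near_infinity hC (min_le_right ρ (1 / 4)) (ζ := z⁻¹)
    ((mul_le_mul_of_nonneg_left (min_le_left _ _) hC).trans hCρ) (inv_ne_zero hz0) (by
      rw [norm_inv]; exact (inv_lt_of_inv_lt₀ hr hcon).le) l hl).1
  rw [inv_inv, hz, norm_zero] at h1
  linarith


/-! ### Transfer to the given samples -/

theorem map_sample_eq_unifPi {Ω : Type*} [MeasurableSpace Ω] {P : Measure Ω}
    [IsProbabilityMeasure P] {n : ℕ} {U : Fin n → Ω → I} (hU : ∀ i, HasLaw (U i) volume P)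
    (hind : iIndepFun U P) :
    AEMeasurable (fun ω i => (U i ω : ℝ)) P ∧ P.map (fun ω i => (U i ω : ℝ)) = unifPi n := by
  have hm : AEMeasurable (fun ω i => U i ω) P := aemeasurable_pi_lambda _ fun i => (hU i).aemeasurable
  have h1 := (iIndepFun_iff_map_fun_eq_pi_map fun i => (hU i).aemeasurable).1 hind
  simp_rw [fun i => (hU i).map_eq] at h1
  have h2 : MeasurePreserving (fun (v : Fin n → I) i => (v i : ℝ)) (Measure.pi fun _ => volume)
      (unifPi n) :=
    measurePreserving_pi (fun _ : Fin n => (volume : Measure I)) (fun _ => unif)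
      fun _ => unitInterval.measurePreserving_coe
  refine ⟨h2.measurable.comp_aemeasurable hm, ?_⟩
  rw [← h2.map_eq, ← h1, AEMeasurable.map_map_of_aemeasurable h2.measurable.aemeasurable hm]
  rfl

/-- Markov's inequality for the areas of the sections of a set. -/
theorem unifPi_section_le {n : ℕ} {T : Set ((Fin n → ℝ) × ℂ)} (hT : MeasurableSet T) {R η : ℝ}
    (hη : 0 < η) (hTR : ∀ p ∈ T, p.2 ∈ Metric.closedBall (0 : ℂ) R) :
    (unifPi n) {u | ENNReal.ofReal η ≤ volume (Prod.mk u ⁻¹' T)} ≤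
      ENNReal.ofReal (((unifPi n).prod volume).real T / η) := by
  have hfin : ((unifPi n).prod volume) T ≠ ∞ :=
    ((measure_mono fun p hp => hTR p hp).trans_lt
      (prod_measure_slab_ne_top n measure_closedBall_lt_top.ne).lt_top).ne
  have h1 := mul_meas_ge_le_lintegral (μ := unifPi n)
    (measurable_measure_prodMk_left (ν := (volume : Measure ℂ)) hT)
    (ENNReal.ofReal η)
  rw [← Measure.prod_apply hT, mul_comm] at h1
  rw [ENNReal.ofReal_div_of_pos hη, ofReal_measureReal hfin]
  exact (ENNReal.le_div_iff_mul_le (Or.inl (ENNReal.ofReal_pos.2 hη).ne')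
    (Or.inl ENNReal.ofReal_ne_top)).2 h1

/-- The pairs of a sample `u` and a parameter `z` in the disc of radius `R` for which the
normalized logarithm of the characteristic polynomial is off by `δ`. -/
def deviationSet (h : ℝ → ℂ × ℂ) (R δ : ℝ) (n : ℕ) : Set ((Fin n → ℝ) × ℂ) :=
  {p | p.2 ∈ Metric.closedBall (0 : ℂ) R ∧
    δ ≤ |Real.log ‖contP p.2 ((seg p.1 (Set.Iio 2)).map h)‖ / n - blockPot h 0 2 p.2|}

theorem measurableSet_deviationSet {h : ℝ → ℂ × ℂ} (hh : Continuous h) (R δ : ℝ) (n : ℕ) :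
    MeasurableSet (deviationSet h R δ n) := by
  have h1 : Measurable fun p : (Fin n → ℝ) × ℂ => contP p.2 ((seg p.1 (Set.Iio 2)).map h) :=
    measurable_contP_seg hh.measurable measurableSet_Iio measurable_fst measurable_snd
  have h2 : Measurable fun p : (Fin n → ℝ) × ℂ => blockPot h 0 2 p.2 :=
    (measurable_blockPot hh 0 2).comp measurable_snd
  have h3 : MeasurableSet {p : (Fin n → ℝ) × ℂ |
      δ ≤ |Real.log ‖contP p.2 ((seg p.1 (Set.Iio 2)).map h)‖ / n - blockPot h 0 2 p.2|} :=
    measurableSet_le measurable_const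
      (((Real.measurable_log.comp h1.norm).div_const _).sub h2).abs
  exact (measurableSet_slab n Metric.isClosed_closedBall.measurableSet).inter h3

theorem eval_charpoly_eq_contP_seg (b c d : C(I, ℂ)) {n : ℕ} (v : Fin n → I) (z : ℂ) :
    (sampledToeplitz (tridiagSymbol b c d) v).charpoly.eval z =
      contP z ((seg (fun i => (v i : ℝ)) (Set.Iio 2)).map (lineParams b c d)) := by
  rw [eval_charpoly_sampledToeplitz, seg_coe_eq_ofFn, List.map_ofFn]
  congr 2
  funext i
  exact (lineParams_coe b c d _).symm

theorem tendstoWeaklyInProbability_eigenvalueMeasure {Ω : Type*} [MeasurableSpace Ω]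
    (P : Measure Ω) [IsProbabilityMeasure P] (U : (n : ℕ) → Fin n → Ω → I)
    (hU : ∀ (n : ℕ) (i : Fin n), HasLaw (U n i) volume P) (hind : ∀ n : ℕ, iIndepFun (U n) P)
    (b c d : C(I, ℂ)) :
    TendstoWeaklyInProbability P
      (fun n ω => eigenvalueMeasure (sampledToeplitz (tridiagSymbol b c d) fun i => U n i ω))
      (arcsineMixture b c d) := by
  intro f
  rw [tendstoInMeasure_iff_norm]
  intro ε hε
  set h := lineParams b c d
  have hh : Continuous h := continuous_lineParams b c d
  obtain ⟨C, hC, hhC⟩ := exists_norm_lineParams_le b c d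
  obtain ⟨R₁, hR₁⟩ := exists_contP_ne_zero hC
  obtain ⟨R, δ, η, hδ, hη, hclose⟩ := exists_logPot_close f.continuous (max R₁ (2 * C + 1)) hε
  have hlim : Tendsto (fun n => ENNReal.ofReal
      (((unifPi n).prod volume).real (deviationSet h R δ n) / η)) atTop (𝓝 0) := by
    have := ENNReal.tendsto_ofReal ((tendsto_measureReal_log_norm_contP hh hC hhC
      (fun x hx => lineParams_of_one_le b c d hx) R hδ).div_const η)
    rwa [zero_div, ENNReal.ofReal_zero] at this
  refine tendsto_of_tendsto_of_tendsto_of_le_of_le' tendsto_const_nhds hlim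
    (Eventually.of_forall fun _ => zero_le) ?_
  filter_upwards [eventually_ne_atTop 0] with n hn
  obtain ⟨hVm, hVmap⟩ := map_sample_eq_unifPi (hU n) (hind n)
  set E : Set (Fin n → ℝ) := {u | ENNReal.ofReal η ≤ volume (Prod.mk u ⁻¹' deviationSet h R δ n)}
  have hT := measurableSet_deviationSet hh R δ n
  have hE : MeasurableSet E :=
    measurableSet_le measurable_const (measurable_measure_prodMk_left hT)
  calc P {ω | ε ≤ ‖∫ z, f z ∂(eigenvalueMeasure (sampledToeplitz (tridiagSymbol b c d)
          fun i => U n i ω)) - ∫ z, f z ∂(arcsineMixture b c d)‖}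
      ≤ P ((fun ω i => (U n i ω : ℝ)) ⁻¹' E) := by
        refine measure_mono fun ω hω => ?_
        by_contra hcon
        have hcon' : volume (Prod.mk (fun i => (U n i ω : ℝ)) ⁻¹' deviationSet h R δ n) <
            ENNReal.ofReal η := not_le.1 hcon
        set M := sampledToeplitz (tridiagSymbol b c d) fun i => U n i ω
        have := isProbabilityMeasure_eigenvalueMeasure hn M
        have hroots : ∀ z, M.charpoly.eval z = 0 → ‖z‖ ≤ R₁ := by
          intro z hz
          rw [eval_charpoly_eq_contP_seg] at hz
          refine hR₁ _ (fun y hy => ?_) z hz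
          obtain ⟨x, _, rfl⟩ := List.mem_map.1 hy
          exact hhC x
        have hae : (volume : Measure ℂ) {z | z ∈ Metric.closedBall (0 : ℂ) R ∧
            δ ≤ |logPot (eigenvalueMeasure M) z - logPot (arcsineMixture b c d) z|} ≤
            volume (Prod.mk (fun i => (U n i ω : ℝ)) ⁻¹' deviationSet h R δ n) := by
          refine measure_mono_ae ?_
          have h2 := ae_logPot_arcsineMixture_eq b c d R
          rw [ae_restrict_iff' Metric.isClosed_closedBall.measurableSet] at h2
          filter_upwards [ae_logPot_eigenvalueMeasure M, h2] with z hz1 hz2 hz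
          obtain ⟨hzR, hzδ⟩ := hz
          rw [hz1, hz2 hzR, eval_charpoly_eq_contP_seg] at hzδ
          exact ⟨hzR, hzδ⟩
        have hlt := hclose (eigenvalueMeasure M) (arcsineMixture b c d)
          ((ae_eigenvalueMeasure_norm_le hroots).mono fun w hw => hw.trans (le_max_left _ _))
          ((ae_arcsineMixture_norm_le b c d hhC).mono fun w hw => hw.trans (le_max_right _ _))
          ((ENNReal.toReal_lt_of_lt_ofReal (hae.trans_lt hcon')))
        exact absurd hlt (not_lt.2 hω)
    _ = (unifPi n) E := by rw [← hVmap, Measure.map_apply_of_aemeasurable hVm hE]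
    _ ≤ _ := unifPi_section_le hT hη fun p hp => hp.1

end TwistedToeplitz

/-- For each `n`, `U n 0, …, U n (n - 1)` are i.i.d. uniform points of `[0, 1]`; nothing is assumed
about the joint law of the samples for different `n`. -/
theorem theorem1p2 {Ω : Type*} [MeasurableSpace Ω] (P : Measure Ω) [IsProbabilityMeasure P]
    (U : (n : ℕ) → Fin n → Ω → unitInterval)
    (hU : ∀ (n : ℕ) (i : Fin n), HasLaw (U n i) volume P)
    (hind : ∀ n : ℕ, iIndepFun (U n) P)
    (b c d : C(unitInterval, ℂ)) :
    TwistedToeplitz.TendstoWeaklyInProbability P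
      (fun n ω => TwistedToeplitz.eigenvalueMeasure
        (TwistedToeplitz.sampledToeplitz (TwistedToeplitz.tridiagSymbol b c d)
          (fun i => U n i ω)))
      (TwistedToeplitz.arcsineMixture b c d) :=
  TwistedToeplitz.tendstoWeaklyInProbability_eigenvalueMeasure P U hU hind b c d
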